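/- Let $\Omega=(0,1)\times(-\tfrac12,\tfrac12)$ and $p\in[2,\infty)$. Let $W:\mathbb R^{2\times2}\to[0,+\infty]$ be continuous on $\{F:\det F>0\}$, with $W(F)=+\infty$ if and only if $\det F\le 0$, and suppose that there is $c>0$ and, for every $\delta>0$, some $c_\delta>0$ such that $$c|F|^p\le W(F)\le c_\delta(1+|F|^p)\qquad\text{for all }F\in\mathbb R^{2\times 2}\text{ with }\det F\ge\delta .$$ Here "homeomorphism" means homeomorphism onto its image, and Sobolev maps are identified with their continuous representatives whenever these exist. Let $\mathcal A$ be the set of all $y\in W^{1,p}(\Omega;\mathbb R^2)$ that are homeomorphisms with $\det\nabla y>0$ a.e. in $\Omega$. For $h>0$ put $\nabla_h y=(\partial_1y\,|\,h^{-1}\partial_2y)$ and, for $y\in W^{1,p}(\Omega;\mathbb R^2)$, $$J_h(y)=\int_\Omega W(\nabla_hy)\,dx\ \text{ if }y\in\mathcal A,\qquad J_h(y)=+\infty\ \text{ otherwise.}$$ Call $y\in W^{1,p}((0,1);\mathbb R^2)$ non-interpenetrative if there is a sequence of homeomorphisms $y_k\in W^{1,p}((0,1);\mathbb R^2)$, bounded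 in $W^{1,p}((0,1);\mathbb R^2)$, that converges to $y$ uniformly on $(0,1)$. For $f:\mathbb R^2\to[0,+\infty]$ let $\mathcal Cf=\sup\{g:\mathbb R^2\to\mathbb R\text{ convex},\ g\le f\}$. For $y\in W^{1,p}((0,1);\mathbb R^2)$ let $$J(y)=\int_0^1(\mathcal Cf)(y'(x))\,dx\ \text{ if }y\text{ is non-interpenetrative},\qquad J(y)=+\infty\ \text{ otherwise,}\qquad\text{where } f(a)=\inf_{\xi\in\mathbb R^2}W(a|\xi)$$ (the infimum being a minimum whenever it is attained), and let $\pi(u)(t)=\int_{-1/2}^{1/2}u(t,s)\,ds$. Then $J_h$ $\pi$-$\Gamma$-converges to $J$ as $h\to0^+$, that is: (i) for every $y\in W^{1,p}((0,1);\mathbb R^2)$ and every family $(y_h)_{h>0}\subset W^{1,p}(\Omega;\mathbb R^2)$ with $\pi(y_h)\to y$ in $L^p((0,1);\mathbb R^2)$ as $h\to 0^+$, one has $J(y)\le\liminf_{h\to0^+}J_h(y_h)$; (ii) for every $u\in W^{1,p}((0,1);\mathbb R^2)$ there is a family $(u_h)_{h>0}\subset W^{1,p}(\Omega;\mathbb R^2)$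 with $\pi(u_h)\to u$ in $L^p((0,1);\mathbb R^2)$ as $h\to 0^+$ and $\limsup_{h\to0^+}J_h(u_h)\le J(u)$. -/

import Mathlib

open MeasureTheory Filter Topology

noncomputable section

/-- The plane `ℝ²` with its Euclidean norm, in which deformations take their values. -/
abbrev Plane : Type := EuclideanSpace ℝ (Fin 2)

/-- The reference configuration `I = (0,1)` of the rod. -/
def rodDomain : Set ℝ := Set.Ioo 0 1

/-- The fixed reference configuration `Ω = (0,1) × (-1/2,1/2)` of the bulk. -/
def bulkDomain : Set (ℝ × ℝ) := Set.Ioo (0 : ℝ) 1 ×ˢ Set.Ioo (-(1 / 2) : ℝ) (1 / 2)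

section Sobolev

variable {E : Type} [NormedAddCommGroup E] [NormedSpace ℝ E] [MeasureSpace E]

/-- `G` is a weak (distributional) gradient of `u` on `Ω`: for every scalar test function
`φ ∈ C_c^∞(Ω)` and every direction `v`, one has `∫_Ω (∂_v φ) u = - ∫_Ω φ (G v)`. -/
def IsWeakGradient (Ω : Set E) (u : E → Plane) (G : E → E →L[ℝ] Plane) : Prop :=
  ∀ φ : E → ℝ, ContDiff ℝ ((⊤ : ℕ∞) : WithTop ℕ∞) φ → HasCompactSupport φ → tsupport φ ⊆ Ω →
    ∀ v : E, ∫ x in Ω, (fderiv ℝ φ x v) • u x = - ∫ x in Ω, φ x • G x v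

/-- An element of the Sobolev space `W^{1,p}(Ω; ℝ²)`: a representative `toFun`, together with a
representative `grad` of its weak gradient (which is determined by `toFun` up to null sets). -/
structure SobolevMap (p : ℝ) (Ω : Set E) where
  toFun : E → Plane
  grad : E → E →L[ℝ] Plane
  memLp_toFun : MemLp toFun (ENNReal.ofReal p) (volume.restrict Ω)
  memLp_grad : MemLp grad (ENNReal.ofReal p) (volume.restrict Ω)
  isWeakGradient : IsWeakGradient Ω toFun grad

/-- The norm of `W^{1,p}(Ω; ℝ²)`, as an extended nonnegative number. -/
def SobolevMap.eNorm {p : ℝ} {Ω : Set E} (u : SobolevMap p Ω) : ENNReal :=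
  eLpNorm u.toFun (ENNReal.ofReal p) (volume.restrict Ω) +
    eLpNorm u.grad (ENNReal.ofReal p) (volume.restrict Ω)

/-- The Sobolev map `u` has a representative which is a homeomorphism from `Ω` onto its image. -/
def SobolevMap.IsHomeo {p : ℝ} {Ω : Set E} (u : SobolevMap p Ω) : Prop :=
  ∃ v : E → Plane, v =ᵐ[volume.restrict Ω] u.toFun ∧ IsEmbedding (Ω.domRestrict v)

end Sobolev

/-- The `2 × 2` matrix `(a | b)` with columns `a` and `b`. -/
def colMatrix (a b : Plane) : Matrix (Fin 2) (Fin 2) ℝ :=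
  !![a 0, b 0; a 1, b 1]

/-- The Euclidean (Frobenius) norm of a `2 × 2` matrix. -/
def matNorm (F : Matrix (Fin 2) (Fin 2) ℝ) : ℝ :=
  Real.sqrt (∑ i, ∑ j, F i j ^ 2)

/-- The rescaled gradient `∇_h y = (∂₁ y | h⁻¹ ∂₂ y)` of a bulk deformation; `h = 1` gives `∇ y`. -/
def scaledGrad {p : ℝ} (h : ℝ) (y : SobolevMap p bulkDomain) (x : ℝ × ℝ) :
    Matrix (Fin 2) (Fin 2) ℝ :=
  colMatrix (y.grad x (1, 0)) (h⁻¹ • y.grad x (0, 1))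

/-- The class `𝒜` of admissible bulk deformations: `W^{1,p}` maps on `Ω` which are homeomorphisms
onto their image and satisfy `det ∇y > 0` almost everywhere. -/
def Admissible {p : ℝ} (y : SobolevMap p bulkDomain) : Prop :=
  y.IsHomeo ∧ ∀ᵐ x ∂(volume.restrict bulkDomain), 0 < (scaledGrad 1 y x).det

open Classical in
/-- The rescaled bulk energy `J_h`, for a stored energy density `W` with values in `[0,∞]`. -/
def bulkEnergy {p : ℝ} (W : Matrix (Fin 2) (Fin 2) ℝ → ENNReal) (h : ℝ)
    (y : SobolevMap p bulkDomain) : ENNReal :=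
  if Admissible y then ∫⁻ x in bulkDomain, W (scaledGrad h y x) else ⊤

/-- A rod deformation `y ∈ W^{1,p}((0,1); ℝ²)` is non-interpenetrative if (its continuous
representative) is the uniform limit on `(0,1)` of a sequence of homeomorphisms onto their image
(again, of continuous representatives) that is bounded in `W^{1,p}((0,1); ℝ²)`.
The limit representative `v` is continuous on `(0,1)`, being a uniform limit of such maps. -/
def NonInterpenetrative {p : ℝ} (y : SobolevMap p rodDomain) : Prop :=
  ∃ v : ℝ → Plane, v =ᵐ[volume.restrict rodDomain] y.toFun ∧
    ∃ (Y : ℕ → SobolevMap p rodDomain) (M : ENNReal), M ≠ ⊤ ∧ (∀ k, (Y k).eNorm ≤ M) ∧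
      (∀ k, IsEmbedding (rodDomain.domRestrict (Y k).toFun)) ∧
      TendstoUniformlyOn (fun k => (Y k).toFun) v atTop rodDomain

/-- The convex envelope `𝒞f = sup {g : ℝ² → ℝ convex, g ≤ f}` of a function `f : ℝ² → [0,∞]`.
As `f ≥ 0`, the condition `g ≤ f` says that `max g 0 ≤ f`, and as `g = 0` is a competitor, the
supremum may be taken of `max g 0`. -/
def convexEnvelope (f : Plane → ENNReal) (a : Plane) : ENNReal :=
  ⨆ (g : Plane → ℝ) (_ : ConvexOn ℝ Set.univ g) (_ : ∀ b, ENNReal.ofReal (g b) ≤ f b),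
    ENNReal.ofReal (g a)

/-- `a ↦ inf_{ξ ∈ ℝ²} W(a | ξ)`. -/
def reducedDensity (W : Matrix (Fin 2) (Fin 2) ℝ → ENNReal) (a : Plane) : ENNReal :=
  ⨅ ξ : Plane, W (colMatrix a ξ)

open Classical in
/-- The rod energy `J`. -/
def rodEnergy {p : ℝ} (W : Matrix (Fin 2) (Fin 2) ℝ → ENNReal)
    (y : SobolevMap p rodDomain) : ENNReal :=
  if NonInterpenetrative y then
    ∫⁻ x in rodDomain, convexEnvelope (reducedDensity W) (y.grad x 1)
  else ⊤

/-- The averaging operator `π(u)(t) = ∫_{-1/2}^{1/2} u(t,s) ds`. -/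
def crossAverage (u : ℝ × ℝ → Plane) (t : ℝ) : Plane :=
  ∫ s in Set.Ioo (-(1 / 2) : ℝ) (1 / 2), u (t, s)

/-- `π(y_h) → y` in `L^p((0,1); ℝ²)` as `h → 0⁺`. -/
def PiConverges {p : ℝ} (y : ℝ → SobolevMap p bulkDomain) (u : SobolevMap p rodDomain) : Prop :=
  Tendsto (fun h => eLpNorm (fun t => crossAverage (y h).toFun t - u.toFun t)
    (ENNReal.ofReal p) (volume.restrict rodDomain)) (𝓝[>] (0 : ℝ)) (𝓝 0)

/-- `π`-`Γ`-convergence, as `h → 0⁺`, of functionals `J h` on `W^{1,p}(Ω; ℝ²)` to a functional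
`J₀` on `W^{1,p}((0,1); ℝ²)`, all with values in `[0,∞]`. Only the members of a family `y` with
positive index matter. -/
def PiGammaConverges {p : ℝ} (J : ℝ → SobolevMap p bulkDomain → ENNReal)
    (J₀ : SobolevMap p rodDomain → ENNReal) : Prop :=
  (∀ (u : SobolevMap p rodDomain) (y : ℝ → SobolevMap p bulkDomain), PiConverges y u →
    J₀ u ≤ liminf (fun h => J h (y h)) (𝓝[>] (0 : ℝ))) ∧
  (∀ u : SobolevMap p rodDomain, ∃ y : ℝ → SobolevMap p bulkDomain, PiConverges y u ∧
    limsup (fun h => J h (y h)) (𝓝[>] (0 : ℝ)) ≤ J₀ u)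

end

/-! Lower bound (`rodEnergy_le_liminf`). Bounded energy bounds `∂₁y` and `h⁻¹∂₂y` in `L^p`, so `∂₂y`
is of order `h` and the deformations themselves, not only their averages, approach `u(x₁)`. On
almost every horizontal line the continuous representative is absolutely continuous, and its
restriction to a line is a homeomorphism. For each `h`, a line with no more than average energy and
distance yields an equicontinuous sequence of homeomorphic curves converging uniformly to `u`, so
`u` is non-interpenetrative (`nonInterpenetrative_of_tendsto`). Pointwise `W(a|ξ) ≥ f(a) ≥ 𝒞f(a)`,
and the convex integral is lower semicontinuous: Jensen bounds the energy of difference quotients,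
which pass to the limit by Fatou (`lintegral_le_of_tendsto_ae`).

Upper bound (`exists_recovery`). Let `u` have finite energy and be the uniform limit of
homeomorphisms `Y k` with bounded variation. Three approximations lead to a bulk deformation.

Injective polygons (`exists_injective_polygon`). The energy of `Y k` is not controlled, but its
length is. Generic grid lines of mesh about `r` are crossed by `Y k` transversally, and the number
of crossings is bounded independently of `k` (`exists_transversal_level`). Each passage through a
cell is replaced by a hook: a short radial spike inwards, a chord of a slightly smaller strictly
convex body, a spike outwards. Disjoint arcs in a convex body have endpoints that do not interlace,
by a winding number argument (`StrictGauge.chords_disjoint`), so the hooks form a simple polygon.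
Its inner vertices are as close to `u` as desired, and their number is bounded. Giving every edge a
little extra time keeps velocities bounded, and Jensen's inequality bounds the energy with density
`𝒞f` by that of `u` up to a small error.

From `𝒞f` to `f` (`PolygonCost.exists_of_convexEnvelope`). Velocities are split repeatedly into two
velocities of a common open half plane. The resulting zigzag is a graph, hence injective, and never
uses the velocity `0`, where `f` is infinite. Such splittings suffice: their envelope is convex on
every half plane, and its supporting affine function at `a ≠ 0` stays below it on the whole
punctured plane (`exists_affine_le_laminateEnvelope`).

Thickening (`exists_thickening`). The deformation is `z(t) + h s d(t)`, with a Lipschitz director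
`d` transversal to the polygon `z`. It is nearly optimal on most of each segment and interpolates
near the vertices. For small `h`, transversality gives injectivity at short range and the
injectivity of `z` gives it at long range, while the growth condition makes the short transition
zones cheap. -/

/-! ### Disjoint arcs in a strictly convex planar body -/

/-- A nowhere vanishing continuous complex function on the plane has a continuous logarithm. -/
theorem exists_continuous_log {F : ℝ × ℝ → ℂ} (hF : Continuous F) (h0 : ∀ x, F x ≠ 0) :
    ∃ l : ℝ × ℝ → ℂ, Continuous l ∧ ∀ x, Complex.exp (l x) = F x := by
  -- The exponential covers the punctured plane, and maps from the simply connected plane lift.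
  obtain ⟨l, ⟨-, hl⟩, -⟩ := Complex.isCoveringMapOn_exp.existsUnique_continuousMap_lifts
    (A := ℝ × ℝ) ⟨F, hF⟩ (a₀ := (0, 0)) (e₀ := Complex.log (F (0, 0)))
    (by simpa using Complex.exp_log (h0 _)) (fun a => by simpa using h0 a)
  exact ⟨l, l.continuous, fun x => congrFun hl x⟩

/-- Strict convexity of the sublevel set `{N ≤ 1}`, with `{N < 1}` in the role of the interior. -/
def StrictGauge (N : ℂ → ℝ) : Prop :=
  ∀ x y, N x ≤ 1 → N y ≤ 1 → x ≠ y → ∀ t ∈ Set.Ioo (0 : ℝ) 1, N (x + t * (y - x)) < 1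

theorem StrictGauge.le_one {N : ℂ → ℝ} (hN : StrictGauge N) {x y : ℂ} (hx : N x ≤ 1)
    (hy : N y ≤ 1) {t : ℝ} (ht : t ∈ Set.Icc (0 : ℝ) 1) : N (x + t * (y - x)) ≤ 1 := by
  rcases eq_or_ne x y with rfl | hxy
  · simpa using hx
  rcases eq_or_lt_of_le ht.1 with h | h
  · simpa [← h] using hx
  rcases eq_or_lt_of_le ht.2 with h' | h'
  · simpa [h'] using hy
  exact (hN x y hx hy hxy t ⟨h, h'⟩).le

/-- A boundary point of a strictly convex body on a chord is one of its endpoints. -/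
theorem StrictGauge.endpoint {N : ℂ → ℝ} (hN : StrictGauge N) {x y : ℂ} (hx : N x ≤ 1)
    (hy : N y ≤ 1) (hxy : x ≠ y) {t : ℝ} (ht : t ∈ Set.Icc (0 : ℝ) 1)
    (h : N (x + t * (y - x)) = 1) : t = 0 ∨ t = 1 := by
  by_contra! hc
  exact (hN x y hx hy hxy t ⟨lt_of_le_of_ne ht.1 hc.1.symm, lt_of_le_of_ne ht.2 hc.2⟩).ne h

/-- A nonpositive real quotient would put `a` strictly inside the segment from `x` to `y`, where the
gauge is below `1`. So differences taken from a common boundary point never have opposite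
directions, and the principal logarithm compares them continuously. -/
theorem StrictGauge.div_mem_slitPlane {N : ℂ → ℝ} (hN : StrictGauge N) {a x y : ℂ}
    (ha : N a = 1) (hx : N x ≤ 1) (hy : N y ≤ 1) (hxa : x ≠ a) (hya : y ≠ a) :
    (a - x) / (a - y) ∈ Complex.slitPlane := by
  by_contra hc
  rw [Complex.mem_slitPlane_iff_not_le_zero, not_not] at hc
  have hay : a - y ≠ 0 := sub_ne_zero.2 hya.symm
  obtain ⟨r, hr⟩ : ∃ r : ℝ, (a - x) / (a - y) = -(r : ℂ) := by
    refine ⟨-((a - x) / (a - y)).re, Complex.ext (by simp) ?_⟩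
    simpa using (Complex.le_def.1 hc).2
  have hr0 : 0 ≤ r := by
    have := (Complex.le_def.1 hc).1
    rw [hr] at this
    simpa using this
  have e : a - x = -r * (a - y) := by rw [← hr]; field_simp
  have hr1 : 0 < r := lt_of_le_of_ne hr0 fun h => hxa (by
    rw [← h] at e; simp at e; exact (sub_eq_zero.1 e).symm)
  have hc1 : (1 + r : ℂ) ≠ 0 := by
    have : (1 + r : ℝ) ≠ 0 := by positivity
    exact_mod_cast this
  have key : a = x + ((r / (1 + r) : ℝ) : ℂ) * (y - x) := by
    push_cast
    field_simp
    linear_combination e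
  have hxy : x ≠ y := fun h => by
    rw [← h] at key; simp at key; exact hxa key.symm
  have := hN x y hx hy hxy (r / (1 + r)) ⟨by positivity, by rw [div_lt_one (by positivity)]; linarith⟩
  rw [← key, ha] at this
  exact lt_irrefl _ this

/-- Two disjoint arcs joining boundary points of a strictly convex body have endpoints that do not
interlace: the corresponding chords are disjoint. -/
theorem StrictGauge.chords_disjoint {N : ℂ → ℝ} (hN : StrictGauge N) {γ₁ γ₂ : ℝ → ℂ}
    (h₁ : Continuous γ₁) (h₂ : Continuous γ₂) (hN₁ : ∀ t, N (γ₁ t) ≤ 1) (hN₂ : ∀ t, N (γ₂ t) ≤ 1)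
    (hA : N (γ₁ 0) = 1) (hB : N (γ₁ 1) = 1) (hC : N (γ₂ 0) = 1) (hD : N (γ₂ 1) = 1)
    (hAB : γ₁ 0 ≠ γ₁ 1) (hCD : γ₂ 0 ≠ γ₂ 1) (hdisj : ∀ s t, γ₁ s ≠ γ₂ t) {s₀ t₀ : ℝ}
    (hs : s₀ ∈ Set.Icc (0 : ℝ) 1) (ht : t₀ ∈ Set.Icc (0 : ℝ) 1) :
    γ₁ 0 + s₀ * (γ₁ 1 - γ₁ 0) ≠ γ₂ 0 + t₀ * (γ₂ 1 - γ₂ 0) := by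
  -- If the chords crossed, compare `γ₁ s - γ₂ t` with the corresponding difference of chord points
  -- around the boundary of the parameter square. They never have opposite directions there, so they
  -- have equal winding numbers. The first has a global logarithm, hence winding number `0`; the
  -- second is affine, invertible and vanishes inside the square, hence has winding number `±1`.
  intro heq
  set A := γ₁ 0 with hAdef
  set B := γ₁ 1 with hBdef
  set C := γ₂ 0 with hCdef
  set D := γ₂ 1 with hDdef
  have bdry : ∀ P X Y : ℂ, N P = 1 → N X = 1 → N Y = 1 → X ≠ Y → P ≠ X → P ≠ Y →
      ∀ t ∈ Set.Icc (0 : ℝ) 1, P ≠ X + t * (Y - X) := by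
    intro P X Y hP hX hY hXY hPX hPY t ht h
    rcases hN.endpoint hX.le hY.le hXY ht (h ▸ hP) with rfl | rfl
    · exact hPX (by simpa using h)
    · exact hPY (by simpa using h)
  have hAC : A ≠ C := hdisj 0 0
  have hAD : A ≠ D := hdisj 0 1
  have hBC : B ≠ C := hdisj 1 0
  have hBD : B ≠ D := hdisj 1 1
  have bA := bdry A C D hA hC hD hCD hAC hAD
  have bB := bdry B C D hB hC hD hCD hBC hBD
  have bC := bdry C A B hC hA hB hAB hAC.symm hBC.symm
  have bD := bdry D A B hD hA hB hAB hAD.symm hBD.symm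
  have hs0 : 0 < s₀ := lt_of_le_of_ne hs.1 fun h => bA t₀ ht (by rw [← heq, ← h]; simp)
  have hs1 : s₀ < 1 := lt_of_le_of_ne hs.2 fun h => bB t₀ ht (by rw [← heq, h]; simp)
  have ht0 : 0 < t₀ := lt_of_le_of_ne ht.1 fun h => bC s₀ hs (by rw [heq, ← h]; simp)
  have ht1 : t₀ < 1 := lt_of_le_of_ne ht.2 fun h => bD s₀ hs (by rw [heq, h]; simp)
  set u := B - A with hu
  set w := D - C with hw
  set Δ : ℝ := u.re * w.im - u.im * w.re with hΔ
  have hu0 : u ≠ 0 := sub_ne_zero.2 hAB.symm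
  have hw0 : w ≠ 0 := sub_ne_zero.2 hCD.symm
  -- Parallel chords that meet are collinear; then one of three collinear boundary points lies
  -- between the other two, against strict convexity.
  have hΔ0 : Δ ≠ 0 := by
    intro h
    obtain ⟨μ, hμ⟩ : ∃ μ : ℝ, w = μ * u := by
      refine ⟨(u.re * w.re + u.im * w.im) / (u.re ^ 2 + u.im ^ 2), ?_⟩
      have hpos : u.re ^ 2 + u.im ^ 2 ≠ 0 := by
        intro h'
        apply hu0
        apply Complex.ext <;> simp <;> nlinarith [sq_nonneg u.re, sq_nonneg u.im]
      have h' : u.re * w.im = u.im * w.re := by linarith [hΔ ▸ h]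
      apply Complex.ext
      · simp only [Complex.mul_re, Complex.ofReal_re, Complex.ofReal_im, zero_mul, sub_zero]
        field_simp; linear_combination (-u.im) * h'
      · simp only [Complex.mul_im, Complex.ofReal_re, Complex.ofReal_im, zero_mul, add_zero]
        field_simp; linear_combination u.re * h'
    have hCc : C = A + ((s₀ - t₀ * μ : ℝ) : ℂ) * u := by
      push_cast; rw [hμ] at heq; linear_combination -heq
    set c : ℝ := s₀ - t₀ * μ
    rcases lt_trichotomy c 0 with h0 | h0 | h0
    · refine bdry A C B hA hC hB hBC.symm hAC hAB (-c / (1 - c))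
        ⟨by apply div_nonneg <;> linarith, by rw [div_le_one] <;> linarith⟩ ?_
      have : (1 - c : ℂ) ≠ 0 := by
        have : (1 - c : ℝ) ≠ 0 := by linarith
        exact_mod_cast this
      rw [hCc, hu]; push_cast; field_simp; ring
    · exact hAC (by rw [hCc, h0]; simp)
    · rcases le_or_gt c 1 with h1 | h1
      · exact bC c ⟨h0.le, h1⟩ hCc
      · refine bdry B A C hB hA hC hAC hAB.symm hBC (1 / c)
          ⟨by positivity, by rw [div_le_one] <;> linarith⟩ ?_
        have : (c : ℂ) ≠ 0 := by exact_mod_cast h0.ne'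
        rw [hCc, hu]; push_cast; field_simp; ring
  -- the continuous logarithm of the difference
  obtain ⟨l, hlc, hl⟩ := exists_continuous_log (F := fun x => γ₁ x.1 - γ₂ x.2) (by fun_prop)
    (fun x => sub_ne_zero.2 (hdisj _ _))
  -- a loop around the boundary of the unit square
  set w₁ : ℝ → ℝ := fun θ => (Real.cos θ * w.im - Real.sin θ * w.re) / Δ with hw₁
  set w₂ : ℝ → ℝ := fun θ => (Real.cos θ * u.im - Real.sin θ * u.re) / Δ with hw₂
  -- Gauge of the unit square seen from `(s₀, t₀)`: dividing by it moves the direction `(w₁, w₂)`,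
  -- found by Cramer's rule, to the boundary of the square. Along this loop the difference of chord
  -- points is `exp(iθ) / q θ`.
  set q : ℝ → ℝ := fun θ => max (max (w₁ θ / (1 - s₀)) (-w₁ θ / s₀))
    (max (w₂ θ / (1 - t₀)) (-w₂ θ / t₀)) with hq
  have hexp : ∀ θ : ℝ, (w₁ θ : ℂ) * u - (w₂ θ : ℂ) * w = Complex.exp (θ * Complex.I) := by
    intro θ
    rw [Complex.exp_mul_I, ← Complex.ofReal_cos, ← Complex.ofReal_sin]
    have e1 : w₁ θ * Δ = Real.cos θ * w.im - Real.sin θ * w.re := div_mul_cancel₀ _ hΔ0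
    have e2 : w₂ θ * Δ = Real.cos θ * u.im - Real.sin θ * u.re := div_mul_cancel₀ _ hΔ0
    apply Complex.ext
    · simp only [Complex.sub_re, Complex.mul_re, Complex.ofReal_re, Complex.ofReal_im,
        Complex.add_re, Complex.I_re, Complex.I_im]
      apply mul_right_cancel₀ hΔ0
      linear_combination u.re * e1 - w.re * e2 - Real.cos θ * hΔ
    · simp only [Complex.sub_im, Complex.mul_im, Complex.ofReal_re, Complex.ofReal_im,
        Complex.add_im, Complex.I_re, Complex.I_im]
      apply mul_right_cancel₀ hΔ0
      linear_combination u.im * e1 - w.im * e2 - Real.sin θ * hΔ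
  have hs1' : 0 < 1 - s₀ := by linarith
  have ht1' : 0 < 1 - t₀ := by linarith
  have hqpos : ∀ θ, 0 < q θ := by
    intro θ
    by_contra hc
    simp only [hq, not_lt, max_le_iff] at hc
    obtain ⟨⟨a1, a2⟩, a3, a4⟩ := hc
    rw [div_le_iff₀ hs1', zero_mul] at a1
    rw [div_le_iff₀ hs0, zero_mul] at a2
    rw [div_le_iff₀ ht1', zero_mul] at a3
    rw [div_le_iff₀ ht0, zero_mul] at a4
    have e1 : w₁ θ = 0 := by linarith
    have e2 : w₂ θ = 0 := by linarith
    have := hexp θ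
    rw [e1, e2] at this
    simp at this
    exact Complex.exp_ne_zero _ this.symm
  set b : ℝ → ℝ × ℝ := fun θ => (s₀ + w₁ θ / q θ, t₀ + w₂ θ / q θ) with hb
  have hqc : Continuous q := by fun_prop
  have hbc : Continuous b := by
    have h := fun θ => (hqpos θ).ne'
    fun_prop (disch := assumption)
  have hbI1 : ∀ θ, (b θ).1 ∈ Set.Icc (0 : ℝ) 1 := by
    intro θ
    have a1 : w₁ θ / (1 - s₀) ≤ q θ := (le_max_left _ _).trans (le_max_left _ _)
    have a2 : -w₁ θ / s₀ ≤ q θ := (le_max_right _ _).trans (le_max_left _ _)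
    rw [div_le_iff₀ hs1'] at a1
    rw [div_le_iff₀ hs0] at a2
    constructor
    · have : -s₀ ≤ w₁ θ / q θ := by rw [le_div_iff₀ (hqpos θ)]; linarith
      simp only [hb]; linarith
    · have : w₁ θ / q θ ≤ 1 - s₀ := by rw [div_le_iff₀ (hqpos θ)]; linarith
      simp only [hb]; linarith
  have hbI2 : ∀ θ, (b θ).2 ∈ Set.Icc (0 : ℝ) 1 := by
    intro θ
    have a1 : w₂ θ / (1 - t₀) ≤ q θ := (le_max_left _ _).trans (le_max_right _ _)
    have a2 : -w₂ θ / t₀ ≤ q θ := (le_max_right _ _).trans (le_max_right _ _)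
    rw [div_le_iff₀ ht1'] at a1
    rw [div_le_iff₀ ht0] at a2
    constructor
    · have : -t₀ ≤ w₂ θ / q θ := by rw [le_div_iff₀ (hqpos θ)]; linarith
      simp only [hb]; linarith
    · have : w₂ θ / q θ ≤ 1 - t₀ := by rw [div_le_iff₀ (hqpos θ)]; linarith
      simp only [hb]; linarith
  have hbB : ∀ θ, (b θ).1 = 0 ∨ (b θ).1 = 1 ∨ (b θ).2 = 0 ∨ (b θ).2 = 1 := by
    intro θ
    have hqne := (hqpos θ).ne'
    simp only [hb]
    rcases max_choice (max (w₁ θ / (1 - s₀)) (-w₁ θ / s₀))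
      (max (w₂ θ / (1 - t₀)) (-w₂ θ / t₀)) with h | h
    · rcases max_choice (w₁ θ / (1 - s₀)) (-w₁ θ / s₀) with h' | h'
      · right; left
        have : q θ = w₁ θ / (1 - s₀) := h.trans h'
        have h2 : w₁ θ = q θ * (1 - s₀) := by rw [this]; field_simp
        rw [h2]; field_simp; ring
      · left
        have : q θ = -w₁ θ / s₀ := h.trans h'
        have h2 : w₁ θ = -(q θ * s₀) := by rw [this]; field_simp
        rw [h2]; field_simp; ring
    · rcases max_choice (w₂ θ / (1 - t₀)) (-w₂ θ / t₀) with h' | h'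
      · right; right; right
        have : q θ = w₂ θ / (1 - t₀) := h.trans h'
        have h2 : w₂ θ = q θ * (1 - t₀) := by rw [this]; field_simp
        rw [h2]; field_simp; ring
      · right; right; left
        have : q θ = -w₂ θ / t₀ := h.trans h'
        have h2 : w₂ θ = -(q θ * t₀) := by rw [this]; field_simp
        rw [h2]; field_simp; ring
  set F₁ : ℝ × ℝ → ℂ := fun x => (A + x.1 * u) - (C + x.2 * w) with hF₁
  have hF₁b : ∀ θ, F₁ (b θ) = Complex.exp (θ * Complex.I) / q θ := by
    intro θ
    have hqne : (q θ : ℂ) ≠ 0 := by exact_mod_cast (hqpos θ).ne'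
    rw [← hexp θ]
    simp only [hF₁, hb]
    push_cast
    field_simp
    linear_combination (q θ : ℂ) * heq
  -- On each side of the square one parameter is `0` or `1`, where arc and chord share an endpoint;
  -- `div_mem_slitPlane` applies at that endpoint.
  have hslit : ∀ θ, F₁ (b θ) / (γ₁ (b θ).1 - γ₂ (b θ).2) ∈ Complex.slitPlane := by
    intro θ
    have hx : N (A + (b θ).1 * u) ≤ 1 := hN.le_one hA.le hB.le (hbI1 θ)
    have hy : N (C + (b θ).2 * w) ≤ 1 := hN.le_one hC.le hD.le (hbI2 θ)
    have hneg : ∀ a b c d : ℂ, (a - b) / (c - d) = (b - a) / (d - c) := by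
      intro a b c d
      rw [← neg_sub b a, ← neg_sub d c, neg_div_neg_eq]
    rcases hbB θ with h | h | h | h
    · have e1 : F₁ (b θ) = A - (C + (b θ).2 * w) := by simp [hF₁, h]
      rw [e1, h, ← hAdef]
      exact hN.div_mem_slitPlane hA hy (hN₂ _) (bA _ (hbI2 θ)).symm (hdisj 0 _).symm
    · have e1 : F₁ (b θ) = B - (C + (b θ).2 * w) := by simp [hF₁, h, hu]
      rw [e1, h, ← hBdef]
      exact hN.div_mem_slitPlane hB hy (hN₂ _) (bB _ (hbI2 θ)).symm (hdisj 1 _).symm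
    · have e1 : F₁ (b θ) = (A + (b θ).1 * u) - C := by simp [hF₁, h]
      rw [e1, h, ← hCdef, hneg]
      exact hN.div_mem_slitPlane hC hx (hN₁ _) (bC _ (hbI1 θ)).symm (hdisj _ 0)
    · have e1 : F₁ (b θ) = (A + (b θ).1 * u) - D := by simp [hF₁, h, hw]
      rw [e1, h, ← hDdef, hneg]
      exact hN.div_mem_slitPlane hD hx (hN₁ _) (bD _ (hbI1 θ)).symm (hdisj _ 1)
  -- A continuous logarithm of `exp(iθ) / q θ` that depends on `θ` only through the closed loop `b`,
  -- hence takes equal values at `0` and `2π`.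
  set L : ℝ → ℂ := fun θ => l (b θ) + Complex.log (F₁ (b θ) / (γ₁ (b θ).1 - γ₂ (b θ).2)) with hL
  have hLc : Continuous L := by
    refine (hlc.comp hbc).add (Continuous.clog ?_ hslit)
    refine Continuous.div ?_ ?_ (fun θ => sub_ne_zero.2 (hdisj _ _))
    · simp only [hF₁]; fun_prop
    · fun_prop
  have hLexp : ∀ θ, Complex.exp (L θ) = Complex.exp (θ * Complex.I) / q θ := by
    intro θ
    have h1 : γ₁ (b θ).1 - γ₂ (b θ).2 ≠ 0 := sub_ne_zero.2 (hdisj _ _)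
    have hne := Complex.slitPlane_ne_zero (hslit θ)
    simp only [hL]
    rw [Complex.exp_add, Complex.exp_log hne, hl, ← hF₁b θ]
    field_simp
  have hper : L (2 * Real.pi) = L 0 := by
    have e : b (2 * Real.pi) = b 0 := by simp [hb, hq, hw₁, hw₂]
    simp only [hL, e]
  -- The imaginary part of `L` differs from `θ` by a multiple of `2π`, so `g` is integer valued and
  -- continuous; periodicity of `L` makes it drop by `1`, which is impossible.
  set g : ℝ → ℝ := fun θ => ((L θ).im - θ) / (2 * Real.pi) with hg
  have hgc : Continuous g := by fun_prop
  have hint : ∀ θ, ∃ n : ℤ, g θ = n := by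
    intro θ
    have hqne : (q θ : ℂ) ≠ 0 := by exact_mod_cast (hqpos θ).ne'
    have h1 : Complex.exp (L θ - θ * Complex.I + (Real.log (q θ) : ℝ)) = 1 := by
      rw [Complex.exp_add, Complex.exp_sub, hLexp, ← Complex.ofReal_exp, Real.exp_log (hqpos θ)]
      field_simp [Complex.exp_ne_zero]
    obtain ⟨n, hn⟩ := Complex.exp_eq_one_iff.1 h1
    refine ⟨n, ?_⟩
    have := congrArg Complex.im hn
    simp at this
    simp only [hg]
    rw [this]; field_simp
  have hg2 : g (2 * Real.pi) = g 0 - 1 := by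
    simp only [hg, hper]
    field_simp
    ring
  obtain ⟨θ, -, hθ⟩ := intermediate_value_Icc' (f := g) (a := 0) (b := 2 * Real.pi)
    (by positivity) hgc.continuousOn
    (show g 0 - 1 / 2 ∈ Set.Icc (g (2 * Real.pi)) (g 0) from ⟨by rw [hg2]; linarith, by linarith⟩)
  obtain ⟨n, hn⟩ := hint θ
  obtain ⟨m, hm⟩ := hint 0
  have : (2 * n : ℝ) = 2 * m - 1 := by rw [← hn, ← hm, hθ]; ring
  have : (2 * n : ℤ) = 2 * m - 1 := by exact_mod_cast this
  omega

/-! ### Weak derivatives of continuous functions on intervals -/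

/-- A sequence of bump functions on the line shrinking to the origin. -/
noncomputable def shrinkBump (n : ℕ) : ContDiffBump (0 : ℝ) where
  rIn := 1 / (2 * (n + 1))
  rOut := 1 / (n + 1)
  rIn_pos := by positivity
  rIn_lt_rOut := by
    have : (0 : ℝ) < n + 1 := by positivity
    rw [div_lt_div_iff₀ (by positivity) this]; linarith

/-- The shrinking bumps, normalized to unit mass. -/
noncomputable def mollifier (n : ℕ) : ℝ → ℝ := (shrinkBump n).normed volume

theorem mollifier_eq_zero {n : ℕ} {x : ℝ} (hx : 1 / ((n : ℝ) + 1) ≤ |x|) : mollifier n x = 0 := by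
  have : x ∉ Function.support ((shrinkBump n).normed volume) := by
    rw [(shrinkBump n).support_normed_eq]
    simpa [shrinkBump] using hx
  exact Function.notMem_support.1 this

theorem continuous_mollifier (n : ℕ) : Continuous (mollifier n) := (shrinkBump n).continuous_normed

/-- A smooth function that increases from `0` to `1` near `q₁` and decreases back to `0` near
`q₂`. -/
noncomputable def plateau (q₁ q₂ : ℝ) (n : ℕ) (t : ℝ) : ℝ :=
  (∫ x in (0 : ℝ)..(q₂ - t), mollifier n x) - ∫ x in (0 : ℝ)..(q₁ - t), mollifier n x

theorem plateau_eq (q₁ q₂ : ℝ) (n : ℕ) (t : ℝ) :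
    plateau q₁ q₂ n t = ∫ x in (q₁ - t)..(q₂ - t), mollifier n x := by
  unfold plateau
  rw [intervalIntegral.integral_interval_sub_left] <;>
    exact (continuous_mollifier n).intervalIntegrable _ _

/-- The derivative is a difference of two approximate point masses, so that testing a weak
derivative with plateaus recovers `w q₂ - w q₁` in the limit. -/
theorem hasDerivAt_plateau (q₁ q₂ : ℝ) (n : ℕ) (t : ℝ) :
    HasDerivAt (plateau q₁ q₂ n) (mollifier n (q₁ - t) - mollifier n (q₂ - t)) t := by
  have h : ∀ q : ℝ, HasDerivAt (fun t => ∫ x in (0 : ℝ)..(q - t), mollifier n x)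
      (-mollifier n (q - t)) t := by
    intro q
    have h1 : HasDerivAt (fun u => ∫ x in (0 : ℝ)..u, mollifier n x) (mollifier n (q - t)) (q - t) :=
      intervalIntegral.integral_hasDerivAt_right ((continuous_mollifier n).intervalIntegrable _ _)
        ((continuous_mollifier n).stronglyMeasurableAtFilter _ _)
        (continuous_mollifier n).continuousAt
    have h2 : HasDerivAt (fun t : ℝ => q - t) (-1) t := by
      simpa using (hasDerivAt_id t).const_sub q
    have h3 := h1.comp t h2
    rw [mul_neg_one] at h3
    exact h3
  have := (h q₂).sub (h q₁)
  convert! this using 1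
  ring

theorem contDiff_plateau (q₁ q₂ : ℝ) (n : ℕ) :
    ContDiff ℝ ((⊤ : ℕ∞) : WithTop ℕ∞) (plateau q₁ q₂ n) := by
  rw [contDiff_infty_iff_deriv]
  refine ⟨fun t => (hasDerivAt_plateau q₁ q₂ n t).differentiableAt, ?_⟩
  have : deriv (plateau q₁ q₂ n) = fun t => mollifier n (q₁ - t) - mollifier n (q₂ - t) :=
    funext fun t => (hasDerivAt_plateau q₁ q₂ n t).deriv
  rw [this]
  have hm : ContDiff ℝ ((⊤ : ℕ∞) : WithTop ℕ∞) (mollifier n) := (shrinkBump n).contDiff_normed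
  exact (hm.comp (contDiff_const.sub contDiff_id)).sub (hm.comp (contDiff_const.sub contDiff_id))

theorem plateau_nonneg {q₁ q₂ : ℝ} (h : q₁ ≤ q₂) (n : ℕ) (t : ℝ) : 0 ≤ plateau q₁ q₂ n t := by
  rw [plateau_eq]
  exact intervalIntegral.integral_nonneg (by linarith) fun x _ => (shrinkBump n).nonneg_normed x

theorem plateau_le_one {q₁ q₂ : ℝ} (h : q₁ ≤ q₂) (n : ℕ) (t : ℝ) : plateau q₁ q₂ n t ≤ 1 := by
  rw [plateau_eq, intervalIntegral.integral_of_le (by linarith),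
    ← (shrinkBump n).integral_normed (μ := volume)]
  exact setIntegral_le_integral (shrinkBump n).integrable_normed
    (Eventually.of_forall fun x => (shrinkBump n).nonneg_normed x)

theorem plateau_eq_zero_left {q₁ q₂ t : ℝ} {n : ℕ} (hq : q₁ ≤ q₂)
    (h : t ≤ q₁ - 1 / ((n : ℝ) + 1)) : plateau q₁ q₂ n t = 0 := by
  rw [plateau_eq]
  apply intervalIntegral.integral_zero_ae
  refine Eventually.of_forall fun x hx => mollifier_eq_zero ?_
  rw [Set.uIoc_of_le (by linarith)] at hx
  exact le_trans (by linarith [hx.1]) (le_abs_self x)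

theorem plateau_eq_zero_right {q₁ q₂ t : ℝ} {n : ℕ} (hq : q₁ ≤ q₂)
    (h : q₂ + 1 / ((n : ℝ) + 1) ≤ t) : plateau q₁ q₂ n t = 0 := by
  rw [plateau_eq]
  apply intervalIntegral.integral_zero_ae
  refine Eventually.of_forall fun x hx => mollifier_eq_zero ?_
  rw [Set.uIoc_of_le (by linarith)] at hx
  exact le_trans (by linarith [hx.2]) (neg_le_abs x)

theorem plateau_eq_one {q₁ q₂ t : ℝ} {n : ℕ} (h₁ : q₁ + 1 / ((n : ℝ) + 1) < t)
    (h₂ : t < q₂ - 1 / ((n : ℝ) + 1)) : plateau q₁ q₂ n t = 1 := by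
  rw [plateau_eq, intervalIntegral.integral_eq_integral_of_support_subset]
  · exact (shrinkBump n).integral_normed
  · intro x hx
    have : |x| < 1 / ((n : ℝ) + 1) := by
      by_contra hc
      exact hx (mollifier_eq_zero (not_lt.1 hc))
    rw [abs_lt] at this
    constructor <;> linarith [this.1, this.2]

theorem tsupport_plateau_subset {q₁ q₂ : ℝ} (hq : q₁ ≤ q₂) (n : ℕ) :
    tsupport (plateau q₁ q₂ n) ⊆ Set.Icc (q₁ - 1 / ((n : ℝ) + 1)) (q₂ + 1 / ((n : ℝ) + 1)) := by
  apply closure_minimal _ isClosed_Icc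
  intro t ht
  constructor
  · by_contra hc
    exact ht (plateau_eq_zero_left hq (not_le.1 hc).le)
  · by_contra hc
    exact ht (plateau_eq_zero_right hq (not_le.1 hc).le)

theorem hasCompactSupport_plateau {q₁ q₂ : ℝ} (hq : q₁ ≤ q₂) (n : ℕ) :
    HasCompactSupport (plateau q₁ q₂ n) :=
  isCompact_Icc.of_isClosed_subset (isClosed_tsupport _) (tsupport_plateau_subset hq n)

theorem tendsto_one_div_succ : Tendsto (fun n : ℕ => 1 / ((n : ℝ) + 1)) atTop (𝓝 0) :=
  tendsto_one_div_add_atTop_nhds_zero_nat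

theorem tendsto_integral_mollifier_smul {a b q : ℝ} (hq : q ∈ Set.Ioo a b) {w : ℝ → Plane}
    (hw : ContinuousOn w (Set.Ioo a b)) :
    Tendsto (fun n => ∫ t in Set.Ioo a b, mollifier n (q - t) • w t) atTop (𝓝 (w q)) := by
  have h := ContDiffBump.convolution_tendsto_right (μ := volume) (φ := shrinkBump)
    (g := fun _ => (Set.Ioo a b).indicator w) (k := fun _ => q) (x₀ := q) (z₀ := w q) (l := atTop)
    tendsto_one_div_succ
    (Eventually.of_forall fun _ => (aestronglyMeasurable_indicator_iff measurableSet_Ioo).2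
      (hw.aestronglyMeasurable measurableSet_Ioo))
    (by
      have : Tendsto ((Set.Ioo a b).indicator w) (𝓝 q) (𝓝 (w q)) := by
        have h1 : Tendsto w (𝓝 q) (𝓝 (w q)) := hw.continuousAt (Ioo_mem_nhds hq.1 hq.2)
        refine h1.congr' ?_
        filter_upwards [Ioo_mem_nhds hq.1 hq.2] with x hx
        simp [hx]
      exact this.comp tendsto_snd) tendsto_const_nhds
  refine h.congr fun n => ?_
  rw [convolution_eq_swap, ← integral_indicator measurableSet_Ioo]
  congr 1
  ext t
  by_cases ht : t ∈ Set.Ioo a b <;> simp [ht, mollifier]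

theorem tendsto_integral_plateau_smul {a b q₁ q₂ : ℝ} (h₁ : a < q₁) (h₁₂ : q₁ ≤ q₂) (h₂ : q₂ < b)
    {g : ℝ → Plane} (hg : IntegrableOn g (Set.Ioo a b)) :
    Tendsto (fun n => ∫ t in Set.Ioo a b, plateau q₁ q₂ n t • g t) atTop
      (𝓝 (∫ t in q₁..q₂, g t)) := by
  have e : ∫ t in q₁..q₂, g t = ∫ t in Set.Ioo a b, (Set.Ioo q₁ q₂).indicator g t := by
    rw [intervalIntegral.integral_of_le h₁₂, integral_Ioc_eq_integral_Ioo,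
      setIntegral_indicator measurableSet_Ioo, Set.inter_eq_self_of_subset_right]
    exact Set.Ioo_subset_Ioo h₁.le h₂.le
  rw [e]
  refine tendsto_integral_of_dominated_convergence (fun t => ‖g t‖) ?_ hg.norm ?_ ?_
  · intro n
    exact (contDiff_plateau q₁ q₂ n).continuous.aestronglyMeasurable.smul hg.1
  · intro n
    refine Eventually.of_forall fun t => ?_
    rw [norm_smul, Real.norm_of_nonneg (plateau_nonneg h₁₂ n t)]
    exact mul_le_of_le_one_left (norm_nonneg _) (plateau_le_one h₁₂ n t)
  · have hne : ∀ q : ℝ, ∀ᵐ t ∂(volume.restrict (Set.Ioo a b)), t ≠ q := fun q =>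
      ae_restrict_of_ae (by simp [ae_iff])
    filter_upwards [hne q₁, hne q₂] with t ht1 ht2
    refine tendsto_const_nhds.congr' ?_
    by_cases ht : t ∈ Set.Ioo q₁ q₂
    · have hpos : 0 < min (t - q₁) (q₂ - t) := lt_min (by linarith [ht.1]) (by linarith [ht.2])
      filter_upwards [tendsto_one_div_succ.eventually (gt_mem_nhds hpos)] with n hn
      rw [lt_min_iff] at hn
      rw [plateau_eq_one (by linarith [hn.1]) (by linarith [hn.2])]
      simp [ht]
    · rcases lt_or_ge t q₁ with h | h
      · filter_upwards [tendsto_one_div_succ.eventually (gt_mem_nhds (sub_pos.2 h))] with n hn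
        rw [plateau_eq_zero_left h₁₂ (by linarith)]
        simp [ht]
      · have h' : q₂ < t := by
          by_contra hc
          exact ht ⟨lt_of_le_of_ne h ht1.symm, lt_of_le_of_ne (not_lt.1 hc) ht2⟩
        filter_upwards [tendsto_one_div_succ.eventually (gt_mem_nhds (sub_pos.2 h'))] with n hn
        rw [plateau_eq_zero_right h₁₂ (by linarith)]
        simp [ht]

/-- If `g` is a weak derivative of the continuous function `w` when tested with smooth plateau
functions between `q₁` and `q₂`, then the fundamental theorem of calculus holds. -/
theorem sub_eq_integral_of_plateau {a b q₁ q₂ : ℝ} (h₁ : a < q₁) (h₁₂ : q₁ ≤ q₂) (h₂ : q₂ < b)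
    {w g : ℝ → Plane} (hw : ContinuousOn w (Set.Ioo a b)) (hwi : IntegrableOn w (Set.Ioo a b))
    (hg : IntegrableOn g (Set.Ioo a b))
    (h : ∀ᶠ n in atTop, ∫ t in Set.Ioo a b,
      (deriv (plateau q₁ q₂ n) t • w t + plateau q₁ q₂ n t • g t) = 0) :
    w q₂ - w q₁ = ∫ t in q₁..q₂, g t := by
  have hi : ∀ q n, IntegrableOn (fun t => mollifier n (q - t) • w t) (Set.Ioo a b) := by
    intro q n
    have hc : Continuous fun t => mollifier n (q - t) :=
      (continuous_mollifier n).comp (continuous_const.sub continuous_id)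
    obtain ⟨C, hC⟩ := hc.bounded_above_of_compact_support (by
      refine HasCompactSupport.of_support_subset_isCompact
        (isCompact_Icc (a := q - 1) (b := q + 1)) fun t ht => ?_
      have h1 : |q - t| < 1 / ((n : ℝ) + 1) := by
        by_contra hc
        exact ht (mollifier_eq_zero (not_lt.1 hc))
      have h2 : 1 / ((n : ℝ) + 1) ≤ 1 := by
        rw [div_le_one (by positivity)]; linarith [n.cast_nonneg (α := ℝ)]
      rw [abs_lt] at h1
      constructor <;> linarith [h1.1, h1.2])
    exact Integrable.bdd_smul hwi C hc.aestronglyMeasurable (Eventually.of_forall hC)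
  have hj : ∀ n, IntegrableOn (fun t => plateau q₁ q₂ n t • g t) (Set.Ioo a b) := fun n =>
    Integrable.bdd_smul hg 1 (contDiff_plateau q₁ q₂ n).continuous.aestronglyMeasurable
      (Eventually.of_forall fun t => by
        rw [Real.norm_of_nonneg (plateau_nonneg h₁₂ n t)]; exact plateau_le_one h₁₂ n t)
  have T : Tendsto (fun n => ((∫ t in Set.Ioo a b, mollifier n (q₁ - t) • w t) -
      ∫ t in Set.Ioo a b, mollifier n (q₂ - t) • w t) +
      ∫ t in Set.Ioo a b, plateau q₁ q₂ n t • g t) atTop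
      (𝓝 ((w q₁ - w q₂) + ∫ t in q₁..q₂, g t)) :=
    ((tendsto_integral_mollifier_smul ⟨h₁, h₁₂.trans_lt h₂⟩ hw).sub
      (tendsto_integral_mollifier_smul ⟨h₁.trans_le h₁₂, h₂⟩ hw)).add
      (tendsto_integral_plateau_smul h₁ h₁₂ h₂ hg)
  have Z : (w q₁ - w q₂) + ∫ t in q₁..q₂, g t = 0 := by
    refine tendsto_nhds_unique T (tendsto_const_nhds.congr' ?_)
    filter_upwards [h] with n hn
    rw [← hn, ← integral_sub (hi _ _) (hi _ _)]
    refine Eq.trans ?_ (integral_add ((hi q₁ n).sub (hi q₂ n)) (hj n))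
    congr 1
    ext1 t
    rw [(hasDerivAt_plateau q₁ q₂ n t).deriv, sub_smul]
  rw [← sub_eq_zero, ← neg_eq_zero, ← Z]
  abel


/-- The fundamental theorem of calculus on an interval follows from its rational instances. -/
theorem sub_eq_integral_of_rat {a b : ℝ} {w g : ℝ → Plane} (hw : ContinuousOn w (Set.Ioo a b))
    (hg : IntegrableOn g (Set.Ioo a b))
    (h : ∀ q₁ q₂ : ℚ, a < q₁ → (q₁ : ℝ) ≤ q₂ → (q₂ : ℝ) < b →
      w q₂ - w q₁ = ∫ t in (q₁ : ℝ)..q₂, g t) {t₁ t₂ : ℝ} (h₁ : t₁ ∈ Set.Ioo a b)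
    (h₂ : t₂ ∈ Set.Ioo a b) : w t₂ - w t₁ = ∫ t in t₁..t₂, g t := by
  have hgI : Integrable ((Set.Ioo a b).indicator g) := (integrable_indicator_iff measurableSet_Ioo).2 hg
  have hsub : ∀ x ∈ Set.Ioo a b, ∀ y ∈ Set.Ioo a b,
      ∫ t in x..y, (Set.Ioo a b).indicator g t = ∫ t in x..y, g t := by
    intro x hx y hy
    refine intervalIntegral.integral_congr fun t ht => ?_
    rw [Set.indicator_of_mem ((Set.ordConnected_Ioo.uIcc_subset hx hy) ht)]
  -- Both sides are continuous in the endpoint and agree on a dense set. Reducing to rational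
  -- endpoints lets almost every slice be handled with countably many test functions.
  obtain ⟨q₀, hq₀a, hq₀b⟩ := exists_rat_btwn (h₁.1.trans h₁.2)
  have hc : Continuous fun t => w q₀ + ∫ x in (q₀ : ℝ)..t, (Set.Ioo a b).indicator g x :=
    continuous_const.add (intervalIntegral.continuous_primitive
      (fun x y => hgI.intervalIntegrable) _)
  have key : Set.EqOn w (fun t => w q₀ + ∫ x in (q₀ : ℝ)..t, (Set.Ioo a b).indicator g x)
      (Set.Ioo a b) := by
    refine Set.EqOn.of_subset_closure (s := Set.Ioo a b ∩ Set.range ((↑) : ℚ → ℝ)) ?_ hw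
      hc.continuousOn Set.inter_subset_left
      (Rat.denseRange_cast.open_subset_closure_inter isOpen_Ioo)
    rintro _ ⟨hx, q, rfl⟩
    simp only
    rw [hsub _ ⟨hq₀a, hq₀b⟩ _ hx]
    rcases le_total (q₀ : ℝ) q with hq | hq
    · rw [← h q₀ q hq₀a hq hx.2]; abel
    · rw [intervalIntegral.integral_symm, ← h q q₀ hx.1 hq hq₀b]; abel
  have hI : ∀ x y : ℝ, IntervalIntegrable ((Set.Ioo a b).indicator g) volume x y :=
    fun x y => hgI.intervalIntegrable
  rw [key h₁, key h₂, ← hsub _ h₁ _ h₂, add_sub_add_left_eq_sub,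
    intervalIntegral.integral_interval_sub_left (hI _ _) (hI _ _)]

/-- A continuous function with integrable weak derivative satisfies the fundamental theorem of
calculus. -/
theorem sub_eq_integral_of_weakDeriv {a b : ℝ} {w g : ℝ → Plane} (hw : ContinuousOn w (Set.Ioo a b))
    (hwi : IntegrableOn w (Set.Ioo a b)) (hg : IntegrableOn g (Set.Ioo a b))
    (h : ∀ φ : ℝ → ℝ, ContDiff ℝ ((⊤ : ℕ∞) : WithTop ℕ∞) φ → HasCompactSupport φ →
      tsupport φ ⊆ Set.Ioo a b → ∫ t in Set.Ioo a b, (deriv φ t • w t + φ t • g t) = 0)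
    {t₁ t₂ : ℝ} (h₁ : t₁ ∈ Set.Ioo a b) (h₂ : t₂ ∈ Set.Ioo a b) :
    w t₂ - w t₁ = ∫ t in t₁..t₂, g t := by
  refine sub_eq_integral_of_rat hw hg (fun q₁ q₂ ha hq hb => ?_) h₁ h₂
  refine sub_eq_integral_of_plateau ha hq hb hw hwi hg ?_
  have hpos : 0 < min ((q₁ : ℝ) - a) (b - q₂) := lt_min (by linarith) (by linarith)
  filter_upwards [tendsto_one_div_succ.eventually (gt_mem_nhds hpos)] with n hn
  rw [lt_min_iff] at hn
  refine h _ (contDiff_plateau _ _ _) (hasCompactSupport_plateau hq n)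
    ((tsupport_plateau_subset hq n).trans fun t ht => ⟨?_, ?_⟩)
  · linarith [ht.1, hn.1]
  · linarith [ht.2, hn.2]

theorem Continuous.exists_norm_le_of_hasCompactSupport {φ : ℝ → ℝ} (hc : Continuous φ)
    (hs : HasCompactSupport φ) : ∃ C, ∀ x, ‖φ x‖ ≤ C :=
  hc.bounded_above_of_compact_support hs

/-- Absolute continuity on lines: a continuous function on a rectangle with an integrable weak
derivative in the first variable satisfies the fundamental theorem of calculus on almost every
line. -/
theorem ae_slice_sub_eq_integral {a b c d : ℝ} {v g : ℝ × ℝ → Plane}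
    (hvc : ContinuousOn v (Set.Ioo a b ×ˢ Set.Ioo c d))
    (hv : IntegrableOn v (Set.Ioo a b ×ˢ Set.Ioo c d))
    (hg : IntegrableOn g (Set.Ioo a b ×ˢ Set.Ioo c d))
    (H : ∀ φ ψ : ℝ → ℝ, ContDiff ℝ ((⊤ : ℕ∞) : WithTop ℕ∞) φ → HasCompactSupport φ →
      tsupport φ ⊆ Set.Ioo a b → ContDiff ℝ ((⊤ : ℕ∞) : WithTop ℕ∞) ψ → HasCompactSupport ψ →
      tsupport ψ ⊆ Set.Ioo c d →
      ∫ x in Set.Ioo a b ×ˢ Set.Ioo c d, (deriv φ x.1 * ψ x.2) • v x =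
        - ∫ x in Set.Ioo a b ×ˢ Set.Ioo c d, (φ x.1 * ψ x.2) • g x) :
    ∀ᵐ s ∂(volume.restrict (Set.Ioo c d)), IntegrableOn (fun t => g (t, s)) (Set.Ioo a b) ∧
      ∀ t₁ ∈ Set.Ioo a b, ∀ t₂ ∈ Set.Ioo a b, v (t₂, s) - v (t₁, s) = ∫ t in t₁..t₂, g (t, s) := by
  have hm : (volume : Measure (ℝ × ℝ)).restrict (Set.Ioo a b ×ˢ Set.Ioo c d) =
      (volume.restrict (Set.Ioo a b)).prod (volume.restrict (Set.Ioo c d)) := by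
    rw [Measure.prod_restrict]; rfl
  rw [IntegrableOn, hm] at hv hg
  -- testing with products
  have key : ∀ φ : ℝ → ℝ, ContDiff ℝ ((⊤ : ℕ∞) : WithTop ℕ∞) φ → HasCompactSupport φ →
      tsupport φ ⊆ Set.Ioo a b → ∀ᵐ s ∂(volume.restrict (Set.Ioo c d)),
        ∫ t in Set.Ioo a b, (deriv φ t • v (t, s) + φ t • g (t, s)) = 0 := by
    intro φ hφ hφc hφs
    have hφ' : Continuous (deriv φ) := hφ.continuous_deriv (by simp)
    obtain ⟨C, hC⟩ := hφ.continuous.exists_norm_le_of_hasCompactSupport hφc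
    obtain ⟨C', hC'⟩ := hφ'.exists_norm_le_of_hasCompactSupport hφc.deriv
    have i1 : Integrable (fun x : ℝ × ℝ => deriv φ x.1 • v x)
        ((volume.restrict (Set.Ioo a b)).prod (volume.restrict (Set.Ioo c d))) :=
      Integrable.bdd_smul hv C' (hφ'.comp continuous_fst).aestronglyMeasurable
        (Eventually.of_forall fun x => hC' x.1)
    have i2 : Integrable (fun x : ℝ × ℝ => φ x.1 • g x)
        ((volume.restrict (Set.Ioo a b)).prod (volume.restrict (Set.Ioo c d))) :=
      Integrable.bdd_smul hg C (hφ.continuous.comp continuous_fst).aestronglyMeasurable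
        (Eventually.of_forall fun x => hC x.1)
    have i3 := i1.add i2
    -- By Fubini, testing with `φ(x₁) ψ(x₂)` says that the slice integral is orthogonal to every
    -- `ψ`.
    have h0 := isOpen_Ioo.ae_eq_zero_of_integral_contDiff_smul_eq_zero (U := Set.Ioo c d)
      (μ := volume) (f := fun s => ∫ t in Set.Ioo a b, (deriv φ t • v (t, s) + φ t • g (t, s)))
      (IntegrableOn.locallyIntegrableOn i3.integral_prod_right) (by
        intro ψ hψ hψc hψs
        obtain ⟨D, hD⟩ := hψ.continuous.exists_norm_le_of_hasCompactSupport hψc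
        have j1 : Integrable (fun x : ℝ × ℝ => (deriv φ x.1 * ψ x.2) • v x)
            ((volume.restrict (Set.Ioo a b)).prod (volume.restrict (Set.Ioo c d))) := by
          refine (Integrable.bdd_smul i1 D (hψ.continuous.comp continuous_snd).aestronglyMeasurable
            (Eventually.of_forall fun x => hD x.2)).congr (Eventually.of_forall fun x => ?_)
          simp [smul_smul, mul_comm]
        have j2 : Integrable (fun x : ℝ × ℝ => (φ x.1 * ψ x.2) • g x)
            ((volume.restrict (Set.Ioo a b)).prod (volume.restrict (Set.Ioo c d))) := by
          refine (Integrable.bdd_smul i2 D (hψ.continuous.comp continuous_snd).aestronglyMeasurable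
            (Eventually.of_forall fun x => hD x.2)).congr (Eventually.of_forall fun x => ?_)
          simp [smul_smul, mul_comm]
        have e0 := H φ ψ hφ hφc hφs hψ hψc hψs
        have e1 := integral_prod_symm _ (j1.add j2)
        simp only [Pi.add_apply] at e1
        rw [hm, eq_neg_iff_add_eq_zero, ← integral_add j1 j2, e1] at e0
        rw [← setIntegral_eq_integral_of_forall_compl_eq_zero (s := Set.Ioo c d), ← e0]
        · congr 1
          ext1 s
          rw [← integral_smul]
          congr 1
          ext1 t
          simp [smul_smul, mul_comm]
        · intro s hs
          rw [image_eq_zero_of_notMem_tsupport (fun h => hs (hψs h)), zero_smul])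
    rw [ae_restrict_iff' measurableSet_Ioo]
    exact h0
  -- The plateaus with rational ends form a countable family, so a single null set of lines is
  -- discarded.
  have all : ∀ᵐ s ∂(volume.restrict (Set.Ioo c d)), ∀ (n : ℕ) (q₁ q₂ : ℚ),
      a < q₁ - 1 / ((n : ℝ) + 1) → (q₁ : ℝ) ≤ q₂ → q₂ + 1 / ((n : ℝ) + 1) < b →
      ∫ t in Set.Ioo a b, (deriv (plateau q₁ q₂ n) t • v (t, s) + plateau q₁ q₂ n t • g (t, s)) = 0 := by
    rw [ae_all_iff]; intro n
    rw [ae_all_iff]; intro q₁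
    rw [ae_all_iff]; intro q₂
    by_cases hcond : a < q₁ - 1 / ((n : ℝ) + 1) ∧ (q₁ : ℝ) ≤ q₂ ∧ q₂ + 1 / ((n : ℝ) + 1) < b
    · filter_upwards [key _ (contDiff_plateau q₁ q₂ n) (hasCompactSupport_plateau hcond.2.1 n)
        ((tsupport_plateau_subset hcond.2.1 n).trans fun t ht =>
          ⟨hcond.1.trans_le ht.1, ht.2.trans_lt hcond.2.2⟩)] with s hs _ _ _
      exact hs
    · exact Eventually.of_forall fun s h1 h2 h3 => absurd ⟨h1, h2, h3⟩ hcond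
  filter_upwards [all, hv.prod_left_ae, hg.prod_left_ae, ae_restrict_mem measurableSet_Ioo]
    with s hs hvs hgs hsm
  have hcs : ContinuousOn (fun t => v (t, s)) (Set.Ioo a b) :=
    hvc.comp (by fun_prop) fun t ht => ⟨ht, hsm⟩
  refine ⟨hgs, fun t₁ h₁ t₂ h₂ => sub_eq_integral_of_rat (w := fun t => v (t, s)) hcs hgs
    (fun q₁ q₂ ha hq hb => ?_) h₁ h₂⟩
  refine sub_eq_integral_of_plateau ha hq hb hcs hvs hgs ?_
  have hpos : 0 < min ((q₁ : ℝ) - a) (b - q₂) := lt_min (by linarith) (by linarith)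
  filter_upwards [tendsto_one_div_succ.eventually (gt_mem_nhds hpos)] with n hn
  rw [lt_min_iff] at hn
  exact hs n q₁ q₂ (by linarith [hn.1]) hq (by linarith [hn.2])

/-! ### Sobolev maps -/

theorem integrableOn_of_memLp {E F : Type*} [MeasureSpace E] [NormedAddCommGroup F] {p : ℝ}
    (hp : 1 ≤ p) {Ω : Set E} (hΩ : volume Ω < ⊤) {f : E → F}
    (hf : MemLp f (ENNReal.ofReal p) (volume.restrict Ω)) : IntegrableOn f Ω := by
  have : IsFiniteMeasure (volume.restrict Ω) := ⟨by simpa using hΩ⟩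
  exact hf.integrable (by simpa using ENNReal.ofReal_le_ofReal hp)

theorem volume_rodDomain : volume rodDomain = 1 := by simp [rodDomain]

theorem volume_bulkDomain : volume bulkDomain = 1 := by
  unfold bulkDomain
  rw [Measure.volume_eq_prod, Measure.prod_prod]
  norm_num

theorem isOpen_bulkDomain : IsOpen bulkDomain := isOpen_Ioo.prod isOpen_Ioo

theorem measurableSet_bulkDomain : MeasurableSet bulkDomain := isOpen_bulkDomain.measurableSet

/-- The fundamental theorem of calculus for the continuous representative of a rod deformation. -/
theorem SobolevMap.sub_eq_integral {p : ℝ} (hp : 1 ≤ p) (u : SobolevMap p rodDomain) {w : ℝ → Plane}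
    (hw : ContinuousOn w rodDomain) (hwu : w =ᵐ[volume.restrict rodDomain] u.toFun) {t₁ t₂ : ℝ}
    (h₁ : t₁ ∈ rodDomain) (h₂ : t₂ ∈ rodDomain) : w t₂ - w t₁ = ∫ t in t₁..t₂, u.grad t 1 := by
  have hfin : volume rodDomain < ⊤ := by rw [volume_rodDomain]; exact ENNReal.one_lt_top
  have hui : IntegrableOn u.toFun rodDomain := integrableOn_of_memLp hp hfin u.memLp_toFun
  have hwi : IntegrableOn w rodDomain := hui.congr hwu.symm
  have hgi : IntegrableOn (fun t => u.grad t 1) rodDomain :=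
    (ContinuousLinearMap.apply ℝ Plane (1 : ℝ)).integrable_comp
      (integrableOn_of_memLp hp hfin u.memLp_grad)
  refine sub_eq_integral_of_weakDeriv hw hwi hgi (fun φ hφ hφc hφs => ?_) h₁ h₂
  obtain ⟨C, hC⟩ := hφ.continuous.exists_norm_le_of_hasCompactSupport hφc
  have hφ' : Continuous (deriv φ) := hφ.continuous_deriv (by simp)
  obtain ⟨C', hC'⟩ := hφ'.exists_norm_le_of_hasCompactSupport hφc.deriv
  have i1 : IntegrableOn (fun t => deriv φ t • w t) (Set.Ioo 0 1) :=
    Integrable.bdd_smul hwi C' hφ'.aestronglyMeasurable (Eventually.of_forall hC')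
  have i2 : IntegrableOn (fun t => φ t • u.grad t 1) (Set.Ioo 0 1) :=
    Integrable.bdd_smul hgi C hφ.continuous.aestronglyMeasurable (Eventually.of_forall hC)
  rw [integral_add i1 i2, ← eq_neg_iff_add_eq_zero]
  have := u.isWeakGradient φ hφ hφc hφs 1
  simp only [fderiv_apply_one_eq_deriv] at this
  refine Eq.trans (integral_congr_ae ?_) this
  filter_upwards [hwu] with t ht
  rw [ht]

section Bulk

variable {p : ℝ} (y : SobolevMap p bulkDomain) {v : ℝ × ℝ → Plane}

theorem SobolevMap.weakGrad_prod {φ ψ : ℝ → ℝ} (hφ : ContDiff ℝ ((⊤ : ℕ∞) : WithTop ℕ∞) φ)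
    (hφc : HasCompactSupport φ) (hφs : tsupport φ ⊆ Set.Ioo 0 1)
    (hψ : ContDiff ℝ ((⊤ : ℕ∞) : WithTop ℕ∞) ψ) (hψc : HasCompactSupport ψ)
    (hψs : tsupport ψ ⊆ Set.Ioo (-(1 / 2) : ℝ) (1 / 2)) (e : ℝ × ℝ) :
    ∫ x in bulkDomain, (deriv φ x.1 * ψ x.2 * e.1 + φ x.1 * deriv ψ x.2 * e.2) • y.toFun x =
      - ∫ x in bulkDomain, (φ x.1 * ψ x.2) • y.grad x e := by
  have hsm : ContDiff ℝ ((⊤ : ℕ∞) : WithTop ℕ∞) (fun x : ℝ × ℝ => φ x.1 * ψ x.2) :=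
    (hφ.comp contDiff_fst).mul (hψ.comp contDiff_snd)
  have hsub : tsupport (fun x : ℝ × ℝ => φ x.1 * ψ x.2) ⊆ tsupport φ ×ˢ tsupport ψ := by
    apply closure_minimal _ ((isClosed_tsupport φ).prod (isClosed_tsupport ψ))
    intro x hx
    simp only [Function.mem_support, ne_eq, mul_eq_zero, not_or] at hx
    exact ⟨subset_closure hx.1, subset_closure hx.2⟩
  have hcs : HasCompactSupport (fun x : ℝ × ℝ => φ x.1 * ψ x.2) :=
    (hφc.prod hψc).of_isClosed_subset (isClosed_tsupport _) hsub
  rw [← y.isWeakGradient _ hsm hcs (hsub.trans (Set.prod_mono hφs hψs)) e]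
  congr 1
  ext1 x
  congr 1
  have h1 : HasFDerivAt (fun x : ℝ × ℝ => φ x.1)
      (deriv φ x.1 • ContinuousLinearMap.fst ℝ ℝ ℝ) x :=
    ((hφ.differentiable (by simp)) x.1).hasDerivAt.comp_hasFDerivAt x hasFDerivAt_fst
  have h2 : HasFDerivAt (fun x : ℝ × ℝ => ψ x.2)
      (deriv ψ x.2 • ContinuousLinearMap.snd ℝ ℝ ℝ) x :=
    ((hψ.differentiable (by simp)) x.2).hasDerivAt.comp_hasFDerivAt x hasFDerivAt_snd
  have h3 : fderiv ℝ (fun x : ℝ × ℝ => φ x.1 * ψ x.2) x = _ := (h1.mul h2).fderiv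
  rw [h3]
  simp
  ring

variable (hp : 1 ≤ p) (hv : ContinuousOn v bulkDomain)
  (hvy : v =ᵐ[volume.restrict bulkDomain] y.toFun)

theorem volume_bulkDomain_lt_top : volume bulkDomain < ⊤ := by
  rw [volume_bulkDomain]; exact ENNReal.one_lt_top

include hp in
theorem SobolevMap.integrableOn_grad (e : ℝ × ℝ) : IntegrableOn (fun x => y.grad x e) bulkDomain :=
  (ContinuousLinearMap.apply ℝ Plane e).integrable_comp
      (integrableOn_of_memLp hp volume_bulkDomain_lt_top y.memLp_grad)

include hp hvy in
theorem SobolevMap.integrableOn_rep : IntegrableOn v bulkDomain :=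
  (integrableOn_of_memLp hp volume_bulkDomain_lt_top y.memLp_toFun).congr hvy.symm

include hp hv hvy in
/-- Absolute continuity of bulk deformations on almost every horizontal line. -/
theorem SobolevMap.ae_slice_fst : ∀ᵐ s ∂(volume.restrict (Set.Ioo (-(1 / 2) : ℝ) (1 / 2))),
    IntegrableOn (fun t => y.grad (t, s) (1, 0)) (Set.Ioo 0 1) ∧
      ∀ t₁ ∈ Set.Ioo (0 : ℝ) 1, ∀ t₂ ∈ Set.Ioo (0 : ℝ) 1,
        v (t₂, s) - v (t₁, s) = ∫ t in t₁..t₂, y.grad (t, s) (1, 0) := by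
  refine ae_slice_sub_eq_integral (g := fun x => y.grad x (1, 0)) hv (y.integrableOn_rep hp hvy)
    (y.integrableOn_grad hp _) fun φ ψ hφ hφc hφs hψ hψc hψs => ?_
  rw [← bulkDomain, ← y.weakGrad_prod hφ hφc hφs hψ hψc hψs]
  apply integral_congr_ae
  filter_upwards [hvy] with x hx
  simp [hx]

include hp hv hvy in
/-- Absolute continuity of bulk deformations on almost every vertical line. -/
theorem SobolevMap.ae_slice_snd : ∀ᵐ t ∂(volume.restrict (Set.Ioo (0 : ℝ) 1)),
    IntegrableOn (fun s => y.grad (t, s) (0, 1)) (Set.Ioo (-(1 / 2) : ℝ) (1 / 2)) ∧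
      ∀ s₁ ∈ Set.Ioo (-(1 / 2) : ℝ) (1 / 2), ∀ s₂ ∈ Set.Ioo (-(1 / 2) : ℝ) (1 / 2),
        v (t, s₂) - v (t, s₁) = ∫ s in s₁..s₂, y.grad (t, s) (0, 1) := by
  have hsw : ∀ f : ℝ × ℝ → Plane, IntegrableOn f bulkDomain →
      IntegrableOn (fun x : ℝ × ℝ => f x.swap) (Set.Ioo (-(1 / 2) : ℝ) (1 / 2) ×ˢ Set.Ioo 0 1) := by
    intro f hf
    have := IntegrableOn.swap hf
    exact this
  refine ae_slice_sub_eq_integral (v := fun x => v x.swap) (g := fun x => y.grad x.swap (0, 1))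
    (hv.comp (by fun_prop) fun x hx => ⟨hx.2, hx.1⟩) (hsw _ (y.integrableOn_rep hp hvy))
    (hsw _ (y.integrableOn_grad hp _)) fun φ ψ hφ hφc hφs hψ hψc hψs => ?_
  have e1 := setIntegral_prod_swap (μ := volume) (ν := volume) (Set.Ioo (0 : ℝ) 1)
    (Set.Ioo (-(1 / 2) : ℝ) (1 / 2)) (fun x : ℝ × ℝ => (ψ x.1 * deriv φ x.2) • v x)
  have e2 := setIntegral_prod_swap (μ := volume) (ν := volume) (Set.Ioo (0 : ℝ) 1)
    (Set.Ioo (-(1 / 2) : ℝ) (1 / 2)) (fun x : ℝ × ℝ => (ψ x.1 * φ x.2) • y.grad x (0, 1))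
  simp only [Prod.fst_swap, Prod.snd_swap] at e1 e2
  simp only [mul_comm _ (ψ _)]
  rw [Measure.volume_eq_prod, e1, e2, ← Measure.volume_eq_prod, ← bulkDomain,
    ← y.weakGrad_prod hψ hψc hψs hφ hφc hφs]
  apply integral_congr_ae
  filter_upwards [hvy] with x hx
  simp [hx]

end Bulk

/-! ### Sobolev maps on the bulk built from Lipschitz maps and from rod deformations -/

theorem setIntegral_smul_eq_of_tsupport_subset {E : Type*} [NormedAddCommGroup E] [MeasurableSpace E]
    {μ : Measure E} {Ω : Set E} {φ : E → ℝ} (hφ : tsupport φ ⊆ Ω) (f : E → Plane) :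
    ∫ x in Ω, φ x • f x ∂μ = ∫ x, φ x • f x ∂μ :=
  setIntegral_eq_integral_of_forall_compl_eq_zero fun x hx => by
    rw [image_eq_zero_of_notMem_tsupport fun h => hx (hφ h), zero_smul]

theorem tsupport_fderiv_apply_subset' {E : Type*} [NormedAddCommGroup E] [NormedSpace ℝ E]
    {φ : E → ℝ} (v : E) : tsupport (fun x => fderiv ℝ φ x v) ⊆ tsupport φ := by
  refine closure_minimal (fun x hx => ?_) (isClosed_tsupport φ)
  refine support_fderiv_subset ℝ (f := φ) ?_
  rw [Function.mem_support] at hx ⊢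
  intro h
  exact hx (by rw [h]; rfl)

theorem MemLp.of_bound_bulk {F : Type*} [NormedAddCommGroup F] {p : ENNReal} {f : ℝ × ℝ → F}
    (hf : AEStronglyMeasurable f (volume.restrict bulkDomain)) (C : ℝ)
    (hC : ∀ x ∈ bulkDomain, ‖f x‖ ≤ C) : MemLp f p (volume.restrict bulkDomain) := by
  have : IsFiniteMeasure (volume.restrict bulkDomain) := ⟨by simpa using volume_bulkDomain_lt_top⟩
  refine MemLp.of_bound hf C ?_
  filter_upwards [ae_restrict_mem measurableSet_bulkDomain] with x hx using hC x hx

/-- A Lipschitz map, as a Sobolev map on the bulk. -/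
noncomputable def LipschitzWith.toSobolevMap {C : NNReal} {u : ℝ × ℝ → Plane}
    (hu : LipschitzWith C u) (p : ℝ) : SobolevMap p bulkDomain where
  toFun := u
  grad := fderiv ℝ u
  memLp_toFun := by
    refine MemLp.of_bound_bulk hu.continuous.aestronglyMeasurable (‖u 0‖ + C) fun x hx => ?_
    have h1 : dist (u x) (u 0) ≤ C * dist x 0 := hu.dist_le_mul x 0
    have h2 : dist x 0 ≤ 1 := by
      rw [dist_zero_right, Prod.norm_def, max_le_iff, Real.norm_eq_abs, Real.norm_eq_abs, abs_le, abs_le]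
      obtain ⟨⟨a, b⟩, c, d⟩ := hx
      refine ⟨⟨?_, ?_⟩, ?_, ?_⟩ <;> linarith
    have h3 : ‖u x‖ ≤ ‖u 0‖ + dist (u x) (u 0) := by
      rw [dist_eq_norm]
      calc ‖u x‖ = ‖u 0 + (u x - u 0)‖ := by congr 1; abel
        _ ≤ _ := norm_add_le _ _
    have h4 : (C : ℝ) * dist x 0 ≤ C := mul_le_of_le_one_right C.2 h2
    linarith
  memLp_grad := by
    have : SecondCountableTopology (ℝ × ℝ →L[ℝ] Plane) := secondCountable_of_proper
    exact MemLp.of_bound_bulk (measurable_fderiv ℝ u).aestronglyMeasurable C fun x _ =>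
      norm_fderiv_le_of_lipschitz ℝ hu
  isWeakGradient := by
    intro φ hφ hφc hφs v
    have hcd : Continuous fun x => fderiv ℝ φ x v :=
      (hφ.continuous_fderiv (by simp)).clm_apply continuous_const
    rw [setIntegral_smul_eq_of_tsupport_subset hφs,
      setIntegral_smul_eq_of_tsupport_subset ((tsupport_fderiv_apply_subset' v).trans hφs)]
    obtain ⟨D, hD⟩ := hφ.lipschitzWith_of_hasCompactSupport hφc (by simp)
    have i1 : Integrable fun x => (fderiv ℝ φ x v) • u x :=
      (hcd.smul hu.continuous).integrable_of_hasCompactSupport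
        ((hφc.fderiv_apply ℝ v).smul_right)
    have hφi : Integrable φ := hφ.continuous.integrable_of_hasCompactSupport hφc
    have i2 : Integrable fun x => φ x • fderiv ℝ u x v := by
      refine hφi.smul_of_top_left (memLp_top_of_bound
        (measurable_fderiv_apply_const ℝ u v).aestronglyMeasurable (C * ‖v‖)
        (Eventually.of_forall fun x => ?_))
      exact (ContinuousLinearMap.le_opNorm _ _).trans
        (mul_le_mul_of_nonneg_right (norm_fderiv_le_of_lipschitz ℝ hu) (norm_nonneg _))
    ext i
    let P : Plane →L[ℝ] ℝ := EuclideanSpace.proj i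
    have e1 : (∫ x, (fderiv ℝ φ x v) • u x) i = ∫ x, fderiv ℝ φ x v * u x i :=
      (P.integral_comp_comm i1).symm
    have e2 : (∫ x, φ x • fderiv ℝ u x v) i = ∫ x, φ x * fderiv ℝ u x v i :=
      (P.integral_comp_comm i2).symm
    have hui : LipschitzWith (‖P‖₊ * C) fun x => u x i := P.lipschitz.comp hu
    -- Integration by parts for two Lipschitz functions, one coordinate at a time; the minus sign
    -- sits in the direction `-v`.
    have key := hui.integral_lineDeriv_mul_eq (μ := volume) hD hφc v
    rw [e1, PiLp.neg_apply, e2]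
    have k1 : ∫ x, lineDeriv ℝ (fun x => u x i) x v * φ x = ∫ x, φ x * fderiv ℝ u x v i := by
      apply integral_congr_ae
      filter_upwards [hu.ae_differentiableAt (μ := volume)] with x hx
      have : HasFDerivAt (fun x => u x i) (P.comp (fderiv ℝ u x)) x :=
        P.hasFDerivAt.comp x hx.hasFDerivAt
      rw [this.differentiableAt.lineDeriv_eq_fderiv, this.fderiv]
      simp [P, mul_comm]
    have k2 : ∫ x, lineDeriv ℝ φ x (-v) * u x i = -∫ x, fderiv ℝ φ x v * u x i := by
      rw [← integral_neg]
      congr 1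
      ext1 x
      rw [((hφ.differentiable (by simp)) x).lineDeriv_eq_fderiv]
      simp
    rw [← k1, key, k2, neg_neg]

instance : IsProbabilityMeasure (volume.restrict (Set.Ioo (-(1 / 2) : ℝ) (1 / 2))) :=
  ⟨by simp; norm_num⟩

theorem volume_restrict_bulkDomain : (volume.restrict bulkDomain : Measure (ℝ × ℝ)) =
    (volume.restrict rodDomain).prod (volume.restrict (Set.Ioo (-(1 / 2) : ℝ) (1 / 2))) := by
  rw [Measure.prod_restrict]; rfl

theorem measurePreserving_fst_bulkDomain :
    MeasurePreserving Prod.fst (volume.restrict bulkDomain : Measure (ℝ × ℝ))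
      (volume.restrict rodDomain) := by
  rw [volume_restrict_bulkDomain]; exact measurePreserving_fst

/-- A rod deformation, extended to the bulk as independent of the second variable. -/
noncomputable def SobolevMap.lift {p : ℝ} (hp : 1 ≤ p) (u : SobolevMap p rodDomain) :
    SobolevMap p bulkDomain where
  toFun x := u.toFun x.1
  grad x := (u.grad x.1).comp (ContinuousLinearMap.fst ℝ ℝ ℝ)
  memLp_toFun := u.memLp_toFun.comp_measurePreserving measurePreserving_fst_bulkDomain
  memLp_grad := by
    have h := u.memLp_grad.comp_measurePreserving measurePreserving_fst_bulkDomain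
    exact ((ContinuousLinearMap.compL ℝ (ℝ × ℝ) ℝ Plane).flip
      (ContinuousLinearMap.fst ℝ ℝ ℝ)).comp_memLp' h
  isWeakGradient := by
    intro φ hφ hφc hφs e
    have hfin : volume rodDomain < ⊤ := by rw [volume_rodDomain]; exact ENNReal.one_lt_top
    have hu := integrableOn_of_memLp hp hfin u.memLp_toFun
    have hg := integrableOn_of_memLp hp hfin u.memLp_grad
    have hu2 : Integrable (fun x : ℝ × ℝ => u.toFun x.1) (volume.restrict bulkDomain) :=
      measurePreserving_fst_bulkDomain.integrable_comp_of_integrable hu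
    have hg2 : Integrable (fun x : ℝ × ℝ => u.grad x.1) (volume.restrict bulkDomain) :=
      measurePreserving_fst_bulkDomain.integrable_comp_of_integrable hg
    have hg3 : Integrable (fun x : ℝ × ℝ => u.grad x.1 1) (volume.restrict bulkDomain) :=
      (ContinuousLinearMap.apply ℝ Plane (1 : ℝ)).integrable_comp hg2
    have hcd : ∀ v, Continuous fun x => fderiv ℝ φ x v := fun v =>
      (hφ.continuous_fderiv (by simp)).clm_apply continuous_const
    have i1 : ∀ v, Integrable (fun x : ℝ × ℝ => fderiv ℝ φ x v • u.toFun x.1)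
        (volume.restrict bulkDomain) := by
      intro v
      obtain ⟨C, hC⟩ := (hcd v).bounded_above_of_compact_support (hφc.fderiv_apply ℝ v)
      exact Integrable.bdd_smul hu2 C (hcd v).aestronglyMeasurable (Eventually.of_forall hC)
    have i2 : Integrable (fun x : ℝ × ℝ => φ x • u.grad x.1 1) (volume.restrict bulkDomain) := by
      obtain ⟨C, hC⟩ := hφ.continuous.bounded_above_of_compact_support hφc
      exact Integrable.bdd_smul hg3 C hφ.continuous.aestronglyMeasurable (Eventually.of_forall hC)
    have hdiff := hφ.differentiable (by simp)
    have d1 : ∀ t s, HasDerivAt (fun t => φ (t, s)) (fderiv ℝ φ (t, s) (1, 0)) t := by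
      intro t s
      have h := (hdiff (t, s)).hasFDerivAt.comp_hasDerivAt t
        ((hasDerivAt_id t).prodMk (hasDerivAt_const t s))
      exact h
    have d2 : ∀ t s, HasDerivAt (fun s => φ (t, s)) (fderiv ℝ φ (t, s) (0, 1)) s := by
      intro t s
      have h := (hdiff (t, s)).hasFDerivAt.comp_hasDerivAt s
        ((hasDerivAt_const s t).prodMk (hasDerivAt_id s))
      exact h
    have H1 : ∫ x in bulkDomain, fderiv ℝ φ x (1, 0) • u.toFun x.1 =
        - ∫ x in bulkDomain, φ x • u.grad x.1 1 := by
      rw [volume_restrict_bulkDomain] at i1 i2 ⊢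
      rw [integral_prod_symm _ (i1 _), integral_prod_symm _ i2, ← integral_neg]
      apply integral_congr_ae
      filter_upwards [ae_restrict_mem measurableSet_Ioo] with s hs
      have hcl : tsupport (fun t => φ (t, s)) ⊆ (fun t => (t, s)) ⁻¹' tsupport φ :=
        closure_minimal (fun t ht => subset_closure ht)
          ((isClosed_tsupport φ).preimage (by fun_prop))
      have hsup : tsupport (fun t => φ (t, s)) ⊆ rodDomain := fun t ht => (hφs (hcl ht)).1
      have hcomp : HasCompactSupport (fun t => φ (t, s)) :=
        (hφc.isCompact.image continuous_fst).of_isClosed_subset (isClosed_tsupport _)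
          fun t ht => ⟨(t, s), hcl ht, rfl⟩
      have := u.isWeakGradient (fun t => φ (t, s)) (hφ.comp (contDiff_id.prodMk contDiff_const))
        hcomp hsup 1
      simp only [fderiv_apply_one_eq_deriv, (d1 _ s).deriv] at this
      exact this
    -- Each vertical line integral is that of the derivative of a compactly supported function, so
    -- the lifted map has no vertical weak derivative.
    have H2 : ∫ x in bulkDomain, fderiv ℝ φ x (0, 1) • u.toFun x.1 = 0 := by
      rw [volume_restrict_bulkDomain] at i1 ⊢
      rw [integral_prod _ (i1 _)]
      apply integral_eq_zero_of_ae
      filter_upwards [ae_restrict_mem measurableSet_Ioo] with t ht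
      have hcl : tsupport (fun s => fderiv ℝ φ (t, s) (0, 1)) ⊆
          (fun s => (t, s)) ⁻¹' tsupport φ :=
        closure_minimal (fun s hs => tsupport_fderiv_apply_subset' (φ := φ) (0, 1)
          (subset_closure hs)) ((isClosed_tsupport φ).preimage (by fun_prop))
      have hcl' : tsupport (fun s => φ (t, s)) ⊆ (fun s => (t, s)) ⁻¹' tsupport φ :=
        closure_minimal (fun s hs => subset_closure hs)
          ((isClosed_tsupport φ).preimage (by fun_prop))
      have hcomp : HasCompactSupport (fun s => fderiv ℝ φ (t, s) (0, 1)) :=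
        (hφc.isCompact.image continuous_snd).of_isClosed_subset (isClosed_tsupport _)
          fun s hs => ⟨(t, s), hcl hs, rfl⟩
      have hcomp' : HasCompactSupport (fun s => φ (t, s)) :=
        (hφc.isCompact.image continuous_snd).of_isClosed_subset (isClosed_tsupport _)
          fun s hs => ⟨(t, s), hcl' hs, rfl⟩
      have hz := integral_eq_zero_of_hasDerivAt_of_integrable (d2 t)
        (((hcd (0, 1)).comp (by fun_prop : Continuous fun s : ℝ => (t, s))).integrable_of_hasCompactSupport hcomp)
        ((hφ.continuous.comp (by fun_prop : Continuous fun s : ℝ => (t, s))).integrable_of_hasCompactSupport hcomp')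
      change ∫ s in Set.Ioo (-(1 / 2) : ℝ) (1 / 2), fderiv ℝ φ (t, s) (0, 1) • u.toFun t = 0
      rw [integral_smul_const, setIntegral_eq_integral_of_forall_compl_eq_zero, hz, zero_smul]
      intro s hs
      exact image_eq_zero_of_notMem_tsupport (f := fun s => fderiv ℝ φ (t, s) (0, 1))
        fun h => hs (hφs (hcl h)).2
    have split : ∀ x, fderiv ℝ φ x e • u.toFun x.1 =
        e.1 • (fderiv ℝ φ x (1, 0) • u.toFun x.1) + e.2 • (fderiv ℝ φ x (0, 1) • u.toFun x.1) := by
      intro x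
      have : e = e.1 • ((1 : ℝ), (0 : ℝ)) + e.2 • ((0 : ℝ), (1 : ℝ)) := by ext <;> simp
      conv_lhs => rw [this]
      rw [map_add, map_smul, map_smul, add_smul, smul_assoc, smul_assoc]
    simp only [split]
    have hadd := integral_add ((i1 (1, 0)).smul e.1) ((i1 (0, 1)).smul e.2)
    simp only [Pi.smul_apply] at hadd
    rw [hadd, integral_smul, integral_smul, H1, H2, smul_zero,
      add_zero, smul_neg, ← integral_smul]
    congr 1
    congr 1
    ext1 x
    have : u.grad x.1 e.1 = e.1 • u.grad x.1 1 := by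
      rw [← map_smul, smul_eq_mul, mul_one]
    change _ = φ x • u.grad x.1 e.1
    rw [this, smul_comm]

/-! ### The convex envelope of the reduced density -/

/-- The determinant of two plane vectors. -/
def cross (a b : Plane) : ℝ := a 0 * b 1 - a 1 * b 0

theorem det_colMatrix (a b : Plane) : (colMatrix a b).det = cross a b := by
  simp [colMatrix, cross, Matrix.det_fin_two_of]; ring

theorem Plane.norm_sq (a : Plane) : ‖a‖ ^ 2 = a 0 ^ 2 + a 1 ^ 2 := by
  rw [EuclideanSpace.norm_sq_eq, Fin.sum_univ_two, Real.norm_eq_abs, Real.norm_eq_abs, sq_abs, sq_abs]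

theorem abs_cross_le (a b : Plane) : |cross a b| ≤ ‖a‖ * ‖b‖ := by
  apply abs_le_of_sq_le_sq _ (by positivity)
  rw [mul_pow, Plane.norm_sq, Plane.norm_sq, cross]
  nlinarith [sq_nonneg (a 0 * b 0 + a 1 * b 1)]

theorem cross_add_left (a b c : Plane) : cross (a + b) c = cross a c + cross b c := by
  simp [cross]; ring

theorem cross_add_right (a b c : Plane) : cross a (b + c) = cross a b + cross a c := by
  simp [cross]; ring

theorem cross_sub_left (a b c : Plane) : cross (a - b) c = cross a c - cross b c := by
  simp [cross]; ring

theorem cross_smul_left (r : ℝ) (a b : Plane) : cross (r • a) b = r * cross a b := by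
  simp [cross]; ring

theorem cross_smul_right (r : ℝ) (a b : Plane) : cross a (r • b) = r * cross a b := by
  simp [cross]; ring

@[simp] theorem cross_zero_left (b : Plane) : cross 0 b = 0 := by simp [cross]

@[simp] theorem cross_same (b : Plane) : cross b b = 0 := by simp [cross]; ring

/-- Rotation by a right angle. -/
def rot (a : Plane) : Plane := !₂[-a 1, a 0]

theorem cross_rot (a b : Plane) : cross a (rot b) = a 0 * b 0 + a 1 * b 1 := by
  simp [cross, rot]

theorem cross_rot_self (a : Plane) : cross a (rot a) = ‖a‖ ^ 2 := by
  rw [cross_rot, Plane.norm_sq]; ring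

theorem matNorm_colMatrix_sq (a b : Plane) : matNorm (colMatrix a b) ^ 2 = ‖a‖ ^ 2 + ‖b‖ ^ 2 := by
  rw [matNorm, Real.sq_sqrt (by positivity), Plane.norm_sq, Plane.norm_sq]
  simp [colMatrix, Fin.sum_univ_two]; ring

theorem matNorm_nonneg (F : Matrix (Fin 2) (Fin 2) ℝ) : 0 ≤ matNorm F := Real.sqrt_nonneg _

section Envelope

variable {f : Plane → ENNReal}

theorem convexEnvelope_le (f : Plane → ENNReal) (a : Plane) : convexEnvelope f a ≤ f a :=
  iSup_le fun _ => iSup_le fun _ => iSup_le fun h => h a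

theorem le_convexEnvelope {g : Plane → ℝ} (hg : ConvexOn ℝ Set.univ g)
    (h : ∀ b, ENNReal.ofReal (g b) ≤ f b) (a : Plane) :
    ENNReal.ofReal (g a) ≤ convexEnvelope f a :=
  le_iSup_of_le g (le_iSup_of_le hg (le_iSup_of_le h le_rfl))

theorem convexEnvelope_combo (f : Plane → ENNReal) (x y : Plane) {α β : ℝ} (hα : 0 ≤ α)
    (hβ : 0 ≤ β) (h : α + β = 1) : convexEnvelope f (α • x + β • y) ≤
      ENNReal.ofReal α * convexEnvelope f x + ENNReal.ofReal β * convexEnvelope f y := by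
  refine iSup_le fun g => iSup_le fun hg => iSup_le fun hgf => ?_
  calc ENNReal.ofReal (g (α • x + β • y)) ≤ ENNReal.ofReal (α * g x + β * g y) :=
        ENNReal.ofReal_le_ofReal (hg.2 (Set.mem_univ _) (Set.mem_univ _) hα hβ h)
    _ ≤ ENNReal.ofReal (α * g x) + ENNReal.ofReal (β * g y) := ENNReal.ofReal_add_le
    _ = ENNReal.ofReal α * ENNReal.ofReal (g x) + ENNReal.ofReal β * ENNReal.ofReal (g y) := by
        rw [ENNReal.ofReal_mul hα, ENNReal.ofReal_mul hβ]
    _ ≤ _ := by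
        gcongr <;> exact le_convexEnvelope hg hgf _

variable (hf : ∀ a, a ≠ 0 → f a ≠ ⊤)

-- At the origin, where `f` may be infinite, the envelope is finite because `0` is the midpoint of
-- `e` and `-e`.
include hf in
theorem convexEnvelope_ne_top (a : Plane) : convexEnvelope f a ≠ ⊤ := by
  have h1 : ∀ a, a ≠ 0 → convexEnvelope f a ≠ ⊤ := fun a ha =>
    ne_top_of_le_ne_top (hf a ha) (convexEnvelope_le f a)
  rcases eq_or_ne a 0 with rfl | ha
  · obtain ⟨e, he⟩ : ∃ e : Plane, e ≠ 0 := exists_ne 0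
    have := convexEnvelope_combo f e (-e) (α := 1 / 2) (β := 1 / 2) (by norm_num) (by norm_num)
      (by norm_num)
    rw [smul_neg, add_neg_cancel] at this
    refine ne_top_of_le_ne_top ?_ this
    exact ENNReal.add_ne_top.2 ⟨ENNReal.mul_ne_top ENNReal.ofReal_ne_top (h1 _ he),
      ENNReal.mul_ne_top ENNReal.ofReal_ne_top (h1 _ (neg_ne_zero.2 he))⟩
  · exact h1 a ha

include hf in
theorem convexOn_toReal_convexEnvelope :
    ConvexOn ℝ Set.univ fun a => (convexEnvelope f a).toReal := by
  refine ⟨convex_univ, fun x _ y _ α β hα hβ h => ?_⟩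
  have hx := convexEnvelope_ne_top hf x
  have hy := convexEnvelope_ne_top hf y
  have := ENNReal.toReal_mono (ENNReal.add_ne_top.2 ⟨ENNReal.mul_ne_top ENNReal.ofReal_ne_top hx,
    ENNReal.mul_ne_top ENNReal.ofReal_ne_top hy⟩) (convexEnvelope_combo f x y hα hβ h)
  rw [ENNReal.toReal_add (ENNReal.mul_ne_top ENNReal.ofReal_ne_top hx)
    (ENNReal.mul_ne_top ENNReal.ofReal_ne_top hy), ENNReal.toReal_mul, ENNReal.toReal_mul,
    ENNReal.toReal_ofReal hα, ENNReal.toReal_ofReal hβ] at this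
  simpa using this

include hf in
theorem ofReal_toReal_convexEnvelope (a : Plane) :
    ENNReal.ofReal (convexEnvelope f a).toReal = convexEnvelope f a :=
  ENNReal.ofReal_toReal (convexEnvelope_ne_top hf a)

include hf in
theorem continuous_toReal_convexEnvelope :
    Continuous fun a => (convexEnvelope f a).toReal := by
  have := (convexOn_toReal_convexEnvelope hf).continuousOn isOpen_univ
  exact continuousOn_univ.1 this

end Envelope

theorem reducedDensity_ne_top {W : Matrix (Fin 2) (Fin 2) ℝ → ENNReal}
    (hW : ∀ F, W F = ⊤ ↔ F.det ≤ 0) {a : Plane} (ha : a ≠ 0) : reducedDensity W a ≠ ⊤ := by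
  refine ne_top_of_le_ne_top (b := W (colMatrix a (rot a))) ?_ (iInf_le _ _)
  rw [ne_eq, hW, det_colMatrix, cross_rot_self, not_le]
  positivity

/-- A real number with finite density is approximated by a director with positive determinant. -/
theorem exists_director {W : Matrix (Fin 2) (Fin 2) ℝ → ENNReal}
    (hW : ∀ F, W F = ⊤ ↔ F.det ≤ 0) {a : Plane} (ha : a ≠ 0) {ε : ℝ} (hε : 0 < ε) :
    ∃ ξ : Plane, 0 < cross a ξ ∧
      W (colMatrix a ξ) ≤ ENNReal.ofReal ((reducedDensity W a).toReal + ε) := by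
  have hne := reducedDensity_ne_top hW ha
  have hlt : reducedDensity W a < ENNReal.ofReal ((reducedDensity W a).toReal + ε) := by
    conv_lhs => rw [← ENNReal.ofReal_toReal hne]
    exact (ENNReal.ofReal_lt_ofReal_iff (by positivity)).2 (by linarith)
  obtain ⟨ξ, hξ⟩ := iInf_lt_iff.1 hlt
  refine ⟨ξ, ?_, hξ.le⟩
  by_contra hc
  have : W (colMatrix a ξ) = ⊤ := (hW _).2 (by rw [det_colMatrix]; exact not_lt.1 hc)
  rw [this] at hξ
  exact not_top_lt hξ

/-! ### Curves with integrable derivative -/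

/-- Integration by parts for indefinite integrals. -/
theorem integral_deriv_smul_of_ftc {z g : ℝ → Plane} (hg : IntegrableOn g (Set.Ioo 0 1))
    (hz : ∀ t₁ ∈ Set.Ioo (0 : ℝ) 1, ∀ t₂ ∈ Set.Ioo (0 : ℝ) 1, z t₂ - z t₁ = ∫ t in t₁..t₂, g t)
    {φ : ℝ → ℝ} (hφ : ContDiff ℝ ((⊤ : ℕ∞) : WithTop ℕ∞) φ) (hφc : HasCompactSupport φ)
    (hφs : tsupport φ ⊆ Set.Ioo 0 1) :
    ∫ t in Set.Ioo (0 : ℝ) 1, deriv φ t • z t = - ∫ t in Set.Ioo (0 : ℝ) 1, φ t • g t := by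
  have hgi : IntervalIntegrable g volume 0 1 :=
    (intervalIntegrable_iff_integrableOn_Ioo_of_le zero_le_one).2 hg
  have hsubi : ∀ t ∈ Set.Icc (0 : ℝ) 1, IntervalIntegrable g volume 0 t := fun t ht =>
    hgi.mono_set (by rw [Set.uIcc_of_le ht.1, Set.uIcc_of_le zero_le_one]; exact Set.Icc_subset_Icc_right ht.2)
  have hhalf : (1 / 2 : ℝ) ∈ Set.Ioo (0 : ℝ) 1 := by norm_num
  set k : Plane := z (1 / 2) - ∫ t in (0 : ℝ)..(1 / 2), g t with hk
  have hzk : ∀ t ∈ Set.Ioo (0 : ℝ) 1, z t = k + ∫ r in (0 : ℝ)..t, g r := by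
    intro t ht
    have h1 := hz _ hhalf _ ht
    rw [← intervalIntegral.integral_interval_sub_left (hsubi t ⟨ht.1.le, ht.2.le⟩)
      (hsubi (1 / 2) (by norm_num))] at h1
    rw [hk, sub_eq_iff_eq_add.1 h1]; abel
  have hφ' : Continuous (deriv φ) := hφ.continuous_deriv (by simp)
  obtain ⟨C, hC⟩ := hφ.continuous.exists_norm_le_of_hasCompactSupport hφc
  have hcont : ContinuousOn (fun t => k + ∫ r in (0 : ℝ)..t, g r) (Set.Icc 0 1) := by
    have h := intervalIntegral.continuousOn_primitive_interval' hgi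
      (Set.left_mem_uIcc)
    rw [Set.uIcc_of_le zero_le_one] at h
    exact continuousOn_const.add h
  have i1 : IntegrableOn (fun t => deriv φ t • z t) (Set.Ioo 0 1) := by
    have : IntegrableOn (fun t => deriv φ t • (k + ∫ r in (0 : ℝ)..t, g r)) (Set.Ioo 0 1) :=
      ((hφ'.continuousOn.smul hcont).integrableOn_compact isCompact_Icc).mono_set
        Set.Ioo_subset_Icc_self
    refine this.congr_fun (fun t ht => ?_) measurableSet_Ioo
    simp only [hzk t ht]
  have i2 : IntegrableOn (fun t => φ t • g t) (Set.Ioo 0 1) :=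
    Integrable.bdd_smul hg C hφ.continuous.aestronglyMeasurable (Eventually.of_forall hC)
  have hφ0 : φ 0 = 0 := image_eq_zero_of_notMem_tsupport fun h => lt_irrefl _ (hφs h).1
  have hφ1 : φ 1 = 0 := image_eq_zero_of_notMem_tsupport fun h => lt_irrefl _ (hφs h).2
  ext i
  let P : Plane →L[ℝ] ℝ := EuclideanSpace.proj i
  have e1 : (∫ t in Set.Ioo (0 : ℝ) 1, deriv φ t • z t) i = ∫ t in Set.Ioo (0 : ℝ) 1, deriv φ t * z t i :=
    (P.integral_comp_comm i1).symm
  have e2 : (∫ t in Set.Ioo (0 : ℝ) 1, φ t • g t) i = ∫ t in Set.Ioo (0 : ℝ) 1, φ t * g t i :=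
    (P.integral_comp_comm i2).symm
  rw [e1, PiLp.neg_apply, e2]
  have hgii : IntervalIntegrable (fun t => g t i) volume 0 1 :=
    (intervalIntegrable_iff_integrableOn_Ioo_of_le zero_le_one).2 (P.integrable_comp hg)
  -- A coordinate of `z`, continued to the closed interval, where it is absolutely continuous and
  -- classical integration by parts is available.
  set Z : ℝ → ℝ := fun t => k i + ∫ r in (0 : ℝ)..t, g r i with hZ
  have hZz : ∀ t ∈ Set.Ioo (0 : ℝ) 1, z t i = Z t := by
    intro t ht
    rw [hzk t ht]
    have : (∫ r in (0 : ℝ)..t, g r) i = ∫ r in (0 : ℝ)..t, g r i :=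
      (P.intervalIntegral_comp_comm (hsubi t ⟨ht.1.le, ht.2.le⟩)).symm
    simp [hZ, this]
  have hac0 := hgii.absolutelyContinuousOnInterval_intervalIntegral (c := 0) Set.left_mem_uIcc
  have hac : AbsolutelyContinuousOnInterval Z 0 1 := by
    have hcst : AbsolutelyContinuousOnInterval (fun _ : ℝ => k i) 0 1 :=
      ((LipschitzWith.const (k i)).lipschitzOnWith (s := Set.uIcc 0 1)).absolutelyContinuousOnInterval
    exact hcst.add hac0
  have hφac : AbsolutelyContinuousOnInterval φ 0 1 :=
    (hφ.of_le (by simp)).contDiffOn.absolutelyContinuousOnInterval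
  have key := hac.integral_mul_deriv_eq_deriv_mul hφac
  rw [hφ0, hφ1, mul_zero, mul_zero, sub_zero, zero_sub, intervalIntegral.integral_of_le zero_le_one,
    intervalIntegral.integral_of_le zero_le_one, integral_Ioc_eq_integral_Ioo,
    integral_Ioc_eq_integral_Ioo] at key
  have k1 : ∫ t in Set.Ioo (0 : ℝ) 1, deriv φ t * z t i = ∫ t in Set.Ioo (0 : ℝ) 1, Z t * deriv φ t :=
    setIntegral_congr_fun measurableSet_Ioo fun t ht => by simp only [hZz t ht]; ring
  have k2 : ∫ t in Set.Ioo (0 : ℝ) 1, deriv Z t * φ t = ∫ t in Set.Ioo (0 : ℝ) 1, φ t * g t i := by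
    apply integral_congr_ae
    filter_upwards [ae_restrict_of_ae hgii.ae_hasDerivAt_integral, ae_restrict_mem measurableSet_Ioo]
      with t ht htm
    have hd := ht (by rw [Set.uIcc_of_le zero_le_one]; exact Set.Ioo_subset_Icc_self htm) 0
      Set.left_mem_uIcc
    rw [(hd.const_add (k i)).deriv]
    ring
  rw [k1, key, k2]

/-- Jensen's inequality on an interval. -/
theorem jensen_interval {G : Plane → ℝ} (hG : ConvexOn ℝ Set.univ G) (hGc : Continuous G)
    (hG0 : ∀ a, 0 ≤ G a) {g : ℝ → Plane} {a b : ℝ} (hab : a < b) (hg : IntegrableOn g (Set.Ioo a b)) :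
    ENNReal.ofReal (b - a) * ENNReal.ofReal (G ((b - a)⁻¹ • ∫ t in a..b, g t)) ≤
      ∫⁻ t in Set.Ioo a b, ENNReal.ofReal (G (g t)) := by
  by_cases htop : ∫⁻ t in Set.Ioo a b, ENNReal.ofReal (G (g t)) = ⊤
  · rw [htop]; exact le_top
  have hGg : IntegrableOn (fun t => G (g t)) (Set.Ioo a b) := by
    refine ⟨hGc.comp_aestronglyMeasurable hg.1, ?_⟩
    rw [hasFiniteIntegral_iff_ofReal (Eventually.of_forall fun t => hG0 _)]
    exact lt_top_iff_ne_top.2 htop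
  have hne : NeZero (volume.restrict (Set.Ioo a b)) := ⟨by
    rw [ne_eq, Measure.restrict_eq_zero, Real.volume_Ioo, ENNReal.ofReal_eq_zero]
    linarith⟩
  have hfin : IsFiniteMeasure (volume.restrict (Set.Ioo a b)) := ⟨by simp⟩
  have hba : 0 < b - a := by linarith
  have h := hG.map_average_le hGc.continuousOn isClosed_univ (Eventually.of_forall fun t => Set.mem_univ _)
    hg hGg
  rw [setAverage_eq, setAverage_eq, measureReal_def, Real.volume_Ioo, ENNReal.toReal_ofReal hba.le,
    ← integral_Ioc_eq_integral_Ioo, ← intervalIntegral.integral_of_le hab.le, smul_eq_mul] at h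
  rw [← ofReal_integral_eq_lintegral_ofReal hGg (Eventually.of_forall fun t => hG0 _),
    ← ENNReal.ofReal_mul hba.le]
  apply ENNReal.ofReal_le_ofReal
  calc (b - a) * G ((b - a)⁻¹ • ∫ t in a..b, g t) ≤ (b - a) * ((b - a)⁻¹ * ∫ t in Set.Ioo a b, G (g t)) :=
        mul_le_mul_of_nonneg_left h hba.le
    _ = _ := by rw [← mul_assoc, mul_inv_cancel₀ hba.ne', one_mul]

/-- The energy of difference quotients is bounded by the energy of the derivative. -/
theorem lintegral_difference_quotient_le {G : Plane → ℝ} (hG : ConvexOn ℝ Set.univ G)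
    (hGc : Continuous G) (hG0 : ∀ a, 0 ≤ G a) {z g : ℝ → Plane} (hg : IntegrableOn g (Set.Ioo 0 1))
    (hz : ∀ t₁ ∈ Set.Ioo (0 : ℝ) 1, ∀ t₂ ∈ Set.Ioo (0 : ℝ) 1, z t₂ - z t₁ = ∫ t in t₁..t₂, g t)
    {τ : ℝ} (hτ : 0 < τ) :
    ∫⁻ t in Set.Ioo 0 (1 - τ), ENNReal.ofReal (G (τ⁻¹ • (z (t + τ) - z t))) ≤
      ∫⁻ t in Set.Ioo 0 1, ENNReal.ofReal (G (g t)) := by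
  -- A measurable version of the energy density, extended by zero so that it can be translated
  -- freely and Tonelli's theorem applies.
  set F : ℝ → ENNReal := (Set.Ioo (0 : ℝ) 1).indicator fun t => ENNReal.ofReal (G (hg.1.mk g t)) with hF
  have hFm : Measurable F :=
    (ENNReal.measurable_ofReal.comp (hGc.measurable.comp hg.1.stronglyMeasurable_mk.measurable)).indicator
      measurableSet_Ioo
  have hFg : ∀ s ⊆ Set.Ioo (0 : ℝ) 1, MeasurableSet s →
      ∫⁻ t in s, ENNReal.ofReal (G (g t)) = ∫⁻ t in s, F t := by
    intro s hs hsm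
    apply lintegral_congr_ae
    filter_upwards [ae_restrict_of_ae_restrict_of_subset hs hg.1.ae_eq_mk, ae_restrict_mem hsm]
      with t ht htm
    rw [hF, Set.indicator_of_mem (hs htm), ht]
  have hτ0 : ENNReal.ofReal τ ≠ 0 := by simpa using hτ
  -- Jensen on `(t, t + τ)`. After exchanging the integrals every point of `(0, 1)` is counted with
  -- weight at most `τ`, which cancels the factor on the left.
  have step : ∀ t ∈ Set.Ioo 0 (1 - τ), ENNReal.ofReal τ * ENNReal.ofReal (G (τ⁻¹ • (z (t + τ) - z t))) ≤
      ∫⁻ r in Set.Ioo 0 τ, F (t + r) := by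
    intro t ht
    have hsub : Set.Ioo t (t + τ) ⊆ Set.Ioo 0 1 :=
      Set.Ioo_subset_Ioo ht.1.le (by linarith [ht.2])
    have hj := jensen_interval hG hGc hG0 (g := g) (a := t) (b := t + τ) (by linarith) (hg.mono_set hsub)
    rw [← hz t ⟨ht.1, by linarith [ht.2]⟩ (t + τ) ⟨by linarith [ht.1], by linarith [ht.2]⟩,
      add_sub_cancel_left, hFg _ hsub measurableSet_Ioo] at hj
    refine hj.trans (le_of_eq ?_)
    rw [← lintegral_indicator measurableSet_Ioo, ← lintegral_indicator measurableSet_Ioo,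
      ← lintegral_add_left_eq_self _ t]
    congr 1
    ext1 r
    by_cases hr : r ∈ Set.Ioo 0 τ
    · rw [Set.indicator_of_mem hr, Set.indicator_of_mem]
      exact ⟨by linarith [hr.1], by linarith [hr.2]⟩
    · rw [Set.indicator_of_notMem hr, Set.indicator_of_notMem]
      exact fun h => hr ⟨by linarith [h.1], by linarith [h.2]⟩
  have main : ENNReal.ofReal τ * ∫⁻ t in Set.Ioo 0 (1 - τ), ENNReal.ofReal (G (τ⁻¹ • (z (t + τ) - z t))) ≤
      ENNReal.ofReal τ * ∫⁻ t in Set.Ioo 0 1, ENNReal.ofReal (G (g t)) := by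
    calc _ = ∫⁻ t in Set.Ioo 0 (1 - τ), ENNReal.ofReal τ * ENNReal.ofReal (G (τ⁻¹ • (z (t + τ) - z t))) :=
          (lintegral_const_mul' _ _ ENNReal.ofReal_ne_top).symm
      _ ≤ ∫⁻ t in Set.Ioo 0 (1 - τ), ∫⁻ r in Set.Ioo 0 τ, F (t + r) := by
          apply setLIntegral_mono' measurableSet_Ioo step
      _ = ∫⁻ r in Set.Ioo 0 τ, ∫⁻ t in Set.Ioo 0 (1 - τ), F (t + r) := by
          apply lintegral_lintegral_swap
          exact (hFm.comp (measurable_fst.add measurable_snd)).aemeasurable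
      _ ≤ ∫⁻ r in Set.Ioo 0 τ, ∫⁻ t, F t := by
          refine lintegral_mono fun r => ?_
          refine (setLIntegral_le_lintegral _ _).trans (le_of_eq ?_)
          exact lintegral_add_right_eq_self F r
      _ = ENNReal.ofReal τ * ∫⁻ t in Set.Ioo 0 1, ENNReal.ofReal (G (g t)) := by
          rw [lintegral_const, hFg _ subset_rfl measurableSet_Ioo, hF,
            ← lintegral_indicator measurableSet_Ioo]
          simp [mul_comm]
  exact (ENNReal.mul_le_mul_iff_right hτ0 ENNReal.ofReal_ne_top).1 main

/-- A uniformly equicontinuous sequence on `(0,1)` that converges almost everywhere converges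
uniformly. -/
theorem exists_tendstoUniformlyOn_of_ae {z : ℕ → ℝ → Plane} {u : ℝ → Plane}
    (heq : ∀ ε > 0, ∃ δ > 0, ∀ n, ∀ t ∈ Set.Ioo (0 : ℝ) 1, ∀ t' ∈ Set.Ioo (0 : ℝ) 1,
      |t - t'| < δ → dist (z n t) (z n t') < ε)
    (hae : ∀ᵐ t ∂(volume.restrict (Set.Ioo (0 : ℝ) 1)), Tendsto (fun n => z n t) atTop (𝓝 (u t))) :
    ∃ v : ℝ → Plane, TendstoUniformlyOn z v atTop (Set.Ioo 0 1) := by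
  have hdense : ∀ a b : ℝ, 0 ≤ a → a < b → b ≤ 1 → ∃ x ∈ Set.Ioo a b,
      Tendsto (fun n => z n x) atTop (𝓝 (u x)) := by
    intro a b ha hab hb
    have h1 := ae_restrict_of_ae_restrict_of_subset (Set.Ioo_subset_Ioo ha hb) hae
    have hne : NeBot (ae (volume.restrict (Set.Ioo a b))) := by
      rw [ae_neBot, ne_eq, Measure.restrict_eq_zero, Real.volume_Ioo, ENNReal.ofReal_eq_zero]
      linarith
    obtain ⟨x, hx, hxm⟩ := (h1.and (ae_restrict_mem measurableSet_Ioo)).exists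
    exact ⟨x, hxm, hx⟩
  have hcau : UniformCauchySeqOn z atTop (Set.Ioo (0 : ℝ) 1) := by
    rw [Metric.uniformCauchySeqOn_iff]
    intro ε hε
    obtain ⟨δ, hδ, hzδ⟩ := heq (ε / 3) (by positivity)
    -- One point of convergence in each of `M` equal subintervals gives a finite `δ`-net;
    -- equicontinuity spreads the Cauchy property from the net to the whole interval.
    obtain ⟨M, hM⟩ := exists_nat_gt (2 / δ)
    have hMpos : (0 : ℝ) < M := lt_trans (by positivity) hM
    have hMδ : 1 / (M : ℝ) < δ := by
      rw [div_lt_iff₀ hMpos]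
      have := (div_lt_iff₀ hδ).1 hM
      linarith
    have hx : ∀ k : Fin M, ∃ x ∈ Set.Ioo ((k : ℝ) / M) (((k : ℝ) + 1) / M),
        Tendsto (fun n => z n x) atTop (𝓝 (u x)) := by
      intro k
      refine hdense _ _ (by positivity) (by gcongr; linarith) ?_
      rw [div_le_one hMpos]
      exact_mod_cast k.2
    choose x hxm hxt using hx
    have hN : ∀ k : Fin M, ∃ N, ∀ m ≥ N, ∀ n ≥ N, dist (z m (x k)) (z n (x k)) < ε / 3 :=
      fun k => Metric.cauchySeq_iff.1 (hxt k).cauchySeq (ε / 3) (by positivity)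
    choose N hN using hN
    refine ⟨Finset.univ.sup N, fun m hm n hn t ht => ?_⟩
    have hfl : ⌊t * M⌋₊ < M := by
      rw [Nat.floor_lt (by have := ht.1; positivity)]
      nlinarith [ht.2]
    set k : Fin M := ⟨⌊t * M⌋₊, hfl⟩ with hk
    have hkt : |t - x k| < δ := by
      have h1 : (⌊t * M⌋₊ : ℝ) ≤ t * M := Nat.floor_le (by have := ht.1; positivity)
      have h2 : t * M < ⌊t * M⌋₊ + 1 := Nat.lt_floor_add_one _
      have h3 : (⌊t * M⌋₊ : ℝ) / M ≤ t := by rw [div_le_iff₀ hMpos]; exact h1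
      have h4 : t < (⌊t * M⌋₊ + 1) / M := by rw [lt_div_iff₀ hMpos]; exact h2
      have h5 := hxm k
      have h6 : ((⌊t * M⌋₊ : ℝ) + 1) / M = (⌊t * M⌋₊ : ℝ) / M + 1 / M := by ring
      simp only [hk] at h5
      rw [abs_lt]
      constructor <;> linarith [h5.1, h5.2]
    have hxI : x k ∈ Set.Ioo (0 : ℝ) 1 := by
      have h5 := hxm k
      refine ⟨lt_of_le_of_lt (by positivity) h5.1, h5.2.trans_le ?_⟩
      rw [div_le_one hMpos]
      exact_mod_cast k.2
    have a1 := hzδ m t ht (x k) hxI hkt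
    have a2 := hzδ n (x k) hxI t ht (by rw [abs_sub_comm]; exact hkt)
    have a3 := hN k m ((Finset.le_sup (Finset.mem_univ k)).trans hm) n
      ((Finset.le_sup (Finset.mem_univ k)).trans hn)
    calc dist (z m t) (z n t) ≤ dist (z m t) (z m (x k)) + dist (z m (x k)) (z n (x k)) +
          dist (z n (x k)) (z n t) := dist_triangle4 _ _ _ _
      _ < ε := by linarith
  have hlim : ∀ t, ∃ l, t ∈ Set.Ioo (0 : ℝ) 1 → Tendsto (fun n => z n t) atTop (𝓝 l) := by
    intro t
    by_cases ht : t ∈ Set.Ioo (0 : ℝ) 1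
    · obtain ⟨l, hl⟩ := cauchySeq_tendsto_of_complete (hcau.cauchySeq ht)
      exact ⟨l, fun _ => hl⟩
    · exact ⟨0, fun h => absurd h ht⟩
  choose v hv using hlim
  exact ⟨v, hcau.tendstoUniformlyOn_of_tendsto hv⟩

/-- Curves whose derivatives are bounded in `L^p`, `p ≥ 2`, are uniformly equicontinuous. -/
theorem equicontinuous_of_lintegral_le {p : ℝ} (hp : 2 ≤ p) {ι : Type*} {z g : ι → ℝ → Plane}
    {K : ENNReal} (hK : K ≠ ⊤) (hgi : ∀ n, IntegrableOn (g n) (Set.Ioo 0 1))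
    (hz : ∀ n, ∀ t₁ ∈ Set.Ioo (0 : ℝ) 1, ∀ t₂ ∈ Set.Ioo (0 : ℝ) 1,
      z n t₂ - z n t₁ = ∫ t in t₁..t₂, g n t)
    (hg : ∀ n, ∫⁻ t in Set.Ioo 0 1, ‖g n t‖ₑ ^ p ≤ K) :
    ∀ ε > 0, ∃ δ > 0, ∀ n, ∀ t ∈ Set.Ioo (0 : ℝ) 1, ∀ t' ∈ Set.Ioo (0 : ℝ) 1,
      |t - t'| < δ → dist (z n t) (z n t') < ε := by
  intro ε hε
  set M : ℝ := 1 + K.toReal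
  have hM : 0 < M := by positivity
  -- The splitting `‖g‖ ≤ R + R⁻¹ ‖g‖²` is integrated: with this `R` the second term contributes at
  -- most `ε / 2` on any interval, the first less than `ε / 2` on intervals shorter than `ε / (2
  -- R)`.
  set R : ℝ := 2 * M / ε with hR
  have hRpos : 0 < R := by positivity
  refine ⟨ε / (2 * R), by positivity, fun n t ht t' ht' hd => ?_⟩
  -- the square of the derivative
  have hsq : ∫⁻ t in Set.Ioo 0 1, ENNReal.ofReal (‖g n t‖ ^ 2) ≤ ENNReal.ofReal M := by
    calc ∫⁻ t in Set.Ioo 0 1, ENNReal.ofReal (‖g n t‖ ^ 2) ≤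
          ∫⁻ t in Set.Ioo (0 : ℝ) 1, (1 + ‖g n t‖ₑ ^ p) := by
          refine lintegral_mono fun t => ?_
          have h1 : ‖g n t‖ ^ 2 ≤ 1 + ‖g n t‖ ^ p := by
            rcases le_total ‖g n t‖ 1 with h | h
            · have : 0 ≤ ‖g n t‖ ^ p := by positivity
              nlinarith [norm_nonneg (g n t)]
            · have : ‖g n t‖ ^ (2 : ℝ) ≤ ‖g n t‖ ^ p := Real.rpow_le_rpow_of_exponent_le h hp
              rw [Real.rpow_two] at this
              linarith
          calc ENNReal.ofReal (‖g n t‖ ^ 2) ≤ ENNReal.ofReal (1 + ‖g n t‖ ^ p) :=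
                ENNReal.ofReal_le_ofReal h1
            _ = _ := by
              rw [ENNReal.ofReal_add zero_le_one (by positivity), ENNReal.ofReal_one,
                ← ENNReal.ofReal_rpow_of_nonneg (norm_nonneg _) (by linarith), ofReal_norm]
      _ = 1 + ∫⁻ t in Set.Ioo (0 : ℝ) 1, ‖g n t‖ₑ ^ p := by
          rw [lintegral_add_left measurable_const]; simp
      _ ≤ 1 + K := by gcongr; exact hg n
      _ = ENNReal.ofReal M := by
          rw [ENNReal.ofReal_add zero_le_one ENNReal.toReal_nonneg, ENNReal.ofReal_one,
            ENNReal.ofReal_toReal hK]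
  have hsqi : IntegrableOn (fun t => ‖g n t‖ ^ 2) (Set.Ioo 0 1) := by
    refine ⟨((hgi n).1.norm.pow 2), ?_⟩
    rw [hasFiniteIntegral_iff_ofReal (Eventually.of_forall fun t => by positivity)]
    exact hsq.trans_lt ENNReal.ofReal_lt_top
  have hsqr : ∫ t in Set.Ioo 0 1, ‖g n t‖ ^ 2 ≤ M := by
    rw [integral_eq_lintegral_of_nonneg_ae (Eventually.of_forall fun t => by positivity) hsqi.1]
    exact ENNReal.toReal_le_of_le_ofReal hM.le hsq
  have hsub : Set.uIoc t' t ⊆ Set.Ioo 0 1 :=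
    (Set.uIoc_subset_uIcc).trans (Set.ordConnected_Ioo.uIcc_subset ht' ht)
  have hfin : IsFiniteMeasure (volume.restrict (Set.uIoc t' t)) := ⟨by
    rw [Measure.restrict_apply_univ, Real.volume_uIoc]; exact ENNReal.ofReal_lt_top⟩
  rw [dist_eq_norm, hz n t' ht' t ht]
  calc ‖∫ t in t'..t, g n t‖ ≤ ∫ t in Set.uIoc t' t, ‖g n t‖ :=
        intervalIntegral.norm_integral_le_integral_norm_uIoc
    _ ≤ ∫ t in Set.uIoc t' t, (R + R⁻¹ * ‖g n t‖ ^ 2) := by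
        refine setIntegral_mono ((hgi n).mono_set hsub).norm ?_ fun t => ?_
        · exact (integrable_const R).add ((hsqi.mono_set hsub).const_mul _)
        · simp only
          rcases le_total ‖g n t‖ R with h | h
          · have : 0 ≤ R⁻¹ * ‖g n t‖ ^ 2 := by positivity
            linarith
          · have : ‖g n t‖ ≤ R⁻¹ * ‖g n t‖ ^ 2 := by
              rw [← div_eq_inv_mul, le_div_iff₀ hRpos]
              nlinarith [norm_nonneg (g n t)]
            linarith
    _ = R * |t - t'| + R⁻¹ * ∫ t in Set.uIoc t' t, ‖g n t‖ ^ 2 := by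
        rw [integral_add (integrable_const R) ((hsqi.mono_set hsub).const_mul _), integral_const_mul,
          setIntegral_const, measureReal_def, Real.volume_uIoc, ENNReal.toReal_ofReal (abs_nonneg _),
          smul_eq_mul, mul_comm]
    _ ≤ R * |t - t'| + R⁻¹ * M := by
        have := setIntegral_mono_set hsqi (Eventually.of_forall fun t => by positivity)
          hsub.eventuallyLE
        have h2 := mul_le_mul_of_nonneg_left (this.trans hsqr) (inv_pos.2 hRpos).le
        linarith
    _ < ε := by
        have h1 : R * |t - t'| < R * (ε / (2 * R)) := mul_lt_mul_of_pos_left hd hRpos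
        have h2 : R * (ε / (2 * R)) = ε / 2 := by field_simp
        have h3 : R⁻¹ * M = ε / 2 := by rw [hR]; field_simp
        linarith

/-! ### Slices of bulk deformations -/

/-- The cross-section `(-1/2, 1/2)`. -/
def crossSection : Set ℝ := Set.Ioo (-(1 / 2) : ℝ) (1 / 2)

/-- The deviation of a bulk deformation from its cross-sectional averages is controlled by its
transversal derivative. -/
theorem SobolevMap.eLpNorm_sub_crossAverage_le {p : ℝ} (hp : 1 ≤ p) (y : SobolevMap p bulkDomain)
    {v : ℝ × ℝ → Plane} (hv : ContinuousOn v bulkDomain)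
    (hvy : v =ᵐ[volume.restrict bulkDomain] y.toFun) :
    eLpNorm (fun x => v x - crossAverage y.toFun x.1) (ENNReal.ofReal p) (volume.restrict bulkDomain) ≤
      eLpNorm (fun x => y.grad x (0, 1)) (ENNReal.ofReal p) (volume.restrict bulkDomain) := by
  have hp0 : ENNReal.ofReal p ≠ 0 := by simp; linarith
  have hpt : (ENNReal.ofReal p).toReal = p := ENNReal.toReal_ofReal (by linarith)
  have hgi := y.integrableOn_grad hp (0, 1)
  have hvi := y.integrableOn_rep hp hvy
  have hsl := y.ae_slice_snd hp hv hvy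
  have hprob : IsProbabilityMeasure (volume.restrict crossSection) := by
    unfold crossSection; infer_instance
  rw [eLpNorm_eq_lintegral_rpow_enorm_toReal hp0 ENNReal.ofReal_ne_top,
    eLpNorm_eq_lintegral_rpow_enorm_toReal hp0 ENNReal.ofReal_ne_top, hpt]
  refine ENNReal.rpow_le_rpow ?_ (by positivity)
  have hgm : AEMeasurable (fun x => ‖y.grad x (0, 1)‖ₑ ^ p) (volume.restrict bulkDomain) :=
    hgi.1.enorm.pow_const p
  rw [volume_restrict_bulkDomain] at hgm ⊢
  rw [lintegral_prod _ hgm]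
  refine (lintegral_prod_le _).trans ?_
  have hvy' : ∀ᵐ t ∂(volume.restrict rodDomain), ∀ᵐ s ∂(volume.restrict crossSection),
      v (t, s) = y.toFun (t, s) := by
    have := hvy
    rw [volume_restrict_bulkDomain] at this
    exact Measure.ae_ae_of_ae_prod this
  have hvi' : ∀ᵐ t ∂(volume.restrict rodDomain),
      Integrable (fun s => v (t, s)) (volume.restrict crossSection) := by
    have := hvi
    rw [IntegrableOn, volume_restrict_bulkDomain] at this
    exact this.prod_right_ae
  apply lintegral_mono_ae
  filter_upwards [hsl, hvy', hvi'] with t ht htv hti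
  obtain ⟨hgt, hft⟩ := ht
  change ∫⁻ s in crossSection, _ ≤ ∫⁻ s in crossSection, _
  have hav : crossAverage y.toFun t = ∫ s in crossSection, v (t, s) :=
    integral_congr_ae (htv.mono fun s hs => hs.symm)
  set B : ENNReal := ∫⁻ s in crossSection, ‖y.grad (t, s) (0, 1)‖ₑ with hB
  -- Vertical sections have unit length, so oscillation, distance to the mean and, by comparison of
  -- norms, the `L^p` norm are bounded with constant `1`.
  have hosc : ∀ s ∈ crossSection, ∀ s' ∈ crossSection, ‖v (t, s) - v (t, s')‖ₑ ≤ B := by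
    intro s hs s' hs'
    rw [hft s' hs' s hs, ← ofReal_norm, intervalIntegral.norm_intervalIntegral_eq, ofReal_norm]
    refine (enorm_integral_le_lintegral_enorm _).trans (lintegral_mono_set ?_)
    exact Set.uIoc_subset_uIcc.trans (Set.ordConnected_Ioo.uIcc_subset hs' hs)
  have hpt2 : ∀ s ∈ crossSection, ‖v (t, s) - crossAverage y.toFun t‖ₑ ≤ B := by
    intro s hs
    have : v (t, s) - crossAverage y.toFun t = ∫ s' in crossSection, (v (t, s) - v (t, s')) := by
      rw [integral_sub (integrable_const _) hti, hav]
      simp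
    rw [this]
    calc _ ≤ ∫⁻ s' in crossSection, ‖v (t, s) - v (t, s')‖ₑ := enorm_integral_le_lintegral_enorm _
      _ ≤ ∫⁻ s' in crossSection, B := setLIntegral_mono' measurableSet_Ioo fun s' hs' => hosc s hs s' hs'
      _ = B := by simp
  calc ∫⁻ s in crossSection, ‖v (t, s) - crossAverage y.toFun t‖ₑ ^ p
      ≤ ∫⁻ s in crossSection, B ^ p :=
        setLIntegral_mono' measurableSet_Ioo fun s hs => ENNReal.rpow_le_rpow (hpt2 s hs) (by linarith)
    _ = B ^ p := by simp
    _ ≤ ∫⁻ s in crossSection, ‖y.grad (t, s) (0, 1)‖ₑ ^ p := by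
        have h1 := eLpNorm_le_eLpNorm_of_exponent_le (μ := volume.restrict crossSection)
          (f := fun s => y.grad (t, s) (0, 1)) (p := 1) (q := ENNReal.ofReal p)
          (by simpa using ENNReal.ofReal_le_ofReal hp) hgt.1
        rw [eLpNorm_one_eq_lintegral_enorm, eLpNorm_eq_lintegral_rpow_enorm_toReal hp0
          ENNReal.ofReal_ne_top, hpt] at h1
        calc B ^ p ≤ ((∫⁻ s in crossSection, ‖y.grad (t, s) (0, 1)‖ₑ ^ p) ^ (1 / p)) ^ p :=
              ENNReal.rpow_le_rpow h1 (by linarith)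
          _ = _ := by
              rw [← ENNReal.rpow_mul, one_div, inv_mul_cancel₀ (by linarith), ENNReal.rpow_one]

theorem SobolevMap.aestronglyMeasurable_crossAverage {p : ℝ} (y : SobolevMap p bulkDomain) :
    AEStronglyMeasurable (crossAverage y.toFun) (volume.restrict rodDomain) := by
  have h := y.memLp_toFun.1
  rw [volume_restrict_bulkDomain] at h
  exact h.integral_prod_right'

/-- Upgrades convergence of the averages to convergence of the deformations: the vertical
oscillation is charged to the vertical derivative, which bounded energy makes of order `h`. -/
theorem SobolevMap.eLpNorm_sub_fst_le {p : ℝ} (hp : 1 ≤ p) (y : SobolevMap p bulkDomain)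
    (u : SobolevMap p rodDomain) {v : ℝ × ℝ → Plane} (hv : ContinuousOn v bulkDomain)
    (hvy : v =ᵐ[volume.restrict bulkDomain] y.toFun) :
    eLpNorm (fun x => v x - u.toFun x.1) (ENNReal.ofReal p) (volume.restrict bulkDomain) ≤
      eLpNorm (fun x => y.grad x (0, 1)) (ENNReal.ofReal p) (volume.restrict bulkDomain) +
      eLpNorm (fun t => crossAverage y.toFun t - u.toFun t) (ENNReal.ofReal p)
        (volume.restrict rodDomain) := by
  have hm1 : AEStronglyMeasurable (fun t => crossAverage y.toFun t - u.toFun t)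
    (volume.restrict rodDomain) := y.aestronglyMeasurable_crossAverage.sub u.memLp_toFun.1
  have hm2 : AEStronglyMeasurable (fun x : ℝ × ℝ => crossAverage y.toFun x.1)
      (volume.restrict bulkDomain) :=
    y.aestronglyMeasurable_crossAverage.comp_measurePreserving measurePreserving_fst_bulkDomain
  have hm3 := hm1.comp_measurePreserving measurePreserving_fst_bulkDomain
  have hvm : AEStronglyMeasurable v (volume.restrict bulkDomain) :=
    hv.aestronglyMeasurable measurableSet_bulkDomain
  have e : (fun x => v x - u.toFun x.1) = (fun x => v x - crossAverage y.toFun x.1) +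
      (fun t => crossAverage y.toFun t - u.toFun t) ∘ Prod.fst := by
    ext1 x; simp
  rw [e]
  refine (eLpNorm_add_le (hvm.sub hm2) hm3 (by simpa using ENNReal.ofReal_le_ofReal hp)).trans ?_
  rw [eLpNorm_comp_measurePreserving hm1 measurePreserving_fst_bulkDomain]
  gcongr
  exact y.eLpNorm_sub_crossAverage_le hp hv hvy

/-- Among almost all horizontal slices, one has at most average energy and average distance. -/
theorem SobolevMap.exists_good_slice {p : ℝ} (y : SobolevMap p bulkDomain)
    (u : SobolevMap p rodDomain) {v : ℝ × ℝ → Plane} (hv : ContinuousOn v bulkDomain)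
    {P : ℝ → Prop} (hP : ∀ᵐ s ∂(volume.restrict crossSection), P s) {K δ : ENNReal}
    (hδ : δ ≠ 0) (hδt : δ ≠ ⊤)
    (hK : ∫⁻ x in bulkDomain, ‖y.grad x (1, 0)‖ₑ ^ p ≤ K)
    (hd : ∫⁻ x in bulkDomain, ‖v x - u.toFun x.1‖ₑ ^ p ≤ δ) :
    ∃ s ∈ crossSection, P s ∧ ∫⁻ t in Set.Ioo 0 1, ‖y.grad (t, s) (1, 0)‖ₑ ^ p ≤ K + 1 ∧
      ∫⁻ t in Set.Ioo 0 1, ‖v (t, s) - u.toFun t‖ₑ ^ p ≤ (K + 1) * δ := by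
  have hprob : IsProbabilityMeasure (volume.restrict crossSection) := by
    unfold crossSection; infer_instance
  have hm1 : AEMeasurable (fun x => ‖y.grad x (1, 0)‖ₑ ^ p) (volume.restrict bulkDomain) :=
    (((ContinuousLinearMap.apply ℝ Plane ((1 : ℝ), (0 : ℝ))).continuous.comp_aestronglyMeasurable
      y.memLp_grad.1).enorm).pow_const p
  have hm2 : AEMeasurable (fun x => ‖v x - u.toFun x.1‖ₑ ^ p) (volume.restrict bulkDomain) :=
    (((hv.aestronglyMeasurable measurableSet_bulkDomain).sub
      (u.memLp_toFun.1.comp_measurePreserving measurePreserving_fst_bulkDomain)).enorm).pow_const p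
  rw [volume_restrict_bulkDomain] at hm1 hm2 hK hd
  rw [lintegral_prod_symm _ hm1] at hK
  rw [lintegral_prod_symm _ hm2] at hd
  set D : ℝ → ENNReal := fun s => ∫⁻ t in rodDomain, ‖y.grad (t, s) (1, 0)‖ₑ ^ p
  set F : ℝ → ENNReal := fun s => ∫⁻ t in rodDomain, ‖v (t, s) - u.toFun t‖ₑ ^ p
  have hDm : AEMeasurable D (volume.restrict crossSection) := hm1.lintegral_prod_left'
  have hFm : AEMeasurable F (volume.restrict crossSection) := hm2.lintegral_prod_left'
  have hae : volume.restrict crossSection {s | ¬ (P s ∧ s ∈ crossSection)} = 0 :=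
    hP.and (ae_restrict_mem measurableSet_Ioo)
  -- Averaging the single quantity `D + δ⁻¹ F`, whose mean is at most `K + 1`, bounds both terms on
  -- the same slice.
  obtain ⟨s, hs, hle⟩ := exists_notMem_null_le_lintegral
    (hDm.add (hFm.const_mul δ⁻¹)) hae
  have hs' : P s ∧ s ∈ crossSection := not_not.1 hs
  have htot : D s + δ⁻¹ * F s ≤ K + 1 := by
    refine hle.trans ?_
    simp only [Pi.add_apply]
    rw [lintegral_add_left' hDm, lintegral_const_mul'' _ hFm]
    refine add_le_add hK ?_
    calc _ ≤ δ⁻¹ * δ := by gcongr; exact hd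
      _ ≤ 1 := ENNReal.inv_mul_le_one δ
  refine ⟨s, hs'.2, hs'.1, le_self_add.trans htot, ?_⟩
  have h2 : δ⁻¹ * F s ≤ K + 1 := le_add_self.trans htot
  calc F s = δ * (δ⁻¹ * F s) := by rw [← mul_assoc, ENNReal.mul_inv_cancel hδ hδt, one_mul]
    _ ≤ δ * (K + 1) := by gcongr
    _ = _ := mul_comm _ _

/-- A rod deformation from a curve satisfying the fundamental theorem of calculus. -/
noncomputable def SobolevMap.ofCurve {p : ℝ} {z g : ℝ → Plane}
    (hz : MemLp z (ENNReal.ofReal p) (volume.restrict rodDomain))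
    (hg : MemLp g (ENNReal.ofReal p) (volume.restrict rodDomain))
    (hgi : IntegrableOn g (Set.Ioo 0 1))
    (hf : ∀ t₁ ∈ Set.Ioo (0 : ℝ) 1, ∀ t₂ ∈ Set.Ioo (0 : ℝ) 1, z t₂ - z t₁ = ∫ t in t₁..t₂, g t) :
    SobolevMap p rodDomain where
  toFun := z
  grad t := ContinuousLinearMap.toSpanSingleton ℝ (g t)
  memLp_toFun := hz
  memLp_grad := by
    have hm : AEStronglyMeasurable (fun t => ContinuousLinearMap.toSpanSingleton ℝ (g t))
        (volume.restrict rodDomain) := by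
      have h := ((ContinuousLinearMap.smulRightL ℝ ℝ Plane)
        (ContinuousLinearMap.id ℝ ℝ)).continuous.comp_aestronglyMeasurable hg.1
      refine h.congr (Eventually.of_forall fun t => ?_)
      ext; simp
    exact hg.of_le hm (Eventually.of_forall fun t => by
      rw [ContinuousLinearMap.norm_toSpanSingleton])
  isWeakGradient := by
    intro φ hφ hφc hφs e
    have key := integral_deriv_smul_of_ftc hgi hf hφ hφc hφs
    have h1 : ∀ t, fderiv ℝ φ t e • z t = e • (deriv φ t • z t) := by
      intro t
      rw [← fderiv_apply_one_eq_deriv, smul_smul, ← smul_eq_mul e, ← map_smul, smul_eq_mul, mul_one]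
    have h2 : ∀ t, φ t • (ContinuousLinearMap.toSpanSingleton ℝ (g t)) e = e • (φ t • g t) := by
      intro t
      rw [ContinuousLinearMap.toSpanSingleton_apply, smul_comm]
    simp only [h1, h2]
    rw [integral_smul, integral_smul, rodDomain, key, smul_neg]

/-! ### Lower semicontinuity and compactness -/

/-- Lower semicontinuity of convex integrals under almost everywhere convergence of the
primitives. -/
theorem lintegral_le_of_tendsto_ae {G : Plane → ℝ} (hG : ConvexOn ℝ Set.univ G)
    (hGc : Continuous G) (hG0 : ∀ a, 0 ≤ G a) {z g : ℕ → ℝ → Plane} {w g₀ : ℝ → Plane}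
    (hg : ∀ n, IntegrableOn (g n) (Set.Ioo 0 1)) (hzc : ∀ n, ContinuousOn (z n) (Set.Ioo 0 1))
    (hz : ∀ n, ∀ t₁ ∈ Set.Ioo (0 : ℝ) 1, ∀ t₂ ∈ Set.Ioo (0 : ℝ) 1,
      z n t₂ - z n t₁ = ∫ t in t₁..t₂, g n t)
    (hg₀ : IntegrableOn g₀ (Set.Ioo 0 1)) (hwc : ContinuousOn w (Set.Ioo 0 1))
    (hw : ∀ t₁ ∈ Set.Ioo (0 : ℝ) 1, ∀ t₂ ∈ Set.Ioo (0 : ℝ) 1, w t₂ - w t₁ = ∫ t in t₁..t₂, g₀ t)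
    (hae : ∀ᵐ t ∂(volume.restrict (Set.Ioo (0 : ℝ) 1)), Tendsto (fun n => z n t) atTop (𝓝 (w t)))
    {L : ENNReal}
    (hL : liminf (fun n => ∫⁻ t in Set.Ioo 0 1, ENNReal.ofReal (G (g n t))) atTop ≤ L) :
    ∫⁻ t in Set.Ioo 0 1, ENNReal.ofReal (G (g₀ t)) ≤ L := by
  have hmeas : ∀ q : ℝ → Plane, ContinuousOn q (Set.Ioo 0 1) → ∀ τ > 0, AEMeasurable
      (fun t => ENNReal.ofReal (G (τ⁻¹ • (q (t + τ) - q t))))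
      (volume.restrict (Set.Ioo 0 (1 - τ))) := by
    intro q hq τ hτ
    refine (ENNReal.measurable_ofReal.comp_aemeasurable (ContinuousOn.aemeasurable ?_ measurableSet_Ioo))
    have h1 : ContinuousOn (fun t => q (t + τ)) (Set.Ioo 0 (1 - τ)) :=
      hq.comp (by fun_prop) fun t ht => ⟨by linarith [ht.1], by linarith [ht.2]⟩
    have h2 : ContinuousOn q (Set.Ioo 0 (1 - τ)) :=
      hq.mono (Set.Ioo_subset_Ioo le_rfl (by linarith))
    exact hGc.comp_continuousOn ((h1.sub h2).const_smul τ⁻¹)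
  have hae' := (ae_restrict_iff' measurableSet_Ioo).1 hae
  -- For a fixed step `τ` the difference quotients converge pointwise, so Fatou applies without any
  -- weak convergence of the derivatives.
  have step : ∀ τ > 0, ∫⁻ t in Set.Ioo 0 (1 - τ),
      ENNReal.ofReal (G (τ⁻¹ • (w (t + τ) - w t))) ≤ L := by
    intro τ hτ
    have hsh := (measurePreserving_add_right volume τ).quasiMeasurePreserving.ae hae'
    have hlim : ∀ᵐ t ∂(volume.restrict (Set.Ioo 0 (1 - τ))),
        ENNReal.ofReal (G (τ⁻¹ • (w (t + τ) - w t))) =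
          liminf (fun n => ENNReal.ofReal (G (τ⁻¹ • (z n (t + τ) - z n t)))) atTop := by
      filter_upwards [ae_restrict_of_ae hae', ae_restrict_of_ae hsh,
        ae_restrict_mem measurableSet_Ioo] with t h1 h2 ht
      have a1 := h1 ⟨ht.1, by linarith [ht.2]⟩
      have a2 := h2 ⟨by linarith [ht.1], by linarith [ht.2]⟩
      refine (Tendsto.liminf_eq ?_).symm
      exact (ENNReal.continuous_ofReal.tendsto _).comp
        ((hGc.tendsto _).comp ((a2.sub a1).const_smul τ⁻¹))
    rw [lintegral_congr_ae hlim]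
    refine (lintegral_liminf_le' fun n => hmeas _ (hzc n) τ hτ).trans (le_trans ?_ hL)
    exact liminf_le_liminf (Eventually.of_forall fun n =>
      lintegral_difference_quotient_le hG hGc hG0 (hg n) (hz n) hτ)
  set τ : ℕ → ℝ := fun k => 1 / ((k : ℝ) + 1) with hτ
  have hτ0 : ∀ k, 0 < τ k := fun k => by positivity
  have hτt : Tendsto τ atTop (𝓝 0) := tendsto_one_div_add_atTop_nhds_zero_nat
  -- Now `τ` tends to `0`: the quotients of the limit curve converge to its derivative almost
  -- everywhere, and Fatou is used once more. The cut-off keeps `t + τ` inside the interval.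
  set F : ℕ → ℝ → ENNReal := fun k => (Set.Ioo 0 (1 - τ k)).indicator
    fun t => ENNReal.ofReal (G ((τ k)⁻¹ • (w (t + τ k) - w t))) with hF
  have hg₀' : IntervalIntegrable g₀ volume 0 1 := by
    rw [intervalIntegrable_iff_integrableOn_Ioo_of_le zero_le_one]; exact hg₀
  have hlim : ∀ᵐ t ∂(volume.restrict (Set.Ioo (0 : ℝ) 1)),
      ENNReal.ofReal (G (g₀ t)) = liminf (fun k => F k t) atTop := by
    filter_upwards [ae_restrict_of_ae hg₀'.ae_hasDerivAt_integral, ae_restrict_mem measurableSet_Ioo]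
      with t ht htm
    have hd := ht (by rw [Set.uIcc_of_le zero_le_one]; exact Set.Ioo_subset_Icc_self htm) t
      (by rw [Set.uIcc_of_le zero_le_one]; exact Set.Ioo_subset_Icc_self htm)
    have hsl := (hasDerivAt_iff_tendsto_slope_zero.1 hd).comp
      (tendsto_nhdsWithin_iff.2 ⟨hτt, Eventually.of_forall fun k => (hτ0 k).ne'⟩)
    refine (Tendsto.liminf_eq ?_).symm
    refine ((ENNReal.continuous_ofReal.tendsto _).comp ((hGc.tendsto _).comp hsl)).congr' ?_
    filter_upwards [hτt.eventually (gt_mem_nhds (sub_pos.2 htm.2))] with k hk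
    have hmem : t ∈ Set.Ioo 0 (1 - τ k) := ⟨htm.1, by linarith⟩
    simp only [hF, Set.indicator_of_mem hmem, Function.comp]
    rw [hw t htm (t + τ k) ⟨by linarith [htm.1, hτ0 k], by linarith⟩]
    simp
  rw [lintegral_congr_ae hlim]
  have hFm : ∀ k, AEMeasurable (F k) (volume.restrict (Set.Ioo 0 1)) := fun k =>
    (aemeasurable_indicator_iff₀ measurableSet_Ioo.nullMeasurableSet).2
      ((hmeas w hwc (τ k) (hτ0 k)).mono_measure (Measure.restrict_mono' 
        (Eventually.of_forall fun _ h => h) Measure.restrict_le_self))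
  refine (lintegral_liminf_le' hFm).trans ?_
  refine (liminf_le_liminf (v := fun _ : ℕ => L) (Eventually.of_forall fun k => ?_)).trans_eq
    (liminf_const _)
  calc ∫⁻ t in Set.Ioo 0 1, F k t ≤ ∫⁻ t, F k t := setLIntegral_le_lintegral _ _
    _ ≤ L := by
      rw [hF, lintegral_indicator measurableSet_Ioo]
      exact step _ (hτ0 k)

theorem IsEmbedding.domRestrict_slice {v : ℝ × ℝ → Plane} (hv : IsEmbedding (bulkDomain.domRestrict v))
    {s : ℝ} (hs : s ∈ crossSection) : IsEmbedding (rodDomain.domRestrict fun t => v (t, s)) := by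
  let φ : rodDomain → bulkDomain := fun t => ⟨(t, s), t.2, hs⟩
  have hφ : IsEmbedding φ := by
    refine IsEmbedding.of_comp (g := Subtype.val) (by fun_prop) continuous_subtype_val ?_
    exact (isEmbedding_prodMkLeft s).comp IsEmbedding.subtypeVal
  exact hv.comp hφ

/-- A sequence of bulk homeomorphisms with bounded horizontal derivatives which approaches a rod
deformation in `L^p` makes it non-interpenetrative. -/
theorem nonInterpenetrative_of_tendsto {p : ℝ} (hp : 2 ≤ p) {u : SobolevMap p rodDomain}
    {y : ℕ → SobolevMap p bulkDomain} {v : ℕ → ℝ × ℝ → Plane}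
    (hvy : ∀ n, v n =ᵐ[volume.restrict bulkDomain] (y n).toFun)
    (hv : ∀ n, IsEmbedding (bulkDomain.domRestrict (v n))) {K : ENNReal} (hKt : K ≠ ⊤)
    (hK : ∀ n, ∫⁻ x in bulkDomain, ‖(y n).grad x (1, 0)‖ₑ ^ p ≤ K)
    (hd1 : ∀ n, ∫⁻ x in bulkDomain, ‖v n x - u.toFun x.1‖ₑ ^ p ≤ 1)
    (hd : Tendsto (fun n => ∫⁻ x in bulkDomain, ‖v n x - u.toFun x.1‖ₑ ^ p) atTop (𝓝 0)) :
    NonInterpenetrative u := by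
  have hp1 : 1 ≤ p := by linarith
  have hp0 : ENNReal.ofReal p ≠ 0 := by simp; linarith
  have hpt : (ENNReal.ofReal p).toReal = p := ENNReal.toReal_ofReal (by linarith)
  have hvc : ∀ n, ContinuousOn (v n) bulkDomain := fun n =>
    continuousOn_iff_continuous_domRestrict.2 (hv n).continuous
  set d : ℕ → ENNReal := fun n => ∫⁻ x in bulkDomain, ‖v n x - u.toFun x.1‖ₑ ^ p
  -- The distance, made strictly positive so that `exists_good_slice` can divide by it, and still
  -- tending to zero.
  set δ : ℕ → ENNReal := fun n => d n + ((n : ENNReal) + 1)⁻¹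
  have hinv : ∀ n : ℕ, ((n : ENNReal) + 1)⁻¹ ≤ 1 := fun n => ENNReal.inv_le_one.2 le_add_self
  have hδ0 : ∀ n, δ n ≠ 0 := fun n => by simp [δ]
  have hδ2 : ∀ n, δ n ≤ 2 := fun n => (add_le_add (hd1 n) (hinv n)).trans (by norm_num)
  have hδt : Tendsto δ atTop (𝓝 0) := by
    have h2 : Tendsto (fun n : ℕ => ((n : ENNReal) + 1)⁻¹) atTop (𝓝 0) := by
      have := (tendsto_add_atTop_iff_nat 1).2 ENNReal.tendsto_inv_nat_nhds_zero
      simpa using this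
    simpa using hd.add h2
  have key := fun n => (y n).exists_good_slice u (hvc n) ((y n).ae_slice_fst hp1 (hvc n) (hvy n))
    (hδ0 n) (ne_top_of_le_ne_top (by simp) (hδ2 n)) (hK n) (le_self_add : d n ≤ δ n)
  choose s hs hP hsK hsd using key
  set z : ℕ → ℝ → Plane := fun n t => v n (t, s n)
  set g : ℕ → ℝ → Plane := fun n t => (y n).grad (t, s n) (1, 0)
  have hzc : ∀ n, ContinuousOn (z n) rodDomain := fun n =>
    (hvc n).comp (by fun_prop) fun t ht => ⟨ht, hs n⟩
  have hzm : ∀ n, AEStronglyMeasurable (z n) (volume.restrict rodDomain) := fun n =>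
    (hzc n).aestronglyMeasurable measurableSet_Ioo
  have hK1 : K + 1 ≠ ⊤ := by simp [hKt]
  have hnorm : ∀ n, eLpNorm (z n - u.toFun) (ENNReal.ofReal p) (volume.restrict rodDomain) ≤
      ((K + 1) * δ n) ^ (1 / p) := by
    intro n
    rw [eLpNorm_eq_lintegral_rpow_enorm_toReal hp0 ENNReal.ofReal_ne_top, hpt]
    exact ENNReal.rpow_le_rpow (hsd n) (by positivity)
  have hnormt : Tendsto (fun n => eLpNorm (z n - u.toFun) (ENNReal.ofReal p)
      (volume.restrict rodDomain)) atTop (𝓝 0) := by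
    refine tendsto_of_tendsto_of_tendsto_of_le_of_le tendsto_const_nhds ?_ (fun n => zero_le)
      hnorm
    have h1 : Tendsto (fun n => (K + 1) * δ n) atTop (𝓝 0) := by
      simpa using ENNReal.Tendsto.const_mul hδt (Or.inr hK1)
    have h2 := (ENNReal.continuous_rpow_const (y := 1 / p)).tendsto 0 |>.comp h1
    rw [ENNReal.zero_rpow_of_pos (by positivity)] at h2
    exact h2
  -- A subsequence of the slices converges almost everywhere, which equicontinuity turns into
  -- uniform convergence.
  obtain ⟨φ, hφ, hφae⟩ := (tendstoInMeasure_of_tendsto_eLpNorm hp0 hzm u.memLp_toFun.1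
    hnormt).exists_seq_tendsto_ae
  have heq := equicontinuous_of_lintegral_le hp (z := fun k => z (φ k)) (g := fun k => g (φ k))
    hK1 (fun k => (hP (φ k)).1) (fun k => (hP (φ k)).2) (fun k => hsK (φ k))
  obtain ⟨w, hw⟩ := exists_tendstoUniformlyOn_of_ae heq hφae
  have hB : ((K + 1) * 2) ^ (1 / p) ≠ ⊤ :=
    ENNReal.rpow_ne_top_of_nonneg (by positivity) (ENNReal.mul_ne_top hK1 (by simp))
  have hzB : ∀ n, eLpNorm (z n) (ENNReal.ofReal p) (volume.restrict rodDomain) ≤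
      ((K + 1) * 2) ^ (1 / p) + eLpNorm u.toFun (ENNReal.ofReal p) (volume.restrict rodDomain) := by
    intro n
    have e : z n = (z n - u.toFun) + u.toFun := by simp
    rw [e]
    refine (eLpNorm_add_le ((hzm n).sub u.memLp_toFun.1) u.memLp_toFun.1
      (by simpa using ENNReal.ofReal_le_ofReal hp1)).trans ?_
    gcongr
    refine (hnorm n).trans (ENNReal.rpow_le_rpow ?_ (by positivity))
    gcongr
    exact hδ2 n
  have hgB : ∀ n, eLpNorm (g n) (ENNReal.ofReal p) (volume.restrict rodDomain) ≤
      (K + 1) ^ (1 / p) := by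
    intro n
    rw [eLpNorm_eq_lintegral_rpow_enorm_toReal hp0 ENNReal.ofReal_ne_top, hpt]
    exact ENNReal.rpow_le_rpow (hsK n) (by positivity)
  have hzL : ∀ n, MemLp (z n) (ENNReal.ofReal p) (volume.restrict rodDomain) := fun n =>
    ⟨hzm n, (hzB n).trans_lt (lt_top_iff_ne_top.2 (ENNReal.add_ne_top.2 ⟨hB, u.memLp_toFun.2.ne⟩))⟩
  have hgB' : (K + 1) ^ (1 / p) ≠ ⊤ := ENNReal.rpow_ne_top_of_nonneg (by positivity) hK1
  have hgL : ∀ n, MemLp (g n) (ENNReal.ofReal p) (volume.restrict rodDomain) := fun n =>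
    ⟨(hP n).1.1, (hgB n).trans_lt (lt_top_iff_ne_top.2 hgB')⟩
  refine ⟨w, ?_, fun k => SobolevMap.ofCurve (hzL (φ k)) (hgL (φ k)) (hP (φ k)).1 (hP (φ k)).2,
    _, ENNReal.add_ne_top.2 ⟨ENNReal.add_ne_top.2 ⟨hB, u.memLp_toFun.2.ne⟩, hgB'⟩,
    fun k => add_le_add (hzB (φ k)) ?_, fun k => IsEmbedding.domRestrict_slice (hv (φ k)) (hs _), hw⟩
  · filter_upwards [hφae, ae_restrict_mem measurableSet_Ioo] with t ht htm
    exact tendsto_nhds_unique (hw.tendsto_at htm) ht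
  · refine le_trans (le_of_eq ?_) (hgB (φ k))
    refine eLpNorm_congr_norm_ae (Eventually.of_forall fun t => ?_)
    simp only [SobolevMap.ofCurve]
    rw [ContinuousLinearMap.norm_toSpanSingleton]

/-- Lower semicontinuity of the energy along bulk deformations that approach a rod deformation. -/
theorem SobolevMap.lintegral_grad_le_of_tendsto {p : ℝ} (hp : 1 ≤ p) {u : SobolevMap p rodDomain}
    {w : ℝ → Plane} (hwc : ContinuousOn w rodDomain)
    (hwu : w =ᵐ[volume.restrict rodDomain] u.toFun)
    {y : ℕ → SobolevMap p bulkDomain} {v : ℕ → ℝ × ℝ → Plane}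
    (hvy : ∀ n, v n =ᵐ[volume.restrict bulkDomain] (y n).toFun)
    (hvc : ∀ n, ContinuousOn (v n) bulkDomain)
    (hd : Tendsto (fun n => ∫⁻ x in bulkDomain, ‖v n x - u.toFun x.1‖ₑ ^ p) atTop (𝓝 0))
    {G : Plane → ℝ} (hG : ConvexOn ℝ Set.univ G) (hGc : Continuous G) (hG0 : ∀ a, 0 ≤ G a)
    {L : ENNReal} (hL : ∀ n, ∫⁻ x in bulkDomain, ENNReal.ofReal (G ((y n).grad x (1, 0))) ≤ L) :
    ∫⁻ t in rodDomain, ENNReal.ofReal (G (u.grad t 1)) ≤ L := by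
  have hp0 : ENNReal.ofReal p ≠ 0 := by simp; linarith
  have hpt : (ENNReal.ofReal p).toReal = p := ENNReal.toReal_ofReal (by linarith)
  have hnormt : Tendsto (fun n => eLpNorm (v n - u.toFun ∘ Prod.fst) (ENNReal.ofReal p)
      (volume.restrict bulkDomain)) atTop (𝓝 0) := by
    have h2 := (ENNReal.continuous_rpow_const (y := 1 / p)).tendsto 0 |>.comp hd
    rw [ENNReal.zero_rpow_of_pos (by positivity)] at h2
    refine h2.congr fun n => ?_
    rw [eLpNorm_eq_lintegral_rpow_enorm_toReal hp0 ENNReal.ofReal_ne_top, hpt]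
    rfl
  obtain ⟨φ, hφ, hφae⟩ := (tendstoInMeasure_of_tendsto_eLpNorm hp0
    (fun n => (hvc n).aestronglyMeasurable measurableSet_bulkDomain)
    (u.memLp_toFun.1.comp_measurePreserving measurePreserving_fst_bulkDomain)
    hnormt).exists_seq_tendsto_ae
  have hsl : ∀ᵐ s ∂(volume.restrict crossSection), ∀ᵐ t ∂(volume.restrict rodDomain),
      Tendsto (fun k => v (φ k) (t, s)) atTop (𝓝 (u.toFun t)) := by
    have h1 : ∀ᵐ x ∂((volume.restrict crossSection).prod (volume.restrict rodDomain)),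
        Tendsto (fun k => v (φ k) x.swap) atTop (𝓝 (u.toFun x.2)) := by
      have h2 := hφae
      rw [volume_restrict_bulkDomain] at h2
      exact (Measure.measurePreserving_swap (μ := volume.restrict crossSection)
        (ν := volume.restrict rodDomain)).quasiMeasurePreserving.ae h2
    exact Measure.ae_ae_of_ae_prod h1
  have hprob : IsProbabilityMeasure (volume.restrict crossSection) := by
    unfold crossSection; infer_instance
  have hm : ∀ n, AEMeasurable (fun x => ENNReal.ofReal (G ((y n).grad x (1, 0))))
      (volume.restrict bulkDomain) := fun n =>
    (hGc.comp_aestronglyMeasurable ((y n).integrableOn_grad hp (1, 0)).1).aemeasurable.ennreal_ofReal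
  set E : ℕ → ℝ → ENNReal := fun n s => ∫⁻ t in rodDomain, ENNReal.ofReal (G ((y n).grad (t, s) (1, 0)))
  have hm' : ∀ n, AEMeasurable (fun x => ENNReal.ofReal (G ((y n).grad x (1, 0))))
      ((volume.restrict rodDomain).prod (volume.restrict crossSection)) := fun n => by
    have := hm n
    rwa [volume_restrict_bulkDomain] at this
  have hEm : ∀ n, AEMeasurable (E n) (volume.restrict crossSection) := fun n =>
    (hm' n).lintegral_prod_left'
  have hE : ∀ n, ∫⁻ s in crossSection, E n s ≤ L := fun n => by
    have := hL n
    rw [volume_restrict_bulkDomain, ← crossSection, lintegral_prod_symm _ (hm' n)] at this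
    exact this
  -- Unlike in `nonInterpenetrative_of_tendsto`, one slice `s` is used for all indices: Fatou over
  -- the cross-section provides one whose lower limit of energies is at most `L`.
  have hfat : ∫⁻ s in crossSection, liminf (fun k => E (φ k) s) atTop ≤ L := by
    refine (lintegral_liminf_le' fun k => hEm (φ k)).trans ?_
    exact (liminf_le_liminf (v := fun _ : ℕ => L) (Eventually.of_forall fun k => hE (φ k))).trans_eq
      (liminf_const _)
  have hgood : ∀ᵐ s ∂(volume.restrict crossSection), s ∈ crossSection ∧
      (∀ᵐ t ∂(volume.restrict rodDomain), Tendsto (fun k => v (φ k) (t, s)) atTop (𝓝 (u.toFun t))) ∧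
      ∀ n, IntegrableOn (fun t => (y n).grad (t, s) (1, 0)) (Set.Ioo 0 1) ∧
      ∀ t₁ ∈ Set.Ioo (0 : ℝ) 1, ∀ t₂ ∈ Set.Ioo (0 : ℝ) 1,
        v n (t₂, s) - v n (t₁, s) = ∫ t in t₁..t₂, (y n).grad (t, s) (1, 0) :=
    (ae_restrict_mem measurableSet_Ioo).and (hsl.and (ae_all_iff.2 fun n =>
      (y n).ae_slice_fst hp (hvc n) (hvy n)))
  obtain ⟨s, hs, hle⟩ := exists_notMem_null_le_lintegral
    (⟨_, Measurable.liminf fun k => (hEm (φ k)).measurable_mk, by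
      filter_upwards [ae_all_iff.2 fun k => (hEm (φ k)).ae_eq_mk] with s hs
      simp only [hs]⟩ : AEMeasurable (fun s => liminf (fun k => E (φ k) s) atTop)
        (volume.restrict crossSection)) hgood
  obtain ⟨hsm, hst, hsf⟩ := not_not.1 hs
  refine lintegral_le_of_tendsto_ae hG hGc hG0 (z := fun k t => v (φ k) (t, s))
    (g := fun k t => (y (φ k)).grad (t, s) (1, 0)) (w := w) (fun k => (hsf (φ k)).1)
    (fun k => (hvc (φ k)).comp (by fun_prop) fun t ht => ⟨ht, hsm⟩) (fun k => (hsf (φ k)).2)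
    ?_ hwc (fun t₁ h₁ t₂ h₂ => u.sub_eq_integral hp hwc hwu h₁ h₂) ?_ ?_
  · exact (ContinuousLinearMap.apply ℝ Plane (1 : ℝ)).integrable_comp
      (integrableOn_of_memLp hp (volume_rodDomain ▸ ENNReal.one_lt_top) u.memLp_grad)
  · filter_upwards [hst, hwu] with t h1 h2
    rw [h2]; exact h1
  · refine le_trans (le_of_eq ?_) (hle.trans hfat)
    rfl

/-! ### The lower bound -/

theorem lintegral_rpow_enorm_eq {α : Type*} [MeasurableSpace α] {μ : Measure α} {p : ℝ} (hp : 0 < p)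
    (f : α → Plane) : ∫⁻ x, ‖f x‖ₑ ^ p ∂μ = eLpNorm f (ENNReal.ofReal p) μ ^ p := by
  rw [eLpNorm_eq_lintegral_rpow_enorm_toReal (by simpa using hp) ENNReal.ofReal_ne_top,
    ENNReal.toReal_ofReal hp.le, ← ENNReal.rpow_mul, one_div, inv_mul_cancel₀ hp.ne',
    ENNReal.rpow_one]

section LowerBound

variable {p : ℝ} {W : Matrix (Fin 2) (Fin 2) ℝ → ENNReal}

theorem norm_le_matNorm_left (a b : Plane) : ‖a‖ ≤ matNorm (colMatrix a b) :=
  le_of_sq_le_sq (by rw [matNorm_colMatrix_sq]; nlinarith [norm_nonneg b]) (matNorm_nonneg _)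

theorem norm_le_matNorm_right (a b : Plane) : ‖b‖ ≤ matNorm (colMatrix a b) :=
  le_of_sq_le_sq (by rw [matNorm_colMatrix_sq]; nlinarith [norm_nonneg a]) (matNorm_nonneg _)

theorem enorm_rpow_le_of_growth (hp : 0 ≤ p) {c : ℝ} (hc : 0 < c)
    (hW : ∀ F, ENNReal.ofReal (c * matNorm F ^ p) ≤ W F) {F : Matrix (Fin 2) (Fin 2) ℝ} {a : Plane}
    (ha : ‖a‖ ≤ matNorm F) : ‖a‖ₑ ^ p ≤ ENNReal.ofReal c⁻¹ * W F := by
  calc ‖a‖ₑ ^ p = ENNReal.ofReal (‖a‖ ^ p) := by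
        rw [← ENNReal.ofReal_rpow_of_nonneg (norm_nonneg _) hp, ofReal_norm]
    _ ≤ ENNReal.ofReal (c⁻¹ * (c * matNorm F ^ p)) := by
        apply ENNReal.ofReal_le_ofReal
        rw [← mul_assoc, inv_mul_cancel₀ hc.ne', one_mul]
        exact Real.rpow_le_rpow (norm_nonneg _) ha hp
    _ = ENNReal.ofReal c⁻¹ * ENNReal.ofReal (c * matNorm F ^ p) :=
        ENNReal.ofReal_mul (by positivity)
    _ ≤ _ := by gcongr; exact hW F

/-- If the inequality failed, some sequence `h n → 0` would have energies below a number `L < J(u)`.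
Compactness makes `u` non-interpenetrative, and lower semicontinuity along the same sequence gives
`J(u) ≤ L`. -/
theorem rodEnergy_le_liminf (hp : 2 ≤ p) (hW_top : ∀ F, W F = ⊤ ↔ F.det ≤ 0) {c : ℝ} (hc : 0 < c)
    (hW : ∀ F, ENNReal.ofReal (c * matNorm F ^ p) ≤ W F) {u : SobolevMap p rodDomain}
    {y : ℝ → SobolevMap p bulkDomain} (hy : PiConverges y u) :
    rodEnergy W u ≤ liminf (fun h => bulkEnergy W h (y h)) (𝓝[>] (0 : ℝ)) := by
  by_contra hlt
  obtain ⟨L, hL1, hL2⟩ := exists_between (not_le.1 hlt)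
  have hp1 : 1 ≤ p := by linarith
  have hp0 : 0 < p := by linarith
  have hLt : L ≠ ⊤ := hL2.ne_top
  obtain ⟨h, hh, hE⟩ := exists_seq_forall_of_frequently (frequently_lt_of_liminf_lt (by isBoundedDefault) hL1)
  have hadm : ∀ n, Admissible (y (h n)) := fun n => by
    by_contra hn
    have := hE n
    rw [bulkEnergy, if_neg hn] at this
    exact not_top_lt this
  have hen : ∀ n, ∫⁻ x in bulkDomain, W (scaledGrad (h n) (y (h n)) x) ≤ L := fun n => by
    have := (hE n).le
    rwa [bulkEnergy, if_pos (hadm n)] at this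
  choose v hvy hv using fun n => (hadm n).1
  have hvc : ∀ n, ContinuousOn (v n) bulkDomain := fun n =>
    continuousOn_iff_continuous_domRestrict.2 (hv n).continuous
  set K : ENNReal := ENNReal.ofReal c⁻¹ * L
  have hKt : K ≠ ⊤ := ENNReal.mul_ne_top ENNReal.ofReal_ne_top hLt
  have hh0 : ∀ᶠ n in atTop, 0 < h n := hh.eventually self_mem_nhdsWithin
  have hint : ∀ n (g : ℝ × ℝ → Plane), (∀ x, ‖g x‖ ≤ matNorm (scaledGrad (h n) (y (h n)) x)) →
      ∫⁻ x in bulkDomain, ‖g x‖ₑ ^ p ≤ K := fun n g hg => by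
    calc _ ≤ ∫⁻ x in bulkDomain, ENNReal.ofReal c⁻¹ * W (scaledGrad (h n) (y (h n)) x) :=
          lintegral_mono fun x => enorm_rpow_le_of_growth hp0.le hc hW (hg x)
      _ ≤ K := by
          rw [lintegral_const_mul' _ _ ENNReal.ofReal_ne_top]
          exact mul_le_mul_right (hen n) _
  have hK1 : ∀ n, ∫⁻ x in bulkDomain, ‖(y (h n)).grad x (1, 0)‖ₑ ^ p ≤ K := fun n =>
    hint n _ fun x => norm_le_matNorm_left _ _
  have hK2 : ∀ n, ∫⁻ x in bulkDomain, ‖(h n)⁻¹ • (y (h n)).grad x (0, 1)‖ₑ ^ p ≤ K := fun n =>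
    hint n _ fun x => norm_le_matNorm_right _ _
  -- Growth bounds `h⁻¹ ∂₂y`; undoing the scaling leaves the factor `h n`, which tends to zero.
  have hK3 : ∀ᶠ n in atTop, eLpNorm (fun x => (y (h n)).grad x (0, 1)) (ENNReal.ofReal p)
      (volume.restrict bulkDomain) ≤ ENNReal.ofReal (h n) * K ^ (1 / p) := by
    filter_upwards [hh0] with n hn
    have e : (fun x => (y (h n)).grad x (0, 1)) =
        h n • fun x => (h n)⁻¹ • (y (h n)).grad x (0, 1) := by
      ext1 x; simp [hn.ne']
    rw [e, eLpNorm_const_smul, Real.enorm_eq_ofReal hn.le]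
    gcongr
    have := hK2 n
    rw [lintegral_rpow_enorm_eq hp0] at this
    rw [one_div]
    exact (ENNReal.le_rpow_inv_iff hp0).2 this
  have hd : Tendsto (fun n => ∫⁻ x in bulkDomain, ‖v n x - u.toFun x.1‖ₑ ^ p) atTop (𝓝 0) := by
    have t1 : Tendsto (fun n => eLpNorm (fun x => v n x - u.toFun x.1) (ENNReal.ofReal p)
        (volume.restrict bulkDomain)) atTop (𝓝 0) := by
      have t2 : Tendsto (fun n => ENNReal.ofReal (h n) * K ^ (1 / p) +
          eLpNorm (fun t => crossAverage (y (h n)).toFun t - u.toFun t) (ENNReal.ofReal p)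
            (volume.restrict rodDomain)) atTop (𝓝 0) := by
        have a1 : Tendsto (fun n => ENNReal.ofReal (h n)) atTop (𝓝 0) := by
          have := (ENNReal.continuous_ofReal.tendsto 0).comp (hh.mono_right nhdsWithin_le_nhds)
          simpa [Function.comp_def] using this
        have a2 := ENNReal.Tendsto.mul_const (b := K ^ (1 / p)) a1
          (Or.inr (ENNReal.rpow_ne_top_of_nonneg (by positivity) hKt))
        simpa using a2.add (hy.comp hh)
      refine tendsto_of_tendsto_of_tendsto_of_le_of_le' tendsto_const_nhds t2
        (Eventually.of_forall fun n => zero_le) ?_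
      filter_upwards [hK3] with n hn
      exact ((y (h n)).eLpNorm_sub_fst_le hp1 u (hvc n) (hvy n)).trans (by gcongr)
    have t3 := ((ENNReal.continuous_rpow_const (y := p)).tendsto 0).comp t1
    rw [ENNReal.zero_rpow_of_pos hp0] at t3
    exact t3.congr fun n => (lintegral_rpow_enorm_eq hp0 _).symm
  -- The sequence is shifted by `N` because the compactness lemma asks for distances at most `1` at
  -- every index.
  obtain ⟨N, hN⟩ := eventually_atTop.1 (hd.eventually (ge_mem_nhds (zero_lt_one' ENNReal)))
  have hNI : NonInterpenetrative u :=
    nonInterpenetrative_of_tendsto hp (y := fun n => y (h (n + N))) (v := fun n => v (n + N))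
      (fun n => hvy _) (fun n => hv _) hKt (fun n => hK1 _) (fun n => hN _ (by omega))
      ((tendsto_add_atTop_iff_nat N).2 hd)
  have hf : ∀ a, a ≠ 0 → reducedDensity W a ≠ ⊤ := fun a ha => reducedDensity_ne_top hW_top ha
  have hJ : rodEnergy W u ≤ L := by
    rw [rodEnergy, if_pos hNI]
    obtain ⟨w, hwu, Y, M, hM, hYM, hYe, hYw⟩ := hNI
    have hwc : ContinuousOn w rodDomain := hYw.continuousOn (Frequently.of_forall fun k =>
      continuousOn_iff_continuous_domRestrict.2 (hYe k).continuous)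
    -- The density passed on is the real-valued envelope, which lies below `W` whatever the second
    -- column of the gradient is.
    have := SobolevMap.lintegral_grad_le_of_tendsto hp1 hwc hwu hvy hvc hd
      (convexOn_toReal_convexEnvelope hf) (continuous_toReal_convexEnvelope hf)
      (fun a => ENNReal.toReal_nonneg) (L := L) fun n => by
        refine le_trans (lintegral_mono fun x => ?_) (hen n)
        rw [ofReal_toReal_convexEnvelope hf]
        exact (convexEnvelope_le _ _).trans (iInf_le _ _)
    simpa only [ofReal_toReal_convexEnvelope hf] using this
  exact absurd hL2 (not_lt.2 hJ)

end LowerBound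

/-! ### Timed polygons -/

/-- The curve `z` is on `[a, b]` a polygon all of whose pieces have a velocity `c` and a cost `r`
per unit time related by `R`, and the total cost is `E`. -/
inductive PolygonCost (R : Plane → ℝ → Prop) (z : ℝ → Plane) : ℝ → ℝ → ℝ → Prop
  | segment {a b : ℝ} {c : Plane} {r : ℝ} (hab : a < b)
      (hz : ∀ t ∈ Set.Icc a b, z t = z a + (t - a) • c) (hr : R c r) :
      PolygonCost R z a b ((b - a) * r)
  | append {a m b E F : ℝ} : PolygonCost R z a m E → PolygonCost R z m b F →
      PolygonCost R z a b (E + F)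

/-- The curve which follows `z₁` up to time `m` and `z₂` afterwards. -/
noncomputable def glueAt {α : Type*} (m : ℝ) (z₁ z₂ : ℝ → α) (t : ℝ) : α :=
  if t ≤ m then z₁ t else z₂ t

theorem glueAt_of_le {α : Type*} {m t : ℝ} (z₁ z₂ : ℝ → α) (h : t ≤ m) : glueAt m z₁ z₂ t = z₁ t :=
  if_pos h

theorem glueAt_of_ge {α : Type*} {m t : ℝ} {z₁ z₂ : ℝ → α} (hm : z₁ m = z₂ m) (h : m ≤ t) :
    glueAt m z₁ z₂ t = z₂ t := by
  rcases eq_or_lt_of_le h with rfl | h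
  · rw [glueAt_of_le _ _ le_rfl, hm]
  · exact if_neg (not_le.2 h)

namespace PolygonCost

variable {R : Plane → ℝ → Prop} {z : ℝ → Plane} {a b E : ℝ}

theorem lt (h : PolygonCost R z a b E) : a < b := by
  induction h with
  | segment hab => exact hab
  | append _ _ h1 h2 => exact h1.trans h2

theorem congr {z' : ℝ → Plane} (h : PolygonCost R z a b E)
    (hz : ∀ t ∈ Set.Icc a b, z' t = z t) : PolygonCost R z' a b E := by
  induction h with
  | segment hab hs hr =>
    refine segment hab (fun t ht => ?_) hr
    rw [hz t ht, hz _ (Set.left_mem_Icc.2 hab.le), hs t ht]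
  | append h1 h2 i1 i2 =>
    exact append (i1 fun t ht => hz t ⟨ht.1, ht.2.trans h2.lt.le⟩)
      (i2 fun t ht => hz t ⟨h1.lt.le.trans ht.1, ht.2⟩)

theorem glue {z₁ z₂ : ℝ → Plane} {m F : ℝ} (h₁ : PolygonCost R z₁ a m E)
    (h₂ : PolygonCost R z₂ m b F) (hm : z₁ m = z₂ m) :
    PolygonCost R (glueAt m z₁ z₂) a b (E + F) :=
  append (h₁.congr fun _ ht => glueAt_of_le _ _ ht.2) (h₂.congr fun _ ht => glueAt_of_ge hm ht.1)

theorem exists_lipschitz (h : PolygonCost R z a b E) :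
    ∃ C : ℝ, 0 ≤ C ∧ ∀ t ∈ Set.Icc a b, ∀ t' ∈ Set.Icc a b, t ≤ t' → ‖z t' - z t‖ ≤ C * (t' - t) := by
  induction h with
  | @segment a b c r hab hs hr =>
    refine ⟨‖c‖, norm_nonneg _, fun t ht t' ht' h => ?_⟩
    rw [hs t ht, hs t' ht', add_sub_add_left_eq_sub, ← sub_smul, norm_smul, Real.norm_of_nonneg (by linarith)]
    exact le_of_eq (by ring)
  | @append a m b E F h1 h2 i1 i2 =>
    obtain ⟨C₁, hC₁, i1⟩ := i1
    obtain ⟨C₂, hC₂, i2⟩ := i2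
    refine ⟨max C₁ C₂, le_max_of_le_left hC₁, fun t ht t' ht' h => ?_⟩
    rcases le_total t' m with h' | h'
    · refine (i1 t ⟨ht.1, h.trans h'⟩ t' ⟨ht'.1, h'⟩ h).trans ?_
      gcongr
      exact le_max_left _ _
    rcases le_total m t with h'' | h''
    · refine (i2 t ⟨h'', ht.2⟩ t' ⟨h', ht'.2⟩ h).trans ?_
      gcongr
      exact le_max_right _ _
    · have e1 := i1 t ⟨ht.1, h''⟩ m ⟨h1.lt.le, le_rfl⟩ h''
      have e2 := i2 m ⟨le_rfl, h2.lt.le⟩ t' ⟨h', ht'.2⟩ h'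
      have e3 : C₁ * (m - t) ≤ max C₁ C₂ * (m - t) := by gcongr; exact le_max_left _ _
      have e4 : C₂ * (t' - m) ≤ max C₁ C₂ * (t' - m) := by gcongr; exact le_max_right _ _
      calc ‖z t' - z t‖ = ‖(z t' - z m) + (z m - z t)‖ := by rw [sub_add_sub_cancel]
        _ ≤ ‖z t' - z m‖ + ‖z m - z t‖ := norm_add_le _ _
        _ ≤ _ := by linarith

theorem continuousOn (h : PolygonCost R z a b E) : ContinuousOn z (Set.Icc a b) := by
  obtain ⟨C, hC, hz⟩ := h.exists_lipschitz
  refine (LipschitzOnWith.of_dist_le_mul (K := C.toNNReal) fun t ht t' ht' => ?_).continuousOn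
  rw [dist_eq_norm, Real.coe_toNNReal _ hC]
  rcases le_total t t' with h | h
  · rw [norm_sub_rev, dist_comm, Real.dist_eq, abs_of_nonneg (by linarith)]
    exact hz t ht t' ht' h
  · rw [Real.dist_eq, abs_of_nonneg (by linarith)]
    exact hz t' ht' t ht h

/-- Changing the cost relation of an injective polygon. -/
theorem exists_cost_le {R' : Plane → ℝ → Prop} (h : PolygonCost R z a b E)
    (hz : Set.InjOn z (Set.Icc a b)) {ε : ℝ}
    (hR : ∀ c r, c ≠ 0 → R c r → ∃ r', R' c r' ∧ r' ≤ r + ε) :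
    ∃ E', PolygonCost R' z a b E' ∧ E' ≤ E + ε * (b - a) := by
  induction h with
  | @segment a b c r hab hs hr =>
    -- A piece of zero velocity would take the same value at both its ends.
    have hc : c ≠ 0 := by
      rintro rfl
      have := hz (Set.left_mem_Icc.2 hab.le) (Set.right_mem_Icc.2 hab.le)
        (by rw [hs b (Set.right_mem_Icc.2 hab.le)]; simp)
      exact hab.ne this
    obtain ⟨r', h1, h2⟩ := hR c r hc hr
    refine ⟨_, segment hab hs h1, ?_⟩
    have := mul_le_mul_of_nonneg_left h2 (sub_nonneg.2 hab.le)
    linarith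
  | @append a m b E F h1 h2 i1 i2 =>
    obtain ⟨E₁, p1, q1⟩ := i1 (hz.mono (Set.Icc_subset_Icc le_rfl h2.lt.le))
    obtain ⟨E₂, p2, q2⟩ := i2 (hz.mono (Set.Icc_subset_Icc h1.lt.le le_rfl))
    exact ⟨_, append p1 p2, by linarith⟩

end PolygonCost

/-! ### Directors -/

/-- Two velocities which are not opposite have a common transversal. -/
theorem exists_common_director {c c' : Plane} (hc : c ≠ 0) (hc' : c' ≠ 0)
    (h : ∀ r : ℝ, 0 < r → c' ≠ -(r • c)) : ∃ d : Plane, 0 < cross c d ∧ 0 < cross c' d := by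
  have hin : ∀ x y : Plane, cross x (rot y) = inner ℝ x y := fun x y => by
    rw [cross_rot, PiLp.inner_apply, Fin.sum_univ_two]
    simp [mul_comm]
  have hn : 0 < ‖c‖ := norm_pos_iff.2 hc
  have hn' : 0 < ‖c'‖ := norm_pos_iff.2 hc'
  have key : -(‖c‖ * ‖c'‖) < inner ℝ c c' := by
    refine lt_of_le_of_ne (neg_le_of_abs_le (abs_real_inner_le_norm c c')) fun he => ?_
    have : inner ℝ c c' / (‖c‖ * ‖c'‖) = -1 := by
      rw [← he, neg_div, div_self (by positivity)]
    obtain ⟨-, r, hr, e⟩ := (real_inner_div_norm_mul_norm_eq_neg_one_iff _ _).1 this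
    exact h (-r) (by linarith) (by rw [e]; simp)
  -- The bisector of the two velocities, turned by a right angle. Both determinants are positive by
  -- the strict Cauchy–Schwarz inequality, whose equality case is that of opposite vectors.
  refine ⟨rot (‖c'‖ • c + ‖c‖ • c'), ?_, ?_⟩
  · rw [hin, inner_add_right, inner_smul_right, inner_smul_right, real_inner_self_eq_norm_sq]
    nlinarith
  · rw [hin, inner_add_right, inner_smul_right, inner_smul_right, real_inner_self_eq_norm_sq,
      real_inner_comm]
    nlinarith

/-- The clamped affine cut-off equal to `1` on `(-∞, 1]` and to `0` on `[2, ∞)`. -/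
noncomputable def ramp (x : ℝ) : ℝ := max 0 (min 1 (2 - x))

theorem ramp_nonneg (x : ℝ) : 0 ≤ ramp x := le_max_left _ _

theorem ramp_le_one (x : ℝ) : ramp x ≤ 1 := max_le zero_le_one (min_le_left _ _)

theorem ramp_of_le {x : ℝ} (h : x ≤ 1) : ramp x = 1 := by
  rw [ramp, min_eq_left (by linarith), max_eq_right zero_le_one]

theorem ramp_of_ge {x : ℝ} (h : 2 ≤ x) : ramp x = 0 := by
  rw [ramp, min_eq_right (by linarith), max_eq_left (by linarith)]

theorem abs_ramp_sub_le (x y : ℝ) : |ramp x - ramp y| ≤ |x - y| := by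
  unfold ramp
  calc _ ≤ |min 1 (2 - x) - min 1 (2 - y)| := by
        simpa using abs_max_sub_max_le_max 0 (min 1 (2 - x)) 0 (min 1 (2 - y))
    _ ≤ |(2 - x) - (2 - y)| := by
        simpa using abs_min_sub_min_le_max 1 (2 - x) 1 (2 - y)
    _ = |x - y| := by rw [abs_sub_comm]; congr 1; ring

theorem matNorm_colMatrix_le (a b : Plane) : matNorm (colMatrix a b) ≤ ‖a‖ + ‖b‖ :=
  le_of_sq_le_sq (by
    rw [matNorm_colMatrix_sq]
    nlinarith [mul_nonneg (norm_nonneg a) (norm_nonneg b)]) (by positivity)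

/-- A Lipschitz field `d` of directors transversal to the curve `z` on `[a, b]`, such that the
energy density `W` of the thickened curve is controlled by `B`, of total integral at most `E`. -/
structure DirectorField (W : Matrix (Fin 2) (Fin 2) ℝ → ENNReal) (z d : ℝ → Plane)
    (a b E L ρ κ h₀ : ℝ) (B : ℝ → ENNReal) : Prop where
  energy_nonneg : 0 ≤ E
  lipschitz_nonneg : 0 ≤ L
  scale_pos : 0 < ρ
  transversality_pos : 0 < κ
  thickness_pos : 0 < h₀
  lipschitz : ∀ t ∈ Set.Icc a b, ∀ t' ∈ Set.Icc a b, t ≤ t' → ‖d t' - d t‖ ≤ L * (t' - t)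
  transversal : ∀ t ∈ Set.Icc a b, ∀ t' ∈ Set.Icc a b, t ≤ t' → t' ≤ t + ρ →
    κ * (t' - t) ≤ cross (z t' - z t) (d t)
  energy : ∀ᵐ t ∂(volume.restrict (Set.Ioo a b)), ∀ e ∈ Set.Icc (-h₀) h₀,
    0 < cross (deriv z t + e • deriv d t) (d t) ∧
      W (colMatrix (deriv z t + e • deriv d t) (d t)) ≤ B t
  total : ∫⁻ t in Set.Ioo a b, B t ≤ ENNReal.ofReal E

/-- A perturbation of size at most `κ / (2 (D + 1))` changes the determinant by at most `κ / 2`, so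
the growth condition with `δ = κ / 2` applies. This bounds the energy where the director is merely
transversal and not optimal. -/
theorem exists_energy_bound {p : ℝ} (hp : 0 ≤ p) {W : Matrix (Fin 2) (Fin 2) ℝ → ENNReal}
    (hW : ∀ δ : ℝ, 0 < δ → ∃ C : ℝ, 0 < C ∧ ∀ F : Matrix (Fin 2) (Fin 2) ℝ, δ ≤ F.det →
      W F ≤ ENNReal.ofReal (C * (1 + matNorm F ^ p)))
    (c : Plane) {κ D : ℝ} (hκ : 0 < κ) (hD : 0 ≤ D) :
    ∃ η > 0, ∃ B₀ > 0, ∀ e d : Plane, ‖e‖ ≤ η → ‖d‖ ≤ D → κ ≤ cross c d →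
      0 < cross (c + e) d ∧ W (colMatrix (c + e) d) ≤ ENNReal.ofReal B₀ := by
  obtain ⟨C, hC, hCW⟩ := hW (κ / 2) (by linarith)
  refine ⟨min 1 (κ / (2 * (D + 1))), by positivity, C * (1 + (‖c‖ + 1 + D) ^ p), by positivity,
    fun e d he hd hc => ?_⟩
  have h1 : |cross e d| ≤ κ / 2 := by
    calc |cross e d| ≤ ‖e‖ * ‖d‖ := abs_cross_le _ _
      _ ≤ κ / (2 * (D + 1)) * (D + 1) :=
        mul_le_mul (he.trans (min_le_right _ _)) (by linarith) (norm_nonneg _) (by positivity)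
      _ = κ / 2 := by field_simp
  have h2 : κ / 2 ≤ cross (c + e) d := by
    rw [cross_add_left]
    linarith [(abs_le.1 h1).1]
  refine ⟨by linarith, (hCW _ (by rwa [det_colMatrix])).trans (ENNReal.ofReal_le_ofReal ?_)⟩
  have h3 : matNorm (colMatrix (c + e) d) ≤ ‖c‖ + 1 + D :=
    (matNorm_colMatrix_le _ _).trans (by
      have := norm_add_le c e
      have := he.trans (min_le_left _ _)
      linarith)
  gcongr
  exact matNorm_nonneg _

/-- The director is a nearly optimal `ξ` except near the ends, where ramps lead to the prescribed
values `dA` and `dB` that allow gluing. A positive determinant with `c` is a convex condition on the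
director, so the interpolation remains transversal. -/
theorem exists_directorField_segment {p : ℝ} (hp : 0 ≤ p) {W : Matrix (Fin 2) (Fin 2) ℝ → ENNReal}
    (hW_top : ∀ F, W F = ⊤ ↔ F.det ≤ 0)
    (hW : ∀ δ : ℝ, 0 < δ → ∃ C : ℝ, 0 < C ∧ ∀ F : Matrix (Fin 2) (Fin 2) ℝ, δ ≤ F.det →
      W F ≤ ENNReal.ofReal (C * (1 + matNorm F ^ p)))
    {z : ℝ → Plane} {a b : ℝ} {c : Plane} (hab : a < b)
    (hz : ∀ t ∈ Set.Icc a b, z t = z a + (t - a) • c) (hc : c ≠ 0) {ε : ℝ} (hε : 0 < ε)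
    {dA dB : Plane} (hA : 0 < cross c dA) (hB : 0 < cross c dB) :
    ∃ d L ρ κ h₀ B, DirectorField W z d a b ((b - a) * (reducedDensity W c).toReal + ε) L ρ κ h₀ B ∧
      (∀ t ∈ Set.Icc a (a + ρ), d t = dA) ∧ ∀ t ∈ Set.Icc (b - ρ) b, d t = dB := by
  have hba : 0 < b - a := sub_pos.2 hab
  obtain ⟨ξ, hξ, hWξ⟩ := exists_director hW_top hc (ε := ε / (2 * (b - a))) (by positivity)
  set f₀ := (reducedDensity W c).toReal
  have hf₀ : 0 ≤ f₀ := ENNReal.toReal_nonneg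
  set κ := min (cross c ξ) (min (cross c dA) (cross c dB)) with hκ
  have hκ0 : 0 < κ := by positivity
  have hκ1 : κ ≤ cross c ξ := min_le_left _ _
  have hκ2 : κ ≤ cross c dA := (min_le_right _ _).trans (min_le_left _ _)
  have hκ3 : κ ≤ cross c dB := (min_le_right _ _).trans (min_le_right _ _)
  set D := max ‖ξ‖ (max ‖dA‖ ‖dB‖)
  have hD : 0 ≤ D := le_max_of_le_left (norm_nonneg _)
  have hD1 : ‖ξ‖ ≤ D := le_max_left _ _
  have hD2 : ‖dA‖ ≤ D := (le_max_left _ _).trans (le_max_right _ _)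
  have hD3 : ‖dB‖ ≤ D := (le_max_right _ _).trans (le_max_right _ _)
  obtain ⟨η, hη, B₀, hB₀, hbd⟩ := exists_energy_bound hp hW c hκ0 hD
  -- Each transition has length `2θ`: the first bound keeps the two apart, the second limits their
  -- total cost `4θ B₀` to `ε / 2`. The other half of `ε` pays for `ξ` being only nearly optimal.
  set θ := min ((b - a) / 4) (ε / (8 * B₀))
  have hθ : 0 < θ := by positivity
  have hθ1 : 4 * θ ≤ b - a := by have := min_le_left ((b - a) / 4) (ε / (8 * B₀)); linarith
  have hθ2 : 4 * θ * B₀ ≤ ε / 2 := by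
    have := min_le_right ((b - a) / 4) (ε / (8 * B₀))
    have h2 : θ * B₀ ≤ ε / (8 * B₀) * B₀ := by gcongr
    have h3 : ε / (8 * B₀) * B₀ = ε / 8 := by field_simp
    linarith
  set d : ℝ → Plane := fun t => ξ + ramp ((t - a) / θ) • (dA - ξ) + ramp ((b - t) / θ) • (dB - ξ)
  set L := (‖dA - ξ‖ + ‖dB - ξ‖) / θ
  have hL : 0 ≤ L := by positivity
  have hlip : ∀ t t', ‖d t' - d t‖ ≤ L * |t' - t| := by
    intro t t'
    have e : d t' - d t = (ramp ((t' - a) / θ) - ramp ((t - a) / θ)) • (dA - ξ) +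
        (ramp ((b - t') / θ) - ramp ((b - t) / θ)) • (dB - ξ) := by
      simp only [d]; module
    have r1 : |ramp ((t' - a) / θ) - ramp ((t - a) / θ)| ≤ |t' - t| / θ := by
      refine (abs_ramp_sub_le _ _).trans (le_of_eq ?_)
      rw [← sub_div, sub_sub_sub_cancel_right, abs_div, abs_of_pos hθ]
    have r2 : |ramp ((b - t') / θ) - ramp ((b - t) / θ)| ≤ |t' - t| / θ := by
      refine (abs_ramp_sub_le _ _).trans (le_of_eq ?_)
      rw [← sub_div, sub_sub_sub_cancel_left, abs_div, abs_of_pos hθ, abs_sub_comm]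
    rw [e]
    refine (norm_add_le _ _).trans ?_
    rw [norm_smul, norm_smul, Real.norm_eq_abs, Real.norm_eq_abs]
    calc _ ≤ |t' - t| / θ * ‖dA - ξ‖ + |t' - t| / θ * ‖dB - ξ‖ := by gcongr
      _ = L * |t' - t| := by simp only [L]; ring
  have hdL : LipschitzWith L.toNNReal d := LipschitzWith.of_dist_le_mul fun t t' => by
    rw [dist_eq_norm, Real.dist_eq, Real.coe_toNNReal _ hL]; exact hlip t' t
  have hcvx : ∀ t ∈ Set.Icc a b, κ ≤ cross c (d t) ∧ ‖d t‖ ≤ D := by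
    intro t ht
    have hs : ramp ((t - a) / θ) + ramp ((b - t) / θ) ≤ 1 := by
      rcases le_total (2 * θ) (t - a) with h | h
      · rw [ramp_of_ge ((le_div_iff₀ hθ).2 h), zero_add]; exact ramp_le_one _
      · rw [ramp_of_ge (x := (b - t) / θ) ((le_div_iff₀ hθ).2 (by linarith)), add_zero]
        exact ramp_le_one _
    have h1 := ramp_nonneg ((t - a) / θ)
    have h2 := ramp_nonneg ((b - t) / θ)
    set r₁ := ramp ((t - a) / θ)
    set r₂ := ramp ((b - t) / θ)
    have e : d t = (1 - r₁ - r₂) • ξ + r₁ • dA + r₂ • dB := by simp only [d, r₁, r₂]; module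
    rw [e]
    constructor
    · rw [cross_add_right, cross_add_right, cross_smul_right, cross_smul_right, cross_smul_right]
      have a1 := mul_le_mul_of_nonneg_left hκ1 (by linarith : 0 ≤ 1 - r₁ - r₂)
      have a2 := mul_le_mul_of_nonneg_left hκ2 h1
      have a3 := mul_le_mul_of_nonneg_left hκ3 h2
      linarith
    · have a1 := mul_le_mul_of_nonneg_left hD1 (by linarith : 0 ≤ 1 - r₁ - r₂)
      have a2 := mul_le_mul_of_nonneg_left hD2 h1
      have a3 := mul_le_mul_of_nonneg_left hD3 h2
      calc _ ≤ ‖(1 - r₁ - r₂) • ξ‖ + ‖r₁ • dA‖ + ‖r₂ • dB‖ := norm_add₃_le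
        _ = (1 - r₁ - r₂) * ‖ξ‖ + r₁ * ‖dA‖ + r₂ * ‖dB‖ := by
          rw [norm_smul, norm_smul, norm_smul, Real.norm_of_nonneg h1, Real.norm_of_nonneg h2,
            Real.norm_of_nonneg (by linarith)]
        _ ≤ D := by linarith
  have hder : ∀ t ∈ Set.Ioo a b, deriv z t = c := by
    intro t ht
    have h1 : z =ᶠ[𝓝 t] fun t => z a + (t - a) • c := by
      filter_upwards [isOpen_Ioo.mem_nhds ht] with t' ht' using hz t' (Set.Ioo_subset_Icc_self ht')
    rw [h1.deriv_eq]
    have : HasDerivAt (fun t => z a + (t - a) • c) ((1 : ℝ) • c) t :=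
      (((hasDerivAt_id t).sub_const a).smul_const c).const_add (z a)
    simpa using this.deriv
  -- For offsets `e` up to `h₀` the term `e • d'` stays within the tolerance `η`; the `1` guards
  -- against `L = 0`.
  set h₀ := η / (L + 1)
  have hh₀ : 0 < h₀ := by positivity
  set f₁ := f₀ + ε / (2 * (b - a))
  have hf₁ : 0 ≤ f₁ := by positivity
  set S := Set.Icc a (a + 2 * θ) ∪ Set.Icc (b - 2 * θ) b
  refine ⟨d, L, θ, κ, h₀, fun t => ENNReal.ofReal f₁ + S.indicator (fun _ => ENNReal.ofReal B₀) t,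
    ⟨by positivity, hL, hθ, hκ0, hh₀, fun t ht t' ht' h => ?_, fun t ht t' ht' h h' => ?_, ?_, ?_⟩,
    fun t ht => ?_, fun t ht => ?_⟩
  · exact (hlip t t').trans_eq (by rw [abs_of_nonneg (by linarith)])
  · rw [hz t ht, hz t' ht', add_sub_add_left_eq_sub, ← sub_smul, sub_sub_sub_cancel_right,
      cross_smul_left, mul_comm]
    exact mul_le_mul_of_nonneg_left (hcvx t ht).1 (by linarith)
  · filter_upwards [ae_restrict_mem measurableSet_Ioo] with t ht e he
    obtain ⟨h1, h2⟩ := hcvx t (Set.Ioo_subset_Icc_self ht)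
    rw [hder t ht]
    have hes : ‖e • deriv d t‖ ≤ η := by
      rw [norm_smul]
      calc ‖e‖ * ‖deriv d t‖ ≤ h₀ * L := by
            refine mul_le_mul (abs_le.2 he) ?_ (norm_nonneg _) hh₀.le
            have := norm_deriv_le_of_lipschitz (x₀ := t) hdL
            rwa [Real.coe_toNNReal _ hL] at this
        _ ≤ h₀ * (L + 1) := by gcongr; linarith
        _ = η := by simp only [h₀]; field_simp
    obtain ⟨b1, b2⟩ := hbd _ _ hes h2 h1
    refine ⟨b1, ?_⟩
    by_cases hS : t ∈ S
    · rw [Set.indicator_of_mem hS]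
      exact b2.trans le_add_self
    · have hm : t ∈ Set.Ioo (a + 2 * θ) (b - 2 * θ) := by
        constructor
        · by_contra hn
          exact hS (Or.inl ⟨ht.1.le, not_lt.1 hn⟩)
        · by_contra hn
          exact hS (Or.inr ⟨not_lt.1 hn, ht.2.le⟩)
      have hdξ : ∀ t ∈ Set.Ioo (a + 2 * θ) (b - 2 * θ), d t = ξ := by
        intro t ht
        simp only [d]
        rw [ramp_of_ge ((le_div_iff₀ hθ).2 (by linarith [ht.1])),
          ramp_of_ge ((le_div_iff₀ hθ).2 (by linarith [ht.2]))]
        simp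
      have h3 : deriv d t = 0 := by
        have : d =ᶠ[𝓝 t] fun _ => ξ := by
          filter_upwards [isOpen_Ioo.mem_nhds hm] with t' ht' using hdξ t' ht'
        rw [this.deriv_eq]; simp
      rw [h3, hdξ t hm, smul_zero, add_zero]
      exact hWξ.trans le_self_add
  · have hSm : MeasurableSet S := measurableSet_Icc.union measurableSet_Icc
    calc _ = ENNReal.ofReal f₁ * ENNReal.ofReal (b - a) +
          ∫⁻ t in Set.Ioo a b, S.indicator (fun _ => ENNReal.ofReal B₀) t := by
          rw [lintegral_add_left measurable_const]; simp
      _ ≤ ENNReal.ofReal f₁ * ENNReal.ofReal (b - a) + ENNReal.ofReal B₀ * ENNReal.ofReal (4 * θ) := by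
          gcongr
          refine (setLIntegral_le_lintegral _ _).trans ?_
          rw [lintegral_indicator hSm, setLIntegral_const]
          gcongr
          refine (measure_union_le _ _).trans (le_of_eq ?_)
          rw [Real.volume_Icc, Real.volume_Icc, ← ENNReal.ofReal_add (by linarith) (by linarith)]
          congr 1; ring
      _ = ENNReal.ofReal (f₁ * (b - a) + B₀ * (4 * θ)) := by
          rw [← ENNReal.ofReal_mul hf₁, ← ENNReal.ofReal_mul hB₀.le,
            ← ENNReal.ofReal_add (by positivity) (by positivity)]
      _ ≤ _ := by
          apply ENNReal.ofReal_le_ofReal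
          have : f₁ * (b - a) = (b - a) * f₀ + ε / 2 := by simp only [f₁]; field_simp
          linarith
  · simp only [d]
    rw [ramp_of_le ((div_le_iff₀ hθ).2 (by linarith [ht.2])),
      ramp_of_ge ((le_div_iff₀ hθ).2 (by linarith [ht.2]))]
    simp
  · simp only [d]
    rw [ramp_of_ge ((le_div_iff₀ hθ).2 (by linarith [ht.1])),
      ramp_of_le ((div_le_iff₀ hθ).2 (by linarith [ht.1]))]
    simp

theorem eventuallyEq_glueAt_of_lt {α : Type*} {m t : ℝ} (z₁ z₂ : ℝ → α) (h : t < m) :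
    glueAt m z₁ z₂ =ᶠ[𝓝 t] z₁ := by
  filter_upwards [gt_mem_nhds h] with x hx using glueAt_of_le _ _ (le_of_lt hx)

theorem eventuallyEq_glueAt_of_gt {α : Type*} {m t : ℝ} (z₁ z₂ : ℝ → α) (h : m < t) :
    glueAt m z₁ z₂ =ᶠ[𝓝 t] z₂ := by
  filter_upwards [lt_mem_nhds h] with x hx using if_neg (not_le.2 hx)

/-- Across the joint, the increment of `z` is a nonnegative combination of the last velocity `cL`
and the first velocity `cF`. Just before the joint the director already has the constant value `dm`,
which is transversal to both, so the short-range estimate survives with the smallest of the four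
constants. -/
theorem DirectorField.glue {W : Matrix (Fin 2) (Fin 2) ℝ → ENNReal} {z d₁ d₂ : ℝ → Plane}
    {a m b E₁ E₂ L₁ L₂ ρ₁ ρ₂ κ₁ κ₂ h₁ h₂ ρ : ℝ} {B₁ B₂ : ℝ → ENNReal} {dm cL cF : Plane}
    (H₁ : DirectorField W z d₁ a m E₁ L₁ ρ₁ κ₁ h₁ B₁)
    (H₂ : DirectorField W z d₂ m b E₂ L₂ ρ₂ κ₂ h₂ B₂) (ham : a < m) (hmb : m < b) (hρ : 0 < ρ)
    (hρ₁ : ρ ≤ ρ₁) (hρ₂ : ρ ≤ ρ₂)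
    (hd₁ : ∀ t ∈ Set.Icc (m - ρ₁) m, d₁ t = dm) (hd₂ : d₂ m = dm)
    (hzL : ∀ t ∈ Set.Icc (m - ρ) m, z t = z m - (m - t) • cL)
    (hzF : ∀ t ∈ Set.Icc m (m + ρ), z t = z m + (t - m) • cF)
    (hcL : 0 < cross cL dm) (hcF : 0 < cross cF dm) :
    DirectorField W z (glueAt m d₁ d₂) a b (E₁ + E₂) (max L₁ L₂) ρ
      (min (min κ₁ κ₂) (min (cross cL dm) (cross cF dm))) (min h₁ h₂) (glueAt m B₁ B₂) := by
  have hd₁m : d₁ m = dm := hd₁ m ⟨by linarith [H₁.scale_pos], le_rfl⟩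
  have hdm : d₁ m = d₂ m := by rw [hd₁m, hd₂]
  have hm₁ : m ∈ Set.Icc a m := ⟨ham.le, le_rfl⟩
  have hm₂ : m ∈ Set.Icc m b := ⟨le_rfl, hmb.le⟩
  have k1 := H₁.transversality_pos
  have k2 := H₂.transversality_pos
  set κ := min (min κ₁ κ₂) (min (cross cL dm) (cross cF dm))
  have hκ1 : κ ≤ κ₁ := (min_le_left _ _).trans (min_le_left _ _)
  have hκ2 : κ ≤ κ₂ := (min_le_left _ _).trans (min_le_right _ _)
  have hκ3 : κ ≤ cross cL dm := (min_le_right _ _).trans (min_le_left _ _)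
  have hκ4 : κ ≤ cross cF dm := (min_le_right _ _).trans (min_le_right _ _)
  refine ⟨add_nonneg H₁.energy_nonneg H₂.energy_nonneg, le_max_of_le_left H₁.lipschitz_nonneg, hρ,
    by positivity, lt_min H₁.thickness_pos H₂.thickness_pos, fun t ht t' ht' h => ?_,
    fun t ht t' ht' h h' => ?_, ?_, ?_⟩
  · have m1 : ∀ x, 0 ≤ x → L₁ * x ≤ max L₁ L₂ * x := fun x hx =>
      mul_le_mul_of_nonneg_right (le_max_left _ _) hx
    have m2 : ∀ x, 0 ≤ x → L₂ * x ≤ max L₁ L₂ * x := fun x hx =>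
      mul_le_mul_of_nonneg_right (le_max_right _ _) hx
    rcases le_total t' m with h' | h'
    · rw [glueAt_of_le _ _ h', glueAt_of_le _ _ (h.trans h')]
      exact (H₁.lipschitz t ⟨ht.1, h.trans h'⟩ t' ⟨ht'.1, h'⟩ h).trans (m1 _ (by linarith))
    rcases le_total m t with h'' | h''
    · rw [glueAt_of_ge hdm h', glueAt_of_ge hdm h'']
      exact (H₂.lipschitz t ⟨h'', ht.2⟩ t' ⟨h', ht'.2⟩ h).trans (m2 _ (by linarith))
    · rw [glueAt_of_ge hdm h', glueAt_of_le _ _ h'']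
      have e1 := (H₁.lipschitz t ⟨ht.1, h''⟩ m hm₁ h'').trans (m1 _ (by linarith))
      have e2 := (H₂.lipschitz m hm₂ t' ⟨h', ht'.2⟩ h').trans (m2 _ (by linarith))
      rw [hdm] at e1
      calc ‖d₂ t' - d₁ t‖ = ‖(d₂ t' - d₂ m) + (d₂ m - d₁ t)‖ := by rw [sub_add_sub_cancel]
        _ ≤ ‖d₂ t' - d₂ m‖ + ‖d₂ m - d₁ t‖ := norm_add_le _ _
        _ ≤ _ := by linarith
  · rcases le_total t' m with h₁' | h₁'
    · rw [glueAt_of_le _ _ (h.trans h₁')]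
      exact (mul_le_mul_of_nonneg_right hκ1 (by linarith)).trans
        (H₁.transversal t ⟨ht.1, h.trans h₁'⟩ t' ⟨ht'.1, h₁'⟩ h (by linarith))
    rcases le_total m t with h'' | h''
    · rw [glueAt_of_ge hdm h'']
      exact (mul_le_mul_of_nonneg_right hκ2 (by linarith)).trans
        (H₂.transversal t ⟨h'', ht.2⟩ t' ⟨h₁', ht'.2⟩ h (by linarith))
    · rw [glueAt_of_le _ _ h'', hd₁ t ⟨by linarith, h''⟩, hzL t ⟨by linarith, h''⟩,
        hzF t' ⟨h₁', by linarith⟩]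
      have e : z m + (t' - m) • cF - (z m - (m - t) • cL) = (t' - m) • cF + (m - t) • cL := by
        abel
      rw [e, cross_add_left, cross_smul_left, cross_smul_left]
      have a1 := mul_le_mul_of_nonneg_left hκ3 (sub_nonneg.2 h'')
      have a2 := mul_le_mul_of_nonneg_left hκ4 (sub_nonneg.2 h₁')
      linarith
  · have e1 := (ae_restrict_iff' measurableSet_Ioo).1 H₁.energy
    have e2 := (ae_restrict_iff' measurableSet_Ioo).1 H₂.energy
    have e3 : ∀ᵐ t : ℝ, t ≠ m := by
      rw [ae_iff]; simp
    filter_upwards [ae_restrict_of_ae e1, ae_restrict_of_ae e2, ae_restrict_of_ae e3,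
      ae_restrict_mem measurableSet_Ioo] with t h1 h2 h3 ht e he
    rcases lt_or_gt_of_ne h3 with h | h
    · rw [(eventuallyEq_glueAt_of_lt d₁ d₂ h).deriv_eq, glueAt_of_le _ _ h.le,
        glueAt_of_le _ _ h.le]
      exact h1 ⟨ht.1, h⟩ e ⟨by linarith [he.1, min_le_left h₁ h₂], he.2.trans (min_le_left _ _)⟩
    · rw [(eventuallyEq_glueAt_of_gt d₁ d₂ h).deriv_eq, glueAt, glueAt, if_neg (not_le.2 h),
        if_neg (not_le.2 h)]
      exact h2 ⟨h, ht.2⟩ e ⟨by linarith [he.1, min_le_right h₁ h₂], he.2.trans (min_le_right _ _)⟩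
  · have hU : Set.Ioo a b ⊆ Set.Ioc a m ∪ Set.Ioo m b := fun t ht =>
      (le_or_gt t m).imp (fun h => ⟨ht.1, h⟩) fun h => ⟨h, ht.2⟩
    calc _ ≤ ∫⁻ t in Set.Ioc a m ∪ Set.Ioo m b, glueAt m B₁ B₂ t := lintegral_mono_set hU
      _ ≤ (∫⁻ t in Set.Ioc a m, glueAt m B₁ B₂ t) + ∫⁻ t in Set.Ioo m b, glueAt m B₁ B₂ t :=
        lintegral_union_le _ _ _
      _ = (∫⁻ t in Set.Ioo a m, B₁ t) + ∫⁻ t in Set.Ioo m b, B₂ t := by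
        rw [restrict_Ioo_eq_restrict_Ioc (a := a) (b := m)]
        congr 1
        · exact setLIntegral_congr_fun measurableSet_Ioc fun t ht => glueAt_of_le _ _ ht.2
        · exact setLIntegral_congr_fun measurableSet_Ioo fun t ht => if_neg (not_le.2 ht.1)
      _ ≤ ENNReal.ofReal E₁ + ENNReal.ofReal E₂ := add_le_add H₁.total H₂.total
      _ = _ := (ENNReal.ofReal_add H₁.energy_nonneg H₂.energy_nonneg).symm

/-- An injective polygon admits directors with nearly optimal energy. -/
theorem PolygonCost.exists_directorField {p : ℝ} (hp : 0 ≤ p)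
    {W : Matrix (Fin 2) (Fin 2) ℝ → ENNReal} (hW_top : ∀ F, W F = ⊤ ↔ F.det ≤ 0)
    (hW : ∀ δ : ℝ, 0 < δ → ∃ C : ℝ, 0 < C ∧ ∀ F : Matrix (Fin 2) (Fin 2) ℝ, δ ≤ F.det →
      W F ≤ ENNReal.ofReal (C * (1 + matNorm F ^ p)))
    {z : ℝ → Plane} {a b E : ℝ}
    (h : PolygonCost (fun c r => c ≠ 0 ∧ r = (reducedDensity W c).toReal) z a b E)
    (hz : Set.InjOn z (Set.Icc a b)) :
    ∃ cF cL : Plane, ∃ ρ > 0, ρ ≤ b - a ∧ cF ≠ 0 ∧ cL ≠ 0 ∧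
      (∀ t ∈ Set.Icc a (a + ρ), z t = z a + (t - a) • cF) ∧
      (∀ t ∈ Set.Icc (b - ρ) b, z t = z b - (b - t) • cL) ∧
      ∀ dA dB : Plane, 0 < cross cF dA → 0 < cross cL dB → ∀ ε > 0,
        ∃ d L ρ κ h₀ B, DirectorField W z d a b (E + ε) L ρ κ h₀ B ∧
          (∀ t ∈ Set.Icc a (a + ρ), d t = dA) ∧ ∀ t ∈ Set.Icc (b - ρ) b, d t = dB := by
  -- The first and last velocities are exposed, and the end directors are left free, so that two
  -- polygons can be joined through a director chosen at their common vertex.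
  induction h with
  | @segment a b c r hab hs hr =>
    obtain ⟨hc, rfl⟩ := hr
    refine ⟨c, c, b - a, by linarith, le_rfl, hc, hc, fun t ht => hs t (by simpa using ht),
      fun t ht => ?_, fun dA dB hA hB ε hε =>
        exists_directorField_segment hp hW_top hW hab hs hc hε hA hB⟩
    rw [sub_sub_cancel] at ht
    rw [hs t ht, hs b ⟨hab.le, le_rfl⟩]
    module
  | @append a m b E₁ E₂ h1 h2 i1 i2 =>
    have ham := h1.lt
    have hmb := h2.lt
    obtain ⟨cF, c₁, ρ₁, hρ₁, hρ₁', hcF, hc₁, zF, z₁, D₁⟩ :=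
      i1 (hz.mono (Set.Icc_subset_Icc le_rfl hmb.le))
    obtain ⟨c₂, cL, ρ₂, hρ₂, hρ₂', hc₂, hcL, z₂, zL, D₂⟩ :=
      i2 (hz.mono (Set.Icc_subset_Icc ham.le le_rfl))
    refine ⟨cF, cL, min ρ₁ ρ₂, lt_min hρ₁ hρ₂, (min_le_left _ _).trans (by linarith), hcF, hcL,
      fun t ht => zF t ⟨ht.1, ht.2.trans (by gcongr; exact min_le_left _ _)⟩,
      fun t ht => zL t ⟨le_trans (by gcongr; exact min_le_right _ _) ht.1, ht.2⟩,
      fun dA dB hA hB ε hε => ?_⟩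
    -- Opposite velocities would make the curve retrace itself: the points at times `m - r x` and `m
    -- + x` would coincide, with `x` small enough for both times to lie in the adjacent affine
    -- pieces.
    obtain ⟨dm, hm1, hm2⟩ : ∃ d : Plane, 0 < cross c₁ d ∧ 0 < cross c₂ d := by
      refine exists_common_director hc₁ hc₂ fun r hr he => ?_
      set x := min (ρ₁ / r) ρ₂
      have hx : 0 < x := by positivity
      have hx1 : r * x ≤ ρ₁ := by
        have : x ≤ ρ₁ / r := min_le_left _ _
        rwa [le_div_iff₀ hr, mul_comm] at this
      have hx2 : x ≤ ρ₂ := min_le_right _ _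
      have hrx : 0 < r * x := by positivity
      have e1 := z₁ (m - r * x) ⟨by linarith, by linarith⟩
      have e2 := z₂ (m + x) ⟨by linarith, by linarith⟩
      have e3 : z (m - r * x) = z (m + x) := by
        rw [e1, e2, he]; module
      have := hz ⟨by linarith, by linarith⟩ ⟨by linarith, by linarith⟩ e3
      linarith
    obtain ⟨d₁, L₁, s₁, κ₁, t₁, B₁, H₁, dA₁, dm₁⟩ := D₁ dA dm hA hm1 (ε / 2) (by linarith)
    obtain ⟨d₂, L₂, s₂, κ₂, t₂, B₂, H₂, dm₂, dB₂⟩ := D₂ dm dB hm2 hB (ε / 2) (by linarith)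
    have hs₁ := H₁.scale_pos
    have hs₂ := H₂.scale_pos
    set ρ := min (min ρ₁ ρ₂) (min s₁ s₂)
    have hρ : 0 < ρ := by positivity
    have r1 : ρ ≤ ρ₁ := (min_le_left _ _).trans (min_le_left _ _)
    have r2 : ρ ≤ ρ₂ := (min_le_left _ _).trans (min_le_right _ _)
    have r3 : ρ ≤ s₁ := (min_le_right _ _).trans (min_le_left _ _)
    have r4 : ρ ≤ s₂ := (min_le_right _ _).trans (min_le_right _ _)
    have hd2 : d₂ m = dm := dm₂ m ⟨le_rfl, by linarith⟩
    have hd1 : d₁ m = d₂ m := by rw [hd2]; exact dm₁ m ⟨by linarith, le_rfl⟩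
    have key := H₁.glue H₂ ham hmb hρ r3 r4 dm₁ hd2
      (fun t ht => z₁ t ⟨by linarith [ht.1], ht.2⟩) (fun t ht => z₂ t ⟨ht.1, by linarith [ht.2]⟩) hm1 hm2
    refine ⟨_, _, _, _, _, _, (by convert key using 1; ring), fun t ht => ?_, fun t ht => ?_⟩
    · rw [glueAt_of_le _ _ (by linarith [ht.2])]
      exact dA₁ t ⟨ht.1, by linarith [ht.2]⟩
    · rw [glueAt_of_ge hd1 (by linarith [ht.1])]
      exact dB₂ t ⟨by linarith [ht.1], ht.2⟩

/-! ### Thickening a polygon -/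

/-- Quantitative injectivity of an injective curve on a compact interval. -/
theorem exists_separation {z : ℝ → Plane} {a b : ℝ} (hzc : ContinuousOn z (Set.Icc a b))
    (hz : Set.InjOn z (Set.Icc a b)) {δ : ℝ} (hδ : 0 < δ) :
    ∃ m > 0, ∀ t ∈ Set.Icc a b, ∀ t' ∈ Set.Icc a b, t + δ ≤ t' → m ≤ ‖z t' - z t‖ := by
  set K : Set (ℝ × ℝ) := (Set.Icc a b ×ˢ Set.Icc a b) ∩ {x | x.1 + δ ≤ x.2}
  have hK : IsCompact K := (isCompact_Icc.prod isCompact_Icc).inter_right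
    (isClosed_le (by fun_prop) (by fun_prop))
  have hc : ContinuousOn (fun x : ℝ × ℝ => ‖z x.2 - z x.1‖) K :=
    ((hzc.comp continuousOn_snd fun x hx => hx.1.2).sub
      (hzc.comp continuousOn_fst fun x hx => hx.1.1)).norm
  rcases K.eq_empty_or_nonempty with h | h
  · refine ⟨1, one_pos, fun t ht t' ht' htt => ?_⟩
    have : (t, t') ∈ K := ⟨⟨ht, ht'⟩, htt⟩
    rw [h] at this
    exact absurd this (Set.notMem_empty _)
  · obtain ⟨x, hx, hmin⟩ := hK.exists_isMinOn h hc
    refine ⟨‖z x.2 - z x.1‖, norm_pos_iff.2 (sub_ne_zero.2 fun he => ?_),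
      fun t ht t' ht' htt => isMinOn_iff.1 hmin (t, t') ⟨⟨ht, ht'⟩, htt⟩⟩
    have h1 := hz hx.1.2 hx.1.1 he
    have h2 : x.1 + δ ≤ x.2 := hx.2
    linarith

/-- A continuous injection of the compact closed rectangle is an embedding. This is why injectivity
is established up to the boundary. -/
theorem isEmbedding_domRestrict_of_injOn {u : ℝ × ℝ → Plane} (hu : Continuous u)
    (h : Set.InjOn u (Set.Icc (0 : ℝ) 1 ×ˢ Set.Icc (-(1 / 2) : ℝ) (1 / 2))) :
    IsEmbedding (bulkDomain.domRestrict u) := by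
  set K := Set.Icc (0 : ℝ) 1 ×ˢ Set.Icc (-(1 / 2) : ℝ) (1 / 2)
  have hK : IsCompact K := isCompact_Icc.prod isCompact_Icc
  have hsub : bulkDomain ⊆ K := Set.prod_mono Set.Ioo_subset_Icc_self Set.Ioo_subset_Icc_self
  have := isCompact_iff_compactSpace.1 hK
  have hemb : IsClosedEmbedding (K.domRestrict u) :=
    Continuous.isClosedEmbedding (hu.comp continuous_subtype_val) fun x y hxy =>
      Subtype.ext (h x.2 y.2 hxy)
  exact hemb.isEmbedding.comp (IsEmbedding.inclusion hsub)

/-- The projection of the real line onto `[a, b]`. -/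
noncomputable def clampTo (a b t : ℝ) : ℝ := max a (min b t)

theorem clampTo_mem {a b : ℝ} (hab : a ≤ b) (t : ℝ) : clampTo a b t ∈ Set.Icc a b :=
  ⟨le_max_left _ _, max_le hab (min_le_left _ _)⟩

theorem clampTo_of_mem {a b t : ℝ} (ht : t ∈ Set.Icc a b) : clampTo a b t = t := by
  rw [clampTo, min_eq_right ht.2, max_eq_right ht.1]

theorem abs_clampTo_sub_le (a b x y : ℝ) : |clampTo a b x - clampTo a b y| ≤ |x - y| := by
  unfold clampTo
  calc _ ≤ |min b x - min b y| := by
        simpa using abs_max_sub_max_le_max a (min b x) a (min b y)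
    _ ≤ |x - y| := by simpa using abs_min_sub_min_le_max b x b y

theorem norm_comp_clampTo_sub_le {z : ℝ → Plane} {a b C : ℝ} (hab : a ≤ b) (hC : 0 ≤ C)
    (hz : ∀ t ∈ Set.Icc a b, ∀ t' ∈ Set.Icc a b, t ≤ t' → ‖z t' - z t‖ ≤ C * (t' - t)) (t t' : ℝ) :
    ‖z (clampTo a b t) - z (clampTo a b t')‖ ≤ C * |t - t'| := by
  refine le_trans ?_ (mul_le_mul_of_nonneg_left (abs_clampTo_sub_le a b t t') hC)
  rcases le_total (clampTo a b t) (clampTo a b t') with h | h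
  · rw [norm_sub_rev, abs_sub_comm, abs_of_nonneg (by linarith)]
    exact hz _ (clampTo_mem hab t) _ (clampTo_mem hab t') h
  · rw [abs_of_nonneg (by linarith)]
    exact hz _ (clampTo_mem hab t') _ (clampTo_mem hab t) h

/-- The deformation is `z(t) + h s d(t)`; rescaling its vertical derivative by `h⁻¹` restores the
director, so the energy is controlled by the density `B`. The polygon extends beyond time `1`, and
only its restriction to the unit interval is thickened. -/
theorem exists_thickening {p : ℝ} (hp : 1 ≤ p)
    {W : Matrix (Fin 2) (Fin 2) ℝ → ENNReal} (hW_top : ∀ F, W F = ⊤ ↔ F.det ≤ 0)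
    (hW : ∀ δ : ℝ, 0 < δ → ∃ C : ℝ, 0 < C ∧ ∀ F : Matrix (Fin 2) (Fin 2) ℝ, δ ≤ F.det →
      W F ≤ ENNReal.ofReal (C * (1 + matNorm F ^ p)))
    {z : ℝ → Plane} {b E : ℝ} (hb : 1 < b)
    (h : PolygonCost (fun c r => c ≠ 0 ∧ r = (reducedDensity W c).toReal) z 0 b E)
    (hz : Set.InjOn z (Set.Icc 0 b)) {ε : ℝ} (hε : 0 < ε) :
    ∃ h₁ > 0, ∀ h ∈ Set.Ioo 0 h₁, ∃ y : SobolevMap p bulkDomain,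
      bulkEnergy W h y ≤ ENNReal.ofReal (E + ε) ∧
      ∀ t ∈ Set.Ioo (0 : ℝ) 1, ‖crossAverage y.toFun t - z t‖ ≤ ε := by
  obtain ⟨C, hC, hzC⟩ := h.exists_lipschitz
  have hzc := h.continuousOn
  obtain ⟨cF, cL, -, -, -, hcF, hcL, -, -, hD⟩ := h.exists_directorField (by linarith) hW_top hW hz
  obtain ⟨d, L, ρ, κ, h₀, B, H, -, -⟩ := hD (rot cF) (rot cL)
    (by rw [cross_rot_self]; positivity) (by rw [cross_rot_self]; positivity) ε hε
  have hb0 : (0 : ℝ) ≤ b := by linarith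
  have hL := H.lipschitz_nonneg
  have hκ := H.transversality_pos
  have hh₀ := H.thickness_pos
  set D := ‖d 0‖ + L * b
  have hD0 : 0 ≤ D := by positivity
  have hdD : ∀ t ∈ Set.Icc 0 b, ‖d t‖ ≤ D := fun t ht => by
    have h1 := H.lipschitz 0 ⟨le_rfl, hb0⟩ t ht ht.1
    have h2 : L * (t - 0) ≤ L * b := by gcongr; linarith [ht.2]
    have h3 := norm_le_norm_add_norm_sub' (d t) (d 0)
    linarith
  obtain ⟨m, hm, hsep⟩ := exists_separation hzc hz H.scale_pos
  -- The four bounds serve, in order, the energy estimate, injectivity at long range, injectivity at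
  -- short range, and closeness of the averages to `z`.
  refine ⟨min (min h₀ (m / (D + 1))) (min (κ / (L * D + 1)) (ε / (D + 1))), by positivity,
    fun h hh => ?_⟩
  have hpos : 0 < h := hh.1
  have h1 : h < h₀ := hh.2.trans_le ((min_le_left _ _).trans (min_le_left _ _))
  have h2 : h * (D + 1) < m := (lt_div_iff₀ (by positivity)).1
    (hh.2.trans_le ((min_le_left _ _).trans (min_le_right _ _)))
  have h3 : h * (L * D + 1) < κ := (lt_div_iff₀ (by positivity)).1
    (hh.2.trans_le ((min_le_right _ _).trans (min_le_left _ _)))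
  have h4 : h * (D + 1) < ε := (lt_div_iff₀ (by positivity)).1
    (hh.2.trans_le ((min_le_right _ _).trans (min_le_right _ _)))
  -- Clamping both coordinates gives a map which is Lipschitz on the whole plane, as `toSobolevMap`
  -- requires; on the bulk it changes nothing.
  set Z : ℝ → Plane := fun t => z (clampTo 0 b t)
  set N : ℝ → Plane := fun t => d (clampTo 0 b t)
  set σ : ℝ → ℝ := clampTo (-(1 / 2)) (1 / 2)
  have hZl := norm_comp_clampTo_sub_le hb0 hC hzC
  have hNl := norm_comp_clampTo_sub_le hb0 hL H.lipschitz
  have hND : ∀ t, ‖N t‖ ≤ D := fun t => hdD _ (clampTo_mem hb0 t)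
  have hσ : ∀ s, |σ s| ≤ 1 / 2 := fun s => abs_le.2 (clampTo_mem (by norm_num) s)
  set u : ℝ × ℝ → Plane := fun x => Z x.1 + (h * σ x.2) • N x.1
  have hu : LipschitzWith (C + h * (D + L)).toNNReal u := by
    refine LipschitzWith.of_dist_le_mul fun x x' => ?_
    rw [Real.coe_toNNReal _ (by positivity), dist_eq_norm]
    have e : u x - u x' = (Z x.1 - Z x'.1) + ((h * (σ x.2 - σ x'.2)) • N x.1 +
        (h * σ x'.2) • (N x.1 - N x'.1)) := by
      simp only [u]; module
    have b1 : |x.1 - x'.1| ≤ dist x x' := by rw [← Real.dist_eq]; exact le_max_left _ _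
    have b2 : |σ x.2 - σ x'.2| ≤ dist x x' := by
      refine (abs_clampTo_sub_le _ _ _ _).trans ?_
      rw [← Real.dist_eq]; exact le_max_right _ _
    have c1 : ‖Z x.1 - Z x'.1‖ ≤ C * dist x x' := (hZl _ _).trans (by gcongr)
    have c2 : ‖(h * (σ x.2 - σ x'.2)) • N x.1‖ ≤ h * dist x x' * D := by
      rw [norm_smul, norm_mul, Real.norm_of_nonneg hpos.le, Real.norm_eq_abs]
      gcongr
      exact hND _
    have c3 : ‖(h * σ x'.2) • (N x.1 - N x'.1)‖ ≤ h * 1 * (L * dist x x') := by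
      rw [norm_smul, norm_mul, Real.norm_of_nonneg hpos.le, Real.norm_eq_abs]
      gcongr
      · linarith [hσ x'.2]
      · exact (hNl _ _).trans (by gcongr)
    rw [e]
    calc _ ≤ ‖Z x.1 - Z x'.1‖ + (‖(h * (σ x.2 - σ x'.2)) • N x.1‖ +
          ‖(h * σ x'.2) • (N x.1 - N x'.1)‖) := (norm_add_le _ _).trans (by gcongr; exact norm_add_le _ _)
      _ ≤ C * dist x x' + (h * dist x x' * D + h * 1 * (L * dist x x')) := by gcongr
      _ = _ := by ring
  have hinj : Set.InjOn u (Set.Icc (0 : ℝ) 1 ×ˢ Set.Icc (-(1 / 2) : ℝ) (1 / 2)) := by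
    have core : ∀ t s t' s' : ℝ, t ∈ Set.Icc (0 : ℝ) 1 → t' ∈ Set.Icc (0 : ℝ) 1 →
        u (t, s) = u (t', s') → ¬ t < t' := by
      intro t s t' s' ht ht' he hlt
      have htb : t ∈ Set.Icc 0 b := ⟨ht.1, by linarith [ht.2]⟩
      have htb' : t' ∈ Set.Icc 0 b := ⟨ht'.1, by linarith [ht'.2]⟩
      simp only [u, Z, N, clampTo_of_mem htb, clampTo_of_mem htb'] at he
      have e1 : z t' - z t = (h * σ s) • d t - (h * σ s') • d t' := by
        rw [sub_eq_sub_iff_add_eq_add, ← he, add_comm]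
      -- At short range the determinant with `d t` removes the displacement along `d t`; what
      -- remains is `O(h (t' - t))`, too small against `κ (t' - t)`. At long range the two
      -- transversal displacements together are smaller than the separation `m`.
      rcases le_total t' (t + ρ) with hc | hc
      · have k1 := H.transversal t htb t' htb' hlt.le hc
        have e2 : z t' - z t = (h * (σ s - σ s')) • d t - (h * σ s') • (d t' - d t) := by
          rw [e1]; module
        rw [e2, cross_sub_left, cross_smul_left, cross_same, mul_zero, zero_sub, cross_smul_left] at k1
        have k2 : |h * σ s' * cross (d t' - d t) (d t)| ≤ h * 1 * (L * (t' - t) * D) := by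
          rw [abs_mul, abs_mul, abs_of_pos hpos]
          gcongr
          · linarith [hσ s']
          · refine (abs_cross_le _ _).trans ?_
            have l1 := H.lipschitz t htb t' htb' hlt.le
            have l2 := hdD t htb
            have l3 : 0 ≤ L * (t' - t) := mul_nonneg hL (by linarith)
            gcongr
        have k3 := (abs_le.1 k2).1
        have k4 : h * 1 * (L * (t' - t) * D) < κ * (t' - t) := by
          have : 0 < t' - t := by linarith
          calc h * 1 * (L * (t' - t) * D) = h * (L * D) * (t' - t) := by ring
            _ < κ * (t' - t) := by gcongr; nlinarith
        linarith
      · have k1 := hsep t htb t' htb' hc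
        rw [e1] at k1
        have k2 : ‖(h * σ s) • d t - (h * σ s') • d t'‖ ≤ h * (1 / 2) * D + h * (1 / 2) * D := by
          refine (norm_sub_le _ _).trans ?_
          rw [norm_smul, norm_smul, norm_mul, norm_mul, Real.norm_of_nonneg hpos.le,
            Real.norm_eq_abs, Real.norm_eq_abs]
          gcongr
          · exact hσ s
          · exact hdD t htb
          · exact hσ s'
          · exact hdD t' htb'
        nlinarith
    rintro ⟨t, s⟩ ⟨ht, hs⟩ ⟨t', s'⟩ ⟨ht', hs'⟩ he
    have ht_eq : t = t' := le_antisymm (not_lt.1 (core t' s' t s ht' ht he.symm))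
      (not_lt.1 (core t s t' s' ht ht' he))
    subst ht_eq
    have htb : t ∈ Set.Icc 0 b := ⟨ht.1, by linarith [ht.2]⟩
    -- Because `b > 1`, every `t` of the closed unit interval has a later time to test
    -- transversality with.
    have hd0 : d t ≠ 0 := by
      intro h0
      set t' := min b (t + ρ)
      have hρ := H.scale_pos
      have l1 : t < t' := lt_min (by linarith [ht.2]) (by linarith)
      have := H.transversal t htb t' ⟨by linarith [htb.1], min_le_left _ _⟩ l1.le (min_le_right _ _)
      rw [h0] at this
      have e0 : cross (z t' - z t) 0 = 0 := by simp [cross]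
      rw [e0] at this
      have : 0 < κ * (t' - t) := mul_pos hκ (by linarith)
      linarith
    simp only [u, N, clampTo_of_mem htb, add_right_inj, σ] at he
    rw [clampTo_of_mem hs, clampTo_of_mem hs'] at he
    have := smul_left_injective ℝ hd0 he
    rw [mul_right_inj' hpos.ne'] at this
    exact congrArg (Prod.mk t) this
  have hclamp : ∀ t ∈ Set.Ioo (0 : ℝ) 1, clampTo 0 b =ᶠ[𝓝 t] id := fun t ht => by
    filter_upwards [isOpen_Ioo.mem_nhds ht] with t' ht'
    exact clampTo_of_mem ⟨ht'.1.le, by linarith [ht'.2]⟩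
  have hZz : ∀ t ∈ Set.Ioo (0 : ℝ) 1, Z =ᶠ[𝓝 t] z := fun t ht =>
    (hclamp t ht).fun_comp z
  have hNd : ∀ t ∈ Set.Ioo (0 : ℝ) 1, N =ᶠ[𝓝 t] d := fun t ht =>
    (hclamp t ht).fun_comp d
  have hZdiff : ∀ᵐ t : ℝ, DifferentiableAt ℝ Z t :=
    LipschitzWith.ae_differentiableAt (C := C.toNNReal) (LipschitzWith.of_dist_le_mul fun t t' => by
      rw [Real.coe_toNNReal _ hC, dist_eq_norm, Real.dist_eq]; exact hZl t t')
  have hNdiff : ∀ᵐ t : ℝ, DifferentiableAt ℝ N t :=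
    LipschitzWith.ae_differentiableAt (C := L.toNNReal) (LipschitzWith.of_dist_le_mul fun t t' => by
      rw [Real.coe_toNNReal _ hL, dist_eq_norm, Real.dist_eq]; exact hNl t t')
  have hae1 : ∀ᵐ t ∂(volume.restrict rodDomain), DifferentiableAt ℝ Z t ∧ DifferentiableAt ℝ N t ∧
      ∀ e ∈ Set.Icc (-h₀) h₀, 0 < cross (deriv z t + e • deriv d t) (d t) ∧
        W (colMatrix (deriv z t + e • deriv d t) (d t)) ≤ B t :=
    (ae_restrict_of_ae hZdiff).and ((ae_restrict_of_ae hNdiff).and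
      (ae_restrict_of_ae_restrict_of_subset (Set.Ioo_subset_Ioo le_rfl hb.le) H.energy))
  have hgrad : ∀ᵐ x ∂(volume.restrict bulkDomain),
      fderiv ℝ u x (1, 0) = deriv z x.1 + (h * x.2) • deriv d x.1 ∧
      fderiv ℝ u x (0, 1) = h • d x.1 ∧ 0 < cross (deriv z x.1 + (h * x.2) • deriv d x.1) (d x.1) ∧
      W (colMatrix (deriv z x.1 + (h * x.2) • deriv d x.1) (d x.1)) ≤ B x.1 := by
    filter_upwards [measurePreserving_fst_bulkDomain.quasiMeasurePreserving.ae hae1,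
      ae_restrict_mem measurableSet_bulkDomain] with x hx hxm
    obtain ⟨hx1, hx2, hx3⟩ := hx
    have hue : u =ᶠ[𝓝 x] fun x => Z x.1 + (h * x.2) • N x.1 := by
      filter_upwards [isOpen_bulkDomain.mem_nhds hxm] with x' hx'
      simp only [u, σ]
      rw [clampTo_of_mem (Set.Ioo_subset_Icc_self hx'.2)]
    have f1 : HasFDerivAt (fun x : ℝ × ℝ => Z x.1) _ x :=
      hx1.hasDerivAt.hasFDerivAt.comp x hasFDerivAt_fst
    have f2 : HasFDerivAt (fun x : ℝ × ℝ => N x.1) _ x :=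
      hx2.hasDerivAt.hasFDerivAt.comp x hasFDerivAt_fst
    have f3 : HasFDerivAt (fun x : ℝ × ℝ => h * x.2) (h • ContinuousLinearMap.snd ℝ ℝ ℝ) x :=
      hasFDerivAt_snd.const_mul h
    have f4 := (f1.add (f3.smul f2)).congr_of_eventuallyEq hue
    have hzd : deriv Z x.1 = deriv z x.1 := (hZz x.1 hxm.1).deriv_eq
    have hnd : deriv N x.1 = deriv d x.1 := (hNd x.1 hxm.1).deriv_eq
    have hnv : N x.1 = d x.1 := (hNd x.1 hxm.1).eq_of_nhds
    rw [f4.fderiv, ← hzd, ← hnd, ← hnv]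
    refine ⟨by simp, by simp, ?_⟩
    rw [hzd, hnd, hnv]
    refine hx3 (h * x.2) (abs_le.1 ?_)
    rw [abs_mul, abs_of_pos hpos]
    have : |x.2| ≤ 1 := by
      rw [abs_le]; constructor <;> linarith [hxm.2.1, hxm.2.2]
    nlinarith [abs_nonneg x.2]
  refine ⟨hu.toSobolevMap p, ?_, fun t ht => ?_⟩
  · have hadm : Admissible (hu.toSobolevMap p) := by
      refine ⟨⟨u, EventuallyEq.rfl, isEmbedding_domRestrict_of_injOn hu.continuous hinj⟩, ?_⟩
      filter_upwards [hgrad] with x hx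
      obtain ⟨g1, g2, g3, -⟩ := hx
      change 0 < (colMatrix (fderiv ℝ u x (1, 0)) ((1 : ℝ)⁻¹ • fderiv ℝ u x (0, 1))).det
      rw [det_colMatrix, g1, g2, cross_smul_right, cross_smul_right]
      positivity
    rw [bulkEnergy, if_pos hadm]
    calc ∫⁻ x in bulkDomain, W (scaledGrad h (hu.toSobolevMap p) x)
        ≤ ∫⁻ x in bulkDomain, B x.1 := by
          refine lintegral_mono_ae ?_
          filter_upwards [hgrad] with x hx
          obtain ⟨g1, g2, -, g4⟩ := hx
          change W (colMatrix (fderiv ℝ u x (1, 0)) (h⁻¹ • fderiv ℝ u x (0, 1))) ≤ B x.1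
          rw [g1, g2, smul_smul, inv_mul_cancel₀ hpos.ne', one_smul]
          exact g4
      _ ≤ ∫⁻ t in rodDomain, ∫⁻ s in Set.Ioo (-(1 / 2) : ℝ) (1 / 2), B t := by
          rw [volume_restrict_bulkDomain]
          exact lintegral_prod_le _
      _ = ∫⁻ t in Set.Ioo 0 1, B t := by
          simp only [lintegral_const, measure_univ, mul_one]; rfl
      _ ≤ ∫⁻ t in Set.Ioo 0 b, B t := lintegral_mono_set (Set.Ioo_subset_Ioo le_rfl hb.le)
      _ ≤ _ := H.total
  · have hint : IntegrableOn (fun s => u (t, s)) (Set.Ioo (-(1 / 2) : ℝ) (1 / 2)) :=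
      ((hu.continuous.comp (by fun_prop : Continuous fun s : ℝ => (t, s))).integrableOn_Icc
        (a := -(1 / 2)) (b := 1 / 2)).mono_set Set.Ioo_subset_Icc_self
    have e : crossAverage u t - z t = ∫ s in Set.Ioo (-(1 / 2) : ℝ) (1 / 2), (u (t, s) - z t) := by
      rw [integral_sub hint (integrable_const _), crossAverage, integral_const, probReal_univ,
        one_smul]
    change ‖crossAverage u t - z t‖ ≤ ε
    have hZt : Z t = z t := (hZz t ht).eq_of_nhds
    rw [e]
    refine (norm_setIntegral_le_of_norm_le_const (C := h * (1 / 2) * D)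
      (by rw [Real.volume_Ioo]; exact ENNReal.ofReal_lt_top) fun s hs => ?_).trans ?_
    · simp only [u, hZt, add_sub_cancel_left]
      rw [norm_smul, norm_mul, Real.norm_of_nonneg hpos.le, Real.norm_eq_abs]
      gcongr
      · exact hσ s
      · exact hND t
    · rw [measureReal_def, Real.volume_Ioo]
      norm_num
      nlinarith

/-! ### Laminates and zigzags -/

/-- The costs `r` of the velocity `v` which are obtained from `f` by at most `n` successive
splittings of velocities, without ever passing through the velocity `0`. -/
def Laminate (f : Plane → ℝ) : ℕ → Plane → ℝ → Prop
  | 0, v, r => v ≠ 0 ∧ r = f v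
  | n + 1, v, r => Laminate f n v r ∨ ∃ (v₁ v₂ : Plane) (s r₁ r₂ : ℝ), 0 < s ∧ s < 1 ∧
      v = s • v₁ + (1 - s) • v₂ ∧ r = s * r₁ + (1 - s) * r₂ ∧ Laminate f n v₁ r₁ ∧
      Laminate f n v₂ r₂ ∧ ∃ l : Plane →L[ℝ] ℝ, 0 < l v₁ ∧ 0 < l v₂

namespace Laminate

variable {f : Plane → ℝ}

theorem mono {n m : ℕ} (h : n ≤ m) {v : Plane} {r : ℝ} (hv : Laminate f n v r) : Laminate f m v r := by
  induction h with
  | refl => exact hv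
  | step _ ih => exact Or.inl ih

theorem of_ne_zero {v : Plane} (hv : v ≠ 0) (n : ℕ) : Laminate f n v (f v) :=
  mono (Nat.zero_le n) (show Laminate f 0 v (f v) from ⟨hv, rfl⟩)

theorem nonneg (hf : ∀ v, 0 ≤ f v) {n : ℕ} {v : Plane} {r : ℝ} (hv : Laminate f n v r) : 0 ≤ r := by
  induction n generalizing v r with
  | zero => rw [hv.2]; exact hf v
  | succ n ih =>
    rcases hv with hv | ⟨v₁, v₂, s, r₁, r₂, hs, hs', -, rfl, h1, h2, -⟩
    · exact ih hv
    · have := mul_nonneg hs.le (ih h1)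
      have := mul_nonneg (sub_pos.2 hs').le (ih h2)
      linarith

end Laminate

namespace PolygonCost

variable {R : Plane → ℝ → Prop}

theorem mono_rel {R' : Plane → ℝ → Prop} (hR : ∀ c r, R c r → R' c r) {z : ℝ → Plane} {a b E : ℝ}
    (h : PolygonCost R z a b E) : PolygonCost R' z a b E := by
  induction h with
  | segment hab hs hr => exact segment hab hs (hR _ _ hr)
  | append _ _ h1 h2 => exact append h1 h2

theorem segment_line {c x : Plane} {r a b : ℝ} (hab : a < b) (hr : R c r) :
    PolygonCost R (fun t => x + (t - a) • c) a b ((b - a) * r) :=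
  segment hab (fun t _ => by simp) hr

/-- A polygon all of whose velocities point to the same side is a graph. -/
theorem strictMonoOn {l : Plane →L[ℝ] ℝ} (hR : ∀ c r, R c r → 0 < l c) {z : ℝ → Plane} {a b E : ℝ}
    (h : PolygonCost R z a b E) : StrictMonoOn (fun t => l (z t)) (Set.Icc a b) := by
  induction h with
  | @segment a b c r hab hs hr =>
    intro t ht t' ht' h
    simp only [hs t ht, hs t' ht', map_add, map_smul, smul_eq_mul]
    have := mul_lt_mul_of_pos_right (sub_lt_sub_right h a) (hR c r hr)
    linarith
  | @append a m b E F h1 h2 i1 i2 =>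
    have hU : Set.Icc a b = Set.Icc a m ∪ Set.Icc m b :=
      (Set.Icc_union_Icc_eq_Icc h1.lt.le h2.lt.le).symm
    rw [hU]
    exact i1.union i2 (isGreatest_Icc h1.lt.le) (isLeast_Icc h2.lt.le)

/-- One period of a zigzag. -/
theorem exists_zigzag_period {v₁ v₂ : Plane} {s r₁ r₂ : ℝ} (hs : 0 < s) (hs' : s < 1)
    (h₁ : R v₁ r₁) (h₂ : R v₂ r₂) (a : ℝ) {τ : ℝ} (hτ : 0 < τ) (x : Plane) :
    ∃ w, PolygonCost R w a (a + τ) (τ * (s * r₁ + (1 - s) * r₂)) ∧ w a = x ∧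
      w (a + τ) = x + τ • (s • v₁ + (1 - s) • v₂) ∧
      ∀ t ∈ Set.Icc a (a + τ), ‖w t - (x + (t - a) • (s • v₁ + (1 - s) • v₂))‖ ≤ τ * ‖v₁ - v₂‖ := by
  set m := a + s * τ
  have hsτ : 0 < s * τ := mul_pos hs hτ
  have hsτ' : 0 < (1 - s) * τ := mul_pos (by linarith) hτ
  have ham : a < m := by simp only [m]; linarith
  have hmb : m < a + τ := by simp only [m]; linarith
  set w₁ : ℝ → Plane := fun t => x + (t - a) • v₁
  set w₂ : ℝ → Plane := fun t => w₁ m + (t - m) • v₂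
  have hm : w₁ m = w₂ m := by simp [w₂]
  refine ⟨glueAt m w₁ w₂, ?_, ?_, ?_, fun t ht => ?_⟩
  · have := (segment_line (x := x) ham h₁).glue (segment_line (x := w₁ m) hmb h₂) hm
    convert this using 1
    simp only [m]; ring
  · rw [glueAt_of_le _ _ ham.le]; simp [w₁]
  · rw [glueAt_of_ge hm hmb.le]
    simp only [w₂, w₁, m]
    module
  · rcases le_total t m with h | h
    · have e : glueAt m w₁ w₂ t - (x + (t - a) • (s • v₁ + (1 - s) • v₂)) =
          ((t - a) * (1 - s)) • (v₁ - v₂) := by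
        rw [glueAt_of_le _ _ h]; simp only [w₁]; module
      rw [e, norm_smul, Real.norm_of_nonneg (mul_nonneg (by linarith [ht.1]) (by linarith))]
      gcongr
      nlinarith [ht.1, ht.2]
    · have e : glueAt m w₁ w₂ t - (x + (t - a) • (s • v₁ + (1 - s) • v₂)) =
          ((a + τ - t) * s) • (v₁ - v₂) := by
        rw [glueAt_of_ge hm h]; simp only [w₂, w₁, m]; module
      rw [e, norm_smul, Real.norm_of_nonneg (mul_nonneg (by linarith [ht.2]) hs.le)]
      gcongr
      nlinarith [ht.1, ht.2]

theorem exists_zigzag_iterate {v₁ v₂ : Plane} {s r₁ r₂ : ℝ} (hs : 0 < s) (hs' : s < 1)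
    (h₁ : R v₁ r₁) (h₂ : R v₂ r₂) (a : ℝ) {τ : ℝ} (hτ : 0 < τ) (x : Plane) (K : ℕ) :
    ∃ w, PolygonCost R w a (a + (K + 1) * τ) ((K + 1) * τ * (s * r₁ + (1 - s) * r₂)) ∧ w a = x ∧
      w (a + (K + 1) * τ) = x + ((K + 1) * τ) • (s • v₁ + (1 - s) • v₂) ∧
      ∀ t ∈ Set.Icc a (a + (K + 1) * τ),
        ‖w t - (x + (t - a) • (s • v₁ + (1 - s) • v₂))‖ ≤ τ * ‖v₁ - v₂‖ := by
  induction K with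
  | zero => simpa using exists_zigzag_period hs hs' h₁ h₂ a hτ x
  | succ K ih =>
    obtain ⟨w, hw, hwa, hwb, hwt⟩ := ih
    set m := a + (K + 1) * τ
    obtain ⟨w', hw', hwa', hwb', hwt'⟩ := exists_zigzag_period hs hs' h₁ h₂ m hτ (w m)
    have hm : w m = w' m := hwa'.symm
    have hK : a + ((K + 1 : ℕ) + 1) * τ = m + τ := by simp only [m]; push_cast; ring
    rw [hK]
    refine ⟨glueAt m w w', ?_, ?_, ?_, fun t ht => ?_⟩
    · convert hw.glue hw' hm using 1
      push_cast; ring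
    · rw [glueAt_of_le _ _ hw.lt.le, hwa]
    · rw [glueAt_of_ge hm (by linarith), hwb', hwb]
      push_cast; module
    · rcases le_total t m with h | h
      · rw [glueAt_of_le _ _ h]; exact hwt t ⟨ht.1, h⟩
      · rw [glueAt_of_ge hm h]
        refine le_trans (le_of_eq ?_) (hwt' t ⟨h, ht.2⟩)
        congr 1
        rw [hwb]
        simp only [m]
        module

theorem exists_zigzag {v₁ v₂ : Plane} {s r₁ r₂ : ℝ} (hs : 0 < s) (hs' : s < 1)
    (h₁ : R v₁ r₁) (h₂ : R v₂ r₂) {a b : ℝ} (hab : a < b) (x : Plane) {η : ℝ} (hη : 0 < η) :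
    ∃ w, PolygonCost R w a b ((b - a) * (s * r₁ + (1 - s) * r₂)) ∧ w a = x ∧
      w b = x + (b - a) • (s • v₁ + (1 - s) • v₂) ∧
      ∀ t ∈ Set.Icc a b, ‖w t - (x + (t - a) • (s • v₁ + (1 - s) • v₂))‖ ≤ η := by
  have hba : 0 < b - a := sub_pos.2 hab
  obtain ⟨K, hK⟩ := exists_nat_ge ((b - a) * ‖v₁ - v₂‖ / η)
  have hK1 : (0 : ℝ) < K + 1 := by positivity
  obtain ⟨w, h1, h2, h3, h4⟩ := exists_zigzag_iterate hs hs' h₁ h₂ a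
    (τ := (b - a) / (K + 1)) (by positivity) x K
  have e : ((K : ℝ) + 1) * ((b - a) / (K + 1)) = b - a := by field_simp
  rw [e, add_sub_cancel] at h1 h3 h4
  refine ⟨w, h1, h2, h3, fun t ht => (h4 t ht).trans ?_⟩
  rw [div_mul_eq_mul_div, div_le_iff₀ hK1]
  rw [div_le_iff₀ hη] at hK
  nlinarith

/-- Replacing the velocities of a polygon by split ones, at a fine scale and away from the
vertices. -/
theorem exists_split {f : Plane → ℝ} {n : ℕ} {z : ℝ → Plane} {a b E : ℝ}
    (h : PolygonCost (Laminate f (n + 1)) z a b E) (hz : Set.InjOn z (Set.Icc a b)) {ε : ℝ}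
    (hε : 0 < ε) :
    ∃ δ > 0, δ ≤ b - a ∧ ∀ η > 0, ∃ z' E', PolygonCost (Laminate f n) z' a b E' ∧ E' ≤ E + ε ∧
      (∀ t ∈ Set.Icc a b, ‖z' t - z t‖ ≤ η) ∧ (∀ t ∈ Set.Icc a (a + δ), z' t = z t) ∧
      (∀ t ∈ Set.Icc (b - δ) b, z' t = z t) ∧
      ∀ t ∈ Set.Icc a b, ∀ t' ∈ Set.Icc a b, t < t' → t' < t + δ → z' t ≠ z' t' := by
  induction h generalizing ε with
  | @segment a b c r hab hs hr =>
    have hba : 0 < b - a := sub_pos.2 hab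
    rcases hr with hr | ⟨v₁, v₂, s, r₁, r₂, hs0, hs1, rfl, rfl, L₁, L₂, l, hl₁, hl₂⟩
    · refine ⟨b - a, hba, le_rfl, fun η hη => ⟨z, _, segment hab hs hr, by linarith, ?_,
        fun _ _ => rfl, fun _ _ => rfl, fun t ht t' ht' hlt _ he => hlt.ne (hz ht ht' he)⟩⟩
      intro t _
      rw [sub_self, norm_zero]; exact hη.le
    · set c := s • v₁ + (1 - s) • v₂ with hc
      set r := s * r₁ + (1 - s) * r₂ with hr
      have hlc : 0 < l c := by
        simp only [hc, map_add, map_smul, smul_eq_mul]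
        exact add_pos (mul_pos hs0 hl₁) (mul_pos (by linarith) hl₂)
      have hc0 : c ≠ 0 := fun h => by rw [h, map_zero] at hlc; exact hlc.ne rfl
      -- Both end pieces of duration `θ` keep the old velocity at cost `f c` per unit time, so
      -- nothing changes near the vertices and injectivity across them is inherited. The bound on
      -- `θ` limits the extra cost to `ε`.
      set θ := min ((b - a) / 4) (ε / (2 * (|f c| + |r| + 1)))
      have hθ : 0 < θ := by positivity
      have hθ1 : θ ≤ (b - a) / 4 := min_le_left _ _
      have hθ2 : θ * (2 * (|f c| + |r| + 1)) ≤ ε :=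
        (le_div_iff₀ (by positivity)).1 (min_le_right _ _)
      refine ⟨θ, hθ, by linarith, fun η hη => ?_⟩
      -- The relation also records that velocities are positive under `l`; by `strictMonoOn` the
      -- modified piece is a graph over `l`, hence injective.
      set R : Plane → ℝ → Prop := fun c r => Laminate f n c r ∧ 0 < l c
      have hRc : R c (f c) := ⟨Laminate.of_ne_zero hc0 n, hlc⟩
      have k1 : a < a + θ := by linarith
      have k2 : a + θ < b - θ := by linarith
      have k3 : b - θ < b := by linarith
      obtain ⟨w, hw, hwa, hwb, hwt⟩ := exists_zigzag (R := R) hs0 hs1 ⟨L₁, hl₁⟩ ⟨L₂, hl₂⟩ k2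
        (z (a + θ)) hη
      rw [← hc] at hwb hwt
      rw [← hr] at hw
      have hsz : ∀ t ∈ Set.Icc a b, ∀ t' ∈ Set.Icc a b, z t' = z t + (t' - t) • c := by
        intro t ht t' ht'
        rw [hs t ht, hs t' ht']; module
      have ma : a + θ ∈ Set.Icc a b := ⟨by linarith, by linarith⟩
      have mb : b - θ ∈ Set.Icc a b := ⟨by linarith, by linarith⟩
      have s1 : PolygonCost R z a (a + θ) ((a + θ - a) * f c) :=
        segment k1 (fun t ht => hs t ⟨ht.1, by linarith [ht.2]⟩) hRc
      have s3 : PolygonCost R z (b - θ) b ((b - (b - θ)) * f c) :=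
        segment k3 (fun t ht => hsz _ mb t ⟨by linarith [ht.1], ht.2⟩) hRc
      have g1 : w (b - θ) = z (b - θ) := by rw [hwb, hsz _ ma _ mb]
      have g2 : z (a + θ) = glueAt (b - θ) w z (a + θ) := by
        rw [glueAt_of_le _ _ k2.le, hwa]
      have P := s1.glue (hw.glue s3 g1) g2
      set z' := glueAt (a + θ) z (glueAt (b - θ) w z)
      have z1 : ∀ t ≤ a + θ, z' t = z t := fun t ht => glueAt_of_le _ _ ht
      have z2 : ∀ t ∈ Set.Icc (a + θ) (b - θ), z' t = w t := fun t ht => by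
        simp only [z']
        rw [glueAt_of_ge g2 ht.1, glueAt_of_le _ _ ht.2]
      have z3 : ∀ t, b - θ ≤ t → z' t = z t := fun t ht => by
        simp only [z']
        rw [glueAt_of_ge g2 (by linarith), glueAt_of_ge g1 ht]
      refine ⟨z', _, P.mono_rel fun _ _ h => h.1, ?_, fun t ht => ?_, fun t ht => z1 t ht.2,
        fun t ht => z3 t ht.1, fun t ht t' ht' hlt _ he => ?_⟩
      · have a1 := le_abs_self (f c)
        have a2 := neg_abs_le r
        nlinarith
      · rcases le_total t (a + θ) with h | h
        · rw [z1 t h, sub_self, norm_zero]; exact hη.le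
        rcases le_total (b - θ) t with h' | h'
        · rw [z3 t h', sub_self, norm_zero]; exact hη.le
        · rw [z2 t ⟨h, h'⟩, hsz _ ma t ht]
          exact hwt t ⟨h, h'⟩
      · have := P.strictMonoOn (l := l) (fun _ _ h => h.2) ht ht' hlt
        simp only [he] at this
        exact lt_irrefl _ this
  | @append a m b E F h1 h2 i1 i2 =>
    have ham := h1.lt
    have hmb := h2.lt
    obtain ⟨δ₁, hδ₁, hδ₁', I₁⟩ := i1 (hz.mono (Set.Icc_subset_Icc le_rfl hmb.le)) (half_pos hε)
    obtain ⟨δ₂, hδ₂, hδ₂', I₂⟩ := i2 (hz.mono (Set.Icc_subset_Icc ham.le le_rfl)) (half_pos hε)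
    have d1 : min δ₁ δ₂ ≤ δ₁ := min_le_left _ _
    have d2 : min δ₁ δ₂ ≤ δ₂ := min_le_right _ _
    refine ⟨min δ₁ δ₂, lt_min hδ₁ hδ₂, by linarith, fun η hη => ?_⟩
    obtain ⟨z₁, E₁, P₁, e₁, c₁, s₁, t₁, l₁⟩ := I₁ η hη
    obtain ⟨z₂, E₂, P₂, e₂, c₂, s₂, t₂, l₂⟩ := I₂ η hη
    have hm : z₁ m = z₂ m := by
      rw [t₁ m ⟨by linarith, le_rfl⟩, s₂ m ⟨le_rfl, by linarith⟩]
    refine ⟨glueAt m z₁ z₂, _, P₁.glue P₂ hm, by linarith, fun t ht => ?_, fun t ht => ?_,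
      fun t ht => ?_, fun t ht t' ht' hlt hlt' => ?_⟩
    · rcases le_total t m with h | h
      · rw [glueAt_of_le _ _ h]; exact c₁ t ⟨ht.1, h⟩
      · rw [glueAt_of_ge hm h]; exact c₂ t ⟨h, ht.2⟩
    · rw [glueAt_of_le _ _ (by linarith [ht.2])]; exact s₁ t ⟨ht.1, by linarith [ht.2]⟩
    · rw [glueAt_of_ge hm (by linarith [ht.1])]; exact t₂ t ⟨by linarith [ht.1], ht.2⟩
    · rcases le_total t' m with h | h
      · rw [glueAt_of_le _ _ h, glueAt_of_le _ _ (hlt.le.trans h)]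
        exact l₁ t ⟨ht.1, hlt.le.trans h⟩ t' ⟨ht'.1, h⟩ hlt (by linarith)
      rcases le_total m t with h' | h'
      · rw [glueAt_of_ge hm h, glueAt_of_ge hm h']
        exact l₂ t ⟨h', ht.2⟩ t' ⟨h, ht'.2⟩ hlt (by linarith)
      -- Times within `δ` of each other on different sides of the vertex lie in the unmodified end
      -- pieces.
      · rw [glueAt_of_ge hm h, glueAt_of_le _ _ h', t₁ t ⟨by linarith, h'⟩,
          s₂ t' ⟨h, by linarith⟩]
        exact fun he => hlt.ne (hz ht ht' he)

/-- An injective polygon with laminate costs is approximated by injective polygons with costs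
given by the density itself. -/
theorem exists_of_laminate {f : Plane → ℝ} {n : ℕ} {z : ℝ → Plane} {a b E : ℝ}
    (h : PolygonCost (Laminate f n) z a b E) (hz : Set.InjOn z (Set.Icc a b)) {ε : ℝ}
    (hε : 0 < ε) :
    ∃ z' E', PolygonCost (Laminate f 0) z' a b E' ∧ E' ≤ E + ε ∧ Set.InjOn z' (Set.Icc a b) ∧
      ∀ t ∈ Set.Icc a b, ‖z' t - z t‖ ≤ ε := by
  induction n generalizing z E ε with
  | zero =>
    refine ⟨z, E, h, by linarith, hz, fun t _ => ?_⟩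
    rw [sub_self, norm_zero]; exact hε.le
  | succ n ih =>
    -- The scale `δ` does not depend on the fineness `η`, so `η` can be chosen below a third of the
    -- separation `m` of `z` at time distance `δ`. Distant times are then separated by closeness to
    -- `z`, nearby ones by the splitting.
    obtain ⟨δ, hδ, -, H⟩ := h.exists_split hz (half_pos hε)
    obtain ⟨m, hm, hsep⟩ := exists_separation h.continuousOn hz hδ
    obtain ⟨z₁, E₁, P₁, e₁, c₁, -, -, l₁⟩ := H (min (m / 3) (ε / 2)) (by positivity)
    have hη1 : min (m / 3) (ε / 2) ≤ m / 3 := min_le_left _ _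
    have hη2 : min (m / 3) (ε / 2) ≤ ε / 2 := min_le_right _ _
    have core : ∀ t ∈ Set.Icc a b, ∀ t' ∈ Set.Icc a b, t < t' → z₁ t ≠ z₁ t' := by
      intro t ht t' ht' hlt he
      rcases lt_or_ge t' (t + δ) with h' | h'
      · exact l₁ t ht t' ht' hlt h' he
      · have k := hsep t ht t' ht' h'
        have e : z t' - z t = (z₁ t - z t) - (z₁ t' - z t') := by rw [he]; abel
        rw [e] at k
        have := norm_sub_le (z₁ t - z t) (z₁ t' - z t')
        have := c₁ t ht
        have := c₁ t' ht'
        linarith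
    have hz₁ : Set.InjOn z₁ (Set.Icc a b) := fun t ht t' ht' he => by
      rcases lt_trichotomy t t' with h' | h' | h'
      · exact absurd he (core t ht t' ht' h')
      · exact h'
      · exact absurd he.symm (core t' ht' t ht h')
    obtain ⟨z₂, E₂, P₂, e₂, i₂, c₂⟩ := ih P₁ hz₁ (half_pos hε)
    refine ⟨z₂, E₂, P₂, by linarith, i₂, fun t ht => ?_⟩
    have h1 := c₁ t ht
    have h2 := c₂ t ht
    calc ‖z₂ t - z t‖ = ‖(z₂ t - z₁ t) + (z₁ t - z t)‖ := by rw [sub_add_sub_cancel]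
      _ ≤ ‖z₂ t - z₁ t‖ + ‖z₁ t - z t‖ := norm_add_le _ _
      _ ≤ ε := by linarith

end PolygonCost

/-! ### Laminates and the convex envelope -/

/-- A convex function on an open convex set has a supporting affine function at each point. -/
theorem ConvexOn.exists_support {U : Set Plane} (hU : IsOpen U) {G : Plane → ℝ} (hG : ConvexOn ℝ U G)
    {a : Plane} (ha : a ∈ U) : ∃ l : Plane →L[ℝ] ℝ, ∀ x ∈ U, G a + l (x - a) ≤ G x := by
  have hGc : ContinuousOn G U := hG.continuousOn hU
  set A : Set (Plane × ℝ) := {x | x.1 ∈ U ∧ G x.1 < x.2}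
  have hA : Convex ℝ A := hG.convex_strict_epigraph
  have hAo : IsOpen A := by
    rw [isOpen_iff_mem_nhds]
    rintro ⟨x, r⟩ ⟨hx, hr⟩
    have h1 : ∀ᶠ q : Plane × ℝ in 𝓝 (x, r), q.1 ∈ U :=
      continuous_fst.continuousAt.eventually (hU.mem_nhds hx)
    have h2 : ContinuousAt (fun q : Plane × ℝ => G q.1) (x, r) :=
      ContinuousAt.comp (f := Prod.fst) (g := G) (hGc.continuousAt (hU.mem_nhds hx))
        continuous_fst.continuousAt
    have h3 := h2.eventually_lt (continuous_snd.continuousAt (x := (x, r))) hr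
    exact h1.and h3
  obtain ⟨L, hL⟩ := geometric_hahn_banach_open_point hA hAo (x := (a, G a)) fun h => lt_irrefl _ h.2
  set k := L (0, 1)
  have hsplit : ∀ x r, L (x, r) = L (x, 0) + r * k := fun x r => by
    have : ((x, r) : Plane × ℝ) = (x, 0) + r • (0, 1) := by simp
    rw [this, map_add, map_smul, smul_eq_mul]
  -- The point one unit above `(a, G a)` lies in the epigraph; hence the separating hyperplane is
  -- not vertical and is the graph of an affine function.
  have hk : k < 0 := by
    have := hL (a, G a + 1) ⟨ha, by simp⟩
    rw [hsplit a (G a + 1), hsplit a (G a)] at this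
    linarith
  refine ⟨(-k⁻¹) • L.comp (ContinuousLinearMap.inl ℝ Plane ℝ), fun x hx => ?_⟩
  have hle : ∀ ε > 0, L (x - a, 0) ≤ -k * (G x + ε - G a) := by
    intro ε hε
    have := (hL (x, G x + ε) ⟨hx, by simp [hε]⟩).le
    rw [hsplit x, hsplit a] at this
    have e : L (x - a, 0) = L (x, 0) - L (a, 0) := by
      rw [← map_sub]; simp
    rw [e]
    linarith
  have hle0 : L (x - a, 0) ≤ -k * (G x - G a) := by
    have hk' : 0 < -k := by linarith
    refine le_of_forall_pos_le_add fun ε hε => ?_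
    have := hle (ε / -k) (by positivity)
    have e : -k * (G x + ε / -k - G a) = -k * (G x - G a) + ε := by
      field_simp [hk.ne]; ring
    linarith
  have hki : 0 < -k⁻¹ := by
    have := inv_neg''.2 hk
    linarith
  have := mul_le_mul_of_nonneg_left hle0 hki.le
  have e : -k⁻¹ * (-k * (G x - G a)) = G x - G a := by field_simp [hk.ne]
  simp only [smul_apply, ContinuousLinearMap.comp_apply,
    ContinuousLinearMap.inl_apply, smul_eq_mul]
  linarith

/-- Two vectors which are not opposite lie in a common open half plane. -/
theorem exists_pos_of_not_opposite {x y : Plane} (hx : x ≠ 0) (hy : y ≠ 0)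
    (h : ∀ r : ℝ, 0 < r → y ≠ -(r • x)) : ∃ l : Plane →L[ℝ] ℝ, 0 < l x ∧ 0 < l y := by
  obtain ⟨d, h1, h2⟩ := exists_common_director hx hy h
  refine ⟨d 1 • (EuclideanSpace.proj 0 : Plane →L[ℝ] ℝ) - d 0 • (EuclideanSpace.proj 1 : Plane →L[ℝ] ℝ),
    ?_, ?_⟩
  · simp only [cross] at h1
    change 0 < d 1 * x 0 - d 0 * x 1
    linarith
  · simp only [cross] at h2
    change 0 < d 1 * y 0 - d 0 * y 1
    linarith

/-- The lowest laminate cost of a velocity. -/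
noncomputable def laminateEnvelope (f : Plane → ℝ) (v : Plane) : ℝ :=
  sInf {r | ∃ n, Laminate f n v r}

section LaminateEnvelope

variable {f : Plane → ℝ} (hf : ∀ v, 0 ≤ f v)

include hf in
theorem bddBelow_laminate (v : Plane) : BddBelow {r | ∃ n, Laminate f n v r} :=
  ⟨0, fun _ ⟨_, h⟩ => h.nonneg hf⟩

include hf in
theorem laminateEnvelope_le {v : Plane} (hv : v ≠ 0) : laminateEnvelope f v ≤ f v :=
  csInf_le (bddBelow_laminate hf v) ⟨0, Laminate.of_ne_zero hv 0⟩

theorem exists_laminate_lt {v : Plane} (hv : v ≠ 0) {ε : ℝ} (hε : 0 < ε) :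
    ∃ n r, Laminate f n v r ∧ r < laminateEnvelope f v + ε := by
  obtain ⟨r, ⟨n, hn⟩, hr⟩ := exists_lt_of_csInf_lt
    (s := {r | ∃ n, Laminate f n v r}) ⟨f v, 0, Laminate.of_ne_zero hv 0⟩
    (show sInf _ < laminateEnvelope f v + ε by unfold laminateEnvelope; linarith)
  exact ⟨n, r, hn, hr⟩

-- Nearly optimal laminates of `x` and `y` are combined by one further splitting. The half-plane
-- condition in `Laminate` restricts this convexity to pairs that lie in a common open half plane.
include hf in
theorem laminateEnvelope_combo {x y : Plane} (h : ∃ l : Plane →L[ℝ] ℝ, 0 < l x ∧ 0 < l y) {s : ℝ}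
    (hs : 0 < s) (hs' : s < 1) : laminateEnvelope f (s • x + (1 - s) • y) ≤
      s * laminateEnvelope f x + (1 - s) * laminateEnvelope f y := by
  obtain ⟨l, hx, hy⟩ := h
  have hx0 : x ≠ 0 := by rintro rfl; simp at hx
  have hy0 : y ≠ 0 := by rintro rfl; simp at hy
  refine le_of_forall_pos_le_add fun ε hε => ?_
  obtain ⟨n, r, hn, hr⟩ := exists_laminate_lt (f := f) hx0 hε
  obtain ⟨m, q, hm, hq⟩ := exists_laminate_lt (f := f) hy0 hε
  have h1 : Laminate f (max n m + 1) (s • x + (1 - s) • y) (s * r + (1 - s) * q) :=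
    Or.inr ⟨x, y, s, r, q, hs, hs', rfl, rfl, hn.mono (le_max_left _ _), hm.mono (le_max_right _ _),
      l, hx, hy⟩
  have h2 := csInf_le (bddBelow_laminate hf _) ⟨_, h1⟩
  have h3 := mul_le_mul_of_nonneg_left hr.le hs.le
  have h4 := mul_le_mul_of_nonneg_left hq.le (sub_pos.2 hs').le
  unfold laminateEnvelope at *
  linarith

include hf in
/-- The laminate envelope has a supporting affine function on the punctured plane. -/
theorem exists_affine_le_laminateEnvelope {a : Plane} (ha : a ≠ 0) :
    ∃ l : Plane →L[ℝ] ℝ, ∀ y ≠ 0, laminateEnvelope f a + l (y - a) ≤ laminateEnvelope f y := by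
  set G := laminateEnvelope f
  set ia : Plane →L[ℝ] ℝ := innerSL ℝ a
  have hia : 0 < ia a := by
    simp only [ia, innerSL_apply_apply, real_inner_self_eq_norm_sq]; positivity
  set U : Set Plane := {x | 0 < ia x}
  have hU : IsOpen U := isOpen_lt continuous_const ia.continuous
  -- All pairs in the half plane around `a` share the functional `ia`, so the envelope is convex
  -- there and has a supporting `l` at `a`.
  have hGU : ConvexOn ℝ U G := by
    refine convexOn_iff_forall_pos.2 ⟨convex_halfSpace_gt ia.toLinearMap.isLinear 0, ?_⟩
    intro x hx y hy s t hs ht hst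
    obtain rfl : t = 1 - s := by linarith
    exact laminateEnvelope_combo hf ⟨ia, hx, hy⟩ hs (by linarith)
  obtain ⟨l, hl⟩ := hGU.exists_support hU (show a ∈ U from hia)
  have hGa : ContinuousAt G a := (hGU.continuousOn hU).continuousAt (hU.mem_nhds hia)
  have main : ∀ x y : Plane, (∃ l : Plane →L[ℝ] ℝ, 0 < l x ∧ 0 < l y) → ∀ t, 0 < t → t < 1 →
      (1 - t) • x + t • y ∈ U → G a + ((1 - t) * l (x - a) + t * l (y - a)) ≤
        (1 - t) * G x + t * G y := by
    intro x y hxy t ht ht' hm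
    have h1 := hl _ hm
    have h2 := laminateEnvelope_combo hf hxy (s := 1 - t) (by linarith) (by linarith)
    rw [sub_sub_cancel] at h2
    have e : (1 - t) • x + t • y - a = (1 - t) • (x - a) + t • (y - a) := by module
    rw [e, map_add, map_smul, map_smul, smul_eq_mul, smul_eq_mul] at h1
    exact h1.trans h2
  refine ⟨l, fun y hy => ?_⟩
  -- With this `t` the point `(1 - t) a + t y` stays in `U`, where the supporting inequality holds.
  -- Convexity between `a` and `y` then transfers the inequality to `y` itself.
  set t := ia a / (2 * (ia a + |ia y|)) with ht
  have hay : 0 < ia a + |ia y| := by positivity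
  have ht0 : 0 < t := by positivity
  have ht1 : t * (2 * (ia a + |ia y|)) = ia a := by rw [ht]; field_simp
  have ht2 : t ≤ 1 / 2 := by
    rw [ht, div_le_iff₀ (by positivity)]
    linarith [abs_nonneg (ia y)]
  have hmem : (1 - t) • a + t • y ∈ U := by
    simp only [U, Set.mem_ofPred_eq, map_add, map_smul, smul_eq_mul]
    have h1 := neg_abs_le (ia y)
    nlinarith
  have fin : G a + t * l (y - a) ≤ (1 - t) * G a + t * G y := by
    by_cases hop : ∀ r : ℝ, 0 < r → y ≠ -(r • a)
    · have := main a y (exists_pos_of_not_opposite ha hy hop) t ht0 (by linarith) hmem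
      simpa using this
    · push Not at hop
      obtain ⟨r, hr, hyr⟩ := hop
      -- When `y` is opposite to `a`, the splitting is not allowed. Tilting `a` slightly makes it
      -- admissible, and the tilt is removed by continuity of the envelope at `a`.
      set q : ℝ → Plane := fun s => a + s • rot a
      have hq : Continuous q := by fun_prop
      have hq0 : q 0 = a := by simp [q]
      have hqt : Tendsto q (𝓝[≠] 0) (𝓝 a) := by
        have := hq.tendsto 0
        rw [hq0] at this
        exact this.mono_left nhdsWithin_le_nhds
      have hmemt : ∀ᶠ s in 𝓝[≠] (0 : ℝ), (1 - t) • q s + t • y ∈ U :=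
        (((hqt.const_smul (1 - t)).add_const (t • y)).eventually (hU.mem_nhds hmem))
      have hineq : ∀ᶠ s in 𝓝[≠] (0 : ℝ), G a + ((1 - t) * l (q s - a) + t * l (y - a)) ≤
          (1 - t) * G (q s) + t * G y := by
        filter_upwards [hmemt, self_mem_nhdsWithin] with s hs hs0
        refine main _ _ (exists_pos_of_not_opposite ?_ hy ?_) t ht0 (by linarith) hs
        · intro h0
          have h1 : cross a (q s) = 0 := by rw [h0]; simp [cross]
          simp only [q] at h1
          rw [cross_add_right, cross_same, cross_smul_right, cross_rot_self, zero_add] at h1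
          have : 0 < ‖a‖ := norm_pos_iff.2 ha
          exact mul_ne_zero hs0 (by positivity) h1
        · intro r' hr' he
          have h1 : cross a y = 0 := by
            rw [hyr, ← neg_smul, cross_smul_right, cross_same, mul_zero]
          rw [he, ← neg_smul, cross_smul_right] at h1
          simp only [q] at h1
          rw [cross_add_right, cross_same, cross_smul_right, cross_rot_self, zero_add] at h1
          have : 0 < ‖a‖ := norm_pos_iff.2 ha
          exact mul_ne_zero (neg_ne_zero.2 hr'.ne') (mul_ne_zero hs0 (by positivity)) h1
      have L1 : Tendsto (fun s => G a + ((1 - t) * l (q s - a) + t * l (y - a))) (𝓝[≠] 0)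
          (𝓝 (G a + ((1 - t) * l (a - a) + t * l (y - a)))) :=
        ((((l.continuous.tendsto _).comp (hqt.sub_const a)).const_mul _).add_const _).const_add _
      have L2 : Tendsto (fun s => (1 - t) * G (q s) + t * G y) (𝓝[≠] 0)
          (𝓝 ((1 - t) * G a + t * G y)) :=
        ((hGa.tendsto.comp hqt).const_mul _).add_const _
      have := le_of_tendsto_of_tendsto L1 L2 hineq
      simpa using this
  nlinarith

end LaminateEnvelope

/-- The convex envelope is reached by laminates away from the origin. -/
theorem exists_laminate_le_convexEnvelope {F : Plane → ENNReal} (hF : ∀ a, a ≠ 0 → F a ≠ ⊤)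
    (hF0 : F 0 = ⊤) {a : Plane} (ha : a ≠ 0) {ε : ℝ} (hε : 0 < ε) :
    ∃ n r, Laminate (fun v => (F v).toReal) n a r ∧ r ≤ (convexEnvelope F a).toReal + ε := by
  have hf : ∀ v, 0 ≤ (F v).toReal := fun v => ENNReal.toReal_nonneg
  obtain ⟨l, hl⟩ := exists_affine_le_laminateEnvelope hf ha
  set G := laminateEnvelope fun v => (F v).toReal
  -- The supporting affine function is below the density away from the origin, while `F 0 = ⊤`
  -- imposes no condition there. It therefore competes in the convex envelope.
  have hle : ENNReal.ofReal (G a + l (a - a)) ≤ convexEnvelope F a := by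
    refine le_convexEnvelope (g := fun y => G a + l (y - a)) ?_ (fun b => ?_) a
    · refine ⟨convex_univ, fun x _ y _ s t _ _ hst => le_of_eq ?_⟩
      have e : s • x + t • y - a = s • (x - a) + t • (y - a) := by
        have : a = (s + t) • a := by rw [hst, one_smul]
        nth_rw 1 [this]; module
      simp only [e, map_add, map_smul, smul_eq_mul]
      linear_combination (-(G a)) * hst
    · rcases eq_or_ne b 0 with rfl | hb
      · rw [hF0]; exact le_top
      · rw [← ENNReal.ofReal_toReal (hF b hb)]
        exact ENNReal.ofReal_le_ofReal ((hl b hb).trans (laminateEnvelope_le hf hb))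
  rw [sub_self, map_zero, add_zero] at hle
  have h1 := (ENNReal.ofReal_le_iff_le_toReal (convexEnvelope_ne_top hF a)).1 hle
  obtain ⟨n, r, hn, hr⟩ := exists_laminate_lt (f := fun v => (F v).toReal) ha hε
  exact ⟨n, r, hn, by linarith⟩

/-- An injective polygon is approximated by injective polygons whose cost is given by the density
instead of its convex envelope. -/
theorem PolygonCost.exists_of_convexEnvelope {F : Plane → ENNReal} (hF : ∀ a, a ≠ 0 → F a ≠ ⊤)
    (hF0 : F 0 = ⊤) {z : ℝ → Plane} {a b E : ℝ}
    (h : PolygonCost (fun c r => r = (convexEnvelope F c).toReal) z a b E)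
    (hz : Set.InjOn z (Set.Icc a b)) {ε : ℝ} (hε : 0 < ε) :
    ∃ z' E', PolygonCost (fun c r => c ≠ 0 ∧ r = (F c).toReal) z' a b E' ∧ E' ≤ E + ε ∧
      Set.InjOn z' (Set.Icc a b) ∧ ∀ t ∈ Set.Icc a b, ‖z' t - z t‖ ≤ ε := by
  set f : Plane → ℝ := fun v => (F v).toReal
  have hba : 0 < b - a := sub_pos.2 h.lt
  obtain ⟨E₁, h₁, hE₁⟩ := h.exists_cost_le (R' := fun c r => ∃ n, Laminate f n c r) hz
    (ε := ε / 2 / (b - a)) (fun c r hc hr => by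
      obtain ⟨n, r', h1, h2⟩ := exists_laminate_le_convexEnvelope hF hF0 hc
        (ε := ε / 2 / (b - a)) (by positivity)
      exact ⟨r', ⟨n, h1⟩, by rw [hr]; exact h2⟩)
  -- A polygon has finitely many pieces, so one depth of lamination serves them all.
  have hn : ∀ {a b E}, PolygonCost (fun c r => ∃ n, Laminate f n c r) z a b E →
      ∃ n, PolygonCost (Laminate f n) z a b E := by
    intro a b E h
    induction h with
    | segment hab hs hr =>
      obtain ⟨n, hn⟩ := hr
      exact ⟨n, .segment hab hs hn⟩
    | append _ _ i1 i2 =>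
      obtain ⟨n, hn⟩ := i1
      obtain ⟨m, hm⟩ := i2
      exact ⟨max n m, .append (hn.mono_rel fun _ _ => Laminate.mono (le_max_left _ _))
        (hm.mono_rel fun _ _ => Laminate.mono (le_max_right _ _))⟩
  obtain ⟨n, h₂⟩ := hn h₁
  obtain ⟨z', E', P, e, i, c⟩ := h₂.exists_of_laminate hz (half_pos hε)
  refine ⟨z', E', P, ?_, i, fun t ht => (c t ht).trans (by linarith)⟩
  have : ε / 2 / (b - a) * (b - a) = ε / 2 := by field_simp
  linarith

/-! ### Levels that a function of bounded variation crosses finitely often -/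

theorem exists_switch {P : ℕ → Prop} {i j : ℕ} (hij : i ≤ j) (h : P i ↔ ¬ P j) :
    ∃ k, i ≤ k ∧ k < j ∧ (P k ↔ ¬ P (k + 1)) := by
  induction j, hij using Nat.le_induction with
  | base => tauto
  | succ j hij ih =>
    by_cases hj : P j ↔ P (j + 1)
    · obtain ⟨k, h1, h2, h3⟩ := ih (by tauto)
      exact ⟨k, h1, by omega, h3⟩
    · exact ⟨j, hij, by omega, by tauto⟩

/-- The number of steps of the uniform partition `(k + 1) / (n + 2)` across which `g` passes the
level `c`. -/
noncomputable def crossingNumber (g : ℝ → ℝ) (n : ℕ) (c : ℝ) : ENNReal :=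
  ∑ k ∈ Finset.range n, (Set.Ioo (min (g ((k + 1) / (n + 2))) (g (((k + 1 : ℕ) + 1) / (n + 2))))
    (max (g ((k + 1) / (n + 2))) (g (((k + 1 : ℕ) + 1) / (n + 2))))).indicator (fun _ => 1) c

theorem measurable_crossingNumber (g : ℝ → ℝ) (n : ℕ) : Measurable (crossingNumber g n) :=
  Finset.measurable_sum _ fun _ _ => measurable_const.indicator measurableSet_Ioo

theorem partition_mem {k n : ℕ} (h : k ≤ n) : ((k : ℝ) + 1) / (n + 2) ∈ Set.Ioo (0 : ℝ) 1 := by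
  refine ⟨by positivity, ?_⟩
  rw [div_lt_one (by positivity)]
  have : (k : ℝ) ≤ n := by exact_mod_cast h
  linarith

/-- A step of the partition is counted for a set of levels of measure equal to the increment of `g`;
summation gives at most the variation. This is the easy half of Banach's indicatrix formula. -/
theorem lintegral_crossingNumber_le {g : ℝ → ℝ} {M : ENNReal}
    (hM : eVariationOn g (Set.Ioo 0 1) ≤ M) (n : ℕ) : ∫⁻ c, crossingNumber g n c ≤ M := by
  unfold crossingNumber
  rw [lintegral_finsetSum _ fun _ _ => measurable_const.indicator measurableSet_Ioo]
  set x : ℕ → ℝ := fun k => ((min k n : ℕ) + 1) / (n + 2)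
  have hx : Monotone x := fun i j hij => by
    simp only [x]
    have : ((min i n : ℕ) : ℝ) ≤ ((min j n : ℕ) : ℝ) := by exact_mod_cast min_le_min_right n hij
    gcongr
  refine le_trans (le_of_eq (Finset.sum_congr rfl fun k hk => ?_))
    ((eVariationOn.sum_le (f := g) (n := n) hx fun i => partition_mem (min_le_right i n)).trans hM)
  have hk' := Finset.mem_range.1 hk
  rw [lintegral_indicator_const measurableSet_Ioo, Real.volume_Ioo, one_mul, edist_dist,
    Real.dist_eq, max_sub_min_eq_abs]
  simp only [x]
  rw [min_eq_left hk'.le, min_eq_left (by omega : k + 1 ≤ n), abs_sub_comm]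

/-- Transversal preimages of a level which is avoided on the partitions are counted by the crossing
numbers of fine partitions. -/
theorem eventually_card_le_crossingNumber {g : ℝ → ℝ} (hg : ContinuousOn g (Set.Ioo 0 1)) {c : ℝ}
    (hc : ∀ k n : ℕ, g ((k + 1) / (n + 2)) ≠ c) {S : Finset ℝ}
    (hcross : ∀ t ∈ S, ∀ δ > 0, (∃ s ∈ Set.Ioo (t - δ) (t + δ) ∩ Set.Ioo 0 1, g s < c) ∧
      ∃ s ∈ Set.Ioo (t - δ) (t + δ) ∩ Set.Ioo 0 1, c < g s) :
    ∀ᶠ n in atTop, (S.card : ENNReal) ≤ crossingNumber g n c := by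
  -- Half the minimal distance in `S`, so that the partition steps assigned to different points are
  -- different.
  obtain ⟨δ, hδ, hsep⟩ : ∃ δ > 0, ∀ t ∈ S, ∀ t' ∈ S, t ≠ t' → 2 * δ ≤ |t - t'| := by
    rcases S.offDiag.eq_empty_or_nonempty with h | h
    · refine ⟨1, one_pos, fun t ht t' ht' hne => ?_⟩
      have : (t, t') ∈ S.offDiag := Finset.mem_offDiag.2 ⟨ht, ht', hne⟩
      rw [h] at this
      exact absurd this (Finset.notMem_empty _)
    · obtain ⟨x, hx, hmin⟩ := S.offDiag.exists_min_image (fun x => |x.1 - x.2|) h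
      obtain ⟨-, -, hne⟩ := Finset.mem_offDiag.1 hx
      refine ⟨|x.1 - x.2| / 2, half_pos (abs_pos.2 (sub_ne_zero.2 hne)), fun t ht t' ht' hne => ?_⟩
      have := hmin (t, t') (Finset.mem_offDiag.2 ⟨ht, ht', hne⟩)
      simp only at this
      linarith
  have hdense : ∀ V : Set ℝ, IsOpen V → V ⊆ Set.Ioo 0 1 → V.Nonempty →
      ∀ᶠ n : ℕ in atTop, ∃ k ≤ n, ((k : ℝ) + 1) / (n + 2) ∈ V := by
    intro V hV hV1 ⟨s, hs⟩
    obtain ⟨ε, hε, hεV⟩ := Metric.isOpen_iff.1 hV s hs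
    obtain ⟨N, hN⟩ := exists_nat_gt (1 / (min ε s))
    have hs0 := hV1 hs
    have hm : 0 < min ε s := lt_min hε hs0.1
    filter_upwards [eventually_ge_atTop N] with n hn
    have hn2 : (0 : ℝ) < n + 2 := by positivity
    have hNn : (N : ℝ) ≤ n := by exact_mod_cast hn
    have h1 : 1 < min ε s * (n + 2) := by
      have := (div_lt_iff₀ hm).1 hN
      nlinarith
    have h2 : 1 < s * (n + 2) := h1.trans_le (by gcongr; exact min_le_right _ _)
    have h3 : 1 < ε * (n + 2) := h1.trans_le (by gcongr; exact min_le_left _ _)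
    set k := ⌊s * (n + 2)⌋₊
    have hk0 : 1 ≤ k := Nat.le_floor (by simpa using h2.le)
    have hk1 : (k : ℝ) ≤ s * (n + 2) := Nat.floor_le (by linarith)
    have hk2 : s * (n + 2) < k + 1 := Nat.lt_floor_add_one _
    have hkn : k < n + 2 := by
      have : (k : ℝ) < (n + 2 : ℕ) := by push_cast; nlinarith [hs0.2]
      exact_mod_cast this
    refine ⟨k - 1, by omega, hεV ?_⟩
    rw [Nat.cast_sub hk0, Nat.cast_one, sub_add_cancel, Metric.mem_ball, Real.dist_eq,
      abs_sub_lt_iff]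
    constructor
    · rw [sub_lt_iff_lt_add, div_lt_iff₀ hn2]; nlinarith
    · rw [sub_lt_comm, lt_div_iff₀ hn2]; nlinarith
  -- A fine partition has points near `t` on both sides of the level, and between them a step where
  -- the side switches. Since the level avoids the values at partition points, it lies strictly
  -- between the two values of that step.
  have hlow : ∀ t ∈ S, ∀ᶠ n : ℕ in atTop, ∃ k < n, (((k : ℝ) + 1) / (n + 2) ∈ Set.Ioo (t - δ) (t + δ)) ∧
      c ∈ Set.Ioo (min (g ((k + 1) / (n + 2))) (g (((k + 1 : ℕ) + 1) / (n + 2))))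
        (max (g ((k + 1) / (n + 2))) (g (((k + 1 : ℕ) + 1) / (n + 2)))) := by
    intro t ht
    obtain ⟨⟨s₁, hs₁, hs₁c⟩, ⟨s₂, hs₂, hs₂c⟩⟩ := hcross t ht δ hδ
    have hopen : IsOpen (Set.Ioo (t - δ) (t + δ) ∩ Set.Ioo (0 : ℝ) 1) := isOpen_Ioo.inter isOpen_Ioo
    have hg' := hg.mono (Set.inter_subset_right (s := Set.Ioo (t - δ) (t + δ)))
    have h1 := hdense _ (hg'.isOpen_inter_preimage hopen isOpen_Iio)
      (fun s hs => hs.1.2) ⟨s₁, hs₁, hs₁c⟩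
    have h2 := hdense _ (hg'.isOpen_inter_preimage hopen isOpen_Ioi)
      (fun s hs => hs.1.2) ⟨s₂, hs₂, hs₂c⟩
    filter_upwards [h1, h2] with n ⟨i, hi, hi1⟩ ⟨j, hj, hj1⟩
    have hPi : g ((i + 1) / (n + 2)) < c := hi1.2
    have hPj : ¬ g ((j + 1) / (n + 2)) < c := not_lt.2 (le_of_lt hj1.2)
    obtain ⟨k, hk1, hk2, hk3⟩ : ∃ k, min i j ≤ k ∧ k < max i j ∧
        (g (((k : ℕ) + 1) / (n + 2)) < c ↔ ¬ g (((k + 1 : ℕ) + 1) / (n + 2)) < c) := by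
      rcases le_total i j with h | h
      · rw [min_eq_left h, max_eq_right h]
        exact exists_switch (P := fun k => g (((k : ℕ) + 1) / (n + 2)) < c) h (by tauto)
      · rw [min_eq_right h, max_eq_left h]
        exact exists_switch (P := fun k => g (((k : ℕ) + 1) / (n + 2)) < c) h (by tauto)
    have hmono : ∀ {p q : ℕ}, p ≤ q → ((p : ℝ) + 1) / (n + 2) ≤ (q + 1) / (n + 2) := fun {p q} h => by
      have : (p : ℝ) ≤ q := by exact_mod_cast h
      gcongr
    refine ⟨k, by omega, ⟨?_, ?_⟩, ?_⟩
    · refine lt_of_lt_of_le ?_ (hmono hk1)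
      rcases le_total i j with h | h
      · rw [min_eq_left h]; exact hi1.1.1.1
      · rw [min_eq_right h]; exact hj1.1.1.1
    · refine lt_of_le_of_lt (hmono hk2.le) ?_
      rcases le_total i j with h | h
      · rw [max_eq_right h]; exact hj1.1.1.2
      · rw [max_eq_left h]; exact hi1.1.1.2
    · have n1 := hc k n
      have n2 := hc (k + 1) n
      by_cases hk4 : g (((k : ℕ) + 1) / (n + 2)) < c
      · have hk5 := lt_of_le_of_ne (not_lt.1 (hk3.1 hk4)) n2.symm
        exact ⟨min_lt_of_left_lt hk4, lt_max_of_lt_right hk5⟩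
      · have hk5 : g (((k + 1 : ℕ) + 1) / (n + 2)) < c := by
          by_contra hcon
          exact hk4 (hk3.2 hcon)
        have hk6 := lt_of_le_of_ne (not_lt.1 hk4) n1.symm
        exact ⟨min_lt_of_right_lt hk5, lt_max_of_lt_left hk6⟩
  filter_upwards [(Filter.eventually_all_finset S).2 hlow] with n hn
  choose! k hk1 hk2 hk3 using hn
  have hinj : Set.InjOn k S := by
    intro t ht t' ht' he
    by_contra hne
    have h1 := hk2 t ht
    have h2 := hk2 t' ht'
    rw [← he] at h2
    have := hsep t ht t' ht' hne
    rw [le_abs] at this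
    rcases this with h | h <;> linarith [h1.1, h1.2, h2.1, h2.2]
  unfold crossingNumber
  simp only [Set.indicator_apply]
  rw [Finset.sum_boole]
  have := Finset.card_le_card_of_injOn k (t := (Finset.range n).filter fun k : ℕ =>
    c ∈ Set.Ioo (min (g ((k + 1) / (n + 2))) (g (((k + 1 : ℕ) + 1) / (n + 2))))
        (max (g ((k + 1) / (n + 2))) (g (((k + 1 : ℕ) + 1) / (n + 2)))))
    (fun t ht => Finset.mem_coe.2 (Finset.mem_filter.2 ⟨Finset.mem_range.2 (hk1 t ht), hk3 t ht⟩)) hinj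
  exact_mod_cast this

/-- Each rational interval contributes at most one maximum and one minimum. A level outside this set
is not a local extreme value, so `g` goes to both sides of it near every preimage. -/
theorem countable_extremal_values (g : ℝ → ℝ) :
    {c | ∃ p q : ℚ, IsGreatest (g '' Set.Ioo (p : ℝ) q) c ∨ IsLeast (g '' Set.Ioo (p : ℝ) q) c}.Countable := by
  have e : {c | ∃ p q : ℚ, IsGreatest (g '' Set.Ioo (p : ℝ) q) c ∨ IsLeast (g '' Set.Ioo (p : ℝ) q) c} =
      ⋃ p : ℚ, ⋃ q : ℚ, ({c | IsGreatest (g '' Set.Ioo (p : ℝ) q) c} ∪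
        {c | IsLeast (g '' Set.Ioo (p : ℝ) q) c}) := by
    ext c; simp
  rw [e]
  refine Set.countable_iUnion fun p => Set.countable_iUnion fun q => Set.Countable.union ?_ ?_
  · exact Set.Subsingleton.countable fun x hx y hy => hx.unique hy
  · exact Set.Subsingleton.countable fun x hx y hy => hx.unique hy

/-- In every interval there is a level at which a continuous function of bounded variation has a
controlled number of preimages, at each of which it passes from one side to the other. -/
theorem exists_transversal_level {g : ℝ → ℝ} (hg : ContinuousOn g (Set.Ioo 0 1)) {M : ENNReal}
    (hM : eVariationOn g (Set.Ioo 0 1) ≤ M) {a b : ℝ} (hab : a < b) :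
    ∃ c ∈ Set.Ioo a b,
      (∀ t ∈ Set.Ioo (0 : ℝ) 1, g t = c → ∀ δ > 0,
        (∃ s ∈ Set.Ioo (t - δ) (t + δ) ∩ Set.Ioo 0 1, g s < c) ∧
        ∃ s ∈ Set.Ioo (t - δ) (t + δ) ∩ Set.Ioo 0 1, c < g s) ∧
      ∀ S : Finset ℝ, (∀ t ∈ S, t ∈ Set.Ioo (0 : ℝ) 1 ∧ g t = c) →
        (S.card : ENNReal) ≤ M / ENNReal.ofReal (b - a) := by
  -- Null sets to be avoided: levels outside the interval, extreme values on rational intervals, and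
  -- values at partition points.
  set N : Set ℝ := {c | ¬ c ∈ Set.Ioo a b} ∪
    ({c | ∃ p q : ℚ, IsGreatest (g '' Set.Ioo (p : ℝ) q) c ∨ IsLeast (g '' Set.Ioo (p : ℝ) q) c} ∪
      Set.range fun x : ℕ × ℕ => g (((x.1 : ℝ) + 1) / (x.2 + 2)))
  have hN : volume.restrict (Set.Ioo a b) N = 0 := by
    refine measure_union_null (ae_restrict_mem measurableSet_Ioo) ?_
    refine Measure.absolutelyContinuous_of_le Measure.restrict_le_self ?_
    exact ((countable_extremal_values g).union (Set.countable_range _)).measure_zero volume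
  have hne : volume.restrict (Set.Ioo a b) ≠ 0 := by
    rw [ne_eq, Measure.restrict_eq_zero, Real.volume_Ioo, ENNReal.ofReal_eq_zero]
    linarith
  have hfin : IsFiniteMeasure (volume.restrict (Set.Ioo a b)) := ⟨by simp⟩
  -- Some level outside the null set has at most the average crossing number, which Fatou bounds by
  -- `M / (b - a)`.
  obtain ⟨c, hcN, hcle⟩ := exists_notMem_null_le_laverage hne
    (Measurable.liminf fun n => measurable_crossingNumber g n).aemeasurable hN
  have hc1 : c ∈ Set.Ioo a b := by
    by_contra h
    exact hcN (Or.inl h)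
  have hc2 : ∀ p q : ℚ, ¬ (IsGreatest (g '' Set.Ioo (p : ℝ) q) c ∨ IsLeast (g '' Set.Ioo (p : ℝ) q) c) :=
    fun p q h => hcN (Or.inr (Or.inl ⟨p, q, h⟩))
  have hc3 : ∀ k n : ℕ, g (((k : ℝ) + 1) / (n + 2)) ≠ c :=
    fun k n h => hcN (Or.inr (Or.inr ⟨(k, n), h⟩))
  have hcross : ∀ t ∈ Set.Ioo (0 : ℝ) 1, g t = c → ∀ δ > 0,
        (∃ s ∈ Set.Ioo (t - δ) (t + δ) ∩ Set.Ioo 0 1, g s < c) ∧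
        ∃ s ∈ Set.Ioo (t - δ) (t + δ) ∩ Set.Ioo 0 1, c < g s := by
    intro t ht htc δ hδ
    obtain ⟨p, hp1, hp2⟩ := exists_rat_btwn (max_lt (by linarith) ht.1 : max (t - δ) 0 < t)
    obtain ⟨q, hq1, hq2⟩ := exists_rat_btwn (lt_min (by linarith) ht.2 : t < min (t + δ) 1)
    have hsub : Set.Ioo (p : ℝ) q ⊆ Set.Ioo (t - δ) (t + δ) ∩ Set.Ioo 0 1 := fun s hs =>
      ⟨⟨((le_max_left _ _).trans_lt hp1).trans hs.1, hs.2.trans (hq2.trans_le (min_le_left _ _))⟩,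
        ((le_max_right _ _).trans_lt hp1).trans hs.1, hs.2.trans (hq2.trans_le (min_le_right _ _))⟩
    have hmem : c ∈ g '' Set.Ioo (p : ℝ) q := ⟨t, ⟨hp2, hq1⟩, htc⟩
    constructor
    · by_contra! hcon
      refine hc2 p q (Or.inr ⟨hmem, ?_⟩)
      rintro _ ⟨s, hs, rfl⟩
      exact hcon s (hsub hs)
    · by_contra! hcon
      refine hc2 p q (Or.inl ⟨hmem, ?_⟩)
      rintro _ ⟨s, hs, rfl⟩
      exact hcon s (hsub hs)
  refine ⟨c, hc1, hcross, fun S hS => ?_⟩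
  have h1 : (S.card : ENNReal) ≤ liminf (fun n => crossingNumber g n c) atTop :=
    le_liminf_of_le (by isBoundedDefault)
      (eventually_card_le_crossingNumber hg hc3 fun t ht => hcross t (hS t ht).1 (hS t ht).2)
  refine (h1.trans hcle).trans ?_
  rw [laverage_eq, Measure.restrict_apply_univ, Real.volume_Ioo]
  gcongr
  refine (lintegral_liminf_le fun n => measurable_crossingNumber g n).trans ?_
  refine (liminf_le_liminf (v := fun _ : ℕ => M) (Eventually.of_forall fun n => ?_)).trans_eq
    (liminf_const _)
  exact (setLIntegral_le_lintegral _ _).trans (lintegral_crossingNumber_le hM n)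

/-! ### Hooks in a convex cell -/

/-- A strictly convex perturbation of a seminorm, centred at `o`. -/
noncomputable def strictify (n : Seminorm ℝ ℂ) (ε : ℝ) (o w : ℂ) : ℝ := n (w - o) + ε * ‖w - o‖

/-- The radial projection onto the unit sphere of the perturbed seminorm. -/
noncomputable def pushIn (n : Seminorm ℝ ℂ) (ε : ℝ) (o p : ℂ) : ℂ :=
  o + (strictify n ε o p)⁻¹ • (p - o)

section Hook

variable {n : Seminorm ℝ ℂ} {ε : ℝ} {o : ℂ}

theorem strictify_ray (w : ℂ) {r : ℝ} (hr : 0 ≤ r) :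
    strictify n ε o (o + r • (w - o)) = r * strictify n ε o w := by
  simp only [strictify, add_sub_cancel_left, map_smul_eq_mul, norm_smul, Real.norm_of_nonneg hr]
  ring

theorem seminorm_ray (w : ℂ) {r : ℝ} (hr : 0 ≤ r) : n (o + r • (w - o) - o) = r * n (w - o) := by
  rw [add_sub_cancel_left, map_smul_eq_mul, Real.norm_of_nonneg hr]

/-- If the gauge were at least `1` inside a chord, equality would hold in the triangle inequality
for the Euclidean norm, placing both ends on one ray from `o`. Points on one ray with gauge `1`
coincide. -/
theorem strictGauge_strictify (hε : 0 < ε) : StrictGauge (strictify n ε o) := by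
  intro x y hx hy hxy t ht
  have e : x + t * (y - x) - o = (1 - t) • (x - o) + t • (y - o) := by
    simp only [Complex.real_smul]; push_cast; ring
  have h1 : 0 < 1 - t := by linarith [ht.2]
  have hn1 : n ((1 - t) • (x - o) + t • (y - o)) ≤ (1 - t) * n (x - o) + t * n (y - o) := by
    refine (map_add_le_add n _ _).trans (le_of_eq ?_)
    rw [map_smul_eq_mul, map_smul_eq_mul, Real.norm_of_nonneg h1.le, Real.norm_of_nonneg ht.1.le]
  have hn2 : ‖(1 - t) • (x - o) + t • (y - o)‖ ≤ (1 - t) * ‖x - o‖ + t * ‖y - o‖ := by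
    refine (norm_add_le _ _).trans (le_of_eq ?_)
    rw [norm_smul, norm_smul, Real.norm_of_nonneg h1.le, Real.norm_of_nonneg ht.1.le]
  have hle : strictify n ε o (x + t * (y - x)) ≤
      (1 - t) * strictify n ε o x + t * strictify n ε o y := by
    simp only [strictify, e]
    have := mul_le_mul_of_nonneg_left hn2 hε.le
    linarith
  by_contra! hge
  have hx1 : strictify n ε o x = 1 := by
    refine le_antisymm hx (not_lt.1 fun h => ?_)
    have h3 := mul_lt_mul_of_pos_left h h1
    have h4 := mul_le_mul_of_nonneg_left hy ht.1.le
    linarith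
  have hy1 : strictify n ε o y = 1 := by
    refine le_antisymm hy (not_lt.1 fun h => ?_)
    have h3 := mul_le_mul_of_nonneg_left hx h1.le
    have h4 := mul_lt_mul_of_pos_left h ht.1
    linarith
  have hray : SameRay ℝ ((1 - t) • (x - o)) (t • (y - o)) := by
    rw [sameRay_iff_norm_add]
    refine le_antisymm (norm_add_le _ _) ?_
    rw [norm_smul, norm_smul, Real.norm_of_nonneg h1.le, Real.norm_of_nonneg ht.1.le]
    by_contra! hlt
    have h3 := mul_lt_mul_of_pos_left hlt hε
    have h4 : 1 ≤ n ((1 - t) • (x - o) + t • (y - o)) + ε * ‖(1 - t) • (x - o) + t • (y - o)‖ := by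
      rw [← e]; exact hge
    have h5 := congrArg (fun r => (1 - t) * r) hx1
    have h6 := congrArg (fun r => t * r) hy1
    simp only [strictify] at h5 h6
    linarith
  have hray' : SameRay ℝ (x - o) (y - o) := by
    have := (hray.pos_smul_left (inv_pos.2 h1)).pos_smul_right (inv_pos.2 ht.1)
    rwa [inv_smul_smul₀ h1.ne', inv_smul_smul₀ ht.1.ne'] at this
  have hxo : x - o ≠ 0 := fun h => by simp [strictify, h] at hx1
  obtain ⟨r, hr, hyr⟩ := hray'.exists_nonneg_left hxo
  have hy2 : y = o + r • (x - o) := by rw [hyr]; ring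
  rw [hy2, strictify_ray _ hr, hx1, mul_one] at hy1
  rw [hy1, one_smul] at hyr
  exact hxy (sub_left_injective hyr)

variable (hε : 0 < ε) {p p' : ℂ} (hp : n (p - o) = 1) (hp' : n (p' - o) = 1)

include hp in
theorem sub_ne_zero_of_seminorm_eq_one : p - o ≠ 0 := fun h => by
  rw [h, map_zero] at hp; exact one_ne_zero hp.symm

include hε hp in
theorem one_lt_strictify : 1 < strictify n ε o p := by
  have := norm_pos_iff.2 (sub_ne_zero_of_seminorm_eq_one hp)
  have := mul_pos hε this
  rw [strictify, hp]; linarith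

include hε hp in
theorem strictify_pushIn : strictify n ε o (pushIn n ε o p) = 1 := by
  have := one_lt_strictify hε hp
  rw [pushIn, strictify_ray _ (by positivity), inv_mul_cancel₀ (by linarith)]

include hp hp' in
theorem eq_of_ray_eq {r r' : ℝ} (hr : 0 ≤ r) (hr' : 0 < r')
    (h : o + r • (p - o) = o + r' • (p' - o)) : p = p' := by
  have h1 := congrArg (fun w => n (w - o)) h
  simp only [seminorm_ray _ hr, seminorm_ray _ hr'.le, hp, hp', mul_one] at h1
  rw [h1, add_right_inj] at h
  exact sub_left_injective (smul_right_injective ℂ hr'.ne' h)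

include hε hp hp' in
theorem pushIn_injective (h : pushIn n ε o p = pushIn n ε o p') : p = p' := by
  have h1 := one_lt_strictify hε hp
  have h2 := one_lt_strictify hε hp'
  exact eq_of_ray_eq hp hp' (r := (strictify n ε o p)⁻¹) (r' := (strictify n ε o p')⁻¹)
    (by positivity) (by positivity) h

include hε hp in
/-- The points on the segment between `p` and its radial projection. -/
theorem spike_point {s : ℝ} (hs : s ∈ Set.Icc (0 : ℝ) 1) :
    (∃ r : ℝ, 0 < r ∧ r ≤ 1 ∧ (s ≠ 0 → r < 1) ∧
      AffineMap.lineMap p (pushIn n ε o p) s = o + r • (p - o)) ∧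
    strictify n ε o (AffineMap.lineMap p (pushIn n ε o p) s) =
      strictify n ε o p - s * (strictify n ε o p - 1) := by
  have h1 := one_lt_strictify hε hp
  set N := strictify n ε o p
  have hN : N⁻¹ < 1 := inv_lt_one_of_one_lt₀ h1
  have hN0 : 0 < N⁻¹ := by positivity
  have e : AffineMap.lineMap p (pushIn n ε o p) s = o + (1 - s * (1 - N⁻¹)) • (p - o) := by
    rw [AffineMap.lineMap_apply_module', pushIn]
    change s • (o + N⁻¹ • (p - o) - p) + p = _
    module
  have hr : 0 < 1 - s * (1 - N⁻¹) := by nlinarith [hs.1, hs.2]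
  refine ⟨⟨_, hr, by nlinarith [hs.1], fun hs0 => ?_, e⟩, ?_⟩
  · have : 0 < s := lt_of_le_of_ne hs.1 hs0.symm
    nlinarith
  · rw [e, strictify_ray _ hr.le]
    change (1 - s * (1 - N⁻¹)) * N = _
    field_simp

-- The reason for perturbing the seminorm: in the rectangle itself a chord could run along a side,
-- whereas here it touches the boundary only at its ends.
include hε hp hp' in
theorem chord_point (hne : p ≠ p') {s : ℝ} (hs : s ∈ Set.Icc (0 : ℝ) 1) :
    strictify n ε o (AffineMap.lineMap (pushIn n ε o p) (pushIn n ε o p') s) ≤ 1 ∧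
    (strictify n ε o (AffineMap.lineMap (pushIn n ε o p) (pushIn n ε o p') s) = 1 → s = 0 ∨ s = 1) := by
  have e : AffineMap.lineMap (pushIn n ε o p) (pushIn n ε o p') s =
      pushIn n ε o p + (s : ℂ) * (pushIn n ε o p' - pushIn n ε o p) := by
    rw [AffineMap.lineMap_apply_module', Complex.real_smul]; ring
  rw [e]
  have hG := strictGauge_strictify (n := n) (o := o) hε
  have h1 := (strictify_pushIn hε hp).le
  have h2 := (strictify_pushIn hε hp').le
  exact ⟨hG.le_one h1 h2 hs,
    hG.endpoint h1 h2 (fun h => hne (pushIn_injective hε hp hp' h)) hs⟩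

-- Spikes lie on the rays from `o` through their outer ends, away from `o`, and distinct points of
-- the unit sphere lie on distinct rays.
include hε hp hp' in
theorem spike_disjoint_spike (hne : p ≠ p') {s s' : ℝ} (hs : s ∈ Set.Icc (0 : ℝ) 1)
    (hs' : s' ∈ Set.Icc (0 : ℝ) 1) : AffineMap.lineMap p (pushIn n ε o p) s ≠
      AffineMap.lineMap p' (pushIn n ε o p') s' := by
  intro h
  obtain ⟨⟨r, hr, -, -, e⟩, -⟩ := spike_point hε hp hs
  obtain ⟨⟨r', hr', -, -, e'⟩, -⟩ := spike_point hε hp' hs'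
  rw [e, e'] at h
  exact hne (eq_of_ray_eq hp hp' hr.le hr' h)

include hε hp in
theorem spike_injective {s s' : ℝ} (hs : s ∈ Set.Icc (0 : ℝ) 1) (hs' : s' ∈ Set.Icc (0 : ℝ) 1)
    (h : AffineMap.lineMap p (pushIn n ε o p) s = AffineMap.lineMap p (pushIn n ε o p) s') :
    s = s' := by
  have h1 := (spike_point hε hp hs).2
  rw [h, (spike_point hε hp hs').2] at h1
  have h2 := one_lt_strictify hε hp
  have : (s' - s) * (strictify n ε o p - 1) = 0 := by linarith
  rcases mul_eq_zero.1 this with h3 | h3 <;> linarith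

include hε hp in
/-- A spike meets a chord only if its inner end is an end of the chord. -/
theorem spike_meets_chord {a b : ℂ} (ha : n (a - o) = 1) (hb : n (b - o) = 1) (hab : a ≠ b)
    {s s' : ℝ} (hs : s ∈ Set.Icc (0 : ℝ) 1) (hs' : s' ∈ Set.Icc (0 : ℝ) 1)
    (h : AffineMap.lineMap p (pushIn n ε o p) s =
      AffineMap.lineMap (pushIn n ε o a) (pushIn n ε o b) s') :
    s = 1 ∧ ((s' = 0 ∧ p = a) ∨ (s' = 1 ∧ p = b)) := by
  -- The perturbed gauge is at least `1` on the spike and at most `1` on the chord, so they can only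
  -- meet where it equals `1`.
  have h1 := (spike_point hε hp hs).2
  have h2 := one_lt_strictify hε hp
  have h3 := (chord_point hε ha hb hab hs').1
  rw [← h, h1] at h3
  have hs1 : s = 1 := le_antisymm hs.2 (by nlinarith)
  refine ⟨hs1, ?_⟩
  have h4 : strictify n ε o (AffineMap.lineMap (pushIn n ε o a) (pushIn n ε o b) s') = 1 := by
    rw [← h, h1, hs1]; ring
  subst hs1
  rw [AffineMap.lineMap_apply_one] at h
  rcases (chord_point hε ha hb hab hs').2 h4 with rfl | rfl
  · rw [AffineMap.lineMap_apply_zero] at h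
    exact Or.inl ⟨rfl, pushIn_injective hε hp ha h⟩
  · rw [AffineMap.lineMap_apply_one] at h
    exact Or.inr ⟨rfl, pushIn_injective hε hp hb h⟩

/-- The vertices of the hook which enters a cell at `p` and leaves it at `p'`. -/
noncomputable def hookVertex (n : Seminorm ℝ ℂ) (ε : ℝ) (o p p' : ℂ) : ℕ → ℂ
  | 0 => p
  | 1 => pushIn n ε o p
  | 2 => pushIn n ε o p'
  | _ => p'

/-- The point at parameter `s` of the `i`-th piece of a hook. -/
noncomputable def hookPoint (n : Seminorm ℝ ℂ) (ε : ℝ) (o p p' : ℂ) (i : ℕ) (s : ℝ) : ℂ :=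
  AffineMap.lineMap (hookVertex n ε o p p' i) (hookVertex n ε o p p' (i + 1)) s

theorem hookPoint_zero (s : ℝ) :
    hookPoint n ε o p p' 0 s = AffineMap.lineMap p (pushIn n ε o p) s := rfl

theorem hookPoint_one (s : ℝ) : hookPoint n ε o p p' 1 s =
    AffineMap.lineMap (pushIn n ε o p) (pushIn n ε o p') s := rfl

theorem hookPoint_two (s : ℝ) :
    hookPoint n ε o p p' 2 s = AffineMap.lineMap p' (pushIn n ε o p') (1 - s) :=
  (AffineMap.lineMap_apply_one_sub p' (pushIn n ε o p') s).symm

theorem one_sub_mem_Icc {s : ℝ} (hs : s ∈ Set.Icc (0 : ℝ) 1) : 1 - s ∈ Set.Icc (0 : ℝ) 1 :=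
  ⟨by linarith [hs.2], by linarith [hs.1]⟩

-- The quantity `i + s` is compared, rather than the pair, because the end of one piece and the
-- beginning of the next are the same point.
include hε hp hp' in
theorem hookPoint_injective (hne : p ≠ p') {i j : ℕ} (hi : i < 3) (hj : j < 3) {s s' : ℝ}
    (hs : s ∈ Set.Icc (0 : ℝ) 1) (hs' : s' ∈ Set.Icc (0 : ℝ) 1)
    (h : hookPoint n ε o p p' i s = hookPoint n ε o p p' j s') : (i : ℝ) + s = j + s' := by
  have chord_inj : ∀ {s s' : ℝ}, hookPoint n ε o p p' 1 s = hookPoint n ε o p p' 1 s' → s = s' := by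
    intro s s' h
    rw [hookPoint_one, hookPoint_one] at h
    exact AffineMap.lineMap_injective ℝ (fun h => hne (pushIn_injective hε hp hp' h)) h
  have mixed01 : ∀ {s s' : ℝ}, s ∈ Set.Icc (0 : ℝ) 1 → s' ∈ Set.Icc (0 : ℝ) 1 →
      hookPoint n ε o p p' 0 s = hookPoint n ε o p p' 1 s' → s = 1 ∧ s' = 0 := by
    intro s s' hs hs' h
    rw [hookPoint_zero, hookPoint_one] at h
    obtain ⟨h1, ⟨h2, -⟩ | ⟨-, h2⟩⟩ := spike_meets_chord hε hp hp hp' hne hs hs' h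
    · exact ⟨h1, h2⟩
    · exact absurd h2 hne
  have mixed21 : ∀ {s s' : ℝ}, s ∈ Set.Icc (0 : ℝ) 1 → s' ∈ Set.Icc (0 : ℝ) 1 →
      hookPoint n ε o p p' 2 s = hookPoint n ε o p p' 1 s' → s = 0 ∧ s' = 1 := by
    intro s s' hs hs' h
    rw [hookPoint_two, hookPoint_one] at h
    obtain ⟨h1, ⟨-, h2⟩ | ⟨h2, -⟩⟩ := spike_meets_chord hε hp' hp hp' hne (one_sub_mem_Icc hs) hs' h
    · exact absurd h2.symm hne
    · exact ⟨by linarith, h2⟩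
  have mixed02 : ∀ {s s' : ℝ}, s ∈ Set.Icc (0 : ℝ) 1 → s' ∈ Set.Icc (0 : ℝ) 1 →
      hookPoint n ε o p p' 0 s ≠ hookPoint n ε o p p' 2 s' := by
    intro s s' hs hs'
    rw [hookPoint_zero, hookPoint_two]
    exact spike_disjoint_spike hε hp hp' hne hs (one_sub_mem_Icc hs')
  interval_cases i <;> interval_cases j
  · rw [spike_injective hε hp hs hs' h]
  · obtain ⟨rfl, rfl⟩ := mixed01 hs hs' h; simp
  · exact absurd h (mixed02 hs hs')
  · obtain ⟨rfl, rfl⟩ := mixed01 hs' hs h.symm; simp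
  · rw [chord_inj h]
  · obtain ⟨rfl, rfl⟩ := mixed21 hs' hs h.symm; norm_num
  · exact absurd h.symm (mixed02 hs' hs)
  · obtain ⟨rfl, rfl⟩ := mixed21 hs hs' h; norm_num
  · rw [hookPoint_two, hookPoint_two] at h
    have := spike_injective hε hp' (one_sub_mem_Icc hs) (one_sub_mem_Icc hs') h
    have : s = s' := by linarith
    rw [this]

-- Spikes from distinct boundary points avoid each other and all foreign chords automatically. Only
-- chord against chord needs topological input, isolated in `hchord`.
include hε hp hp' in
theorem hookPoint_disjoint (hne : p ≠ p') {a b : ℂ} (ha : n (a - o) = 1) (hb : n (b - o) = 1)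
    (hab : a ≠ b) (hpa : p ≠ a) (hpb : p ≠ b) (hpa' : p' ≠ a) (hpb' : p' ≠ b)
    (hchord : ∀ s ∈ Set.Icc (0 : ℝ) 1, ∀ s' ∈ Set.Icc (0 : ℝ) 1,
      hookPoint n ε o p p' 1 s ≠ hookPoint n ε o a b 1 s')
    {i j : ℕ} (hi : i < 3) (hj : j < 3) {s s' : ℝ}
    (hs : s ∈ Set.Icc (0 : ℝ) 1) (hs' : s' ∈ Set.Icc (0 : ℝ) 1) :
    hookPoint n ε o p p' i s ≠ hookPoint n ε o a b j s' := by
  have hspike : ∀ (p p' : ℂ), n (p - o) = 1 → n (p' - o) = 1 → ∀ {i : ℕ}, i < 3 → i ≠ 1 →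
      ∀ {s : ℝ}, s ∈ Set.Icc (0 : ℝ) 1 → ∃ w, (w = p ∨ w = p') ∧ ∃ s' ∈ Set.Icc (0 : ℝ) 1,
        hookPoint n ε o p p' i s = AffineMap.lineMap w (pushIn n ε o w) s' := by
    intro p p' _ _ i hi hi1 s hs
    interval_cases i
    · exact ⟨p, Or.inl rfl, s, hs, hookPoint_zero s⟩
    · exact absurd rfl hi1
    · exact ⟨p', Or.inr rfl, 1 - s, one_sub_mem_Icc hs, hookPoint_two s⟩
  have hw1 : ∀ w, (w = p ∨ w = p') → n (w - o) = 1 ∧ w ≠ a ∧ w ≠ b := by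
    rintro w (rfl | rfl)
    · exact ⟨hp, hpa, hpb⟩
    · exact ⟨hp', hpa', hpb'⟩
  intro h
  by_cases hi1 : i = 1
  · by_cases hj1 : j = 1
    · subst hi1 hj1
      exact hchord s hs s' hs' h
    · subst hi1
      obtain ⟨w, hw, r, hr, e⟩ := hspike a b ha hb hj hj1 hs'
      rw [e, hookPoint_one] at h
      have hwn : n (w - o) = 1 := by rcases hw with rfl | rfl <;> assumption
      obtain ⟨-, ⟨-, h2⟩ | ⟨-, h2⟩⟩ := spike_meets_chord hε hwn hp hp' hne hr hs h.symm
      · rcases hw with rfl | rfl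
        · exact hpa h2.symm
        · exact hpb h2.symm
      · rcases hw with rfl | rfl
        · exact hpa' h2.symm
        · exact hpb' h2.symm
  · obtain ⟨w, hw, r, hr, e⟩ := hspike p p' hp hp' hi hi1 hs
    obtain ⟨hwn, hwa, hwb⟩ := hw1 w hw
    rw [e] at h
    by_cases hj1 : j = 1
    · subst hj1
      rw [hookPoint_one] at h
      obtain ⟨-, ⟨-, h2⟩ | ⟨-, h2⟩⟩ := spike_meets_chord hε hwn ha hb hab hr hs' h
      · exact hwa h2
      · exact hwb h2
    · obtain ⟨w', hw', r', hr', e'⟩ := hspike a b ha hb hj hj1 hs'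
      rw [e'] at h
      rcases hw' with rfl | rfl
      · exact spike_disjoint_spike hε hwn ha hwa hr hr' h
      · exact spike_disjoint_spike hε hwn hb hwb hr hr' h

/-- A hook stays in the open cell, except for its ends. -/
theorem hookPoint_mem (hε : 0 < ε) (hp : n (p - o) = 1) (hp' : n (p' - o) = 1) (hne : p ≠ p')
    {i : ℕ} (hi : i < 3) {s : ℝ}
    (hs : s ∈ Set.Icc (0 : ℝ) 1) : n (hookPoint n ε o p p' i s - o) < 1 ∨
      (i = 0 ∧ s = 0 ∧ hookPoint n ε o p p' i s = p) ∨
      (i = 2 ∧ s = 1 ∧ hookPoint n ε o p p' i s = p') := by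
  interval_cases i
  · by_cases hs0 : s = 0
    · exact Or.inr (Or.inl ⟨rfl, hs0, by rw [hookPoint_zero, hs0, AffineMap.lineMap_apply_zero]⟩)
    · obtain ⟨⟨r, hr, -, hr1, e⟩, -⟩ := spike_point hε hp hs
      left
      rw [hookPoint_zero, e, seminorm_ray _ hr.le, hp, mul_one]
      exact hr1 hs0
  · left
    rw [hookPoint_one]
    have h1 := (chord_point hε hp hp' hne hs).1
    set x := AffineMap.lineMap (pushIn n ε o p) (pushIn n ε o p') s
    by_cases hx : x - o = 0
    · rw [hx, map_zero]; exact one_pos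
    · have : 0 < ε * ‖x - o‖ := mul_pos hε (norm_pos_iff.2 hx)
      rw [strictify] at h1
      linarith
  · by_cases hs0 : s = 1
    · exact Or.inr (Or.inr ⟨rfl, hs0, by
        rw [hookPoint_two, hs0, sub_self, AffineMap.lineMap_apply_zero]⟩)
    · obtain ⟨⟨r, hr, -, hr1, e⟩, -⟩ := spike_point hε hp' (one_sub_mem_Icc hs)
      left
      rw [hookPoint_two, e, seminorm_ray _ hr.le, hp', mul_one]
      exact hr1 (sub_ne_zero.2 (Ne.symm hs0))

end Hook

/-! ### Transport of arcs from a cell to the strictly convex body -/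

section Squeeze

variable {n : Seminorm ℝ ℂ} {ε : ℝ} {o : ℂ} (hn : Continuous n) (hn0 : ∀ w, n w = 0 → w = 0)

/-- A radial homeomorphism of the plane which maps the unit ball of a norm onto that of its strictly
convex perturbation. -/
noncomputable def squeeze (n : Seminorm ℝ ℂ) (ε : ℝ) (o w : ℂ) : ℂ :=
  o + (n (w - o) / strictify n ε o w) • (w - o)

theorem strictify_pos (hε : 0 < ε) {w : ℂ} (hw : w ≠ o) : 0 < strictify n ε o w := by
  have h1 : 0 < ‖w - o‖ := norm_pos_iff.2 (sub_ne_zero.2 hw)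
  exact add_pos_of_nonneg_of_pos (apply_nonneg n _) (mul_pos hε h1)

theorem strictify_squeeze (hε : 0 < ε) (w : ℂ) : strictify n ε o (squeeze n ε o w) = n (w - o) := by
  rcases eq_or_ne w o with rfl | hw
  · simp [squeeze, strictify]
  · have h1 := strictify_pos (n := n) hε hw
    rw [squeeze, strictify_ray _ (div_nonneg (apply_nonneg n _) h1.le), div_mul_cancel₀ _ h1.ne']

-- At the centre the quotient of the two gauges has no limit in general, but it is at most `1`, so
-- the displacement from the centre still tends to zero.
include hn in
theorem continuous_squeeze (hε : 0 < ε) : Continuous (squeeze n ε o) := by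
  have hN : Continuous (strictify n ε o) :=
    (hn.comp (continuous_sub_right o)).add ((continuous_sub_right o).norm.const_mul ε)
  rw [continuous_iff_continuousAt]
  intro w
  rcases eq_or_ne w o with rfl | hw
  · have h0 : squeeze n ε w w = w := by simp [squeeze]
    rw [ContinuousAt, h0, tendsto_iff_norm_sub_tendsto_zero]
    refine squeeze_zero (g := fun x => ‖x - w‖) (fun _ => norm_nonneg _) (fun x => ?_) ?_
    · rw [squeeze, add_sub_cancel_left, norm_smul]
      have h1 : 0 ≤ n (x - w) := apply_nonneg n _
      have h2 : 0 ≤ ε * ‖x - w‖ := by positivity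
      have h3 : ‖n (x - w) / strictify n ε w x‖ ≤ 1 := by
        unfold strictify
        rw [Real.norm_of_nonneg (div_nonneg h1 (add_nonneg h1 h2))]
        exact div_le_one_of_le₀ (by linarith) (add_nonneg h1 h2)
      nlinarith [norm_nonneg (x - w)]
    · have := (continuous_sub_right w).norm.tendsto w
      simpa using this
  · have h1 : strictify n ε o w ≠ 0 := by
      have : 0 < ‖w - o‖ := norm_pos_iff.2 (sub_ne_zero.2 hw)
      exact (add_pos_of_nonneg_of_pos (apply_nonneg n _) (mul_pos hε this)).ne'
    exact continuousAt_const.add ((((hn.comp (continuous_sub_right o)).continuousAt).div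
      hN.continuousAt h1).smul (continuous_sub_right o).continuousAt)

include hn0 in
theorem squeeze_injective (hε : 0 < ε) : Function.Injective (squeeze n ε o) := by
  have hpos : ∀ {w}, w ≠ o → 0 < n (w - o) / strictify n ε o w := fun {w} hw => by
    refine div_pos (lt_of_le_of_ne (apply_nonneg n _) fun h => ?_) (strictify_pos hε hw)
    exact hw (sub_eq_zero.1 (hn0 _ h.symm))
  have hcen : ∀ {w}, squeeze n ε o w = o → w = o := by
    intro w h
    by_contra hw
    rw [squeeze, add_eq_left, smul_eq_zero] at h
    rcases h with h | h
    · exact (hpos hw).ne' h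
    · exact hw (sub_eq_zero.1 h)
  have ho : squeeze n ε o o = o := by simp [squeeze]
  intro x y h
  by_cases hx : x = o
  · rw [hx, ho] at h
    rw [hx, hcen h.symm]
  by_cases hy : y = o
  · rw [hy, ho] at h
    rw [hy, hcen h]
  have cx := hpos hx
  have cy := hpos hy
  simp only [squeeze, add_right_inj] at h
  set a := n (x - o) / strictify n ε o x with ha
  set b := n (y - o) / strictify n ε o y with hb
  have hyx : y = o + (a / b) • (x - o) := by
    have : y - o = (a / b) • (x - o) := by
      rw [div_eq_inv_mul, ← smul_smul, h, smul_smul, inv_mul_cancel₀ cy.ne', one_smul]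
    rw [← this]; ring
  have hab : 0 < a / b := div_pos cx cy
  have hba : b = a := by
    rw [hb, hyx, seminorm_ray _ hab.le, strictify_ray _ hab.le, mul_div_mul_left _ _ hab.ne']
  rw [hba, div_self cx.ne', one_smul] at hyx
  rw [hyx]; ring

theorem squeeze_of_eq_one {w : ℂ} (hw : n (w - o) = 1) : squeeze n ε o w = pushIn n ε o w := by
  rw [squeeze, hw, one_div, pushIn]

include hn hn0 in
/-- Disjoint arcs in a cell have hooks with disjoint chords. -/
theorem hookPoint_chords_disjoint (hε : 0 < ε) {γ₁ γ₂ : ℝ → ℂ} (h₁ : Continuous γ₁)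
    (h₂ : Continuous γ₂) (b₁ : ∀ t, n (γ₁ t - o) ≤ 1) (b₂ : ∀ t, n (γ₂ t - o) ≤ 1)
    (e₁ : n (γ₁ 0 - o) = 1) (e₁' : n (γ₁ 1 - o) = 1) (e₂ : n (γ₂ 0 - o) = 1)
    (e₂' : n (γ₂ 1 - o) = 1) (d₁ : γ₁ 0 ≠ γ₁ 1) (d₂ : γ₂ 0 ≠ γ₂ 1) (d : ∀ s t, γ₁ s ≠ γ₂ t)
    {s s' : ℝ} (hs : s ∈ Set.Icc (0 : ℝ) 1) (hs' : s' ∈ Set.Icc (0 : ℝ) 1) :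
    hookPoint n ε o (γ₁ 0) (γ₁ 1) 1 s ≠ hookPoint n ε o (γ₂ 0) (γ₂ 1) 1 s' := by
  have hinj := squeeze_injective (n := n) (o := o) hn0 hε
  have hc := continuous_squeeze (n := n) (o := o) hn hε
  -- The squeezed arcs are still disjoint and end at the radial projections of the old endpoints, so
  -- the chords in question are the middle pieces of the hooks.
  have key := (strictGauge_strictify (n := n) (o := o) hε).chords_disjoint
    (γ₁ := fun t => squeeze n ε o (γ₁ t)) (γ₂ := fun t => squeeze n ε o (γ₂ t))
    (hc.comp h₁) (hc.comp h₂)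
    (fun t => by rw [strictify_squeeze hε]; exact b₁ t)
    (fun t => by rw [strictify_squeeze hε]; exact b₂ t)
    (by rw [strictify_squeeze hε]; exact e₁) (by rw [strictify_squeeze hε]; exact e₁')
    (by rw [strictify_squeeze hε]; exact e₂) (by rw [strictify_squeeze hε]; exact e₂')
    (hinj.ne d₁) (hinj.ne d₂) (fun s t => hinj.ne (d s t)) hs hs'
  simp only [squeeze_of_eq_one e₁, squeeze_of_eq_one e₁', squeeze_of_eq_one e₂,
    squeeze_of_eq_one e₂'] at key
  rw [hookPoint_one, hookPoint_one, AffineMap.lineMap_apply_module', AffineMap.lineMap_apply_module',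
    Complex.real_smul, Complex.real_smul, add_comm, add_comm (_ * _)]
  exact key

end Squeeze

/-! ### Chains of hooks -/

/-- The relative displacement `1 - N⁻¹` is at most `N - 1 = ε ‖p - o‖`. A small `ε` thus keeps the
inner vertices of a hook near the points where the curve meets the grid. -/
theorem norm_pushIn_sub_le {n : Seminorm ℝ ℂ} {ε : ℝ} {o p : ℂ} (hε : 0 < ε) (hp : n (p - o) = 1)
    {D : ℝ} (hD : ‖p - o‖ ≤ D) : ‖pushIn n ε o p - p‖ ≤ ε * D ^ 2 := by
  have h1 := one_lt_strictify hε hp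
  set N := strictify n ε o p with hN
  have hN0 : 0 < N := by linarith
  have e : pushIn n ε o p - p = (-(1 - N⁻¹)) • (p - o) := by
    rw [pushIn, ← hN]; module
  have h2 : 0 ≤ 1 - N⁻¹ := sub_nonneg.2 (inv_le_one_of_one_le₀ h1.le)
  have h3 : 1 - N⁻¹ ≤ ε * ‖p - o‖ := by
    have h4 : N = 1 + ε * ‖p - o‖ := by rw [hN, strictify, hp]
    have h5 : (1 - N⁻¹) * N = N - 1 := by field_simp
    nlinarith
  rw [e, norm_smul, norm_neg, Real.norm_of_nonneg h2]
  calc (1 - N⁻¹) * ‖p - o‖ ≤ ε * ‖p - o‖ * ‖p - o‖ := by gcongr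
    _ = ε * ‖p - o‖ ^ 2 := by ring
    _ ≤ _ := by gcongr

section Chain

variable {ι : Type*} (n : ι → Seminorm ℝ ℂ) (o : ι → ℂ) (ε : ℝ) (R : ℕ → ι) (p : ℕ → ℂ)

/-- The vertices of the chain of hooks through the points `p 0, p 1, …`, the `k`-th of which lies in
the cell `R k`. -/
noncomputable def chainVertex (i : ℕ) : ℂ :=
  hookVertex (n (R (i / 3))) ε (o (R (i / 3))) (p (i / 3)) (p (i / 3 + 1)) (i % 3)

variable {n o ε R p}

theorem chainVertex_three_mul (k : ℕ) : chainVertex n o ε R p (3 * k) = p k := by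
  rw [chainVertex, Nat.mul_div_cancel_left k (by norm_num), Nat.mul_mod_right]
  rfl

theorem chainVertex_add {k e : ℕ} (he : e ≤ 3) : chainVertex n o ε R p (3 * k + e) =
    hookVertex (n (R k)) ε (o (R k)) (p k) (p (k + 1)) e := by
  rcases eq_or_lt_of_le he with rfl | he
  · rw [show 3 * k + 3 = 3 * (k + 1) by ring, chainVertex_three_mul]
    rfl
  · have h1 : (3 * k + e) / 3 = k := by omega
    have h2 : (3 * k + e) % 3 = e := by omega
    rw [chainVertex, h1, h2]

theorem chain_point {k e : ℕ} (he : e < 3) (s : ℝ) :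
    AffineMap.lineMap (chainVertex n o ε R p (3 * k + e)) (chainVertex n o ε R p (3 * k + e + 1)) s =
      hookPoint (n (R k)) ε (o (R k)) (p k) (p (k + 1)) e s := by
  rw [add_assoc, chainVertex_add he.le, chainVertex_add he, hookPoint]

/-- Interior points of hooks lie in open cells and their ends in none, so hooks in different cells
meet at most in ends, which are distinct except for consecutive hooks. Hooks in the same cell are
never consecutive by `hadj`, and `hookPoint_disjoint` separates them. -/
theorem chain_injective (hε : 0 < ε) {m : ℕ} (h₀ : ∀ k < m, n (R k) (p k - o (R k)) = 1)
    (h₁ : ∀ k < m, n (R k) (p (k + 1) - o (R k)) = 1)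
    (hp : ∀ i ≤ m, ∀ j ≤ m, p i = p j → i = j)
    (hcell : ∀ a b : ι, ∀ x, n a (x - o a) < 1 → n b (x - o b) < 1 → a = b)
    (hout : ∀ i ≤ m, ∀ a, 1 ≤ n a (p i - o a))
    (hadj : ∀ k, k + 1 < m → R k ≠ R (k + 1))
    (hchord : ∀ j k, j + 1 < k → k < m → R j = R k → ∀ s ∈ Set.Icc (0 : ℝ) 1,
      ∀ s' ∈ Set.Icc (0 : ℝ) 1, hookPoint (n (R j)) ε (o (R j)) (p j) (p (j + 1)) 1 s ≠
        hookPoint (n (R k)) ε (o (R k)) (p k) (p (k + 1)) 1 s')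
    {i j : ℕ} (hi : i < 3 * m) (hj : j < 3 * m) {s s' : ℝ} (hs : s ∈ Set.Icc (0 : ℝ) 1)
    (hs' : s' ∈ Set.Icc (0 : ℝ) 1)
    (h : AffineMap.lineMap (chainVertex n o ε R p i) (chainVertex n o ε R p (i + 1)) s =
      AffineMap.lineMap (chainVertex n o ε R p j) (chainVertex n o ε R p (j + 1)) s') :
    (i : ℝ) + s = j + s' := by
  have hne : ∀ k < m, p k ≠ p (k + 1) := fun k hk he => by
    have := hp k hk.le (k + 1) hk he
    omega
  have core : ∀ k e k' e' : ℕ, k < m → k' < m → e < 3 → e' < 3 → k < k' →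
      ∀ s ∈ Set.Icc (0 : ℝ) 1, ∀ s' ∈ Set.Icc (0 : ℝ) 1,
      hookPoint (n (R k)) ε (o (R k)) (p k) (p (k + 1)) e s =
        hookPoint (n (R k')) ε (o (R k')) (p k') (p (k' + 1)) e' s' →
      k + 1 = k' ∧ e = 2 ∧ s = 1 ∧ e' = 0 ∧ s' = 0 := by
    intro k e k' e' hk hk' he he' hkk s hs s' hs' h
    have m1 := hookPoint_mem hε (h₀ k hk) (h₁ k hk) (hne k hk) he hs
    have m2 := hookPoint_mem hε (h₀ k' hk') (h₁ k' hk') (hne k' hk') he' hs'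
    rcases m1 with m1 | m1
    · exfalso
      rcases m2 with m2 | ⟨-, -, m2⟩ | ⟨-, -, m2⟩
      · have hR : R k = R k' := hcell _ _ _ m1 (by rw [h]; exact m2)
        have hkk' : k + 1 < k' := by
          refine lt_of_le_of_ne hkk fun he => ?_
          subst he
          exact hadj k hk' hR
        have hch := hchord k k' hkk' hk' hR
        have a1 := h₀ k' hk'
        have a2 := h₁ k' hk'
        rw [← hR] at a1 a2 h hch
        refine hookPoint_disjoint hε (h₀ k hk) (h₁ k hk) (hne k hk) a1 a2 (hne k' hk') ?_ ?_ ?_ ?_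
          hch he he' hs hs' h
        · exact fun he => by have := hp k hk.le k' hk'.le he; omega
        · exact fun he => by have := hp k hk.le (k' + 1) hk' he; omega
        · exact fun he => by have := hp (k + 1) hk k' hk'.le he; omega
        · exact fun he => by have := hp (k + 1) hk (k' + 1) hk' he; omega
      · rw [h, m2] at m1
        exact absurd m1 (not_lt.2 (hout k' hk'.le _))
      · rw [h, m2] at m1
        exact absurd m1 (not_lt.2 (hout (k' + 1) hk' _))
    · obtain ⟨i, hik, him, hpi⟩ : ∃ i, i ≤ k + 1 ∧ (i = k + 1 → e = 2 ∧ s = 1) ∧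
          hookPoint (n (R k)) ε (o (R k)) (p k) (p (k + 1)) e s = p i := by
        rcases m1 with ⟨-, -, m1⟩ | ⟨a, b, m1⟩
        · exact ⟨k, by omega, fun h => by omega, m1⟩
        · exact ⟨k + 1, le_rfl, fun _ => ⟨a, b⟩, m1⟩
      rcases m2 with m2 | ⟨b1, b2, m2⟩ | ⟨b1, b2, m2⟩
      · rw [← h, hpi] at m2
        exact absurd m2 (not_lt.2 (hout i (by omega) _))
      · have := hp i (by omega) k' hk'.le (by rw [← hpi, h, m2])
        have hi : i = k + 1 := by omega
        exact ⟨by omega, (him hi).1, (him hi).2, b1, b2⟩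
      · have := hp i (by omega) (k' + 1) hk' (by rw [← hpi, h, m2])
        omega
  have hi3 : 3 * (i / 3) + i % 3 = i := Nat.div_add_mod i 3
  have hj3 : 3 * (j / 3) + j % 3 = j := Nat.div_add_mod j 3
  have hi4 : i % 3 < 3 := Nat.mod_lt _ (by norm_num)
  have hj4 : j % 3 < 3 := Nat.mod_lt _ (by norm_num)
  have hik : i / 3 < m := by omega
  have hjk : j / 3 < m := by omega
  generalize i / 3 = k at *
  generalize i % 3 = e at *
  generalize j / 3 = k' at *
  generalize j % 3 = e' at *
  subst hi3 hj3
  rw [chain_point hi4, chain_point hj4] at h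
  rcases lt_trichotomy k k' with hkk | hkk | hkk
  · obtain ⟨rfl, rfl, rfl, rfl, rfl⟩ := core k e k' e' hik hjk hi4 hj4 hkk s hs s' hs' h
    push_cast; ring
  · subst hkk
    have := hookPoint_injective hε (h₀ k hik) (h₁ k hik) (hne k hik) hi4 hj4 hs hs' h
    push_cast; linarith
  · obtain ⟨rfl, rfl, rfl, rfl, rfl⟩ := core k' e' k e hjk hik hj4 hi4 hkk s' hs' s hs h.symm
    push_cast; ring

end Chain

/-! ### Rectangular cells -/

/-- The norm whose unit ball is the rectangle `(-α, α) × (-β, β)`. -/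
noncomputable def rectSeminorm (α β : ℝ) : Seminorm ℝ ℂ :=
  Seminorm.of (fun w => max (|w.re| / |α|) (|w.im| / |β|))
    (fun x y => by
      rw [Complex.add_re, Complex.add_im]
      refine max_le ?_ ?_
      · calc |x.re + y.re| / |α| ≤ (|x.re| + |y.re|) / |α| := by gcongr; exact abs_add_le _ _
          _ = |x.re| / |α| + |y.re| / |α| := add_div _ _ _
          _ ≤ _ := add_le_add (le_max_left _ _) (le_max_left _ _)
      · calc |x.im + y.im| / |β| ≤ (|x.im| + |y.im|) / |β| := by gcongr; exact abs_add_le _ _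
          _ = |x.im| / |β| + |y.im| / |β| := add_div _ _ _
          _ ≤ _ := add_le_add (le_max_right _ _) (le_max_right _ _))
    (fun r x => by
      simp only [Complex.smul_re, Complex.smul_im, smul_eq_mul, abs_mul, mul_div_assoc,
        Real.norm_eq_abs]
      exact (mul_max_of_nonneg _ _ (abs_nonneg r)).symm)

theorem rectSeminorm_apply (α β : ℝ) (w : ℂ) :
    rectSeminorm α β w = max (|w.re| / |α|) (|w.im| / |β|) := rfl

theorem continuous_rectSeminorm (α β : ℝ) : Continuous (rectSeminorm α β) := by
  have : Continuous fun w : ℂ => max (|w.re| / |α|) (|w.im| / |β|) := by fun_prop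
  exact this

theorem eq_zero_of_rectSeminorm {α β : ℝ} (hα : α ≠ 0) (hβ : β ≠ 0) {w : ℂ}
    (h : rectSeminorm α β w = 0) : w = 0 := by
  rw [rectSeminorm_apply] at h
  have h1 : |w.re| / |α| ≤ 0 := h ▸ le_max_left _ _
  have h2 : |w.im| / |β| ≤ 0 := h ▸ le_max_right _ _
  have h1' := (div_le_iff₀ (abs_pos.2 hα)).1 h1
  have h2' := (div_le_iff₀ (abs_pos.2 hβ)).1 h2
  rw [zero_mul] at h1' h2'
  exact Complex.ext (abs_nonpos_iff.1 h1') (abs_nonpos_iff.1 h2')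

/-- The seminorm attached to the cell `[a, a'] × [b, b']`. -/
noncomputable def cellSeminorm (a a' b b' : ℝ) : Seminorm ℝ ℂ :=
  rectSeminorm ((a' - a) / 2) ((b' - b) / 2)

/-- The centre of the cell `[a, a'] × [b, b']`. -/
noncomputable def cellCenter (a a' b b' : ℝ) : ℂ := ⟨(a + a') / 2, (b + b') / 2⟩

theorem cellSeminorm_lt_one_iff {a a' b b' : ℝ} (ha : a < a') (hb : b < b') (w : ℂ) :
    cellSeminorm a a' b b' (w - cellCenter a a' b b') < 1 ↔
      w.re ∈ Set.Ioo a a' ∧ w.im ∈ Set.Ioo b b' := by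
  have h1 : |(a' - a) / 2| = (a' - a) / 2 := abs_of_pos (by linarith)
  have h2 : |(b' - b) / 2| = (b' - b) / 2 := abs_of_pos (by linarith)
  rw [cellSeminorm, rectSeminorm_apply, max_lt_iff, h1, h2, div_lt_one (by linarith),
    div_lt_one (by linarith), abs_lt, abs_lt]
  simp only [cellCenter, Complex.sub_re, Complex.sub_im, Set.mem_Ioo]
  constructor
  · rintro ⟨⟨h1, h2⟩, h3, h4⟩
    exact ⟨⟨by linarith, by linarith⟩, by linarith, by linarith⟩
  · rintro ⟨⟨h1, h2⟩, h3, h4⟩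
    exact ⟨⟨by linarith, by linarith⟩, by linarith, by linarith⟩

theorem cellSeminorm_le_one_iff {a a' b b' : ℝ} (ha : a < a') (hb : b < b') (w : ℂ) :
    cellSeminorm a a' b b' (w - cellCenter a a' b b') ≤ 1 ↔
      w.re ∈ Set.Icc a a' ∧ w.im ∈ Set.Icc b b' := by
  have h1 : |(a' - a) / 2| = (a' - a) / 2 := abs_of_pos (by linarith)
  have h2 : |(b' - b) / 2| = (b' - b) / 2 := abs_of_pos (by linarith)
  rw [cellSeminorm, rectSeminorm_apply, max_le_iff, h1, h2, div_le_one (by linarith),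
    div_le_one (by linarith), abs_le, abs_le]
  simp only [cellCenter, Complex.sub_re, Complex.sub_im, Set.mem_Icc]
  constructor
  · rintro ⟨⟨h1, h2⟩, h3, h4⟩
    exact ⟨⟨by linarith, by linarith⟩, by linarith, by linarith⟩
  · rintro ⟨⟨h1, h2⟩, h3, h4⟩
    exact ⟨⟨by linarith, by linarith⟩, by linarith, by linarith⟩

theorem norm_sub_le_of_cell {a a' b b' r : ℝ} {w w' : ℂ} (ha : a' - a ≤ r) (hb : b' - b ≤ r)
    (hw : w.re ∈ Set.Icc a a' ∧ w.im ∈ Set.Icc b b')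
    (hw' : w'.re ∈ Set.Icc a a' ∧ w'.im ∈ Set.Icc b b') : ‖w - w'‖ ≤ 2 * r := by
  refine (Complex.norm_le_abs_re_add_abs_im _).trans ?_
  have h1 : |(w - w').re| ≤ r := by
    rw [Complex.sub_re, abs_le]
    constructor <;> linarith [hw.1.1, hw.1.2, hw'.1.1, hw'.1.2]
  have h2 : |(w - w').im| ≤ r := by
    rw [Complex.sub_im, abs_le]
    constructor <;> linarith [hw.2.1, hw.2.2, hw'.2.1, hw'.2.2]
  linarith

/-! ### Grids transversal to a curve -/

theorem exists_finset_of_card_le {A : Set ℝ} {K : ℕ}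
    (h : ∀ S : Finset ℝ, (∀ t ∈ S, t ∈ A) → S.card ≤ K) :
    ∃ S : Finset ℝ, (∀ t, t ∈ S ↔ t ∈ A) ∧ S.card ≤ K := by
  have hA : A.Finite := by
    by_contra hinf
    obtain ⟨S, hS, hc⟩ := Set.Infinite.exists_subset_card_eq hinf (K + 1)
    have := h S fun t ht => hS ht
    omega
  exact ⟨hA.toFinset, fun t => hA.mem_toFinset, h _ fun t ht => hA.mem_toFinset.1 ht⟩

/-- The values of `g` pass from one side of `c` to the other at each preimage of `c`. -/
def TransversalAt (g : ℝ → ℝ) (c : ℝ) : Prop :=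
  ∀ t ∈ Set.Ioo (0 : ℝ) 1, g t = c → ∀ δ > 0,
    (∃ s ∈ Set.Ioo (t - δ) (t + δ) ∩ Set.Ioo 0 1, g s < c) ∧
    ∃ s ∈ Set.Ioo (t - δ) (t + δ) ∩ Set.Ioo 0 1, c < g s

/-- One generic level is taken in each interval of length `r`. As all these intervals have the same
length, the bound on the number of preimages does not depend on the level. -/
theorem exists_levels {g : ℝ → ℝ} (hg : ContinuousOn g (Set.Ioo 0 1)) {M : ENNReal}
    (hM : eVariationOn g (Set.Ioo 0 1) ≤ M) (hMt : M ≠ ⊤) {r : ℝ} (hr : 0 < r) :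
    ∃ c : ℤ → ℝ, (∀ i : ℤ, c i ∈ Set.Ioo (i * r) ((i + 1) * r)) ∧ (∀ i, TransversalAt g (c i)) ∧
      ∀ i, ∃ A : Finset ℝ, (∀ t, t ∈ A ↔ t ∈ Set.Ioo (0 : ℝ) 1 ∧ g t = c i) ∧
        A.card ≤ ⌊(M / ENNReal.ofReal r).toReal⌋₊ := by
  have key : ∀ i : ℤ, ∃ c ∈ Set.Ioo (i * r) ((i + 1) * r), TransversalAt g c ∧
      ∀ S : Finset ℝ, (∀ t ∈ S, t ∈ Set.Ioo (0 : ℝ) 1 ∧ g t = c) →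
        (S.card : ENNReal) ≤ M / ENNReal.ofReal ((i + 1) * r - i * r) := fun i =>
    exists_transversal_level hg hM (by nlinarith)
  choose c hc ht hS using key
  refine ⟨c, hc, ht, fun i => exists_finset_of_card_le (A := {t | t ∈ Set.Ioo (0 : ℝ) 1 ∧ g t = c i})
    fun S hSm => ?_⟩
  have h1 := hS i S hSm
  rw [show ((i : ℝ) + 1) * r - i * r = r by ring] at h1
  have h2 : M / ENNReal.ofReal r ≠ ⊤ := ENNReal.div_ne_top hMt (by simpa using hr)
  have h3 := ENNReal.toReal_mono h2 h1
  rw [ENNReal.toReal_natCast] at h3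
  exact Nat.le_floor h3

section Slots

variable {c : ℤ → ℝ} {r : ℝ} (hc : ∀ i : ℤ, c i ∈ Set.Ioo (i * r) ((i + 1) * r))

include hc in
theorem strictMono_levels : StrictMono c := by
  refine strictMono_int_of_lt_succ fun i => (hc i).2.trans ?_
  have := (hc (i + 1)).1
  push_cast at this
  exact this

include hc in
theorem exists_slot (hr : 0 < r) {x : ℝ} (hx : ∀ i, x ≠ c i) : ∃ i, x ∈ Set.Ioo (c i) (c (i + 1)) := by
  set i := ⌊x / r⌋
  have h1 : i * r ≤ x := (le_div_iff₀ hr).1 (Int.floor_le _)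
  have h2 : x < (i + 1) * r := (div_lt_iff₀ hr).1 (Int.lt_floor_add_one _)
  -- The level `c i` lies somewhere in the interval of `x`, so `x` is in slot `i - 1` or `i`
  -- according to its side.
  rcases lt_or_gt_of_ne (hx i) with h | h
  · refine ⟨i - 1, ?_, by rwa [sub_add_cancel]⟩
    have := (hc (i - 1)).2
    push_cast at this
    rw [sub_add_cancel] at this
    linarith
  · refine ⟨i, h, h2.trans ?_⟩
    have := (hc (i + 1)).1
    push_cast at this
    exact this

include hc in
theorem slot_unique {x : ℝ} {i j : ℤ} (hi : x ∈ Set.Ioo (c i) (c (i + 1)))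
    (hj : x ∈ Set.Ioo (c j) (c (j + 1))) : i = j := by
  have hm := strictMono_levels hc
  have h1 := hm.lt_iff_lt.1 (hi.1.trans hj.2)
  have h2 := hm.lt_iff_lt.1 (hj.1.trans hi.2)
  omega

include hc in
theorem level_notMem_slot (i j : ℤ) : c j ∉ Set.Ioo (c i) (c (i + 1)) := fun h => by
  have hm := strictMono_levels hc
  have h1 := hm.lt_iff_lt.1 h.1
  have h2 := hm.lt_iff_lt.1 h.2
  omega

include hc in
theorem slot_width (i : ℤ) : c (i + 1) - c i ≤ 2 * r := by
  have h1 := (hc i).1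
  have h2 := (hc (i + 1)).2
  push_cast at h2
  linarith

include hc in
theorem exists_slot_on (hr : 0 < r) {g : ℝ → ℝ} {a b : ℝ} (hab : a < b) (hg : ContinuousOn g (Set.Ioo a b))
    (h : ∀ t ∈ Set.Ioo a b, ∀ i, g t ≠ c i) : ∃ i, ∀ t ∈ Set.Ioo a b, g t ∈ Set.Ioo (c i) (c (i + 1)) := by
  have hm : (a + b) / 2 ∈ Set.Ioo a b := ⟨by linarith, by linarith⟩
  obtain ⟨i, hi⟩ := exists_slot hc hr (h _ hm)
  refine ⟨i, fun t ht => ⟨?_, ?_⟩⟩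
  · by_contra! hcon
    obtain ⟨s, hs, e⟩ := isPreconnected_Ioo.intermediate_value ht hm hg ⟨hcon, hi.1.le⟩
    exact h s hs i e
  · by_contra! hcon
    obtain ⟨s, hs, e⟩ := isPreconnected_Ioo.intermediate_value hm ht hg ⟨hi.2.le, hcon⟩
    exact h s hs (i + 1) e

end Slots

theorem mem_Icc_of_mem_Ioo {g : ℝ → ℝ} (hg : ContinuousOn g (Set.Ioo 0 1)) {a b x y : ℝ} (hab : a < b)
    (h : ∀ t ∈ Set.Ioo a b, g t ∈ Set.Ioo x y) {t : ℝ} (ht : t ∈ Set.Icc a b)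
    (ht' : t ∈ Set.Ioo (0 : ℝ) 1) : g t ∈ Set.Icc x y := by
  have h1 : t ∈ closure (Set.Ioo a b) := by rwa [closure_Ioo hab.ne]
  have h2 : ContinuousWithinAt g (Set.Ioo a b) t :=
    (hg.continuousAt (isOpen_Ioo.mem_nhds ht')).continuousWithinAt
  have h3 := h2.mem_closure_image h1
  refine closure_minimal ?_ isClosed_Icc h3
  rintro _ ⟨s, hs, rfl⟩
  exact Set.Ioo_subset_Icc_self (h s hs)

/-- The sorted enumeration of a finite set of numbers. -/
theorem exists_enumeration (T : Finset ℝ) : ∃ τ : ℕ → ℝ, (∀ k < T.card, τ k ∈ T) ∧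
    (∀ j k, j < k → k < T.card → τ j < τ k) ∧ ∀ t ∈ T, ∃ k < T.card, τ k = t := by
  refine ⟨fun k => if h : k < T.card then T.orderEmbOfFin rfl ⟨k, h⟩ else 0, fun k hk => ?_,
    fun j k hjk hk => ?_, fun t ht => ?_⟩
  · simp only [hk, dif_pos]; exact T.orderEmbOfFin_mem rfl _
  · simp only [hk, hjk.trans hk, dif_pos]
    exact (T.orderEmbOfFin rfl).strictMono hjk
  · have : t ∈ Set.range (T.orderEmbOfFin rfl) := by rw [Finset.range_orderEmbOfFin]; exact ht
    obtain ⟨k, hk⟩ := this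
    exact ⟨k, k.2, by simp only [k.2, dif_pos]; exact hk⟩

/-! ### Replacing a curve by a chain of hooks -/

/-- The seminorm attached to the cell `[c i, c (i + 1)] × [d j, d (j + 1)]` of a grid. -/
noncomputable def gridSeminorm (c d : ℤ → ℝ) (R : ℤ × ℤ) : Seminorm ℝ ℂ :=
  cellSeminorm (c R.1) (c (R.1 + 1)) (d R.2) (d (R.2 + 1))

/-- The centre of the cell `[c i, c (i + 1)] × [d j, d (j + 1)]` of a grid. -/
noncomputable def gridCenter (c d : ℤ → ℝ) (R : ℤ × ℤ) : ℂ :=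
  cellCenter (c R.1) (c (R.1 + 1)) (d R.2) (d (R.2 + 1))

section Grid

variable {c d : ℤ → ℝ} {r : ℝ} (hc : ∀ i : ℤ, c i ∈ Set.Ioo (i * r) ((i + 1) * r))
  (hd : ∀ i : ℤ, d i ∈ Set.Ioo (i * r) ((i + 1) * r))

include hc hd

theorem gridSeminorm_lt_one_iff (R : ℤ × ℤ) (w : ℂ) :
    gridSeminorm c d R (w - gridCenter c d R) < 1 ↔
      w.re ∈ Set.Ioo (c R.1) (c (R.1 + 1)) ∧ w.im ∈ Set.Ioo (d R.2) (d (R.2 + 1)) :=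
  cellSeminorm_lt_one_iff (strictMono_levels hc (by omega)) (strictMono_levels hd (by omega)) w

theorem gridSeminorm_le_one_iff (R : ℤ × ℤ) (w : ℂ) :
    gridSeminorm c d R (w - gridCenter c d R) ≤ 1 ↔
      w.re ∈ Set.Icc (c R.1) (c (R.1 + 1)) ∧ w.im ∈ Set.Icc (d R.2) (d (R.2 + 1)) :=
  cellSeminorm_le_one_iff (strictMono_levels hc (by omega)) (strictMono_levels hd (by omega)) w

theorem eq_zero_of_gridSeminorm (R : ℤ × ℤ) (w : ℂ) (h : gridSeminorm c d R w = 0) : w = 0 := by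
  have h1 : c R.1 < c (R.1 + 1) := strictMono_levels hc (by omega)
  have h2 : d R.2 < d (R.2 + 1) := strictMono_levels hd (by omega)
  exact eq_zero_of_rectSeminorm (by linarith) (by linarith) h

theorem grid_cell_unique (R S : ℤ × ℤ) (w : ℂ) (h : gridSeminorm c d R (w - gridCenter c d R) < 1)
    (h' : gridSeminorm c d S (w - gridCenter c d S) < 1) : R = S := by
  rw [gridSeminorm_lt_one_iff hc hd] at h h'
  exact Prod.ext (slot_unique hc h.1 h'.1) (slot_unique hd h.2 h'.2)

theorem one_le_gridSeminorm {w : ℂ} (hw : (∃ l, w.re = c l) ∨ ∃ l, w.im = d l) (R : ℤ × ℤ) :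
    1 ≤ gridSeminorm c d R (w - gridCenter c d R) := by
  by_contra! h
  rw [gridSeminorm_lt_one_iff hc hd] at h
  rcases hw with ⟨l, e⟩ | ⟨l, e⟩
  · exact level_notMem_slot hc R.1 l (e ▸ h.1)
  · exact level_notMem_slot hd R.2 l (e ▸ h.2)

theorem norm_sub_le_of_grid {R : ℤ × ℤ} {w w' : ℂ}
    (h : gridSeminorm c d R (w - gridCenter c d R) ≤ 1)
    (h' : gridSeminorm c d R (w' - gridCenter c d R) ≤ 1) : ‖w - w'‖ ≤ 4 * r := by
  rw [gridSeminorm_le_one_iff hc hd] at h h'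
  have := norm_sub_le_of_cell (slot_width hc R.1) (slot_width hd R.2) h h'
  linarith

theorem exists_grid_cell (hr : 0 < r) {Y : ℝ → ℂ} (hY : ContinuousOn Y (Set.Ioo 0 1)) {a b : ℝ}
    (ha : 0 ≤ a) (hab : a < b) (hb : b ≤ 1)
    (h : ∀ t ∈ Set.Ioo a b, ¬ ((∃ l, (Y t).re = c l) ∨ ∃ l, (Y t).im = d l)) :
    ∃ R : ℤ × ℤ, (∀ t ∈ Set.Ioo a b, gridSeminorm c d R (Y t - gridCenter c d R) < 1) ∧
      ∀ t ∈ Set.Icc a b, t ∈ Set.Ioo (0 : ℝ) 1 → gridSeminorm c d R (Y t - gridCenter c d R) ≤ 1 := by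
  have hsub : Set.Ioo a b ⊆ Set.Ioo 0 1 := Set.Ioo_subset_Ioo ha hb
  have hre : ContinuousOn (fun t => (Y t).re) (Set.Ioo 0 1) := Complex.continuous_re.comp_continuousOn hY
  have him : ContinuousOn (fun t => (Y t).im) (Set.Ioo 0 1) := Complex.continuous_im.comp_continuousOn hY
  obtain ⟨i, hi⟩ := exists_slot_on hc hr hab (hre.mono hsub) fun t ht i e => h t ht (Or.inl ⟨i, e⟩)
  obtain ⟨j, hj⟩ := exists_slot_on hd hr hab (him.mono hsub) fun t ht i e => h t ht (Or.inr ⟨i, e⟩)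
  refine ⟨(i, j), fun t ht => (gridSeminorm_lt_one_iff hc hd _ _).2 ⟨hi t ht, hj t ht⟩,
    fun t ht ht' => (gridSeminorm_le_one_iff hc hd _ _).2
      ⟨mem_Icc_of_mem_Ioo hre hab hi ht ht', mem_Icc_of_mem_Ioo him hab hj ht ht'⟩⟩

-- Near a transversal crossing there are times on both sides of the level, and both values would lie
-- in one slot, which would then contain the level. This forces consecutive passages into different
-- cells.
omit hd in
theorem TransversalAt.not_slot {g : ℝ → ℝ} {a t b : ℝ} {i l : ℤ} (h : TransversalAt g (c l))
    (ht : t ∈ Set.Ioo (0 : ℝ) 1) (hat : a < t) (htb : t < b) (hgt : g t = c l)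
    (h₁ : ∀ s ∈ Set.Ioo a t, g s ∈ Set.Ioo (c i) (c (i + 1)))
    (h₂ : ∀ s ∈ Set.Ioo t b, g s ∈ Set.Ioo (c i) (c (i + 1))) : False := by
  obtain ⟨⟨s, hs, hs'⟩, s₂, hs₂, hs₂'⟩ :=
    h t ht hgt (min (t - a) (b - t)) (lt_min (by linarith) (by linarith))
  have key : ∀ s ∈ Set.Ioo (t - min (t - a) (b - t)) (t + min (t - a) (b - t)), g s ≠ c l →
      g s ∈ Set.Ioo (c i) (c (i + 1)) := by
    intro s hs hne
    have e1 := min_le_left (t - a) (b - t)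
    have e2 := min_le_right (t - a) (b - t)
    rcases lt_trichotomy s t with h | h | h
    · exact h₁ s ⟨by linarith [hs.1], h⟩
    · exact absurd (h ▸ hgt) hne
    · exact h₂ s ⟨h, by linarith [hs.2]⟩
  exact level_notMem_slot hc i l ⟨(key s hs.1 hs'.ne).1.trans hs', hs₂'.trans (key s₂ hs₂.1 hs₂'.ne').2⟩

end Grid

theorem abs_level_le {c : ℤ → ℝ} {r B : ℝ} (hr : 0 < r)
    (hc : ∀ i : ℤ, c i ∈ Set.Ioo (i * r) ((i + 1) * r)) {i : ℤ} (h : |c i| ≤ B) :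
    i ∈ Finset.Icc (-(⌈B / r⌉₊ + 1 : ℤ)) (⌈B / r⌉₊ + 1) := by
  have h1 := hc i
  have h2 := abs_le.1 h
  have h3 : B ≤ ⌈B / r⌉₊ * r := (div_le_iff₀ hr).1 (Nat.le_ceil _)
  rw [Finset.mem_Icc]
  constructor
  · have : (-(⌈B / r⌉₊ + 1 : ℤ) : ℝ) < (i : ℝ) + 1 := by
      push_cast
      by_contra! hcon
      nlinarith [h1.2]
    have : -(⌈B / r⌉₊ + 1 : ℤ) < i + 1 := by exact_mod_cast this
    omega
  · have : (i : ℝ) < (⌈B / r⌉₊ + 1 : ℤ) := by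
      push_cast
      by_contra! hcon
      nlinarith [h1.1]
    have : i < (⌈B / r⌉₊ + 1 : ℤ) := by exact_mod_cast this
    omega

/-- Only levels of modulus at most `B` can be met, and their indices lie between `-(⌈B / r⌉ + 1)`
and `⌈B / r⌉ + 1`, whence the factor `2 ⌈B / r⌉ + 3`. -/
theorem exists_crossings {g : ℝ → ℝ} {c : ℤ → ℝ} {r B : ℝ} (hr : 0 < r)
    (hc : ∀ i : ℤ, c i ∈ Set.Ioo (i * r) ((i + 1) * r)) {K : ℕ} (hB : ∀ t ∈ Set.Ioo (0 : ℝ) 1, |g t| ≤ B)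
    (h : ∀ i, ∃ A : Finset ℝ, (∀ t, t ∈ A ↔ t ∈ Set.Ioo (0 : ℝ) 1 ∧ g t = c i) ∧ A.card ≤ K) :
    ∃ T : Finset ℝ, (∀ t, t ∈ T ↔ t ∈ Set.Ioo (0 : ℝ) 1 ∧ ∃ i, g t = c i) ∧
      T.card ≤ (2 * ⌈B / r⌉₊ + 3) * K := by
  choose A hA hAK using h
  set Q := ⌈B / r⌉₊ with hQ
  refine ⟨(Finset.Icc (-(Q + 1 : ℤ)) (Q + 1)).biUnion A, fun t => ?_, ?_⟩
  · rw [Finset.mem_biUnion]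
    constructor
    · rintro ⟨i, -, hi⟩
      exact ⟨((hA i t).1 hi).1, i, ((hA i t).1 hi).2⟩
    · rintro ⟨ht, i, hi⟩
      exact ⟨i, abs_level_le hr hc (hi ▸ hB t ht), (hA i t).2 ⟨ht, hi⟩⟩
  · refine (Finset.card_biUnion_le_card_mul _ _ K fun i _ => hAK i).trans ?_
    rw [Int.card_Icc]
    gcongr
    omega

/-- A polygon with vertices `U 0, …, U n` and without self-intersections which follows the curve `Y`
along the partition `θ` of `[0, 1]`. -/
structure SimpleChain {E : Type*} [NormedAddCommGroup E] [NormedSpace ℝ E] (Y : ℝ → E) (ρ η : ℝ)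
    (n : ℕ) (θ : ℕ → ℝ) (U : ℕ → E) : Prop where
  one_lt : 1 < n
  zero : θ 0 = 0
  last : θ n = 1
  le_succ : ∀ j < n, θ j ≤ θ (j + 1)
  mem : ∀ j, 0 < j → j < n → θ j ∈ Set.Ioo (0 : ℝ) 1
  simple : ∀ i < n, ∀ j < n, ∀ s ∈ Set.Icc (0 : ℝ) 1, ∀ s' ∈ Set.Icc (0 : ℝ) 1,
    AffineMap.lineMap (U i) (U (i + 1)) s = AffineMap.lineMap (U j) (U (j + 1)) s' →
      (i : ℝ) + s = j + s'
  near : ∀ j, 0 < j → j < n → ‖U j - Y (θ j)‖ ≤ η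
  near_first : ‖U 1 - U 0‖ ≤ η
  near_last : ‖U n - U (n - 1)‖ ≤ η
  close : ∀ j < n, ∀ s ∈ Set.Icc (0 : ℝ) 1, ∀ t ∈ Set.Icc (θ j) (θ (j + 1)), t ∈ Set.Ioo (0 : ℝ) 1 →
    ‖AffineMap.lineMap (U j) (U (j + 1)) s - Y t‖ ≤ ρ

/-- The times at which the chain of hooks through the points of a curve at the times `τ 0, …, τ m`
passes its vertices. -/
noncomputable def chainTime (τ : ℕ → ℝ) (m i : ℕ) : ℝ :=
  if i = 0 then 0 else if i = 3 * m then 1 else τ ((i + 1) / 3)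

/-- Vertices `3k - 1`, `3k` and `3k + 1` share the time `τ k`, so inner spikes take no time. The
extreme vertices have times `0` and `1` instead, so that the first and last spikes absorb the ends
of the curve. -/
theorem chainTime_of {τ : ℕ → ℝ} {m i : ℕ} (h : 0 < i) (h' : i < 3 * m) :
    chainTime τ m i = τ ((i + 1) / 3) := by
  rw [chainTime, if_neg h.ne', if_neg h'.ne]

theorem exists_pos_lt_three (j : ℕ) : ∃ k e, e < 3 ∧ j = 3 * k + e :=
  ⟨j / 3, j % 3, Nat.mod_lt _ (by norm_num), (Nat.div_add_mod j 3).symm⟩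

/-- The `m + 1` crossings delimit `m` passages, each inside one cell and replaced by a hook.
Passages in the same cell are disjoint arcs because the curve is injective, which makes their chords
disjoint. -/
theorem simpleChain_of_crossings {Y : ℝ → ℂ} (hY : ContinuousOn Y (Set.Ioo 0 1))
    (hinj : Set.InjOn Y (Set.Ioo 0 1)) {c d : ℤ → ℝ} {r : ℝ} (hr : 0 < r)
    (hc : ∀ i : ℤ, c i ∈ Set.Ioo (i * r) ((i + 1) * r))
    (hd : ∀ i : ℤ, d i ∈ Set.Ioo (i * r) ((i + 1) * r))
    (hct : ∀ i, TransversalAt (fun t => (Y t).re) (c i))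
    (hdt : ∀ i, TransversalAt (fun t => (Y t).im) (d i)) {m : ℕ} (hm : 0 < m) {τ : ℕ → ℝ}
    (hτ : ∀ k ≤ m, τ k ∈ Set.Ioo (0 : ℝ) 1) (hτm : ∀ j k, j < k → k ≤ m → τ j < τ k)
    (hcr : ∀ t ∈ Set.Ioo (0 : ℝ) 1, ((∃ l, (Y t).re = c l) ∨ ∃ l, (Y t).im = d l) ↔
      ∃ k ≤ m, τ k = t) {η : ℝ} (hη : 0 < η) :
    ∃ U, SimpleChain Y (8 * r) η (3 * m) (chainTime τ m) U := by
  have hnc : ∀ t ∈ Set.Ioo (0 : ℝ) 1, (∀ k ≤ m, τ k ≠ t) →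
      ¬ ((∃ l, (Y t).re = c l) ∨ ∃ l, (Y t).im = d l) := fun t ht h h' => by
    obtain ⟨k, hk, e⟩ := (hcr t ht).1 h'
    exact h k hk e
  have hτle : ∀ j k, j ≤ k → k ≤ m → τ j ≤ τ k := fun j k h hk => by
    rcases h.eq_or_lt with rfl | h
    · rfl
    · exact (hτm j k h hk).le
  have hcell : ∀ k, ∃ R : ℤ × ℤ, k < m →
      (∀ t ∈ Set.Ioo (τ k) (τ (k + 1)), gridSeminorm c d R (Y t - gridCenter c d R) < 1) ∧
      ∀ t ∈ Set.Icc (τ k) (τ (k + 1)), t ∈ Set.Ioo (0 : ℝ) 1 →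
        gridSeminorm c d R (Y t - gridCenter c d R) ≤ 1 := by
    intro k
    by_cases hk : k < m
    · have h0 := hτ k hk.le
      have h1 := hτ (k + 1) hk
      obtain ⟨R, hR⟩ := exists_grid_cell hc hd hr hY h0.1.le (hτm k (k + 1) k.lt_succ_self hk) h1.2.le
        fun t ht => hnc t ⟨h0.1.trans ht.1, ht.2.trans h1.2⟩ fun i hi e => by
          subst e
          rcases Nat.lt_or_ge k i with h | h
          · exact absurd ht.2 (not_lt.2 (hτle _ _ h hi))
          · exact absurd ht.1 (not_lt.2 (hτle _ _ h hk.le))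
      exact ⟨R, fun _ => hR⟩
    · exact ⟨(0, 0), fun h => absurd h hk⟩
  choose R hR using hcell
  -- The curve before the first and after the last crossing gets no hook, but it stays in one cell
  -- adjacent to that crossing.
  obtain ⟨RL, -, hRL⟩ := exists_grid_cell hc hd hr hY le_rfl (hτ 0 m.zero_le).1 (hτ 0 m.zero_le).2.le
    fun t ht => hnc t ⟨ht.1, ht.2.trans (hτ 0 m.zero_le).2⟩ fun i hi e => by
      subst e; exact absurd ht.2 (not_lt.2 (hτle _ _ i.zero_le hi))
  obtain ⟨RR, -, hRR⟩ := exists_grid_cell hc hd hr hY (hτ m le_rfl).1.le (hτ m le_rfl).2 le_rfl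
    fun t ht => hnc t ⟨(hτ m le_rfl).1.trans ht.1, ht.2⟩ fun i hi e => by
      subst e; exact absurd ht.1 (not_lt.2 (hτle _ _ hi le_rfl))
  set p : ℕ → ℂ := fun k => Y (τ k) with hp
  have hcross : ∀ k ≤ m, (∃ l, (p k).re = c l) ∨ ∃ l, (p k).im = d l := fun k hk =>
    (hcr _ (hτ k hk)).2 ⟨k, hk, rfl⟩
  have hle : ∀ k < m, τ k ≤ τ (k + 1) := fun k hk => (hτm k (k + 1) k.lt_succ_self hk).le
  have hout : ∀ i ≤ m, ∀ a, 1 ≤ gridSeminorm c d a (p i - gridCenter c d a) := fun i hi a =>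
    one_le_gridSeminorm hc hd (hcross i hi) a
  have h₀' : ∀ k < m, gridSeminorm c d (R k) (p k - gridCenter c d (R k)) ≤ 1 := fun k hk =>
    (hR k hk).2 _ ⟨le_rfl, hle k hk⟩ (hτ k hk.le)
  have h₁' : ∀ k < m, gridSeminorm c d (R k) (p (k + 1) - gridCenter c d (R k)) ≤ 1 := fun k hk =>
    (hR k hk).2 _ ⟨hle k hk, le_rfl⟩ (hτ (k + 1) hk)
  have h₀ : ∀ k < m, gridSeminorm c d (R k) (p k - gridCenter c d (R k)) = 1 := fun k hk =>
    le_antisymm (h₀' k hk) (hout k hk.le _)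
  have h₁ : ∀ k < m, gridSeminorm c d (R k) (p (k + 1) - gridCenter c d (R k)) = 1 := fun k hk =>
    le_antisymm (h₁' k hk) (hout (k + 1) hk _)
  have hpinj : ∀ i ≤ m, ∀ j ≤ m, p i = p j → i = j := fun i hi j hj e => by
    have e' := hinj (hτ i hi) (hτ j hj) e
    rcases lt_trichotomy i j with h | h | h
    · exact absurd e' (hτm i j h hj).ne
    · exact h
    · exact absurd e' (hτm j i h hi).ne'
  -- Consecutive passages in one cell would keep the curve in the same slot on both sides of a
  -- transversal crossing.
  have hadj : ∀ k, k + 1 < m → R k ≠ R (k + 1) := by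
    intro k hk e
    have hk' : k < m := by omega
    have g1 := (hR k hk').1
    have g2 := (hR (k + 1) hk).1
    rw [← e] at g2
    simp only [gridSeminorm_lt_one_iff hc hd] at g1 g2
    rcases hcross (k + 1) hk' with ⟨l, hl⟩ | ⟨l, hl⟩
    · exact (hct l).not_slot hc (hτ (k + 1) hk') (hτm k (k + 1) (by omega) hk')
        (hτm (k + 1) (k + 1 + 1) (by omega) hk) hl (fun s hs => (g1 s hs).1) fun s hs => (g2 s hs).1
    · exact (hdt l).not_slot hd (hτ (k + 1) hk') (hτm k (k + 1) (by omega) hk')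
        (hτm (k + 1) (k + 1 + 1) (by omega) hk) hl (fun s hs => (g1 s hs).2) fun s hs => (g2 s hs).2
  -- The passage, reparametrized by `[0, 1]` and frozen outside it, since the topological lemma
  -- takes arcs defined on the whole line.
  have hγ : ∀ k < m, ∃ γ : ℝ → ℂ, Continuous γ ∧ γ 0 = p k ∧ γ 1 = p (k + 1) ∧
      ∀ t, ∃ s ∈ Set.Icc (τ k) (τ (k + 1)), s ∈ Set.Ioo (0 : ℝ) 1 ∧ γ t = Y s := by
    intro k hk
    have hcl : Continuous (clampTo 0 1) := by unfold clampTo; fun_prop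
    have hmem : ∀ t, τ k + (τ (k + 1) - τ k) * clampTo 0 1 t ∈ Set.Icc (τ k) (τ (k + 1)) := fun t => by
      have h1 := clampTo_mem zero_le_one t
      have h2 := hle k hk
      constructor <;> nlinarith [h1.1, h1.2]
    have hmem' : ∀ t, τ k + (τ (k + 1) - τ k) * clampTo 0 1 t ∈ Set.Ioo (0 : ℝ) 1 := fun t =>
      ⟨(hτ k hk.le).1.trans_le (hmem t).1, (hmem t).2.trans_lt (hτ (k + 1) hk).2⟩
    refine ⟨fun t => Y (τ k + (τ (k + 1) - τ k) * clampTo 0 1 t),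
      hY.comp_continuous (by fun_prop) hmem', ?_, ?_, fun t => ⟨_, hmem t, hmem' t, rfl⟩⟩
    · simp [clampTo, hp]
    · simp [clampTo, hp]
  have hr4 : 0 < 4 * r := by linarith
  -- Points of a cell are within `4r` of its centre, so this choice displaces the inner vertices by
  -- at most `η`.
  set ε : ℝ := η / (4 * r) ^ 2 with hε
  have hε0 : 0 < ε := by positivity
  have hchord : ∀ j k, j + 1 < k → k < m → R j = R k → ∀ s ∈ Set.Icc (0 : ℝ) 1,
      ∀ s' ∈ Set.Icc (0 : ℝ) 1,
      hookPoint (gridSeminorm c d (R j)) ε (gridCenter c d (R j)) (p j) (p (j + 1)) 1 s ≠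
        hookPoint (gridSeminorm c d (R k)) ε (gridCenter c d (R k)) (p k) (p (k + 1)) 1 s' := by
    intro j k hjk hk e s hs s' hs'
    have hj : j < m := by omega
    obtain ⟨γ, a1, a2, a3, a4⟩ := hγ j hj
    obtain ⟨δ, b1, b2, b3, b4⟩ := hγ k hk
    have c1 := h₀ k hk
    have c2 := h₁ k hk
    have c3 := (hR k hk).2
    rw [← e] at c1 c2 c3 ⊢
    rw [← a2, ← a3, ← b2, ← b3]
    refine hookPoint_chords_disjoint (continuous_rectSeminorm _ _)
      (eq_zero_of_gridSeminorm hc hd (R j)) hε0 a1 b1 (fun t => ?_) (fun t => ?_)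
      (a2 ▸ h₀ j hj) (a3 ▸ h₁ j hj) (b2 ▸ c1) (b3 ▸ c2) ?_ ?_ (fun t t' => ?_) hs hs'
    · obtain ⟨x, hx, hx', ex⟩ := a4 t
      rw [ex]; exact (hR j hj).2 x hx hx'
    · obtain ⟨x, hx, hx', ex⟩ := b4 t
      rw [ex]; exact c3 x hx hx'
    · rw [a2, a3]
      exact fun h => by have := hpinj j hj.le (j + 1) hj h; omega
    · rw [b2, b3]
      exact fun h => by have := hpinj k hk.le (k + 1) hk h; omega
    · obtain ⟨x, hx, hx', ex⟩ := a4 t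
      obtain ⟨y, hy, hy', ey⟩ := b4 t'
      rw [ex, ey]
      intro h
      have h1 := hinj hx' hy' h
      have h2 := hτm (j + 1) k hjk hk.le
      linarith [hx.2, hy.1]
  have hcen : ∀ a, gridSeminorm c d a (gridCenter c d a - gridCenter c d a) ≤ 1 := fun a => by
    rw [sub_self, map_zero]; exact zero_le_one
  have hpush : ∀ a, ∀ q, gridSeminorm c d a (q - gridCenter c d a) = 1 →
      ‖pushIn (gridSeminorm c d a) ε (gridCenter c d a) q - q‖ ≤ η := fun a q hq => by
    refine (norm_pushIn_sub_le hε0 hq (norm_sub_le_of_grid hc hd hq.le (hcen a))).trans_eq ?_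
    rw [hε]; field_simp
  refine ⟨chainVertex (gridSeminorm c d) (gridCenter c d) ε R p, ⟨by omega, by simp [chainTime], ?_,
    fun j hj => ?_, fun j hj hj' => ?_, fun i hi j hj s hs s' hs' h =>
      chain_injective hε0 h₀ h₁ hpinj (fun a b x => grid_cell_unique hc hd a b x) hout hadj hchord hi hj
        hs hs' h, fun j hj hj' => ?_, ?_, ?_, fun j hj s hs t ht ht' => ?_⟩⟩
  · simp [chainTime, hm.ne']
  · rcases Nat.eq_zero_or_pos j with rfl | hj0
    · have : chainTime τ m 0 = 0 := by simp [chainTime]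
      rw [this, chainTime_of (by omega) (by omega)]
      exact (hτ _ (by omega)).1.le
    · rw [chainTime_of hj0 hj]
      rcases (Nat.succ_le_of_lt hj).eq_or_lt with h | h
      · have : chainTime τ m (j + 1) = 1 := by
          rw [chainTime, if_neg (by omega), if_pos (by omega)]
        rw [this]
        exact (hτ _ (by omega)).2.le
      · rw [chainTime_of (by omega) h]
        exact hτle _ _ (by omega) (by omega)
  · rw [chainTime_of hj hj']
    exact hτ _ (by omega)
  · rw [chainTime_of hj hj']
    obtain ⟨k, e, he, rfl⟩ := exists_pos_lt_three j
    have hk : k < m := by omega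
    rw [chainVertex_add he.le]
    interval_cases e
    · rw [show (3 * k + 0 + 1) / 3 = k by omega]
      simp [hookVertex, hp, hη.le]
    · rw [show (3 * k + 1 + 1) / 3 = k by omega]
      exact hpush _ _ (h₀ k hk)
    · rw [show (3 * k + 2 + 1) / 3 = k + 1 by omega]
      exact hpush _ _ (h₁ k hk)
  · have e0 := chainVertex_add (n := gridSeminorm c d) (o := gridCenter c d) (ε := ε) (R := R) (p := p)
      (k := 0) (e := 0) (by norm_num)
    have e1 := chainVertex_add (n := gridSeminorm c d) (o := gridCenter c d) (ε := ε) (R := R) (p := p)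
      (k := 0) (e := 1) (by norm_num)
    rw [mul_zero, zero_add] at e0 e1
    rw [e0, e1]
    exact hpush _ _ (h₀ 0 hm)
  · obtain ⟨k, rfl⟩ : ∃ k, m = k + 1 := ⟨m - 1, by omega⟩
    rw [chainVertex_three_mul, show 3 * (k + 1) - 1 = 3 * k + 2 by omega, chainVertex_add (by norm_num),
      norm_sub_rev]
    exact hpush _ _ (h₁ k k.lt_succ_self)
  · obtain ⟨k, e, he, rfl⟩ := exists_pos_lt_three j
    have hk : k < m := by omega
    rw [chain_point he]
    have hx : gridSeminorm c d (R k) (hookPoint (gridSeminorm c d (R k)) ε (gridCenter c d (R k)) (p k)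
        (p (k + 1)) e s - gridCenter c d (R k)) ≤ 1 := by
      rcases hookPoint_mem hε0 (h₀ k hk) (h₁ k hk) (fun h => by
        have := hpinj k hk.le (k + 1) hk h; omega) he hs with h | ⟨-, -, h⟩ | ⟨-, -, h⟩
      · exact h.le
      · rw [h]; exact h₀' k hk
      · rw [h]; exact h₁' k hk
    have hin : t ∈ Set.Icc (τ k) (τ (k + 1)) → ‖hookPoint (gridSeminorm c d (R k)) ε
        (gridCenter c d (R k)) (p k) (p (k + 1)) e s - Y t‖ ≤ 8 * r := fun h =>
      (norm_sub_le_of_grid hc hd hx ((hR k hk).2 t h ht')).trans (by linarith)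
    -- Two cells with a common point `q` are compared through it, at distance `4r + 4r`; this is the
    -- origin of the constant `8r`.
    have hvia : ∀ (a : ℤ × ℤ) (q : ℂ), gridSeminorm c d (R k) (q - gridCenter c d (R k)) ≤ 1 →
        gridSeminorm c d a (q - gridCenter c d a) ≤ 1 →
        gridSeminorm c d a (Y t - gridCenter c d a) ≤ 1 → ‖hookPoint (gridSeminorm c d (R k)) ε
        (gridCenter c d (R k)) (p k) (p (k + 1)) e s - Y t‖ ≤ 8 * r := fun a q h h' h'' => by
      refine (norm_sub_le_norm_sub_add_norm_sub _ q _).trans ?_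
      linarith [norm_sub_le_of_grid hc hd hx h, norm_sub_le_of_grid hc hd h' h'']
    have hτk := hle k hk
    interval_cases e
    · rw [chainTime_of (i := 3 * k + 0 + 1) (by omega) (by omega),
        show (3 * k + 0 + 1 + 1) / 3 = k by omega] at ht
      rcases Nat.eq_zero_or_pos k with rfl | hk0
      · rw [show chainTime τ m (3 * 0 + 0) = 0 by simp [chainTime]] at ht
        exact hvia RL (p 0) (h₀' 0 hk) (hRL _ ⟨(hτ 0 hk.le).1.le, le_rfl⟩ (hτ 0 hk.le)) (hRL t ht ht')
      · rw [chainTime_of (by omega) (by omega), show (3 * k + 0 + 1) / 3 = k by omega] at ht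
        exact hin ⟨ht.1, ht.2.trans hτk⟩
    · rw [chainTime_of (by omega) (by omega), chainTime_of (by omega) (by omega),
        show (3 * k + 1 + 1) / 3 = k by omega, show (3 * k + 1 + 1 + 1) / 3 = k + 1 by omega] at ht
      exact hin ht
    · rw [chainTime_of (i := 3 * k + 2) (by omega) (by omega),
        show (3 * k + 2 + 1) / 3 = k + 1 by omega] at ht
      rcases hk.nat_succ_le.eq_or_lt with h | h
      · rw [show chainTime τ m (3 * k + 2 + 1) = 1 by
          rw [chainTime, if_neg (by omega), if_pos (by omega)]] at ht
        have e : k + 1 = m := h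
        rw [e] at ht
        exact hvia RR (p m) (by rw [← e]; exact h₁' k hk)
          (hRR _ ⟨le_rfl, (hτ m le_rfl).2.le⟩ (hτ m le_rfl)) (hRR t ht ht')
      · rw [chainTime_of (by omega) (by omega), show (3 * k + 2 + 1 + 1) / 3 = k + 1 by omega] at ht
        exact hin ⟨hτk.trans ht.1, ht.2⟩

/-- A curve without self-intersections is followed by a simple polygon, with a number of vertices
controlled by the variation of the curve. -/
theorem exists_simpleChain {M : ENNReal} (hM : M ≠ ⊤) {r : ℝ} (hr : 0 < r) (B : ℝ) :
    ∃ N : ℕ, ∀ Y : ℝ → ℂ, ContinuousOn Y (Set.Ioo 0 1) → Set.InjOn Y (Set.Ioo 0 1) →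
      eVariationOn Y (Set.Ioo 0 1) ≤ M → (∀ t ∈ Set.Ioo (0 : ℝ) 1, ‖Y t‖ ≤ B) → ∀ η > 0,
      (∀ t ∈ Set.Ioo (0 : ℝ) 1, ∀ t' ∈ Set.Ioo (0 : ℝ) 1, ‖Y t - Y t'‖ ≤ 8 * r) ∨
      ∃ n θ U, n ≤ N ∧ SimpleChain Y (8 * r) η n θ U := by
  -- Three edges per passage, and two families of grid lines, each met at most as often as
  -- `exists_crossings` allows. The bound does not involve `η` or the particular curve.
  refine ⟨3 * (2 * ((2 * ⌈B / r⌉₊ + 3) * ⌊(M / ENNReal.ofReal r).toReal⌋₊)), fun Y hY hinj hMY hB η hη => ?_⟩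
  have hre : ContinuousOn (fun t => (Y t).re) (Set.Ioo 0 1) := Complex.continuous_re.comp_continuousOn hY
  have him : ContinuousOn (fun t => (Y t).im) (Set.Ioo 0 1) := Complex.continuous_im.comp_continuousOn hY
  have hvre : eVariationOn (fun t => (Y t).re) (Set.Ioo 0 1) ≤ M := by
    refine le_trans ?_ hMY
    have := (LipschitzWith.of_dist_le_mul (K := 1) (f := Complex.re) fun x y => by
      rw [NNReal.coe_one, one_mul, dist_eq_norm, dist_eq_norm, ← Complex.sub_re]
      exact Complex.abs_re_le_norm _).lipschitzOnWith.comp_eVariationOn_le (Set.mapsTo_univ Y (Set.Ioo 0 1))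
    simpa [Function.comp_def] using this
  have hvim : eVariationOn (fun t => (Y t).im) (Set.Ioo 0 1) ≤ M := by
    refine le_trans ?_ hMY
    have := (LipschitzWith.of_dist_le_mul (K := 1) (f := Complex.im) fun x y => by
      rw [NNReal.coe_one, one_mul, dist_eq_norm, dist_eq_norm, ← Complex.sub_im]
      exact Complex.abs_im_le_norm _).lipschitzOnWith.comp_eVariationOn_le (Set.mapsTo_univ Y (Set.Ioo 0 1))
    simpa [Function.comp_def] using this
  obtain ⟨c, hc, hct, hcA⟩ := exists_levels hre hvre hM hr
  obtain ⟨d, hd, hdt, hdA⟩ := exists_levels him hvim hM hr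
  obtain ⟨T₁, hT₁, hT₁c⟩ := exists_crossings hr hc
    (fun t ht => (Complex.abs_re_le_norm _).trans (hB t ht)) hcA
  obtain ⟨T₂, hT₂, hT₂c⟩ := exists_crossings hr hd
    (fun t ht => (Complex.abs_im_le_norm _).trans (hB t ht)) hdA
  have hT : ∀ t, t ∈ T₁ ∪ T₂ ↔ t ∈ Set.Ioo (0 : ℝ) 1 ∧
      ((∃ l, (Y t).re = c l) ∨ ∃ l, (Y t).im = d l) := fun t => by
    rw [Finset.mem_union, hT₁, hT₂, and_or_left]
  have hTc : (T₁ ∪ T₂).card ≤ 2 * ((2 * ⌈B / r⌉₊ + 3) * ⌊(M / ENNReal.ofReal r).toReal⌋₊) := by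
    have := Finset.card_union_le T₁ T₂
    omega
  generalize T₁ ∪ T₂ = T at hT hTc
  obtain ⟨τ, hτ, hτm, hτs⟩ := exists_enumeration T
  rcases Nat.lt_or_ge 1 T.card with h | h
  · right
    obtain ⟨U, hU⟩ := simpleChain_of_crossings hY hinj hr hc hd hct hdt (m := T.card - 1) (by omega)
      (τ := τ) (fun k hk => ((hT _).1 (hτ k (by omega))).1) (fun j k hjk hk => hτm j k hjk (by omega))
      (fun t ht => ⟨fun h' => by
        obtain ⟨k, hk, e⟩ := hτs t ((hT t).2 ⟨ht, h'⟩)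
        exact ⟨k, by omega, e⟩, fun ⟨k, hk, e⟩ => e ▸ ((hT _).1 (hτ k (by omega))).2⟩) hη
    exact ⟨_, _, U, by omega, hU⟩
  · left
    -- With at most one crossing there is no passage to replace; the curve then lies in two cells
    -- having the point at `t₀` in common, so its diameter is at most `8r`.
    obtain ⟨t₀, ht₀, hu⟩ : ∃ t₀ ∈ Set.Ioo (0 : ℝ) 1, ∀ t ∈ T, t = t₀ := by
      rcases T.eq_empty_or_nonempty with rfl | ⟨t₀, h₀⟩
      · exact ⟨1 / 2, by norm_num, by simp⟩
      · exact ⟨t₀, ((hT _).1 h₀).1, fun t ht => Finset.card_le_one.1 h t ht t₀ h₀⟩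
    obtain ⟨RL, -, hRL⟩ := exists_grid_cell hc hd hr hY le_rfl ht₀.1 ht₀.2.le
      fun t ht h' => ht.2.ne (hu t ((hT t).2 ⟨⟨ht.1, ht.2.trans ht₀.2⟩, h'⟩))
    obtain ⟨RR, -, hRR⟩ := exists_grid_cell hc hd hr hY ht₀.1.le ht₀.2 le_rfl
      fun t ht h' => ht.1.ne' (hu t ((hT t).2 ⟨⟨ht₀.1.trans ht.1, ht.2⟩, h'⟩))
    have key : ∀ t ∈ Set.Ioo (0 : ℝ) 1, ‖Y t - Y t₀‖ ≤ 4 * r := fun t ht => by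
      rcases le_total t t₀ with h | h
      · exact norm_sub_le_of_grid hc hd (hRL t ⟨ht.1.le, h⟩ ht) (hRL t₀ ⟨ht₀.1.le, le_rfl⟩ ht₀)
      · exact norm_sub_le_of_grid hc hd (hRR t ⟨h, ht.2.le⟩ ht) (hRR t₀ ⟨le_rfl, ht₀.2.le⟩ ht₀)
    intro t ht t' ht'
    refine (norm_sub_le_norm_sub_add_norm_sub _ (Y t₀) _).trans ?_
    rw [norm_sub_rev (Y t₀)]
    linarith [key t ht, key t' ht']

theorem LinearIsometryEquiv.map_lineMap {E F : Type*} [NormedAddCommGroup E] [NormedSpace ℝ E]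
    [NormedAddCommGroup F] [NormedSpace ℝ F] (L : E ≃ₗᵢ[ℝ] F) (a b : E) (s : ℝ) :
    L (AffineMap.lineMap a b s) = AffineMap.lineMap (L a) (L b) s := by
  simp [AffineMap.lineMap_apply_module, map_add]

theorem SimpleChain.map {E F : Type*} [NormedAddCommGroup E] [NormedSpace ℝ E]
    [NormedAddCommGroup F] [NormedSpace ℝ F] (L : E ≃ₗᵢ[ℝ] F) {Y : ℝ → E} {ρ η : ℝ} {n : ℕ}
    {θ : ℕ → ℝ} {U : ℕ → E} (h : SimpleChain Y ρ η n θ U) :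
    SimpleChain (fun t => L (Y t)) ρ η n θ fun j => L (U j) where
  one_lt := h.one_lt
  zero := h.zero
  last := h.last
  le_succ := h.le_succ
  mem := h.mem
  simple i hi j hj s hs s' hs' e := by
    rw [← L.map_lineMap, ← L.map_lineMap] at e
    exact h.simple i hi j hj s hs s' hs' (L.injective e)
  near j hj hj' := by rw [← map_sub, L.norm_map]; exact h.near j hj hj'
  near_first := by rw [← map_sub, L.norm_map]; exact h.near_first
  near_last := by rw [← map_sub, L.norm_map]; exact h.near_last
  close j hj s hs t ht ht' := by
    rw [← L.map_lineMap, ← map_sub, L.norm_map]; exact h.close j hj s hs t ht ht'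

/-- A curve in the plane without self-intersections is followed by a simple polygon, with a number of
vertices controlled by the variation of the curve. -/
theorem exists_simpleChain_plane {M : ENNReal} (hM : M ≠ ⊤) {r : ℝ} (hr : 0 < r) (B : ℝ) :
    ∃ N : ℕ, ∀ Y : ℝ → Plane, ContinuousOn Y (Set.Ioo 0 1) → Set.InjOn Y (Set.Ioo 0 1) →
      eVariationOn Y (Set.Ioo 0 1) ≤ M → (∀ t ∈ Set.Ioo (0 : ℝ) 1, ‖Y t‖ ≤ B) → ∀ η > 0,
      (∀ t ∈ Set.Ioo (0 : ℝ) 1, ∀ t' ∈ Set.Ioo (0 : ℝ) 1, ‖Y t - Y t'‖ ≤ 8 * r) ∨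
      ∃ n θ U, n ≤ N ∧ SimpleChain Y (8 * r) η n θ U := by
  have L : Plane ≃ₗᵢ[ℝ] ℂ := Complex.orthonormalBasisOneI.repr.symm
  obtain ⟨N, hN⟩ := exists_simpleChain hM hr B
  refine ⟨N, fun Y hY hinj hMY hB η hη => ?_⟩
  have hv : eVariationOn (fun t => L (Y t)) (Set.Ioo 0 1) ≤ M := by
    have := L.isometry.lipschitz.lipschitzOnWith.comp_eVariationOn_le (Set.mapsTo_univ Y (Set.Ioo 0 1))
    rw [ENNReal.coe_one, one_mul] at this
    exact this.trans hMY
  rcases hN (fun t => L (Y t)) (L.continuous.comp_continuousOn hY)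
    (fun t ht t' ht' h => hinj ht ht' (L.injective h)) hv
    (fun t ht => by rw [L.norm_map]; exact hB t ht) η hη with h | ⟨n, θ, U, hn, h⟩
  · exact Or.inl fun t ht t' ht' => by
      have := h t ht t' ht'
      rwa [← map_sub, L.norm_map] at this
  · refine Or.inr ⟨n, θ, fun j => L.symm (U j), hn, ?_⟩
    have := h.map L.symm
    simpa using this

theorem exists_mem_Icc_succ {T : ℕ → ℝ} {n : ℕ} (hn : 0 < n) {t : ℝ} (ht : t ∈ Set.Icc (T 0) (T n)) :
    ∃ j < n, t ∈ Set.Icc (T j) (T (j + 1)) := by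
  induction n with
  | zero => omega
  | succ n ih =>
    rcases le_total t (T n) with h | h
    · rcases Nat.eq_zero_or_pos n with rfl | h0
      · exact ⟨0, by omega, ht.1, ht.2⟩
      · obtain ⟨j, hj, hj'⟩ := ih h0 ⟨ht.1, h⟩
        exact ⟨j, by omega, hj'⟩
    · exact ⟨n, by omega, h, ht.2⟩

/-- The polygon with vertices `U j` at the times `T j`. -/
theorem exists_polygon {T : ℕ → ℝ} (hT : ∀ j, T j < T (j + 1)) (U : ℕ → Plane) (n : ℕ) :
    ∃ z : ℝ → Plane, ∀ j < n, ∀ t ∈ Set.Icc (T j) (T (j + 1)),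
      z t = AffineMap.lineMap (U j) (U (j + 1)) ((t - T j) / (T (j + 1) - T j)) := by
  have hTm : StrictMono T := strictMono_nat_of_lt_succ hT
  induction n with
  | zero => exact ⟨0, by simp⟩
  | succ n ih =>
    obtain ⟨z, hz⟩ := ih
    refine ⟨fun t => if t < T n then z t else
      AffineMap.lineMap (U n) (U (n + 1)) ((t - T n) / (T (n + 1) - T n)), fun j hj t ht => ?_⟩
    rcases Nat.lt_succ_iff_lt_or_eq.1 hj with h | rfl
    · dsimp only
      split_ifs with hlt
      · exact hz j h t ht
      · have h1 : T (j + 1) ≤ T n := hTm.monotone h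
        have h2 : T (j + 1) = T n := le_antisymm h1 ((not_lt.1 hlt).trans ht.2)
        have h3 : j + 1 = n := hTm.injective h2
        have h4 : t = T (j + 1) := le_antisymm ht.2 (h2 ▸ not_lt.1 hlt)
        subst h3
        rw [h4, sub_self, zero_div, AffineMap.lineMap_apply_zero, div_self (sub_pos.2 (hT j)).ne',
          AffineMap.lineMap_apply_one]
    · exact if_neg (not_lt.2 ht.1)

theorem PolygonCost.of_vertices (G : Plane → ℝ) {T : ℕ → ℝ} (hT : ∀ j, T j < T (j + 1)) (U : ℕ → Plane)
    {z : ℝ → Plane} {n : ℕ} (hn : 0 < n) (hz : ∀ j < n, ∀ t ∈ Set.Icc (T j) (T (j + 1)),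
      z t = AffineMap.lineMap (U j) (U (j + 1)) ((t - T j) / (T (j + 1) - T j))) :
    PolygonCost (fun c r => r = G c) z (T 0) (T n)
      (∑ j ∈ Finset.range n, (T (j + 1) - T j) * G ((T (j + 1) - T j)⁻¹ • (U (j + 1) - U j))) := by
  have seg : ∀ j < n, PolygonCost (fun c r => r = G c) z (T j) (T (j + 1))
      ((T (j + 1) - T j) * G ((T (j + 1) - T j)⁻¹ • (U (j + 1) - U j))) := fun j hj => by
    refine .segment (c := (T (j + 1) - T j)⁻¹ • (U (j + 1) - U j)) (hT j) (fun t ht => ?_) rfl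
    rw [hz j hj t ht, hz j hj _ (Set.left_mem_Icc.2 (hT j).le), sub_self, zero_div,
      AffineMap.lineMap_apply_zero, AffineMap.lineMap_apply, vsub_eq_sub, vadd_eq_add, smul_smul,
      div_eq_mul_inv, add_comm]
  clear hz
  induction n with
  | zero => omega
  | succ n ih =>
    rw [Finset.sum_range_succ]
    rcases Nat.eq_zero_or_pos n with rfl | h0
    · simpa using seg 0 (by omega)
    · exact .append (ih h0 fun j hj => seg j (by omega)) (seg n (by omega))

theorem injOn_polygon {T : ℕ → ℝ} (hT : ∀ j, T j < T (j + 1)) {U : ℕ → Plane}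
    {z : ℝ → Plane} {n : ℕ} (hn : 0 < n) (hz : ∀ j < n, ∀ t ∈ Set.Icc (T j) (T (j + 1)),
      z t = AffineMap.lineMap (U j) (U (j + 1)) ((t - T j) / (T (j + 1) - T j)))
    (hU : ∀ i < n, ∀ j < n, ∀ s ∈ Set.Icc (0 : ℝ) 1, ∀ s' ∈ Set.Icc (0 : ℝ) 1,
      AffineMap.lineMap (U i) (U (i + 1)) s = AffineMap.lineMap (U j) (U (j + 1)) s' →
        (i : ℝ) + s = j + s') : Set.InjOn z (Set.Icc (T 0) (T n)) := by
  have hmem : ∀ j, ∀ t ∈ Set.Icc (T j) (T (j + 1)), (t - T j) / (T (j + 1) - T j) ∈ Set.Icc (0 : ℝ) 1 :=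
    fun j t ht => by
      have := sub_pos.2 (hT j)
      exact ⟨div_nonneg (sub_nonneg.2 ht.1) this.le, (div_le_one this).2 (by linarith [ht.2])⟩
  have core : ∀ i < n, ∀ j < n, i ≤ j → ∀ t ∈ Set.Icc (T i) (T (i + 1)), ∀ t' ∈ Set.Icc (T j) (T (j + 1)),
      z t = z t' → t = t' := by
    intro i hi j hj hij t ht t' ht' h
    rw [hz i hi t ht, hz j hj t' ht'] at h
    have e := hU i hi j hj _ (hmem i t ht) _ (hmem j t' ht') h
    have p1 := sub_pos.2 (hT i)
    have p2 := sub_pos.2 (hT j)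
    rcases hij.eq_or_lt with rfl | hij
    · have := add_left_cancel e
      rw [div_left_inj' p1.ne'] at this
      linarith
    · have h1 : ((i : ℝ) + 1) ≤ j := by exact_mod_cast hij
      have h2 : (t - T i) / (T (i + 1) - T i) = 1 :=
        le_antisymm (hmem i t ht).2 (by linarith [(hmem j t' ht').1])
      have h3 : (t' - T j) / (T (j + 1) - T j) = 0 :=
        le_antisymm (by linarith) (hmem j t' ht').1
      have h4 : i + 1 = j := by
        have : (i : ℝ) + 1 = j := by linarith
        exact_mod_cast this
      rw [div_eq_one_iff_eq p1.ne'] at h2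
      rcases div_eq_zero_iff.1 h3 with h3 | h3
      · subst h4; linarith
      · exact absurd h3 p2.ne'
  intro t ht t' ht' h
  obtain ⟨i, hi, hti⟩ := exists_mem_Icc_succ hn ht
  obtain ⟨j, hj, htj⟩ := exists_mem_Icc_succ hn ht'
  rcases le_total i j with hij | hij
  · exact core i hi j hj hij t hti t' htj h
  · exact (core j hj i hi hij t' htj t hti h.symm).symm

/-! ### Energy of polygons along a curve -/

section Convex

variable {G : Plane → ℝ} (hG : ConvexOn ℝ Set.univ G)

-- Taking longer over the same displacement amounts to averaging the old velocity with rest during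
-- the extra time `σ`. The form also covers `Δ = 0`, an edge to which the curve assigns no time.
include hG in
theorem ConvexOn.stretch_le {Δ σ : ℝ} (hΔ : 0 ≤ Δ) (hσ : 0 < σ) {D : Plane} (hD : Δ = 0 → D = 0) :
    (Δ + σ) * G ((Δ + σ)⁻¹ • D) ≤ Δ * G (Δ⁻¹ • D) + σ * G 0 := by
  rcases hΔ.eq_or_lt with rfl | hΔ
  · simp [hD rfl]
  · have h := hG.2 (Set.mem_univ (Δ⁻¹ • D)) (Set.mem_univ 0)
      (show 0 ≤ Δ / (Δ + σ) by positivity) (show 0 ≤ σ / (Δ + σ) by positivity) (by field_simp)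
    have e : (Δ / (Δ + σ)) • Δ⁻¹ • D + (σ / (Δ + σ)) • (0 : Plane) = (Δ + σ)⁻¹ • D := by
      rw [smul_zero, add_zero, smul_smul]
      congr 1
      field_simp
    rw [e, smul_eq_mul, smul_eq_mul] at h
    calc (Δ + σ) * G ((Δ + σ)⁻¹ • D) ≤ (Δ + σ) * (Δ / (Δ + σ) * G (Δ⁻¹ • D) + σ / (Δ + σ) * G 0) := by
          gcongr
      _ = _ := by field_simp

-- The origin is a convex combination of `a` and the unit vector opposite to it, where `G` is
-- bounded, so `G` cannot decrease faster than linearly from the origin.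
include hG in
theorem ConvexOn.exists_slope_bound (hGc : Continuous G) (hG0 : ∀ a, 0 ≤ G a) :
    ∃ Λ : ℝ, 0 ≤ Λ ∧ ∀ a, G 0 - Λ * ‖a‖ ≤ G a := by
  obtain ⟨C, hC⟩ := (isCompact_closedBall (0 : Plane) 1).exists_bound_of_continuousOn hGc.continuousOn
  have hC' : ∀ a, ‖a‖ ≤ 1 → G a ≤ C := fun a ha =>
    (le_abs_self _).trans (hC a (by simpa using ha))
  refine ⟨C, (hG0 0).trans (hC' 0 (by simp)), fun a => ?_⟩
  rcases eq_or_ne a 0 with rfl | ha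
  · simp
  · set s := ‖a‖
    have hs : 0 < s := norm_pos_iff.2 ha
    have h := hG.2 (Set.mem_univ a) (Set.mem_univ (-(s⁻¹ • a)))
      (show 0 ≤ 1 / (1 + s) by positivity) (show 0 ≤ s / (1 + s) by positivity) (by field_simp)
    have e : (1 / (1 + s)) • a + (s / (1 + s)) • (-(s⁻¹ • a)) = 0 := by
      rw [smul_neg, smul_smul, ← sub_eq_add_neg, ← sub_smul]
      have : 1 / (1 + s) - s / (1 + s) * s⁻¹ = 0 := by field_simp; simp
      rw [this, zero_smul]
    rw [e, smul_eq_mul, smul_eq_mul] at h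
    have h1 : G (-(s⁻¹ • a)) ≤ C := hC' _ (by
      rw [norm_neg, norm_smul, norm_inv, Real.norm_of_nonneg hs.le, inv_mul_cancel₀ hs.ne'])
    have h2 : (1 + s) * G 0 ≤ G a + s * G (-(s⁻¹ • a)) := by
      calc (1 + s) * G 0 ≤ (1 + s) * (1 / (1 + s) * G a + s / (1 + s) * G (-(s⁻¹ • a))) := by gcongr
        _ = _ := by field_simp
    nlinarith [hG0 0, mul_le_mul_of_nonneg_left h1 hs.le, mul_nonneg hs.le (hG0 0)]

theorem Continuous.exists_modulus_on_ball (hGc : Continuous G) (R : ℝ) {ε : ℝ} (hε : 0 < ε) :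
    ∃ δ > 0, ∀ x y, ‖x‖ ≤ R → ‖y - x‖ ≤ δ → G y ≤ G x + ε := by
  obtain ⟨δ, hδ, h⟩ := Metric.uniformContinuousOn_iff_le.1
    ((isCompact_closedBall (0 : Plane) (R + 1)).uniformContinuousOn_of_continuous hGc.continuousOn) ε hε
  refine ⟨min δ 1, lt_min hδ one_pos, fun x y hx hxy => ?_⟩
  have h1 : ‖y‖ ≤ R + 1 := by
    have := norm_add_le (y - x) x
    rw [sub_add_cancel] at this
    linarith [hxy.trans (min_le_right δ 1)]
  have := h y (by simpa using h1) x (by simpa using (by linarith : ‖x‖ ≤ R + 1))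
    (by rw [dist_eq_norm]; exact hxy.trans (min_le_left _ _))
  rw [Real.dist_eq] at this
  linarith [le_abs_self (G y - G x)]

include hG in
theorem jensen_intervalIntegral (hGc : Continuous G) (hG0 : ∀ a, 0 ≤ G a) {g : ℝ → Plane}
    (hg : IntegrableOn g (Set.Ioo 0 1)) (hGg : IntervalIntegrable (fun t => G (g t)) volume 0 1)
    {a b : ℝ} (ha : 0 ≤ a) (hab : a ≤ b) (hb : b ≤ 1) :
    (b - a) * G ((b - a)⁻¹ • ∫ t in a..b, g t) ≤ ∫ t in a..b, G (g t) := by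
  rcases hab.eq_or_lt with rfl | hab
  · simp
  · have h := jensen_interval hG hGc hG0 hab (hg.mono_set (Set.Ioo_subset_Ioo ha hb))
    have hi : IntegrableOn (fun t => G (g t)) (Set.Ioo a b) :=
      ((intervalIntegrable_iff_integrableOn_Ioo_of_le zero_le_one).1 hGg).mono_set
        (Set.Ioo_subset_Ioo ha hb)
    have h0 : 0 ≤ ∫ t in Set.Ioo a b, G (g t) := setIntegral_nonneg measurableSet_Ioo fun t _ => hG0 _
    rw [← ofReal_integral_eq_lintegral_ofReal hi (Eventually.of_forall fun t => hG0 _),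
      ← ENNReal.ofReal_mul (sub_nonneg.2 hab.le), ENNReal.ofReal_le_ofReal_iff h0] at h
    rwa [intervalIntegral.integral_of_le hab.le (f := fun t => G (g t)), integral_Ioc_eq_integral_Ioo]

end Convex

/-- Curves with an integrable derivative on `(0, 1)` extend continuously to `[0, 1]`. -/
theorem exists_extension_of_ftc {v g : ℝ → Plane} (hg : IntegrableOn g (Set.Ioo 0 1))
    (hv : ∀ t₁ ∈ Set.Ioo (0 : ℝ) 1, ∀ t₂ ∈ Set.Ioo (0 : ℝ) 1, v t₂ - v t₁ = ∫ t in t₁..t₂, g t) :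
    ∃ w : ℝ → Plane, ContinuousOn w (Set.Icc 0 1) ∧ (∀ t ∈ Set.Ioo (0 : ℝ) 1, w t = v t) ∧
      ∀ a ∈ Set.Icc (0 : ℝ) 1, ∀ b ∈ Set.Icc (0 : ℝ) 1, w b - w a = ∫ t in a..b, g t := by
  have hgi : IntervalIntegrable g volume 0 1 :=
    (intervalIntegrable_iff_integrableOn_Ioo_of_le zero_le_one).2 hg
  have hsub : ∀ a ∈ Set.Icc (0 : ℝ) 1, ∀ b ∈ Set.Icc (0 : ℝ) 1, IntervalIntegrable g volume a b :=
    fun a ha b hb => hgi.mono_set (by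
      rw [Set.uIcc_of_le zero_le_one]
      exact Set.uIcc_subset_Icc ha hb)
  have h2 : (1 / 2 : ℝ) ∈ Set.Ioo (0 : ℝ) 1 := by norm_num
  have h2' := Set.Ioo_subset_Icc_self h2
  refine ⟨fun t => v (1 / 2) + ∫ s in (1 / 2)..t, g s, ?_, fun t ht => ?_, fun a ha b hb => ?_⟩
  · have := intervalIntegral.continuousOn_primitive_interval' hgi (a := 1 / 2)
      (by rw [Set.uIcc_of_le zero_le_one]; exact h2')
    rw [Set.uIcc_of_le zero_le_one] at this
    exact continuousOn_const.add this
  · dsimp only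
    rw [← hv _ h2 t ht]; abel
  · rw [add_sub_add_left_eq_sub]
    exact intervalIntegral.integral_interval_sub_left (hsub _ h2' _ hb) (hsub _ h2' _ ha)

section Approximation

variable {G : Plane → ℝ} (hG : ConvexOn ℝ Set.univ G) (hGc : Continuous G) (hG0 : ∀ a, 0 ≤ G a)
  {g w : ℝ → Plane} (hg : IntegrableOn g (Set.Ioo 0 1))
  (hGg : IntervalIntegrable (fun t => G (g t)) volume 0 1)
  (hw : ∀ a ∈ Set.Icc (0 : ℝ) 1, ∀ b ∈ Set.Icc (0 : ℝ) 1, w b - w a = ∫ t in a..b, g t)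

include hG hGc hG0 hg hGg hw

/-- A curve of small diameter is replaced by a short segment. -/
theorem exists_segment_near {Λ D : ℝ} (hΛ : ∀ a, G 0 - Λ * ‖a‖ ≤ G a) (hΛ0 : 0 ≤ Λ)
    (hD : ∀ t ∈ Set.Icc (0 : ℝ) 1, ∀ t' ∈ Set.Icc (0 : ℝ) 1, ‖w t - w t'‖ ≤ D) {ε : ℝ} (hε : 0 < ε)
    (hΛD : Λ * D ≤ ε / 4) (hDε : D ≤ ε / 2) :
    ∃ z b E, 1 < b ∧ PolygonCost (fun c r => r = G c) z 0 b E ∧ Set.InjOn z (Set.Icc 0 b) ∧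
      E ≤ (∫ t in 0..1, G (g t)) + ε ∧ ∀ t ∈ Set.Ioo (0 : ℝ) 1, ‖z t - w t‖ ≤ ε := by
  obtain ⟨σ, hσ, hσ1, hσG⟩ : ∃ σ > 0, σ ≤ 1 ∧ σ * G 0 ≤ ε / 4 := by
    refine ⟨min 1 (ε / 4 / (G 0 + 1)), lt_min one_pos (by have := hG0 0; positivity), min_le_left _ _, ?_⟩
    have h0 := hG0 0
    calc _ ≤ ε / 4 / (G 0 + 1) * G 0 := by gcongr; exact min_le_right _ _
      _ ≤ ε / 4 / (G 0 + 1) * (G 0 + 1) := by gcongr; linarith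
      _ = ε / 4 := by field_simp
  obtain ⟨δ, hδ, hδG⟩ := hGc.exists_modulus_on_ball 0 (ε := ε / 8) (by linarith)
  obtain ⟨e, he0, heδ⟩ : ∃ e : Plane, e ≠ 0 ∧ ‖e‖ ≤ min δ (ε / 4) := by
    obtain ⟨x, hx⟩ := exists_norm_eq Plane (c := min δ (ε / 4)) (by positivity)
    refine ⟨x, fun h => ?_, hx.le⟩
    rw [h, norm_zero] at hx
    exact (lt_min hδ (by linarith : 0 < ε / 4)).ne hx
  have hGe : G e ≤ G 0 + ε / 8 := hδG 0 e (by simp) (by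
    rw [sub_zero]; exact heδ.trans (min_le_left _ _))
  -- Jensen and the slope bound give `∫ G ≥ G 0 - Λ D`, so almost resting is nearly optimal. The
  -- small nonzero velocity `e` only serves injectivity.
  have hJ := jensen_intervalIntegral hG hGc hG0 hg hGg le_rfl zero_le_one le_rfl
  have h01 : (0 : ℝ) ∈ Set.Icc (0 : ℝ) 1 := by norm_num
  have h11 : (1 : ℝ) ∈ Set.Icc (0 : ℝ) 1 := by norm_num
  rw [← hw 0 h01 1 h11, sub_zero, one_mul, inv_one, one_smul] at hJ
  have hlow := hΛ (w 1 - w 0)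
  have hΛD' : Λ * ‖w 1 - w 0‖ ≤ Λ * D := by gcongr; exact hD 1 h11 0 h01
  refine ⟨fun t => w (1 / 2) + t • e, 1 + σ, (1 + σ - 0) * G e, by linarith,
    .segment (c := e) (by linarith) (fun t _ => by module) rfl, fun t _ t' _ h => ?_, ?_, fun t ht => ?_⟩
  · exact smul_left_injective ℝ he0 (add_left_cancel h)
  · have : (1 + σ) * G e ≤ (1 + σ) * (G 0 + ε / 8) := by gcongr
    rw [sub_zero]
    nlinarith
  · have h1 := hD (1 / 2) (by norm_num) t (Set.Ioo_subset_Icc_self ht)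
    have h2 : ‖t • e‖ ≤ ε / 4 := by
      rw [norm_smul, Real.norm_of_nonneg ht.1.le]
      have := heδ.trans (min_le_right _ _)
      nlinarith [norm_nonneg e, ht.2]
    calc ‖w (1 / 2) + t • e - w t‖ = ‖(w (1 / 2) - w t) + t • e‖ := by congr 1; abel
      _ ≤ ‖w (1 / 2) - w t‖ + ‖t • e‖ := norm_add_le _ _
      _ ≤ ε := by linarith

omit hGc hG0 hg hGg hw in
theorem ConvexOn.mul_le_of_near {Δ σ I κ lam : ℝ} {D d : Plane} (hΔ : 0 ≤ Δ) (hσ : 0 < σ)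
    (hD : Δ = 0 → D = 0) (hI : Δ * G (Δ⁻¹ • D) ≤ I + lam)
    (hd : G ((Δ + σ)⁻¹ • d) ≤ G ((Δ + σ)⁻¹ • D) + κ) :
    (Δ + σ) * G ((Δ + σ)⁻¹ • d) ≤ I + lam + σ * G 0 + (Δ + σ) * κ := by
  have h1 := hG.stretch_le hΔ hσ hD
  have h2 := mul_le_mul_of_nonneg_left hd (by linarith : 0 ≤ Δ + σ)
  linarith

/-- The energy of a simple polygon which follows a curve closely. -/
theorem SimpleChain.exists_polygon {Y : ℝ → Plane} {ρ η : ℝ} {n : ℕ} {θ : ℕ → ℝ} {U : ℕ → Plane}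
    (hch : SimpleChain Y ρ η n θ U) (hwc : ContinuousOn w (Set.Icc 0 1))
    (hYw : ∀ t ∈ Set.Ioo (0 : ℝ) 1, ‖Y t - w t‖ ≤ η) {Λ : ℝ} (hΛ : ∀ a, G 0 - Λ * ‖a‖ ≤ G a)
    (hΛ0 : 0 ≤ Λ) {σ κ R δ μ : ℝ} (hσ : 0 < σ)
    (hR : ∀ t ∈ Set.Icc (0 : ℝ) 1, ∀ t' ∈ Set.Icc (0 : ℝ) 1, ‖w t - w t'‖ ≤ R * σ)
    (hδ : ∀ x y, ‖x‖ ≤ R → ‖y - x‖ ≤ δ → G y ≤ G x + κ) (hηδ : 4 * η ≤ δ * σ) (hη : 0 ≤ η)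
    (hμ : ∀ t ∈ Set.Icc (0 : ℝ) 1, ∀ t' ∈ Set.Icc (0 : ℝ) 1, |t - t'| ≤ n * σ → ‖w t - w t'‖ ≤ μ) :
    ∃ z b E, 1 < b ∧ PolygonCost (fun c r => r = G c) z 0 b E ∧ Set.InjOn z (Set.Icc 0 b) ∧
      E ≤ (∫ t in 0..1, G (g t)) + n * σ * G 0 + (1 + n * σ) * κ + 2 * (Λ * (2 * ρ + 2 * η)) ∧
      ∀ t ∈ Set.Ioo (0 : ℝ) 1, ‖z t - w t‖ ≤ ρ + η + μ := by
  have hn : 0 < n := by linarith [hch.one_lt]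
  have hR0 : 0 ≤ R := by
    have := hR 0 (by norm_num) 0 (by norm_num)
    rw [sub_self, norm_zero] at this
    nlinarith
  -- Every edge gets the extra time `σ`, which bounds the comparison velocities by `R` and lets a
  -- vertex error of order `η` be absorbed when `4η ≤ δ σ`. The minimum keeps the times increasing
  -- beyond index `n`.
  set T : ℕ → ℝ := fun j => θ (min j n) + σ * j with hT
  have hTj : ∀ j ≤ n, T j = θ j + σ * j := fun j hj => by rw [hT]; simp only [min_eq_left hj]
  have hTs : ∀ j, T j < T (j + 1) := fun j => by
    simp only [hT, Nat.cast_add, Nat.cast_one]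
    have : θ (min j n) ≤ θ (min (j + 1) n) := by
      rcases Nat.lt_or_ge j n with h | h
      · rw [min_eq_left h.le, min_eq_left (Nat.succ_le_of_lt h)]; exact hch.le_succ j h
      · rw [min_eq_right h, min_eq_right (by omega)]
    linarith
  have hΔT : ∀ j < n, T (j + 1) - T j = (θ (j + 1) - θ j) + σ := fun j hj => by
    rw [hTj j hj.le, hTj (j + 1) hj]; push_cast; ring
  have hT0 : T 0 = 0 := by rw [hTj 0 hn.le, hch.zero]; simp
  have hTn : T n = 1 + n * σ := by rw [hTj n le_rfl, hch.last]; ring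
  have hθ : ∀ j ≤ n, θ j ∈ Set.Icc (0 : ℝ) 1 := fun j hj => by
    rcases Nat.eq_zero_or_pos j with rfl | h0
    · rw [hch.zero]; norm_num
    rcases hj.eq_or_lt with rfl | h1
    · rw [hch.last]; norm_num
    · exact Set.Ioo_subset_Icc_self (hch.mem j h0 h1)
  obtain ⟨z, hz⟩ := _root_.exists_polygon hTs U n
  have hcost := PolygonCost.of_vertices G hTs U hn hz
  have hinj := injOn_polygon hTs hn hz hch.simple
  rw [hT0] at hcost hinj
  have hnσ : 0 < n * σ := by have : (0 : ℝ) < n := by exact_mod_cast hn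
                             positivity
  refine ⟨z, T n, _, by rw [hTn]; linarith, hcost, hinj, ?_, fun t ht => ?_⟩
  · set I : ℕ → ℝ := fun j => ∫ t in θ j..θ (j + 1), G (g t) with hI
    have hjen : ∀ j < n, (θ (j + 1) - θ j) * G ((θ (j + 1) - θ j)⁻¹ • (w (θ (j + 1)) - w (θ j))) ≤ I j :=
      fun j hj => by
        rw [hw _ (hθ j hj.le) _ (hθ (j + 1) hj)]
        exact jensen_intervalIntegral hG hGc hG0 hg hGg (hθ j hj.le).1 (hch.le_succ j hj) (hθ (j + 1) hj).2
    -- Additional error on the first and last edges: these are short spikes, while the curve may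
    -- move by `2ρ + 2η` during the corresponding time.
    set lam : ℕ → ℝ := fun j => (if j = 0 then Λ * (2 * ρ + 2 * η) else 0) +
      if j = n - 1 then Λ * (2 * ρ + 2 * η) else 0 with hlam
    have hend : ∀ j < n, (∀ t ∈ Set.Ioo (θ j) (θ (j + 1)), ‖w t - w (θ j)‖ ≤ 2 * ρ + 2 * η) ∨
        (∀ t ∈ Set.Ioo (θ j) (θ (j + 1)), ‖w t - w (θ (j + 1))‖ ≤ 2 * ρ + 2 * η) →
        ‖w (θ (j + 1)) - w (θ j)‖ ≤ 2 * ρ + 2 * η := by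
      intro j hj h
      rcases (hch.le_succ j hj).eq_or_lt with e | hlt
      · rw [← e, sub_self, norm_zero]
        have h1 := hch.close j hj 0 (by norm_num)
        by_contra! hcon
        rcases Nat.eq_zero_or_pos j with rfl | h0
        · have h2 := hch.mem 1 one_pos hch.one_lt
          rw [← e, hch.zero] at h2
          exact lt_irrefl _ h2.1
        · have h2 := h1 (θ j) ⟨le_rfl, e.le⟩ (hch.mem j h0 hj)
          linarith [norm_nonneg (AffineMap.lineMap (U j) (U (j + 1)) (0 : ℝ) - Y (θ j))]
      · have hcl : Set.Icc (θ j) (θ (j + 1)) ⊆ Set.Icc 0 1 :=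
          Set.Icc_subset_Icc (hθ j hj.le).1 (hθ (j + 1) hj).2
        have key : ∀ x, (∀ t ∈ Set.Ioo (θ j) (θ (j + 1)), ‖w t - x‖ ≤ 2 * ρ + 2 * η) →
            ∀ t ∈ Set.Icc (θ j) (θ (j + 1)), ‖w t - x‖ ≤ 2 * ρ + 2 * η := fun x hx t ht => by
          have hc : ContinuousOn (fun t => ‖w t - x‖) (Set.Icc (θ j) (θ (j + 1))) :=
            ((hwc.mono hcl).sub continuousOn_const).norm
          rw [← closure_Ioo hlt.ne] at ht hc
          exact le_on_closure hx hc continuousOn_const ht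
        rcases h with h | h
        · exact key _ h _ ⟨hlt.le, le_rfl⟩
        · rw [norm_sub_rev]; exact key _ h _ ⟨le_rfl, hlt.le⟩
    have hosc : ∀ j < n, ∀ t ∈ Set.Icc (θ j) (θ (j + 1)), ∀ t' ∈ Set.Icc (θ j) (θ (j + 1)),
        t ∈ Set.Ioo (0 : ℝ) 1 → t' ∈ Set.Ioo (0 : ℝ) 1 → ‖w t - w t'‖ ≤ 2 * ρ + 2 * η := by
      intro j hj t ht t' ht' h1 h2
      have a1 := hch.close j hj 0 (by norm_num) t ht h1
      have a2 := hch.close j hj 0 (by norm_num) t' ht' h2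
      have a3 := hYw t h1
      have a4 := hYw t' h2
      set u := AffineMap.lineMap (U j) (U (j + 1)) (0 : ℝ)
      rw [norm_sub_rev] at a1 a3
      calc ‖w t - w t'‖ = ‖(w t - Y t) + (Y t - u) + (u - Y t') + (Y t' - w t')‖ := by congr 1; abel
        _ ≤ ‖w t - Y t‖ + ‖Y t - u‖ + ‖u - Y t'‖ + ‖Y t' - w t'‖ := norm_add₄_le
        _ ≤ _ := by linarith
    have hseg : ∀ j < n, (T (j + 1) - T j) * G ((T (j + 1) - T j)⁻¹ • (U (j + 1) - U j)) ≤
        I j + lam j + σ * G 0 + (T (j + 1) - T j) * κ := by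
      intro j hj
      have hΔ := sub_nonneg.2 (hch.le_succ j hj)
      have hσΔ : σ ≤ θ (j + 1) - θ j + σ := by linarith
      rw [hΔT j hj]
      have hscale : ∀ x : Plane, ∀ B : ℝ, 0 ≤ B → ‖x‖ ≤ B * σ →
          ‖(θ (j + 1) - θ j + σ)⁻¹ • x‖ ≤ B := fun x B hB hx => by
        rw [norm_smul, norm_inv, Real.norm_of_nonneg (by linarith), inv_mul_le_iff₀ (by linarith)]
        nlinarith
      have hδ0 : 0 ≤ δ := by
        by_contra! h
        nlinarith
      -- A short end edge is compared with rest instead of with the curve: the slope bound and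
      -- Jensen show that the curve saves at most `Λ (2ρ + 2η)` over rest.
      have htiny : ‖U (j + 1) - U j‖ ≤ η → ‖w (θ (j + 1)) - w (θ j)‖ ≤ 2 * ρ + 2 * η →
          Λ * (2 * ρ + 2 * η) ≤ lam j → (θ (j + 1) - θ j + σ) *
          G ((θ (j + 1) - θ j + σ)⁻¹ • (U (j + 1) - U j)) ≤
          I j + lam j + σ * G 0 + (θ (j + 1) - θ j + σ) * κ := fun hU hD hl => by
        refine hG.mul_le_of_near (D := 0) hΔ hσ (fun _ => rfl) ?_ ?_
        · rw [smul_zero]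
          have h1 := hjen j hj
          rcases hΔ.eq_or_lt with e | hΔ0
          · rw [← e, zero_mul] at h1 ⊢
            have : 0 ≤ lam j := le_trans (mul_nonneg hΛ0 ((norm_nonneg _).trans hD)) hl
            linarith
          · have h2 := mul_le_mul_of_nonneg_left
              (hΛ ((θ (j + 1) - θ j)⁻¹ • (w (θ (j + 1)) - w (θ j)))) hΔ
            rw [norm_smul, norm_inv, Real.norm_of_nonneg hΔ, mul_sub] at h2
            have h3 : (θ (j + 1) - θ j) * (Λ * ((θ (j + 1) - θ j)⁻¹ * ‖w (θ (j + 1)) - w (θ j)‖)) =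
                Λ * ‖w (θ (j + 1)) - w (θ j)‖ := by field_simp
            have h4 := mul_le_mul_of_nonneg_left hD hΛ0
            linarith
        · refine hδ _ _ (by rw [smul_zero, norm_zero]; exact hR0) ?_
          rw [smul_zero, sub_zero]
          exact hscale _ _ hδ0 (by linarith)
      rcases Nat.eq_zero_or_pos j with rfl | h0
      · have hm := hch.mem 1 one_pos hch.one_lt
        refine htiny hch.near_first (hend 0 hj (Or.inr fun t ht => ?_)) ?_
        · exact hosc 0 hj t ⟨ht.1.le, ht.2.le⟩ _ ⟨hch.le_succ 0 hj, le_rfl⟩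
            ⟨by rw [hch.zero] at ht; exact ht.1, ht.2.trans hm.2⟩ hm
        · simp only [hlam, if_true]
          split_ifs with h
          · have := hch.one_lt; omega
          · rw [add_zero]
      rcases (Nat.succ_le_of_lt hj).eq_or_lt with h1 | h1
      · have hm := hch.mem j h0 hj
        have hj1 : j + 1 = n := h1
        have hnl := hch.near_last
        rw [← hj1, Nat.add_sub_cancel] at hnl
        refine htiny hnl (hend j hj (Or.inl fun t ht => ?_)) ?_
        · refine hosc j hj t ⟨ht.1.le, ht.2.le⟩ _ ⟨le_rfl, hch.le_succ j hj⟩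
            ⟨hm.1.trans ht.1, ht.2.trans_le ?_⟩ hm
          rw [hj1, hch.last]
        · simp only [hlam, if_neg h0.ne', if_pos (show j = n - 1 by omega), zero_add, le_refl]
      · have hl : lam j = 0 := by
          simp only [hlam, if_neg h0.ne', if_neg (show j ≠ n - 1 by omega), add_zero]
        have hm := hch.mem j h0 hj
        have hm' := hch.mem (j + 1) j.succ_pos h1
        refine hG.mul_le_of_near (D := w (θ (j + 1)) - w (θ j)) hΔ hσ (fun e => ?_)
          (by rw [hl, add_zero]; exact hjen j hj) (hδ _ _ (hscale _ _ hR0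
            (hR _ (hθ (j + 1) hj) _ (hθ j hj.le))) ?_)
        · rw [sub_eq_zero.1 e, sub_self]
        · rw [← smul_sub]
          refine hscale _ _ hδ0 (le_trans ?_ hηδ)
          have a1 := hch.near j h0 hj
          have a2 := hch.near (j + 1) j.succ_pos h1
          have a3 := hYw _ hm
          have a4 := hYw _ hm'
          rw [norm_sub_rev] at a1 a3
          calc ‖U (j + 1) - U j - (w (θ (j + 1)) - w (θ j))‖
              = ‖(U (j + 1) - Y (θ (j + 1))) + (Y (θ (j + 1)) - w (θ (j + 1))) +
                (w (θ j) - Y (θ j)) + (Y (θ j) - U j)‖ := by congr 1; abel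
            _ ≤ _ := norm_add₄_le
            _ ≤ 4 * η := by linarith
    refine (Finset.sum_le_sum fun j hj => hseg j (Finset.mem_range.1 hj)).trans_eq ?_
    rw [Finset.sum_add_distrib, Finset.sum_add_distrib, Finset.sum_add_distrib, ← Finset.sum_mul, ← Finset.sum_mul,
      Finset.sum_range_sub, hTn, hT0, Finset.sum_const, Finset.card_range, nsmul_eq_mul]
    have e1 : ∑ j ∈ Finset.range n, I j = ∫ t in 0..1, G (g t) := by
      have := intervalIntegral.sum_integral_adjacent_intervals (f := fun t => G (g t)) (μ := volume)
        (a := θ) (n := n) fun j hj => hGg.mono_set (by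
          rw [Set.uIcc_of_le zero_le_one]
          exact Set.uIcc_subset_Icc (hθ j hj.le) (hθ (j + 1) hj))
      rw [hch.zero, hch.last] at this
      exact this
    have e2 : ∑ j ∈ Finset.range n, lam j = 2 * (Λ * (2 * ρ + 2 * η)) := by
      simp only [hlam, Finset.sum_add_distrib, Finset.sum_ite_eq', Finset.mem_range]
      rw [if_pos hn, if_pos (by omega)]
      ring
    rw [e1, e2]
    ring
  · obtain ⟨j, hj, htj⟩ := exists_mem_Icc_succ (T := T) hn (t := t) (by
      rw [hT0, hTn]; exact ⟨ht.1.le, by linarith [ht.2]⟩)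
    have hs : (t - T j) / (T (j + 1) - T j) ∈ Set.Icc (0 : ℝ) 1 := by
      have := sub_pos.2 (hTs j)
      exact ⟨div_nonneg (sub_nonneg.2 htj.1) this.le, (div_le_one this).2 (by linarith [htj.2])⟩
    rw [hz j hj t htj]
    set u := AffineMap.lineMap (U j) (U (j + 1)) ((t - T j) / (T (j + 1) - T j)) with hu
    rw [hTj j hj.le, hTj (j + 1) hj] at htj
    push_cast at htj
    -- The polygon at time `t` is on edge `j`; `x` is a time that the curve assigns to this edge,
    -- obtained by removing the accumulated delay, at most `n σ`.
    set x := min (t - σ * j) (θ (j + 1)) with hx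
    have hle := hch.le_succ j hj
    have hσj : 0 ≤ σ * j := by positivity
    have hx1 : x ∈ Set.Icc (θ j) (θ (j + 1)) := ⟨le_min (by linarith [htj.1]) hle, min_le_right _ _⟩
    have hxt : x ≤ t := (min_le_left _ _).trans (by linarith)
    have hx2 : x ∈ Set.Ioo (0 : ℝ) 1 := by
      refine ⟨?_, hxt.trans_lt ht.2⟩
      rcases Nat.eq_zero_or_pos j with rfl | h0
      · have := hch.mem 1 one_pos hch.one_lt
        refine lt_min ?_ this.1
        simpa using ht.1
      · exact (hch.mem j h0 hj).1.trans_le hx1.1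
    have hxn : |x - t| ≤ n * σ := by
      have h1 : σ * (j + 1) ≤ n * σ := by
        rw [mul_comm]
        gcongr
        exact_mod_cast hj
      rw [abs_of_nonpos (by linarith), neg_sub, hx]
      rcases min_choice (t - σ * j) (θ (j + 1)) with e | e <;> rw [e]
      · linarith
      · linarith [htj.2]
    have b1 := hch.close j hj _ hs x hx1 hx2
    have b2 := hYw x hx2
    have b3 := hμ x (Set.Ioo_subset_Icc_self hx2) t (Set.Ioo_subset_Icc_self ht) hxn
    calc ‖u - w t‖ = ‖(u - Y x) + (Y x - w x) + (w x - w t)‖ := by congr 1; abel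
      _ ≤ ‖u - Y x‖ + ‖Y x - w x‖ + ‖w x - w t‖ := norm_add₃_le
      _ ≤ _ := by linarith

end Approximation

/-- A uniform limit of curves without self-intersections and of bounded variation is approximated by
polygons without self-intersections, with control of a convex energy. -/
theorem exists_injective_polygon {G : Plane → ℝ} (hG : ConvexOn ℝ Set.univ G) (hGc : Continuous G)
    (hG0 : ∀ a, 0 ≤ G a) {g v : ℝ → Plane} (hg : IntegrableOn g (Set.Ioo 0 1))
    (hGg : IntervalIntegrable (fun t => G (g t)) volume 0 1)
    (hv : ∀ t₁ ∈ Set.Ioo (0 : ℝ) 1, ∀ t₂ ∈ Set.Ioo (0 : ℝ) 1, v t₂ - v t₁ = ∫ t in t₁..t₂, g t)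
    {Y : ℕ → ℝ → Plane} (hYc : ∀ k, ContinuousOn (Y k) (Set.Ioo 0 1))
    (hYi : ∀ k, Set.InjOn (Y k) (Set.Ioo 0 1)) {M : ENNReal} (hM : M ≠ ⊤)
    (hYM : ∀ k, eVariationOn (Y k) (Set.Ioo 0 1) ≤ M)
    (hYv : TendstoUniformlyOn Y v atTop (Set.Ioo 0 1)) {ε : ℝ} (hε : 0 < ε) :
    ∃ z b E, 1 < b ∧ PolygonCost (fun c r => r = G c) z 0 b E ∧ Set.InjOn z (Set.Icc 0 b) ∧
      E ≤ (∫ t in 0..1, G (g t)) + ε ∧ ∀ t ∈ Set.Ioo (0 : ℝ) 1, ‖z t - v t‖ ≤ ε := by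
  obtain ⟨w, hwc, hwv, hw⟩ := exists_extension_of_ftc hg hv
  suffices ∃ z b E, 1 < b ∧ PolygonCost (fun c r => r = G c) z 0 b E ∧ Set.InjOn z (Set.Icc 0 b) ∧
      E ≤ (∫ t in 0..1, G (g t)) + ε ∧ ∀ t ∈ Set.Ioo (0 : ℝ) 1, ‖z t - w t‖ ≤ ε by
    obtain ⟨z, b, E, h1, h2, h3, h4, h5⟩ := this
    exact ⟨z, b, E, h1, h2, h3, h4, fun t ht => hwv t ht ▸ h5 t ht⟩
  obtain ⟨B, hB⟩ := isCompact_Icc.exists_bound_of_continuousOn hwc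
  have hB0 : 0 ≤ B := (norm_nonneg _).trans (hB 0 (by norm_num))
  obtain ⟨Λ, hΛ0, hΛ⟩ := hG.exists_slope_bound hGc hG0
  -- Order of choices: the mesh `r` fixes the bound `N` on the number of edges for all `k`; `N`
  -- fixes the extra time `σ`; `σ` bounds the velocities and fixes the modulus `δ` of `G`; `δ σ`
  -- fixes `η`; only then is `k` chosen.
  set r : ℝ := ε / (144 * (1 + Λ)) with hr
  have hr0 : 0 < r := by positivity
  have hΛr : Λ * r ≤ ε / 144 := by
    rw [hr, ← mul_div_assoc, div_le_div_iff₀ (by positivity) (by norm_num)]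
    nlinarith
  have hrε : r ≤ ε / 144 := by
    rw [hr]
    gcongr
    linarith
  obtain ⟨N, hN⟩ := exists_simpleChain_plane hM hr0 (B + 1)
  have hG00 := hG0 0
  obtain ⟨μ, hμ0, hμ⟩ := Metric.uniformContinuousOn_iff_le.1
    (isCompact_Icc.uniformContinuousOn_of_continuous hwc) (ε / 2) (by linarith)
  obtain ⟨σ, hσ, hσ1, hσG, hσμ⟩ : ∃ σ : ℝ, σ > 0 ∧ N * σ ≤ 1 ∧ N * σ * G 0 ≤ ε / 4 ∧ N * σ ≤ μ := by
    set q := min 1 (min (ε / 4 / (G 0 + 1)) μ)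
    have hq0 : 0 < q := by positivity
    have e : N * (q / (N + 1)) ≤ q := by
      rw [mul_div_assoc', div_le_iff₀ (by positivity)]
      nlinarith
    have hq2 : q ≤ ε / 4 / (G 0 + 1) := (min_le_right _ _).trans (min_le_left _ _)
    refine ⟨q / (N + 1), by positivity, e.trans (min_le_left _ _), ?_,
      e.trans ((min_le_right _ _).trans (min_le_right _ _))⟩
    calc N * (q / (N + 1)) * G 0 ≤ ε / 4 / (G 0 + 1) * (G 0 + 1) := by
          gcongr
          · exact e.trans hq2
          · linarith
      _ = ε / 4 := by field_simp
  obtain ⟨δ, hδ0, hδ⟩ := hGc.exists_modulus_on_ball (2 * B / σ) (ε := ε / 16) (by linarith)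
  set η : ℝ := min (min r 1) (δ * σ / 4) with hη
  have hη0 : 0 < η := by positivity
  have hηr : η ≤ r := (min_le_left _ _).trans (min_le_left _ _)
  have hη1 : η ≤ 1 := (min_le_left _ _).trans (min_le_right _ _)
  have hηδ : 4 * η ≤ δ * σ := by linarith [min_le_right (min r 1) (δ * σ / 4)]
  obtain ⟨k, hk⟩ := (Metric.tendstoUniformlyOn_iff.1 hYv η hη0).exists
  have hYw : ∀ t ∈ Set.Ioo (0 : ℝ) 1, ‖Y k t - w t‖ ≤ η := fun t ht => by
    have := hk t ht
    rw [dist_comm, dist_eq_norm, ← hwv t ht] at this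
    exact this.le
  have hYB : ∀ t ∈ Set.Ioo (0 : ℝ) 1, ‖Y k t‖ ≤ B + 1 := fun t ht => by
    have h1 := norm_add_le (Y k t - w t) (w t)
    rw [sub_add_cancel] at h1
    linarith [hYw t ht, hB t (Set.Ioo_subset_Icc_self ht)]
  rcases hN (Y k) (hYc k) (hYi k) (hYM k) hYB η hη0 with h | ⟨n, θ, U, hn, hch⟩
  · refine exists_segment_near hG hGc hG0 hg hGg hw hΛ hΛ0 (D := 8 * r + 2 * η) ?_ hε (by nlinarith)
      (by linarith)
    have key : ∀ t ∈ Set.Ioo (0 : ℝ) 1, ∀ t' ∈ Set.Ioo (0 : ℝ) 1, ‖w t - w t'‖ ≤ 8 * r + 2 * η := by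
      intro t ht t' ht'
      have a1 := h t ht t' ht'
      have a2 := hYw t ht
      have a3 := hYw t' ht'
      rw [norm_sub_rev] at a2
      calc ‖w t - w t'‖ = ‖(w t - Y k t) + (Y k t - Y k t') + (Y k t' - w t')‖ := by congr 1; abel
        _ ≤ ‖w t - Y k t‖ + ‖Y k t - Y k t'‖ + ‖Y k t' - w t'‖ := norm_add₃_le
        _ ≤ _ := by linarith
    have hcl : ∀ x, (∀ t ∈ Set.Ioo (0 : ℝ) 1, ‖w t - x‖ ≤ 8 * r + 2 * η) →
        ∀ t ∈ Set.Icc (0 : ℝ) 1, ‖w t - x‖ ≤ 8 * r + 2 * η := fun x hx t ht => by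
      have hc : ContinuousOn (fun t => ‖w t - x‖) (Set.Icc 0 1) := (hwc.sub continuousOn_const).norm
      rw [← closure_Ioo zero_ne_one] at ht hc
      exact le_on_closure hx hc continuousOn_const ht
    intro t ht t' ht'
    refine hcl _ (fun t ht => ?_) t ht
    rw [norm_sub_rev]
    exact hcl _ (fun t' ht' => key t' ht' t ht) t' ht'
  · have hnN : (n : ℝ) * σ ≤ N * σ := by
      gcongr
    have hnG : (n : ℝ) * σ * G 0 ≤ N * σ * G 0 := by gcongr
    obtain ⟨z, b, E, h1, h2, h3, h4, h5⟩ := hch.exists_polygon hG hGc hG0 hg hGg hw hwc hYw hΛ hΛ0 hσ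
      (κ := ε / 16) (R := 2 * B / σ) (fun t ht t' ht' => by
        rw [div_mul_cancel₀ _ hσ.ne']
        linarith [norm_sub_le (w t) (w t'), hB t ht, hB t' ht']) hδ hηδ hη0.le (μ := ε / 2)
      (fun t ht t' ht' h => by
        have := hμ t ht t' ht' (by rw [Real.dist_eq]; linarith)
        rwa [dist_eq_norm] at this)
    refine ⟨z, b, E, h1, h2, h3, h4.trans ?_, fun t ht => (h5 t ht).trans (by linarith)⟩
    have e1 : Λ * (2 * (8 * r) + 2 * η) ≤ 18 * (Λ * r) := by nlinarith
    have e2 : (1 + n * σ) * (ε / 16) ≤ 2 * (ε / 16) := by gcongr; linarith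
    linarith

/-- Turns the Sobolev bound on the approximating homeomorphisms into a common bound on their length,
the quantity that limits the number of grid crossings. -/
theorem eVariationOn_le_lintegral_of_ftc {v g : ℝ → Plane}
    (hv : ∀ t₁ ∈ Set.Ioo (0 : ℝ) 1, ∀ t₂ ∈ Set.Ioo (0 : ℝ) 1, v t₂ - v t₁ = ∫ t in t₁..t₂, g t) :
    eVariationOn v (Set.Ioo 0 1) ≤ ∫⁻ t in Set.Ioo 0 1, ‖g t‖ₑ := by
  refine iSup_le ?_
  rintro ⟨n, ⟨x, hx, hxs⟩⟩
  have key : ∀ n : ℕ, ∑ i ∈ Finset.range n, edist (v (x (i + 1))) (v (x i)) ≤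
      ∫⁻ t in Set.Ioc (x 0) (x n), ‖g t‖ₑ := by
    intro n
    induction n with
    | zero => simp
    | succ n ih =>
      rw [Finset.sum_range_succ, ← Set.Ioc_union_Ioc_eq_Ioc (hx n.zero_le) (hx n.le_succ),
        lintegral_union measurableSet_Ioc (Set.Ioc_disjoint_Ioc_of_le le_rfl)]
      gcongr
      rw [edist_eq_enorm_sub, hv _ (hxs n) _ (hxs (n + 1)), intervalIntegral.integral_of_le (hx n.le_succ)]
      exact enorm_integral_le_lintegral_enorm _
  exact (key n).trans (lintegral_mono_set fun t ht => ⟨(hxs 0).1.trans ht.1, ht.2.trans_lt (hxs n).2⟩)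

theorem isProbabilityMeasure_rodDomain : IsProbabilityMeasure (volume.restrict rodDomain) :=
  ⟨by rw [Measure.restrict_apply_univ, volume_rodDomain]⟩

theorem SobolevMap.lintegral_grad_le {p : ℝ} (hp : 1 ≤ p) (u : SobolevMap p rodDomain) :
    ∫⁻ t in Set.Ioo 0 1, ‖u.grad t 1‖ₑ ≤ u.eNorm := by
  have := isProbabilityMeasure_rodDomain
  calc ∫⁻ t in Set.Ioo 0 1, ‖u.grad t 1‖ₑ ≤ ∫⁻ t in rodDomain, ‖u.grad t‖ₑ := lintegral_mono fun t => by
        have := (u.grad t).le_opENorm 1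
        simpa using this
    _ = eLpNorm u.grad 1 (volume.restrict rodDomain) := eLpNorm_one_eq_lintegral_enorm.symm
    _ ≤ eLpNorm u.grad (ENNReal.ofReal p) (volume.restrict rodDomain) :=
        eLpNorm_le_eLpNorm_of_exponent_le (by simpa using ENNReal.ofReal_le_ofReal hp) u.memLp_grad.1
    _ ≤ _ := le_add_self

/-- Selection of almost minimizers. -/
theorem exists_tendsto_of_eventually_le {Y : Type*} [Nonempty Y] {q : ℝ → Y → ENNReal}
    (h : ∀ ε > 0, ∀ᶠ s in 𝓝[>] (0 : ℝ), ∃ y, q s y ≤ ENNReal.ofReal ε) :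
    ∃ y : ℝ → Y, Tendsto (fun s => q s (y s)) (𝓝[>] (0 : ℝ)) (𝓝 0) := by
  -- The selected element is within `s` of the infimum, an error that vanishes with `s`.
  have hsel : ∀ s, ∃ y, 0 < s → q s y ≤ (⨅ y, q s y) + ENNReal.ofReal s := fun s => by
    by_cases hs : 0 < s ∧ (⨅ y, q s y) ≠ ⊤
    · obtain ⟨y, hy⟩ := iInf_lt_iff.1 (ENNReal.lt_add_right hs.2 (ENNReal.ofReal_pos.2 hs.1).ne')
      exact ⟨y, fun _ => hy.le⟩
    · refine ⟨Classical.arbitrary Y, fun h0 => ?_⟩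
      rw [not_not.1 fun h => hs ⟨h0, h⟩, top_add]
      exact le_top
  choose y hy using hsel
  refine ⟨y, ENNReal.tendsto_nhds_zero.2 fun ε hε => ?_⟩
  rcases eq_or_ne ε ⊤ with rfl | hεt
  · exact Eventually.of_forall fun _ => le_top
  have hε' : 0 < ε.toReal / 2 := half_pos (ENNReal.toReal_pos hε.ne' hεt)
  have hs : ∀ᶠ s in 𝓝[>] (0 : ℝ), s < ε.toReal / 2 :=
    mem_nhdsWithin_of_mem_nhds (Iio_mem_nhds hε')
  filter_upwards [h _ hε', self_mem_nhdsWithin, hs] with s ⟨x, hx⟩ hs0 hs1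
  calc q s (y s) ≤ (⨅ y, q s y) + ENNReal.ofReal s := hy s hs0
    _ ≤ ENNReal.ofReal (ε.toReal / 2) + ENNReal.ofReal (ε.toReal / 2) :=
        add_le_add ((iInf_le _ x).trans hx) (ENNReal.ofReal_le_ofReal hs1.le)
    _ = ε := by
        rw [← ENNReal.ofReal_add hε'.le hε'.le, add_halves, ENNReal.ofReal_toReal hεt]

/-! ### Recovery families and the convergence theorem -/

section UpperBound

variable {p : ℝ} {W : Matrix (Fin 2) (Fin 2) ℝ → ENNReal}

theorem reducedDensity_zero (hW_top : ∀ F, W F = ⊤ ↔ F.det ≤ 0) : reducedDensity W 0 = ⊤ := by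
  refine iInf_eq_top.2 fun ξ => (hW_top _).2 ?_
  rw [det_colMatrix, cross_zero_left]

/-- Composes injective polygon, lamination and thickening, each with tolerance `ε / 3` in energy and
in distance. -/
theorem exists_bulk_near (hp : 1 ≤ p) (hW_top : ∀ F, W F = ⊤ ↔ F.det ≤ 0)
    (hW : ∀ δ : ℝ, 0 < δ → ∃ C : ℝ, 0 < C ∧ ∀ F : Matrix (Fin 2) (Fin 2) ℝ, δ ≤ F.det →
      W F ≤ ENNReal.ofReal (C * (1 + matNorm F ^ p)))
    {u : SobolevMap p rodDomain} (hu : rodEnergy W u ≠ ⊤) {ε : ℝ} (hε : 0 < ε) :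
    ∃ h₁ > 0, ∀ h ∈ Set.Ioo 0 h₁, ∃ y : SobolevMap p bulkDomain,
      bulkEnergy W h y ≤ rodEnergy W u + ENNReal.ofReal ε ∧
      eLpNorm (fun t => crossAverage y.toFun t - u.toFun t) (ENNReal.ofReal p)
        (volume.restrict rodDomain) ≤ ENNReal.ofReal ε := by
  have := isProbabilityMeasure_rodDomain
  have hNI : NonInterpenetrative u := by
    by_contra h
    exact hu (by rw [rodEnergy, if_neg h])
  have hf : ∀ a, a ≠ 0 → reducedDensity W a ≠ ⊤ := fun a ha => reducedDensity_ne_top hW_top ha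
  set G : Plane → ℝ := fun a => (convexEnvelope (reducedDensity W) a).toReal with hGdef
  have hG0 : ∀ a, 0 ≤ G a := fun a => ENNReal.toReal_nonneg
  have hGc : Continuous G := continuous_toReal_convexEnvelope hf
  have hJ : rodEnergy W u = ∫⁻ t in rodDomain, ENNReal.ofReal (G (u.grad t 1)) := by
    rw [rodEnergy, if_pos hNI]
    simp only [hGdef, ofReal_toReal_convexEnvelope hf]
  have hgrad : ∀ y : SobolevMap p rodDomain, IntegrableOn (fun t => y.grad t 1) rodDomain := fun y =>
    (ContinuousLinearMap.apply ℝ Plane (1 : ℝ)).integrable_comp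
      (integrableOn_of_memLp hp (by rw [volume_rodDomain]; exact ENNReal.one_lt_top) y.memLp_grad)
  have hGi : IntegrableOn (fun t => G (u.grad t 1)) rodDomain := by
    refine ⟨hGc.comp_aestronglyMeasurable (hgrad u).1, ?_⟩
    rw [hasFiniteIntegral_iff_ofReal (Eventually.of_forall fun t => hG0 _), ← hJ]
    exact lt_top_iff_ne_top.2 hu
  have hGg : IntervalIntegrable (fun t => G (u.grad t 1)) volume 0 1 :=
    (intervalIntegrable_iff_integrableOn_Ioo_of_le zero_le_one).2 hGi
  have hJ' : rodEnergy W u = ENNReal.ofReal (∫ t in 0..1, G (u.grad t 1)) := by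
    rw [hJ, ← ofReal_integral_eq_lintegral_ofReal hGi (Eventually.of_forall fun t => hG0 _),
      intervalIntegral.integral_of_le zero_le_one, integral_Ioc_eq_integral_Ioo]
    rfl
  obtain ⟨v, hvu, Y, M, hM, hYM, hYe, hYv⟩ := hNI
  have hYc : ∀ k, ContinuousOn (Y k).toFun rodDomain := fun k =>
    continuousOn_iff_continuous_domRestrict.2 (hYe k).continuous
  have hvc : ContinuousOn v rodDomain := hYv.continuousOn (Frequently.of_forall hYc)
  obtain ⟨z, b, E, hb, hz, hzi, hE, hzv⟩ := exists_injective_polygon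
    (convexOn_toReal_convexEnvelope hf) hGc hG0 (g := fun t => u.grad t 1) (hgrad u) hGg
    (fun t₁ h₁ t₂ h₂ => u.sub_eq_integral hp hvc hvu h₁ h₂) (Y := fun k => (Y k).toFun) hYc
    (fun k => Set.injOn_iff_injective.2 (hYe k).injective) hM
    (fun k => (eVariationOn_le_lintegral_of_ftc fun t₁ h₁ t₂ h₂ =>
      (Y k).sub_eq_integral hp (hYc k) (ae_eq_refl _) h₁ h₂).trans
        (((Y k).lintegral_grad_le hp).trans (hYM k))) hYv (ε := ε / 3) (by linarith)
  obtain ⟨z', E', hz', hE', hzi', hzz'⟩ := hz.exists_of_convexEnvelope hf (reducedDensity_zero hW_top)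
    hzi (ε := ε / 3) (by linarith)
  obtain ⟨h₁, hh₁, H⟩ := exists_thickening hp hW_top hW hb hz' hzi' (ε := ε / 3) (by linarith)
  refine ⟨h₁, hh₁, fun h hh => ?_⟩
  obtain ⟨y, hy, hyz⟩ := H h hh
  refine ⟨y, hy.trans ?_, ?_⟩
  · rw [hJ', ← ENNReal.ofReal_add (intervalIntegral.integral_nonneg zero_le_one fun t _ => hG0 _) hε.le]
    exact ENNReal.ofReal_le_ofReal (by linarith)
  · have hbd : ∀ᵐ t ∂(volume.restrict rodDomain), ‖crossAverage y.toFun t - u.toFun t‖ ≤ ε := by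
      filter_upwards [ae_restrict_mem measurableSet_Ioo, hvu] with t ht htu
      have a1 := hyz t ht
      have a2 := hzz' t ⟨ht.1.le, ht.2.le.trans hb.le⟩
      have a3 := hzv t ht
      rw [← htu]
      calc ‖crossAverage y.toFun t - v t‖ =
            ‖(crossAverage y.toFun t - z' t) + (z' t - z t) + (z t - v t)‖ := by congr 1; abel
        _ ≤ ‖crossAverage y.toFun t - z' t‖ + ‖z' t - z t‖ + ‖z t - v t‖ := norm_add₃_le
        _ ≤ ε := by linarith
    refine (eLpNorm_le_of_ae_bound hbd).trans ?_
    rw [measure_univ, ENNReal.one_rpow, one_mul]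

theorem exists_recovery (hp : 1 ≤ p) (hW_top : ∀ F, W F = ⊤ ↔ F.det ≤ 0)
    (hW : ∀ δ : ℝ, 0 < δ → ∃ C : ℝ, 0 < C ∧ ∀ F : Matrix (Fin 2) (Fin 2) ℝ, δ ≤ F.det →
      W F ≤ ENNReal.ofReal (C * (1 + matNorm F ^ p))) (u : SobolevMap p rodDomain) :
    ∃ y : ℝ → SobolevMap p bulkDomain, PiConverges y u ∧
      limsup (fun h => bulkEnergy W h (y h)) (𝓝[>] (0 : ℝ)) ≤ rodEnergy W u := by
  by_cases hu : rodEnergy W u = ⊤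
  -- With infinite rod energy only the convergence of averages matters, and the lift has average `u`
  -- exactly.
  · refine ⟨fun _ => u.lift hp, ?_, hu ▸ le_top⟩
    have : ∀ t, crossAverage (u.lift hp).toFun t - u.toFun t = 0 := fun t => by
      have : crossAverage (u.lift hp).toFun t = ∫ _ in Set.Ioo (-(1 / 2) : ℝ) (1 / 2), u.toFun t := rfl
      rw [this, setIntegral_const, Measure.real, Real.volume_Ioo]
      norm_num
    simp only [PiConverges, this, eLpNorm_zero', tendsto_const_nhds_iff]
  · have : Nonempty (SobolevMap p bulkDomain) := ⟨u.lift hp⟩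
    -- The excess energy, with truncated subtraction, and the distance are added up so that a single
    -- selection makes both vanish.
    obtain ⟨y, hy⟩ := exists_tendsto_of_eventually_le
      (q := fun h y => (bulkEnergy W h y - rodEnergy W u) +
        eLpNorm (fun t => crossAverage y.toFun t - u.toFun t) (ENNReal.ofReal p)
          (volume.restrict rodDomain)) fun ε hε => by
        obtain ⟨h₁, hh₁, H⟩ := exists_bulk_near hp hW_top hW hu (half_pos hε)
        filter_upwards [Ioo_mem_nhdsGT hh₁] with h hh
        obtain ⟨y, h1, h2⟩ := H h hh
        refine ⟨y, ?_⟩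
        rw [← add_halves ε, ENNReal.ofReal_add (half_pos hε).le (half_pos hε).le]
        exact add_le_add (tsub_le_iff_left.2 h1) h2
    refine ⟨y, tendsto_of_tendsto_of_tendsto_of_le_of_le tendsto_const_nhds hy (fun _ => zero_le)
      fun h => le_add_self, ?_⟩
    have h1 : Tendsto (fun h => ((bulkEnergy W h (y h) - rodEnergy W u) +
        eLpNorm (fun t => crossAverage (y h).toFun t - u.toFun t) (ENNReal.ofReal p)
          (volume.restrict rodDomain)) + rodEnergy W u) (𝓝[>] (0 : ℝ)) (𝓝 (0 + rodEnergy W u)) :=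
      hy.add tendsto_const_nhds
    rw [zero_add] at h1
    refine (limsup_le_limsup (Eventually.of_forall fun h => ?_)).trans_eq h1.limsup_eq
    exact (le_tsub_add (b := bulkEnergy W h (y h)) (a := rodEnergy W u)).trans
      (add_le_add le_self_add le_rfl)

end UpperBound

theorem theorem3p1 (p : ℝ) (hp : 2 ≤ p)
    (W : Matrix (Fin 2) (Fin 2) ℝ → ENNReal)
    (hW_cont : ContinuousOn W {F | 0 < F.det})
    (hW_top : ∀ F, W F = ⊤ ↔ F.det ≤ 0)
    (hW_growth : ∃ c : ℝ, 0 < c ∧ ∀ δ : ℝ, 0 < δ → ∃ C : ℝ, 0 < C ∧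
      ∀ F : Matrix (Fin 2) (Fin 2) ℝ, δ ≤ F.det →
        ENNReal.ofReal (c * matNorm F ^ p) ≤ W F ∧
        W F ≤ ENNReal.ofReal (C * (1 + matNorm F ^ p))) :
    PiGammaConverges (p := p) (fun h y => bulkEnergy W h y) (fun y => rodEnergy W y) := by
  obtain ⟨c, hc, hW⟩ := hW_growth
  -- The constant `c` is the same for all `δ`, so `δ = det F` gives the lower bound wherever the
  -- determinant is positive; elsewhere `W` is infinite.
  have hlow : ∀ F, ENNReal.ofReal (c * matNorm F ^ p) ≤ W F := fun F => by
    rcases le_or_gt F.det 0 with h | h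
    · rw [(hW_top F).2 h]; exact le_top
    · obtain ⟨C, -, hC⟩ := hW F.det h
      exact (hC F le_rfl).1
  refine ⟨fun u y hy => rodEnergy_le_liminf hp hW_top hc hlow hy,
    exists_recovery (by linarith) hW_top fun δ hδ => ?_⟩
  obtain ⟨C, hC, hCF⟩ := hW δ hδ
  exact ⟨C, hC, fun F hF => (hCF F hF).2⟩
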